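/- **Setting.** Let $N\ge 2$, $s\in(0,1)$, $q>1$, $\mathtt L\ge 1$, let $\Omega\subset\mathbb R^N$ be open and bounded, $T>0$, $\Omega_T:=\Omega\times(0,T]$. Let $K:\mathbb R^N\times\mathbb R^N\times(0,T]\to[0,\infty)$ be measurable with $$\frac{\mathtt L^{-1}}{|x-y|^{N+2s}}\le K(x,y,t)=K(y,x,t)\le\frac{\mathtt L}{|x-y|^{N+2s}}\qquad(x\ne y,\ t\in(0,T]),$$ and consider $\partial_t u^q-\mathcal L^s_K u=0$ in $\Omega_T$, where $-\mathcal L_K^su(x,t)=2\,\mathrm{P.V.}\int_{\mathbb R^N}(u(x,t)-u(y,t))K(x,y,t)\,dy$. Here $U\Subset V$ means that $\overline U$ is compact and contained in $V$, and "loc" in time refers to compact subintervals of $(0,T]$. A measurable $u:\mathbb R^N\times(0,T]\to\mathbb R$ with $u\in C_{\rm loc}(0,T;L^{q+1}_{\rm loc}(\Omega))\cap L^2_{\rm loc}(0,T;W^{s,2}_{\rm loc}(\Omega))$ is a local weak sub-solution if for all $[t_1,t_2]\subset(0,T]$ one has $\int_{t_1}^{t_2}\int_{\mathbb R^N}\frac{|u(x,t)|}{1+|x|^{N+2s}}\,dx\,dt<\infty$,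 and, for every open $\tilde\Omega\Subset\Omega$, $$\int_{\tilde\Omega}|u|^{q-1}u\,\phi\,dx\Big|_{t_1}^{t_2}-\int_{t_1}^{t_2}\!\!\int_{\tilde\Omega}|u|^{q-1}u\,\partial_t\phi\,dx\,dt+\int_{t_1}^{t_2}\!\!\iint_{\mathbb R^N\times\mathbb R^N}(u(x,t)-u(y,t))(\phi(x,t)-\phi(y,t))K(x,y,t)\,dx\,dy\,dt\le0$$ for all nonnegative $\phi\in L^2_{\rm loc}(0,T;W^{s,2}_0(\tilde\Omega))\cap W^{1,q+1}_{\rm loc}(0,T;L^{q+1}(\tilde\Omega))$, where $W^{s,2}_0(\tilde\Omega)$ denotes the functions in $W^{s,2}(\mathbb R^N)$ vanishing outside $\tilde\Omega$. Put $Q_{R,\theta}(x_0,t_0):=B_R(x_0)\times(t_0-\theta,t_0)$, $\ \mathtt m:=\frac2N(N+(q+1)s)$, $\ \Lambda_x:=2sx+N(1-q)$ and $$\mathrm{Tail}(u;Q_{R,\theta}(x_0,t_0)):=\int_{t_0-\theta}^{t_0}\int_{\mathbb R^N\setminus B_R(x_0)}\frac{|u(x,t)|}{|x-x_0|^{N+2s}}\,dx\,dt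 .$$ **Theorem.** Let $r\ge1$ and let $u$ be a local, nonnegative, weak sub-solution in $\Omega_T$. (1) If $r\le\mathtt m$ and $\Lambda_r>0$, then on every cylinder $Q_{\varrho,\sigma}(x_0,t_0)\Subset\Omega_T$ ($\varrho,\sigma>0$) $$\operatorname*{ess\,sup}_{Q_{\varrho/2,\sigma/2}(x_0,t_0)}u\le c\Big(\frac{\varrho^{2s}}{\sigma}\Big)^{\frac N{\Lambda_r}}\Big(\frac1{|Q_{\varrho,\sigma}|}\iint_{Q_{\varrho,\sigma}(x_0,t_0)}u^r\,dx\,dt\Big)^{\frac{2s}{\Lambda_r}}+c\Big(\frac\sigma{\varrho^{2s}}\Big)^{\frac1{q-1}}+c\,\mathrm{Tail}^{\frac1q}(u;Q_{\varrho/2,\sigma}(x_0,t_0)),$$ where $c$ depends only on $s,q,N,\mathtt L$ and a positive lower bound for $\Lambda_r$. (2) If $r>\mathtt m$ and $\Lambda_r\le0$, and moreover $u\in L^A_{\rm loc}(\Omega_T)$ for some $A>\frac N{2s}(q-1)$, then on every cylinder $Q_{\varrho,\sigma}(x_0,t_0)\Subset\Omega_T$ $$\operatorname*{ess\,sup}_{Q_{\varrho/2,\sigma/2}(x_0,t_0)}u\le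 c\Big(\frac{\varrho^{2s}}{\sigma}\Big)^{\frac N{\Lambda_A}}\Big(\frac1{|Q_{\varrho,\sigma}|}\iint_{Q_{\varrho,\sigma}(x_0,t_0)}u^A\,dx\,dt\Big)^{\frac{2s}{\Lambda_A}}+c\Big(\frac\sigma{\varrho^{2s}}\Big)^{\frac1{q-1}}+c\,\mathrm{Tail}^{\frac1q}(u;Q_{\varrho/2,\sigma}(x_0,t_0)),$$ where $c$ depends only on $s,q,N,\mathtt L,A$. In both cases all the integrals on the right-hand side are finite. -/

import Mathlib

open MeasureTheory Set Filter Topology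
open scoped ENNReal

noncomputable section

/-- The Euclidean space `ℝ^N`. -/
abbrev RN (N : ℕ) : Type := EuclideanSpace ℝ (Fin N)

/-- `U ⋐ V`: the closure of `U` is compact and contained in `V`. -/
def CompactlyContained {X : Type*} [TopologicalSpace X] (U V : Set X) : Prop :=
  IsCompact (closure U) ∧ closure U ⊆ V

/-- The space-time cylinder `Ω_T = Ω × (0, T]`. -/
def spaceTime {N : ℕ} (Ω : Set (RN N)) (T : ℝ) : Set (RN N × ℝ) := Ω ×ˢ Ioc 0 T

/-- The backward parabolic cylinder `Q_{R,θ}(x₀,t₀) = B_R(x₀) × (t₀ - θ, t₀)`. -/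
def paraCyl {N : ℕ} (x₀ : RN N) (t₀ R θ : ℝ) : Set (RN N × ℝ) :=
  Metric.ball x₀ R ×ˢ Ioo (t₀ - θ) t₀

/-- Symmetric measurable kernels on `ℝ^N × ℝ^N × (0, T]` with
`L⁻¹ |x-y|^{-N-2s} ≤ K(x,y,t) = K(y,x,t) ≤ L |x-y|^{-N-2s}`. -/
structure IsKernel {N : ℕ} (s L T : ℝ) (K : RN N → RN N → ℝ → ℝ) : Prop where
  aemeasurable : AEMeasurable (fun z : (RN N × RN N) × ℝ => K z.1.1 z.1.2 z.2)
    (volume.restrict (univ ×ˢ Ioc 0 T))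
  symm : ∀ t ∈ Ioc 0 T, ∀ x y, K x y t = K y x t
  lower : ∀ t ∈ Ioc 0 T, ∀ x y, x ≠ y → L⁻¹ / ‖x - y‖ ^ ((N : ℝ) + 2 * s) ≤ K x y t
  upper : ∀ t ∈ Ioc 0 T, ∀ x y, x ≠ y → K x y t ≤ L / ‖x - y‖ ^ ((N : ℝ) + 2 * s)

/-- The squared norm of `W^{s,2}(U)`:
`∫_U |v|² dx + ∬_{U×U} |v(x)-v(y)|² / |x-y|^{N+2s} dx dy`, with values in `[0,∞]`. -/
def sobolevSq {N : ℕ} (s : ℝ) (U : Set (RN N)) (v : RN N → ℝ) : ℝ≥0∞ :=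
  (∫⁻ x in U, ENNReal.ofReal (|v x| ^ 2)) +
    ∫⁻ p in U ×ˢ U, ENNReal.ofReal (|v p.1 - v p.2| ^ 2 / ‖p.1 - p.2‖ ^ ((N : ℝ) + 2 * s))

/-- `u ∈ C_loc(0,T; L^p_loc(Ω))`: on every `U ⋐ Ω`, each slice `u(·,t)`, `t ∈ (0,T]`, lies in
`L^p(U)`, and `t ↦ u(·,t)` is continuous on `(0,T]` with values in `L^p(U)`. -/
def MemCLocLp {N : ℕ} (p : ℝ) (Ω : Set (RN N)) (T : ℝ) (u : RN N → ℝ → ℝ) : Prop :=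
  ∀ U : Set (RN N), IsOpen U → CompactlyContained U Ω →
    (∀ t ∈ Ioc 0 T, MemLp (fun x => u x t) (ENNReal.ofReal p) (volume.restrict U)) ∧
    ∀ τ ∈ Ioc 0 T, Tendsto
      (fun t => eLpNorm (fun x => u x t - u x τ) (ENNReal.ofReal p) (volume.restrict U))
      (𝓝[Ioc 0 T] τ) (𝓝 0)

/-- `u ∈ L²_loc(0,T; W^{s,2}(U))` (integrability on every `[t₁,t₂] ⊆ (0,T]`). -/
def MemL2LocSobolev {N : ℕ} (s : ℝ) (U : Set (RN N)) (T : ℝ) (u : RN N → ℝ → ℝ) : Prop :=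
  ∀ t₁ t₂ : ℝ, 0 < t₁ → t₁ < t₂ → t₂ ≤ T →
    ∫⁻ t in Icc t₁ t₂, sobolevSq s U (fun x => u x t) < ⊤

/-- Nonnegative test functions
`φ ∈ L²_loc(0,T; W₀^{s,2}(U)) ∩ W^{1,q+1}_loc(0,T; L^{q+1}(U))`, with time derivative `φ'`.
Elements of `W₀^{s,2}(U)` are the functions of `W^{s,2}(ℝ^N)` that vanish outside `U`; elements of
`W^{1,q+1}_loc(0,T; L^{q+1}(U))` are represented by their absolutely continuous representative,
`φ(t₂) - φ(t₁) = ∫_{t₁}^{t₂} φ' dt` in `L^{q+1}(U)`, with `φ, φ' ∈ L^{q+1}(U × (t₁,t₂))`. -/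
structure IsTest {N : ℕ} (s q : ℝ) (U : Set (RN N)) (T : ℝ) (φ φ' : RN N → ℝ → ℝ) : Prop where
  aemeasurable : AEMeasurable (fun z : RN N × ℝ => φ z.1 z.2)
    (volume.restrict (univ ×ˢ Ioc 0 T))
  nonneg : ∀ t ∈ Ioc 0 T, ∀ x, 0 ≤ φ x t
  zero_outside : ∀ t ∈ Ioc 0 T, ∀ x, x ∉ U → φ x t = 0
  sobolev : MemL2LocSobolev s univ T φ
  memLp : ∀ t₁ t₂ : ℝ, 0 < t₁ → t₁ < t₂ → t₂ ≤ T →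
    MemLp (fun z : RN N × ℝ => φ z.1 z.2) (ENNReal.ofReal (q + 1))
      (volume.restrict (U ×ˢ Icc t₁ t₂))
  memLp_deriv : ∀ t₁ t₂ : ℝ, 0 < t₁ → t₁ < t₂ → t₂ ≤ T →
    MemLp (fun z : RN N × ℝ => φ' z.1 z.2) (ENNReal.ofReal (q + 1))
      (volume.restrict (U ×ˢ Icc t₁ t₂))
  deriv : ∀ t₁ t₂ : ℝ, 0 < t₁ → t₁ < t₂ → t₂ ≤ T →
    ∀ᵐ x ∂(volume.restrict U), φ x t₂ - φ x t₁ = ∫ t in t₁..t₂, φ' x t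

/-- Local weak sub-solutions of `∂_t u^q - 𝓛_K^s u = 0` in `Ω_T`. -/
structure IsWeakSubsolution {N : ℕ} (s q : ℝ) (K : RN N → RN N → ℝ → ℝ) (Ω : Set (RN N)) (T : ℝ)
    (u : RN N → ℝ → ℝ) : Prop where
  aemeasurable : AEMeasurable (fun z : RN N × ℝ => u z.1 z.2)
    (volume.restrict (univ ×ˢ Ioc 0 T))
  continuous : MemCLocLp (q + 1) Ω T u
  sobolev : ∀ U : Set (RN N), IsOpen U → CompactlyContained U Ω → MemL2LocSobolev s U T u
  tail : ∀ t₁ t₂ : ℝ, 0 < t₁ → t₁ < t₂ → t₂ ≤ T →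
    IntegrableOn (fun z : RN N × ℝ => |u z.1 z.2| / (1 + ‖z.1‖ ^ ((N : ℝ) + 2 * s)))
      (univ ×ˢ Icc t₁ t₂)
  weak : ∀ t₁ t₂ : ℝ, 0 < t₁ → t₁ < t₂ → t₂ ≤ T →
    ∀ U : Set (RN N), IsOpen U → CompactlyContained U Ω →
    ∀ φ φ' : RN N → ℝ → ℝ, IsTest s q U T φ φ' →
      (∫ x in U, |u x t₂| ^ (q - 1) * u x t₂ * φ x t₂)
        - (∫ x in U, |u x t₁| ^ (q - 1) * u x t₁ * φ x t₁)
        - (∫ t in t₁..t₂, ∫ x in U, |u x t| ^ (q - 1) * u x t * φ' x t)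
        + (∫ t in t₁..t₂, ∫ p : RN N × RN N,
            (u p.1 t - u p.2 t) * (φ p.1 t - φ p.2 t) * K p.1 p.2 t) ≤ 0

/-- `u ≥ 0` almost everywhere in `ℝ^N × (0,T]`. -/
def IsNonneg {N : ℕ} (T : ℝ) (u : RN N → ℝ → ℝ) : Prop :=
  ∀ᵐ z ∂((volume : Measure (RN N × ℝ)).restrict (univ ×ˢ Ioc 0 T)), 0 ≤ u z.1 z.2

/-- `u ∈ L^A_loc(Ω_T)`. -/
def MemLpLoc {N : ℕ} (A : ℝ) (Ω : Set (RN N)) (T : ℝ) (u : RN N → ℝ → ℝ) : Prop :=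
  ∀ C : Set (RN N × ℝ), IsCompact C → C ⊆ spaceTime Ω T →
    MemLp (fun z : RN N × ℝ => u z.1 z.2) (ENNReal.ofReal A) (volume.restrict C)

/-- The region `(ℝ^N \ B_R(x₀)) × (t₀ - θ, t₀)` of integration of the tail. -/
def tailRegion {N : ℕ} (x₀ : RN N) (t₀ R θ : ℝ) : Set (RN N × ℝ) :=
  (Metric.ball x₀ R)ᶜ ×ˢ Ioo (t₀ - θ) t₀

/-- The integrand `|u(x,t)| / |x - x₀|^{N+2s}` of the tail. -/
def tailIntegrand {N : ℕ} (s : ℝ) (u : RN N → ℝ → ℝ) (x₀ : RN N) (z : RN N × ℝ) : ℝ :=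
  |u z.1 z.2| / ‖z.1 - x₀‖ ^ ((N : ℝ) + 2 * s)

/-- `Tail(u; Q_{R,θ}(x₀,t₀))`. -/
def parabolicTail {N : ℕ} (s : ℝ) (u : RN N → ℝ → ℝ) (x₀ : RN N) (t₀ R θ : ℝ) : ℝ :=
  ∫ z in tailRegion x₀ t₀ R θ, tailIntegrand s u x₀ z

/-- The exponent `m = (2/N)(N + (q+1)s)`. -/
def mExp (N : ℕ) (s q : ℝ) : ℝ := 2 / (N : ℝ) * ((N : ℝ) + (q + 1) * s)

/-- `Λ_x = 2 s x + N (1 - q)`. -/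
def lamExp (N : ℕ) (s q x : ℝ) : ℝ := 2 * s * x + (N : ℝ) * (1 - q)

/-- The right-hand side of the quantitative sup estimate, with exponent `r` and constant `c`. -/
def supBound {N : ℕ} (s q r c : ℝ) (u : RN N → ℝ → ℝ) (x₀ : RN N) (t₀ ρ σ : ℝ) : ℝ :=
  c * (ρ ^ (2 * s) / σ) ^ ((N : ℝ) / lamExp N s q r) *
      (⨍ z in paraCyl x₀ t₀ ρ σ, u z.1 z.2 ^ r) ^ (2 * s / lamExp N s q r)
    + c * (σ / ρ ^ (2 * s)) ^ (1 / (q - 1))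
    + c * (parabolicTail s u x₀ t₀ (ρ / 2) σ) ^ (1 / q)

/-- The sup estimate on `Q_{ρ/2,σ/2}(x₀,t₀)`, together with the finiteness of the two integrals on
its right-hand side. The essential supremum is taken in `[-∞,∞]`, so that the inequality contains
the boundedness of `u` from above. -/
def SupEstimate {N : ℕ} (s q r c : ℝ) (u : RN N → ℝ → ℝ) (x₀ : RN N) (t₀ ρ σ : ℝ) : Prop :=
  IntegrableOn (fun z : RN N × ℝ => u z.1 z.2 ^ r) (paraCyl x₀ t₀ ρ σ) ∧
  IntegrableOn (tailIntegrand s u x₀) (tailRegion x₀ t₀ (ρ / 2) σ) ∧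
  essSup (fun z : RN N × ℝ => (u z.1 z.2 : EReal))
      (volume.restrict (paraCyl x₀ t₀ (ρ / 2) (σ / 2))) ≤
    (supBound s q r c u x₀ t₀ ρ σ : EReal)

end

noncomputable section

/-! The proof is a De Giorgi iteration in which a barrier replaces the cut-off functions and the
levels grow in time. Let `d` be the relative distance to the boundary of `B_R(x₀)` and `P = d ^
(-M)` with `M = barExp N s q`; the truncation is `v = (u - ℓ(t) P)₊`, extended by zero outside the
ball. Because `P` blows up at the boundary, no cut-off is needed, and wherever `v > 0` one has `P <
u / ℓ`, so every weight lost near the boundary turns into a power of `u` times a negative power of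
the level. The exponent `M` is large enough for `P ^ (q - 1)` to dominate `d ^ (-2s)` and for `P ^
q` to dominate `d ^ (-N - 2s)`.

Pairs of points are split by `nearSet`. On near pairs `P` is Lipschitz at the scale of the distance
to the boundary, and its increments cost at most a multiple of `R ^ (-2s) ℓ ^ (1 - q) ∫ u ^ (q + 1)`
over the set where `v > 0` (`exists_lintegral_barrierError_le`). On far pairs the kernel is at most
`C P(x) ^ q (R + |y - x₀|) ^ (-N - 2s)`, so the only term of unfavourable sign is bounded by `C
tail(t) ∫ v P ^ q`.

The tail is merely integrable in time. The level is therefore chosen with `ℓ ^ q = k ^ q + C ∫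
tail`: the growth of `ℓ ^ q P ^ q` in the parabolic term produces the same quantity `C tail(t) ∫ v P
^ q`, and the two cancel (`CylinderSubsolution.exists_window`). Only the time integral of the tail
has to be compared with `k ^ q`, which is where the power `1 / q` of the tail in the estimate comes
from.

No time derivative of `u` is available. The weak inequality between `t - h` and `t` is tested with
the fixed function `v(t)`, a convexity inequality (`entropy_sub_le`) acts as a discrete chain rule,
and `sub_add_integral_le_of_window` integrates in `t`, divides by `h` and lets `h` tend to zero. The
outcome is the energy inequality `exists_energy_le`.

Together with a fractional Gagliardo–Nirenberg inequality, proved pointwise from Chebyshev's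
inequality, the energy inequality bounds the `L^m` mass above one level by a superlinear power of
the `L^(q+1)` mass above the previous one (`exists_levelMass_step`), where `m = mExp N s q`. If `q +
1 < m`, the inequality `u ≥ k` above the levels closes the recursion. If `m ≤ q + 1`, it is closed
by interpolation with `L^A`, and the recursion remains superlinear because `Λ_A > 0`. Both cases
yield a criterion: if the mass of `u ^ p` is small compared with `k ^ (Λ_p / 2s) g ^ ((N + 2s) /
2s)`, then `u ≤ 3 k P` after the waiting time `g`.

Finally let `S` be the sum of the three terms on the right-hand side of the estimate, without the
constant. A fixed multiple of `S` is an admissible level, which settles exponents for which the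
criterion is available. For `r < q + 1` the criterion with exponent `q + 1` is used on nested
cylinders with `u ^ (q + 1) ≤ (sup u) ^ (q + 1 - r) u ^ r`; this bounds a supremum by the power `1 -
Λ_r / Λ_{q+1} < 1` of a supremum on a larger cylinder, and such a sublinear relation can be iterated
(`ae_le_of_sublinear_iteration`). -/

/-! ### Integrals of powers of the distance and of the kernel. -/

lemma lintegral_ofReal_fun_norm {N : ℕ} (hN : 2 ≤ N) {f : ℝ → ℝ} (hf : ∀ y, 0 ≤ f y)
    (hint : IntegrableOn (fun y : ℝ => y ^ (N - 1) * f y) (Ioi 0)) :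
    ∫⁻ z : RN N, ENNReal.ofReal (f ‖z‖) = ENNReal.ofReal
      (N * (volume.real (Metric.ball (0 : RN N) 1) * ∫ y in Ioi (0 : ℝ), y ^ (N - 1) * f y)) := by
  have : Nontrivial (RN N) := by
    apply Module.nontrivial_of_finrank_pos (R := ℝ)
    simp; omega
  have h1 : Integrable (fun z : RN N => f ‖z‖) := by
    rw [integrable_fun_norm_addHaar (μ := (volume : Measure (RN N))) (f := f)]
    simpa using hint
  rw [← ofReal_integral_eq_lintegral_ofReal h1 (Eventually.of_forall fun z => hf _),
    integral_fun_norm_addHaar (volume : Measure (RN N)) f]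
  simp

lemma lintegral_norm_rpow_ball {N : ℕ} (hN : 2 ≤ N) {α r : ℝ} (hα : 0 < α + N) (hr : 0 < r) :
    ∫⁻ z in Metric.ball (0 : RN N) r, ENNReal.ofReal (‖z‖ ^ α) = ENNReal.ofReal
      (N * volume.real (Metric.ball (0 : RN N) 1) / (α + N) * r ^ (α + N)) := by
  have hcast : ((N - 1 : ℕ) : ℝ) = N - 1 := by
    rw [Nat.cast_sub (by omega)]; simp
  have hfun : ∀ y ∈ Ioi (0 : ℝ), y ^ (N - 1) * (Iio r).indicator (fun y => y ^ α) y
      = (Ioo 0 r).indicator (fun y => y ^ (α + N - 1)) y := by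
    intro y hy
    have hy : 0 < y := hy
    by_cases hyr : y < r
    · rw [indicator_of_mem (by exact hyr), indicator_of_mem (by exact ⟨hy, hyr⟩),
        ← Real.rpow_natCast, ← Real.rpow_add hy, hcast]
      congr 1; ring
    · rw [indicator_of_notMem (by simpa using hyr), indicator_of_notMem (by simp; intro _; linarith)]
      simp
  have hI : IntegrableOn (fun y : ℝ => y ^ (α + N - 1)) (Ioo 0 r) :=
    (intervalIntegral.integrableOn_Ioo_rpow_iff hr).2 (by linarith)
  have key := lintegral_ofReal_fun_norm hN (f := (Iio r).indicator (fun y => |y| ^ α))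
    (fun y => indicator_nonneg (fun y _ => by positivity) y) (by
      rw [integrableOn_congr_fun (g := (Ioo 0 r).indicator (fun y => y ^ (α + N - 1))) _
        measurableSet_Ioi]
      · exact (hI.integrable_indicator measurableSet_Ioo).integrableOn
      · intro y hy
        simp only
        rw [← hfun y hy]
        congr 1
        simp only [indicator]
        rw [abs_of_pos hy])
  have h2 : ∫ y in Ioi (0 : ℝ), y ^ (N - 1) * (Iio r).indicator (fun y => |y| ^ α) y
      = r ^ (α + N) / (α + N) := by
    rw [setIntegral_congr_fun (g := (Ioo 0 r).indicator (fun y => y ^ (α + N - 1)))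
      measurableSet_Ioi]
    · rw [setIntegral_indicator measurableSet_Ioo,
        inter_eq_right.2 (fun y hy => hy.1), ← integral_Ioc_eq_integral_Ioo,
        ← intervalIntegral.integral_of_le hr.le, integral_rpow (by left; linarith)]
      rw [show α + N - 1 + 1 = α + N by ring, Real.zero_rpow hα.ne', sub_zero]
    · intro y hy
      simp only
      rw [← hfun y hy]
      congr 1
      simp only [indicator]
      rw [abs_of_pos hy]
  rw [← lintegral_indicator Metric.isOpen_ball.measurableSet]
  calc _ = ∫⁻ z : RN N, ENNReal.ofReal ((Iio r).indicator (fun y => |y| ^ α) ‖z‖) := by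
        congr 1; ext z
        by_cases hz : ‖z‖ < r
        · rw [indicator_of_mem (by simpa using hz), indicator_of_mem (by simpa using hz)]
          simp
        · rw [indicator_of_notMem (by simpa using hz), indicator_of_notMem (by simpa using hz)]
          simp
    _ = _ := by rw [key, h2]; congr 1; ring

lemma lintegral_norm_rpow_compl_ball {N : ℕ} (hN : 2 ≤ N) {α r : ℝ} (hα : α + N < 0)
    (hr : 0 < r) :
    ∫⁻ z in (Metric.ball (0 : RN N) r)ᶜ, ENNReal.ofReal (‖z‖ ^ α) = ENNReal.ofReal
      (N * volume.real (Metric.ball (0 : RN N) 1) / (-(α + N)) * r ^ (α + N)) := by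
  have hcast : ((N - 1 : ℕ) : ℝ) = N - 1 := by
    rw [Nat.cast_sub (by omega)]; simp
  have hfun : ∀ y ∈ Ioi (0 : ℝ), y ^ (N - 1) * (Ici r).indicator (fun y => |y| ^ α) y
      = (Ici r).indicator (fun y => y ^ (α + N - 1)) y := by
    intro y hy
    have hy : 0 < y := hy
    by_cases hyr : r ≤ y
    · rw [indicator_of_mem (by exact hyr), indicator_of_mem (by exact hyr),
        ← Real.rpow_natCast, abs_of_pos hy, ← Real.rpow_add hy, hcast]
      congr 1; ring
    · rw [indicator_of_notMem (by simpa using hyr), indicator_of_notMem (by simpa using hyr)]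
      simp
  have hI : IntegrableOn (fun y : ℝ => y ^ (α + N - 1)) (Ioi r) :=
    integrableOn_Ioi_rpow_of_lt (by linarith) hr
  have hI' : IntegrableOn (fun y : ℝ => y ^ (α + N - 1)) (Ici r) :=
    (integrableOn_Ici_iff_integrableOn_Ioi (by simp)).2 hI
  have key := lintegral_ofReal_fun_norm hN (f := (Ici r).indicator (fun y => |y| ^ α))
    (fun y => indicator_nonneg (fun y _ => by positivity) y) (by
      rw [integrableOn_congr_fun (g := (Ici r).indicator (fun y => y ^ (α + N - 1))) hfun
        measurableSet_Ioi]
      exact (hI'.integrable_indicator measurableSet_Ici).integrableOn)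
  have h2 : ∫ y in Ioi (0 : ℝ), y ^ (N - 1) * (Ici r).indicator (fun y => |y| ^ α) y
      = r ^ (α + N) / (-(α + N)) := by
    rw [setIntegral_congr_fun (g := (Ici r).indicator (fun y => y ^ (α + N - 1)))
      measurableSet_Ioi hfun, setIntegral_indicator measurableSet_Ici,
        show Ioi (0 : ℝ) ∩ Ici r = Ici r from
          inter_eq_right.2 (fun y hy => hr.trans_le (mem_Ici.1 hy)), integral_Ici_eq_integral_Ioi,
        integral_Ioi_rpow_of_lt (by linarith) hr]
    rw [show α + N - 1 + 1 = α + N by ring, neg_div, div_neg]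
  rw [← lintegral_indicator Metric.isOpen_ball.measurableSet.compl]
  calc _ = ∫⁻ z : RN N, ENNReal.ofReal ((Ici r).indicator (fun y => |y| ^ α) ‖z‖) := by
        congr 1; ext z
        by_cases hz : r ≤ ‖z‖
        · rw [indicator_of_mem (by simpa using hz), indicator_of_mem (by simpa using hz)]
          simp
        · rw [indicator_of_notMem (by simpa using hz), indicator_of_notMem (by simpa using hz)]
          simp
    _ = _ := by rw [key, h2]; congr 1; ring

/-- The truncated second moment of the kernel `|x-y|^{-N-2s}` near its singularity. -/
lemma exists_lintegral_kernel_near_le {N : ℕ} (hN : 2 ≤ N) {s : ℝ} (hs1 : s < 1) :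
    ∃ C : ℝ, 0 < C ∧ ∀ (x : RN N) (r : ℝ), 0 < r →
      ∫⁻ y in {y | ‖x - y‖ < r},
        ENNReal.ofReal (‖x - y‖ ^ 2 / ‖x - y‖ ^ ((N : ℝ) + 2 * s)) ≤
        ENNReal.ofReal (C * r ^ (2 - 2 * s)) := by
  have : Nonempty (Fin N) := ⟨⟨0, by omega⟩⟩
  have hω : 0 < volume.real (Metric.ball (0 : RN N) 1) :=
    ENNReal.toReal_pos (Metric.measure_ball_pos _ _ one_pos).ne' measure_ball_lt_top.ne
  have hN0 : (0 : ℝ) < N := by exact_mod_cast (by omega : 0 < N)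
  refine ⟨N * volume.real (Metric.ball (0 : RN N) 1) / (2 - 2 * s), by
    apply div_pos (by positivity); linarith, fun x r hr => ?_⟩
  have h := lintegral_norm_rpow_ball hN (α := 2 - (N + 2 * s)) (by linarith) hr
  rw [show 2 - (N + 2 * s) + N = 2 - 2 * s by ring] at h
  rw [← h, ← lintegral_indicator Metric.isOpen_ball.measurableSet,
    ← lintegral_indicator (measurableSet_lt (by fun_prop) (by fun_prop)),
    ← lintegral_sub_left_eq_self _ x]
  refine lintegral_mono fun y => ?_
  simp only [indicator, mem_ofPred_eq, sub_sub_cancel, Metric.mem_ball, dist_zero_right]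
  split_ifs with hy
  · refine ENNReal.ofReal_le_ofReal ?_
    rcases (norm_nonneg y).eq_or_lt with h0 | h0
    · rw [← h0]; simp; positivity
    · rw [Real.rpow_sub h0]; norm_num
  · exact le_rfl

/-- The tail of the kernel `|x-y|^{-N-2s}`. -/
lemma exists_lintegral_kernel_far_le {N : ℕ} (hN : 2 ≤ N) {s : ℝ} (hs0 : 0 < s) :
    ∃ C : ℝ, 0 < C ∧ ∀ (x : RN N) (r : ℝ), 0 < r →
      ∫⁻ y in {y | r ≤ ‖x - y‖}, ENNReal.ofReal (1 / ‖x - y‖ ^ ((N : ℝ) + 2 * s)) ≤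
        ENNReal.ofReal (C * r ^ (-(2 * s))) := by
  have : Nonempty (Fin N) := ⟨⟨0, by omega⟩⟩
  have hω : 0 < volume.real (Metric.ball (0 : RN N) 1) :=
    ENNReal.toReal_pos (Metric.measure_ball_pos _ _ one_pos).ne' measure_ball_lt_top.ne
  have hN0 : (0 : ℝ) < N := by exact_mod_cast (by omega : 0 < N)
  refine ⟨N * volume.real (Metric.ball (0 : RN N) 1) / (2 * s), by positivity, fun x r hr => ?_⟩
  have h := lintegral_norm_rpow_compl_ball hN (α := -(N + 2 * s)) (by linarith) hr
  rw [show -(N + 2 * s) + N = -(2 * s) by ring, neg_neg] at h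
  rw [← h, ← lintegral_indicator Metric.isOpen_ball.measurableSet.compl,
    ← lintegral_indicator (measurableSet_le (by fun_prop) (by fun_prop)),
    ← lintegral_sub_left_eq_self _ x]
  refine lintegral_mono fun y => ?_
  simp only [indicator, mem_ofPred_eq, sub_sub_cancel, mem_compl_iff, Metric.mem_ball,
    dist_zero_right, not_lt]
  split_ifs with hy
  · refine ENNReal.ofReal_le_ofReal ?_
    rw [Real.rpow_neg (norm_nonneg _), one_div]
  · exact le_rfl

/-! ### Fractional Gagliardo–Nirenberg inequality. -/

/-- The volume of the unit ball of `ℝ^N`. -/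
def unitVol (N : ℕ) : ℝ := volume.real (Metric.ball (0 : RN N) 1)

lemma unitVol_pos {N : ℕ} : 0 < unitVol N :=
  ENNReal.toReal_pos (Metric.measure_ball_pos _ _ one_pos).ne' measure_ball_lt_top.ne

lemma volume_ball_eq {N : ℕ} (x : RN N) {r : ℝ} (hr : 0 < r) :
    volume (Metric.ball x r) = ENNReal.ofReal (unitVol N * r ^ N) := by
  have : volume (Metric.ball (0 : RN N) 1) = ENNReal.ofReal (unitVol N) := by
    rw [unitVol, ofReal_measureReal measure_ball_lt_top.ne]
  rw [Measure.addHaar_ball_of_pos _ _ hr, this, mul_comm, ← ENNReal.ofReal_mul unitVol_pos.le]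
  simp

/-- At least half of the ball around `x` consists of points where `v < v x / 2`. There the increment
is at least `v x / 2` and the kernel at least `r ^ (-N - 2s)`, while the volume is at least `unitVol
N * r ^ N / 2`. The product of the three gives the factor `unitVol N / 8`. -/
lemma le_lintegral_quotient_of_superlevel {N : ℕ} {s : ℝ} (hs0 : 0 < s) {v : RN N → ℝ}
    (hv : Measurable v) {S : Set (RN N)} (hS : MeasurableSet S) {x : RN N} {r : ℝ} (hr : 0 < r)
    (hrS : Metric.ball x r ⊆ S) (ha : 0 < v x)
    (hE : 2 * volume (S ∩ {y | v x / 2 ≤ v y}) ≤ volume (Metric.ball x r)) :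
    ENNReal.ofReal (unitVol N / 8 * v x ^ 2 * r ^ (-(2 * s))) ≤
      ∫⁻ y in S, ENNReal.ofReal (|v x - v y| ^ 2 / ‖x - y‖ ^ ((N : ℝ) + 2 * s)) := by
  set E := S ∩ {y | v x / 2 ≤ v y} with hEdef
  have hEm : MeasurableSet E := hS.inter (measurableSet_le measurable_const hv)
  set c : ℝ := (v x / 2) ^ 2 / r ^ ((N : ℝ) + 2 * s) with hc
  have hfin : volume E ≠ ⊤ := by
    intro h
    rw [h] at hE
    exact absurd (lt_of_le_of_lt hE measure_ball_lt_top) (by simp)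
  have h1 : volume (Metric.ball x r) / 2 ≤ volume (Metric.ball x r \ E) := by
    have h2 : volume (Metric.ball x r) ≤ volume (Metric.ball x r \ E) + volume E := by
      rw [add_comm]
      exact (measure_mono (by intro y hy; by_cases h : y ∈ E <;> simp [h, hy])).trans
        (measure_union_le E (Metric.ball x r \ E))
    have h3 : volume E ≤ volume (Metric.ball x r) / 2 := by
      rw [ENNReal.le_div_iff_mul_le (by simp) (by simp), mul_comm]; exact hE
    rw [← ENNReal.add_halves (volume (Metric.ball x r))] at h2
    exact (ENNReal.add_le_add_iff_right
      (ENNReal.div_ne_top measure_ball_lt_top.ne (by simp))).1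
      (h2.trans (add_le_add le_rfl h3))
  have h2 : ENNReal.ofReal c * volume (Metric.ball x r \ E) ≤
      ∫⁻ y in Metric.ball x r \ E,
        ENNReal.ofReal (|v x - v y| ^ 2 / ‖x - y‖ ^ ((N : ℝ) + 2 * s)) := by
    rw [← setLIntegral_const]
    refine setLIntegral_mono' (Metric.isOpen_ball.measurableSet.diff hEm) fun y hy => ?_
    refine ENNReal.ofReal_le_ofReal ?_
    have hyS := hrS hy.1
    have hlt : v y < v x / 2 := by
      by_contra h
      exact hy.2 ⟨hyS, not_lt.1 h⟩
    have hne : 0 < ‖x - y‖ := by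
      rw [norm_pos_iff, sub_ne_zero]
      rintro rfl
      linarith
    have hlt' : ‖x - y‖ < r := by simpa [dist_eq_norm, norm_sub_rev] using hy.1
    have : v x / 2 ≤ |v x - v y| := le_trans (by linarith) (le_abs_self _)
    rw [hc]
    gcongr
  calc _ = ENNReal.ofReal c * (volume (Metric.ball x r) / 2) := by
        rw [volume_ball_eq x hr, show (2 : ℝ≥0∞) = ENNReal.ofReal 2 by simp,
          ← ENNReal.ofReal_div_of_pos two_pos, ← ENNReal.ofReal_mul (by positivity)]
        congr 1
        rw [hc, Real.rpow_add hr, Real.rpow_neg hr.le, Real.rpow_natCast]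
        have := (Real.rpow_pos_of_pos hr (2 * s)).ne'
        field_simp
        ring
    _ ≤ _ := mul_le_mul_right h1 _
    _ ≤ _ := h2
    _ ≤ _ := lintegral_mono_set (sdiff_subset.trans hrS)

lemma volume_superlevel_le {N : ℕ} {p : ℝ} (hp : 0 < p) {v : RN N → ℝ} (hv : Measurable v)
    {S : Set (RN N)} {I a : ℝ} (ha : 0 < a)
    (hI : ∫⁻ y in S, ENNReal.ofReal (v y ^ p) ≤ ENNReal.ofReal I) :
    volume (S ∩ {y | a ≤ v y}) ≤ ENNReal.ofReal (I / a ^ p) := by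
  have hap : 0 < a ^ p := Real.rpow_pos_of_pos ha p
  rw [ENNReal.ofReal_div_of_pos hap, ENNReal.le_div_iff_mul_le (by simp [hap]) (by simp), mul_comm]
  refine le_trans ?_ hI
  have := mul_meas_ge_le_lintegral (μ := volume.restrict S)
    (f := fun y => ENNReal.ofReal (v y ^ p)) (by fun_prop) (ENNReal.ofReal (a ^ p))
  refine le_trans (mul_le_mul_right ?_ _) this
  rw [Measure.restrict_apply (measurableSet_le (by fun_prop) (by fun_prop))]
  refine measure_mono fun y hy => ⟨?_, hy.1⟩
  exact ENNReal.ofReal_le_ofReal (Real.rpow_le_rpow ha.le hy.2 hp.le)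

/-- The constant of the fractional Gagliardo–Nirenberg inequality. -/
def gnConst (N : ℕ) (s p : ℝ) : ℝ :=
  (unitVol N / 8 * (unitVol N / 2 ^ (p + 1)) ^ (2 * s / N))⁻¹

lemma gnConst_pos {N : ℕ} {s p : ℝ} : 0 < gnConst N s p := by
  have := unitVol_pos (N := N)
  unfold gnConst; positivity

/-- Pointwise form of the fractional Gagliardo–Nirenberg inequality, at a point `x` for which the
ball whose volume is twice the Chebyshev bound on `{v ≥ v x / 2}` is contained in `S`. -/
lemma rpow_le_mul_lintegral_quotient {N : ℕ} (hN : 2 ≤ N) {s p : ℝ} (hs0 : 0 < s) (hp : 0 < p)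
    {v : RN N → ℝ} (hv : Measurable v) (hv0 : ∀ y, 0 ≤ v y) {S : Set (RN N)}
    (hS : MeasurableSet S) {I : ℝ} (hI0 : 0 < I)
    (hI : ∫⁻ y in S, ENNReal.ofReal (v y ^ p) ≤ ENNReal.ofReal I) {x : RN N}
    (hball : 0 < v x → Metric.ball x ((2 ^ (p + 1) * I / (unitVol N * v x ^ p)) ^ (1 / (N : ℝ))) ⊆ S) :
    ENNReal.ofReal (v x ^ (2 + 2 * s * p / N)) ≤
      ENNReal.ofReal (gnConst N s p * I ^ (2 * s / N)) *
      ∫⁻ y in S, ENNReal.ofReal (|v x - v y| ^ 2 / ‖x - y‖ ^ ((N : ℝ) + 2 * s)) := by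
  have hN0 : (0 : ℝ) < N := by exact_mod_cast (by omega : 0 < N)
  have hω := unitVol_pos (N := N)
  rcases (hv0 x).eq_or_lt with h0 | ha
  · rw [← h0, Real.zero_rpow (by positivity)]; simp
  have hball := hball ha
  set a := v x with hadef
  have hap : 0 < a ^ p := Real.rpow_pos_of_pos ha p
  -- `b = r ^ N` is fixed by requiring that the volume `unitVol N * b` of the ball be twice the
  -- Chebyshev bound `I / (a / 2) ^ p` for the set `{v ≥ a / 2}`.
  set b : ℝ := 2 ^ (p + 1) * I / (unitVol N * a ^ p) with hb
  have hb0 : 0 < b := by positivity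
  set r : ℝ := b ^ (1 / (N : ℝ)) with hr
  have hr0 : 0 < r := Real.rpow_pos_of_pos hb0 _
  have hrN : r ^ N = b := by
    rw [hr, ← Real.rpow_natCast, ← Real.rpow_mul hb0.le]; field_simp; simp
  have h1 := le_lintegral_quotient_of_superlevel hs0 hv hS hr0 hball ha (by
    refine (mul_le_mul_right (volume_superlevel_le hp hv (half_pos ha) hI) _).trans ?_
    rw [volume_ball_eq x hr0, hrN, show (2 : ℝ≥0∞) = ENNReal.ofReal 2 by simp,
      ← ENNReal.ofReal_mul (by norm_num)]
    refine ENNReal.ofReal_le_ofReal (le_of_eq ?_)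
    rw [hb, Real.div_rpow ha.le (by norm_num), Real.rpow_add two_pos]
    field_simp
    simp)
  refine le_trans ?_ (mul_le_mul_right h1 _)
  rw [← ENNReal.ofReal_mul (by have := gnConst_pos (N := N) (s := s) (p := p); positivity)]
  refine ENNReal.ofReal_le_ofReal (le_of_eq ?_)
  have hrs : r ^ (-(2 * s)) = (unitVol N / 2 ^ (p + 1)) ^ (2 * s / N) * a ^ (2 * s * p / N)
      / I ^ (2 * s / N) := by
    rw [hr, ← Real.rpow_mul hb0.le, show 1 / (N : ℝ) * -(2 * s) = -(2 * s / N) by ring,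
      Real.rpow_neg hb0.le, ← Real.inv_rpow hb0.le, hb,
      show (2 ^ (p + 1) * I / (unitVol N * a ^ p))⁻¹ = unitVol N / 2 ^ (p + 1) * a ^ p / I by
        field_simp,
      Real.div_rpow (by positivity) hI0.le, Real.mul_rpow (by positivity) (by positivity),
      ← Real.rpow_mul ha.le]
    congr 3; ring
  rw [← hadef, hrs, gnConst, Real.rpow_add ha]
  have h1 : (unitVol N / 2 ^ (p + 1)) ^ (2 * s / (N : ℝ)) ≠ 0 := by positivity
  have h2 : I ^ (2 * s / (N : ℝ)) ≠ 0 := by positivity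
  set A := (unitVol N / 2 ^ (p + 1)) ^ (2 * s / (N : ℝ))
  field_simp
  simp

/-- Fractional Gagliardo–Nirenberg inequality on `ℝ^N`. -/
lemma lintegral_rpow_le_gagliardo {N : ℕ} (hN : 2 ≤ N) {s p : ℝ} (hs0 : 0 < s) (hp : 0 < p)
    {v : RN N → ℝ} (hv : Measurable v) (hv0 : ∀ y, 0 ≤ v y) {I : ℝ} (hI0 : 0 < I)
    (hI : ∫⁻ y, ENNReal.ofReal (v y ^ p) ≤ ENNReal.ofReal I) :
    ∫⁻ x, ENNReal.ofReal (v x ^ (2 + 2 * s * p / N)) ≤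
      ENNReal.ofReal (gnConst N s p * I ^ (2 * s / N)) *
      ∫⁻ x, ∫⁻ y, ENNReal.ofReal (|v x - v y| ^ 2 / ‖x - y‖ ^ ((N : ℝ) + 2 * s)) := by
  rw [← lintegral_const_mul' _ _ ENNReal.ofReal_ne_top]
  refine lintegral_mono fun x => ?_
  simpa using rpow_le_mul_lintegral_quotient hN hs0 hp hv hv0 MeasurableSet.univ hI0 (by simpa using hI)
    (x := x) (fun _ => subset_univ _)

/-- Local fractional Gagliardo–Nirenberg inequality, on a ball inside a larger set. -/
lemma lintegral_rpow_ball_le {N : ℕ} (hN : 2 ≤ N) {s p : ℝ} (hs0 : 0 < s) (hp : 0 < p)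
    {v : RN N → ℝ} (hv : Measurable v) (hv0 : ∀ y, 0 ≤ v y) {I : ℝ} (hI0 : 0 < I)
    {x₀ : RN N} {ρ R : ℝ} (hρR : ρ < R)
    (hI : ∫⁻ y in Metric.ball x₀ R, ENNReal.ofReal (v y ^ p) ≤ ENNReal.ofReal I) :
    ∫⁻ x in Metric.ball x₀ ρ, ENNReal.ofReal (v x ^ (2 + 2 * s * p / N)) ≤
      ENNReal.ofReal (gnConst N s p * I ^ (2 * s / N)) *
      (∫⁻ x in Metric.ball x₀ R, ∫⁻ y in Metric.ball x₀ R,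
        ENNReal.ofReal (|v x - v y| ^ 2 / ‖x - y‖ ^ ((N : ℝ) + 2 * s))) +
      ENNReal.ofReal ((2 ^ (p + 1) * I / (unitVol N * (R - ρ) ^ N)) ^ ((2 + 2 * s * p / N) / p)) *
        volume (Metric.ball x₀ ρ) := by
  have hN0 : (0 : ℝ) < N := by exact_mod_cast (by omega : 0 < N)
  have hω := unitVol_pos (N := N)
  have hd : 0 < R - ρ := by linarith
  rw [← lintegral_const_mul' _ _ ENNReal.ofReal_ne_top, ← setLIntegral_const]
  refine le_trans ?_ (add_le_add_left (lintegral_mono_set (Metric.ball_subset_ball hρR.le)) _)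
  rw [← lintegral_add_right _ measurable_const]
  refine setLIntegral_mono' Metric.isOpen_ball.measurableSet fun x hx => ?_
  -- If `v x` is above this threshold, the radius in the pointwise inequality is at most `R - ρ` and
  -- the ball stays inside `B_R`. Otherwise `v x` is bounded by a constant, which the second summand
  -- pays for.
  by_cases h : 0 < v x ∧ (2 ^ (p + 1) * I / (unitVol N * (R - ρ) ^ N)) < v x ^ p
  · refine le_trans ?_ le_self_add
    refine rpow_le_mul_lintegral_quotient hN hs0 hp hv hv0 Metric.isOpen_ball.measurableSet hI0 hI ?_
    intro ha
    refine Metric.ball_subset_ball' ?_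
    have h1 : (2 ^ (p + 1) * I / (unitVol N * v x ^ p)) ^ (1 / (N : ℝ)) ≤ R - ρ := by
      rw [one_div, Real.rpow_inv_le_iff_of_pos (by positivity) hd.le hN0, Real.rpow_natCast]
      have h2 := h.2
      rw [div_lt_iff₀ (by positivity)] at h2
      rw [div_le_iff₀ (by positivity)]
      nlinarith
    have h2 : dist x x₀ < ρ := hx
    linarith
  · refine le_trans ?_ le_add_self
    refine ENNReal.ofReal_le_ofReal ?_
    have hb0 : 0 < 2 ^ (p + 1) * I / (unitVol N * (R - ρ) ^ N) := by positivity
    rcases (hv0 x).eq_or_lt with h0 | ha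
    · rw [← h0, Real.zero_rpow (by positivity)]; positivity
    · have h3 : v x ^ p ≤ 2 ^ (p + 1) * I / (unitVol N * (R - ρ) ^ N) := by
        by_contra h4; exact h ⟨ha, not_le.1 h4⟩
      calc v x ^ (2 + 2 * s * p / N) = (v x ^ p) ^ ((2 + 2 * s * p / N) / p) := by
            rw [← Real.rpow_mul ha.le]; congr 1; field_simp
        _ ≤ _ := by gcongr

/-! ### Entropy of the truncation, discrete chain rule and coercivity. -/

/-- The entropy `∫_ℓ^u (τ - ℓ)₊ q τ^{q-1} dτ` of the truncation at level `ℓ`. -/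
def entropy (q u ℓ : ℝ) : ℝ :=
  if ℓ < u then q / (q + 1) * u ^ (q + 1) - ℓ * u ^ q + ℓ ^ (q + 1) / (q + 1) else 0

lemma measurable_entropy {q : ℝ} : Measurable fun z : ℝ × ℝ => entropy q z.1 z.2 := by
  unfold entropy
  exact Measurable.ite (measurableSet_lt (by fun_prop) (by fun_prop)) (by fun_prop) (by fun_prop)

/-- The difference of the two sides vanishes at `u = ℓ`, and its derivative `(q u ^ (q - 1) - (u -
ℓ) ^ (q - 1)) (u - ℓ)` is nonnegative for `u > ℓ`. This turns control of the entropy into control of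
the `L^(q+1)` norm of the truncation. -/
lemma rpow_add_one_div_le_entropy {q u ℓ : ℝ} (hq : 1 < q) (hℓ : 0 ≤ ℓ) :
    max (u - ℓ) 0 ^ (q + 1) / (q + 1) ≤ entropy q u ℓ := by
  unfold entropy
  split_ifs with h
  · rw [max_eq_left (by linarith)]
    have hmono : MonotoneOn (fun x : ℝ => q / (q + 1) * x ^ (q + 1) - ℓ * x ^ q +
        ℓ ^ (q + 1) / (q + 1) - (x - ℓ) ^ (q + 1) / (q + 1)) (Ici ℓ) := by
      have hd : ∀ x : ℝ, HasDerivAt (fun x : ℝ => q / (q + 1) * x ^ (q + 1) - ℓ * x ^ q +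
          ℓ ^ (q + 1) / (q + 1) - (x - ℓ) ^ (q + 1) / (q + 1))
          (q * x ^ q - ℓ * (q * x ^ (q - 1)) - (x - ℓ) ^ q) x := by
        intro x
        have h1 := (Real.hasDerivAt_rpow_const (x := x) (p := q + 1) (Or.inr (by linarith))).const_mul
          (q / (q + 1))
        have h2 := (Real.hasDerivAt_rpow_const (x := x) (p := q) (Or.inr hq.le)).const_mul ℓ
        have h3 := (((hasDerivAt_id x).sub_const ℓ).rpow_const (p := q + 1)
          (Or.inr (by linarith))).div_const (q + 1)
        have h4 := ((h1.sub h2).add_const (ℓ ^ (q + 1) / (q + 1))).sub h3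
        refine h4.congr_deriv ?_
        have : q + 1 ≠ 0 := by linarith
        simp only [add_sub_cancel_right, id]
        field_simp
      refine monotoneOn_of_deriv_nonneg (convex_Ici ℓ)
        (fun x _ => (hd x).continuousAt.continuousWithinAt)
        (fun x _ => (hd x).differentiableAt.differentiableWithinAt) fun x hx => ?_
      rw [interior_Ici] at hx
      have hx : ℓ < x := hx
      have hx0 : 0 < x := hℓ.trans_lt hx
      rw [(hd x).deriv]
      have e1 : x ^ q = x ^ (q - 1) * x := by
        rw [← Real.rpow_add_one hx0.ne']; simp
      have e2 : (x - ℓ) ^ q = (x - ℓ) ^ (q - 1) * (x - ℓ) := by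
        rw [← Real.rpow_add_one (by linarith)]; simp
      have e3 : (x - ℓ) ^ (q - 1) ≤ x ^ (q - 1) :=
        Real.rpow_le_rpow (by linarith) (by linarith) (by linarith)
      have e4 : 0 ≤ x ^ (q - 1) := by positivity
      rw [e1, e2]
      nlinarith [mul_nonneg (sub_nonneg.2 e3) (sub_nonneg.2 hx.le),
        mul_nonneg (mul_nonneg (sub_nonneg.2 hq.le) e4) (sub_nonneg.2 hx.le)]
    have := hmono self_mem_Ici (mem_Ici.2 h.le) h.le
    have e5 : ℓ * ℓ ^ q = ℓ ^ (q + 1) := by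
      rw [Real.rpow_add_one' hℓ (by linarith), mul_comm]
    have hq1 : q + 1 ≠ 0 := by linarith
    have e6 : q / (q + 1) * ℓ ^ (q + 1) - ℓ * ℓ ^ q + ℓ ^ (q + 1) / (q + 1) = 0 := by
      rw [e5]; field_simp; ring
    simp only [sub_self] at this
    rw [e6, Real.zero_rpow hq1, zero_div, sub_zero] at this
    linarith
  · rw [max_eq_right (by linarith), Real.zero_rpow (by linarith)]; simp

lemma entropy_nonneg {q u ℓ : ℝ} (hq : 1 < q) (hℓ : 0 ≤ ℓ) : 0 ≤ entropy q u ℓ :=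
  le_trans (by positivity) (rpow_add_one_div_le_entropy hq hℓ)

lemma entropy_le {q u ℓ : ℝ} (hq : 1 < q) (hℓ : 0 ≤ ℓ) :
    entropy q u ℓ ≤ if ℓ < u then u ^ (q + 1) else 0 := by
  unfold entropy
  split_ifs with h
  · have hu : 0 < u := hℓ.trans_lt h
    have e1 : ℓ ^ (q + 1) ≤ ℓ * u ^ q := by
      rw [Real.rpow_add_one' hℓ (by linarith), mul_comm]
      exact mul_le_mul_of_nonneg_left (Real.rpow_le_rpow hℓ h.le (by linarith)) hℓ
    have e2 : 0 ≤ u ^ (q + 1) := by positivity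
    have e3 : 0 ≤ ℓ * u ^ q := by positivity
    have e4 : ℓ ^ (q + 1) / (q + 1) ≤ ℓ * u ^ q :=
      (div_le_self (by positivity) (by linarith)).trans e1
    have e5 : q / (q + 1) * u ^ (q + 1) ≤ 1 * u ^ (q + 1) := by
      gcongr; rw [div_le_one (by linarith)]; linarith
    linarith
  · exact le_rfl

/-- The convex conjugate of the entropy. -/
def entropyConj (q y ℓ : ℝ) : ℝ :=
  ((y + ℓ) ^ (q + 1) - ℓ ^ (q + 1)) / (q + 1) - ℓ ^ q * y

lemma one_le_rpow_add_sub {q y ℓ : ℝ} (hq : 1 < q) (hℓ : 0 < ℓ) (hy : 0 ≤ y) :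
    q * ℓ ^ (q - 1) * y ≤ (y + ℓ) ^ q - ℓ ^ q := by
  have h := one_add_mul_self_le_rpow_one_add (s := y / ℓ) (by
    have : 0 ≤ y / ℓ := by positivity
    linarith) hq.le
  have e1 : (y + ℓ) ^ q = ℓ ^ q * (1 + y / ℓ) ^ q := by
    rw [← Real.mul_rpow hℓ.le (by positivity)]; congr 1; field_simp; ring
  have e2 : ℓ ^ q = ℓ ^ (q - 1) * ℓ := by
    rw [← Real.rpow_add_one hℓ.ne']; simp
  have e3 : 0 ≤ ℓ ^ q := by positivity
  have e4 : ℓ ^ q * (y / ℓ) = ℓ ^ (q - 1) * y := by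
    rw [e2]; field_simp
  rw [e1]
  nlinarith [mul_le_mul_of_nonneg_left h e3]

/-- The derivative in the level is `(y + ℓ) ^ q - ℓ ^ q - q ℓ ^ (q - 1) y`, which is nonnegative by
Bernoulli's inequality. Through this monotonicity a level that increases in time is admissible in
the chain rule. -/
lemma entropyConj_mono {q y ℓ₀ ℓ₁ : ℝ} (hq : 1 < q) (hy : 0 ≤ y) (h0 : 0 ≤ ℓ₀) (h1 : ℓ₀ ≤ ℓ₁) :
    entropyConj q y ℓ₀ ≤ entropyConj q y ℓ₁ := by
  have hd : ∀ x : ℝ, HasDerivAt (fun ℓ : ℝ => entropyConj q y ℓ)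
      ((y + x) ^ q - x ^ q - q * x ^ (q - 1) * y) x := by
    intro x
    have hA := ((hasDerivAt_id x).const_add y).rpow_const (p := q + 1) (Or.inr (by linarith))
    have hB := Real.hasDerivAt_rpow_const (x := x) (p := q + 1) (Or.inr (by linarith))
    have hC := (Real.hasDerivAt_rpow_const (x := x) (p := q) (Or.inr hq.le)).mul_const y
    have h4 := ((hA.sub hB).div_const (q + 1)).sub hC
    refine h4.congr_deriv ?_
    have : q + 1 ≠ 0 := by linarith
    simp only [add_sub_cancel_right, id]
    field_simp
  have hmono : MonotoneOn (fun ℓ : ℝ => entropyConj q y ℓ) (Ici 0) := by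
    refine monotoneOn_of_deriv_nonneg (convex_Ici 0)
        (fun x _ => (hd x).continuousAt.continuousWithinAt)
        (fun x _ => (hd x).differentiableAt.differentiableWithinAt) fun x hx => ?_
    rw [interior_Ici] at hx
    rw [(hd x).deriv]
    linarith [one_le_rpow_add_sub hq hx hy]
  exact hmono h0 (h0.trans h1) h1

/-- Discrete chain rule for the entropy with a level that increases in time. -/
lemma entropy_sub_le {q u₀ u₁ ℓ₀ ℓ₁ : ℝ} (hq : 1 < q) (hu₀ : 0 ≤ u₀) (hℓ₀ : 0 ≤ ℓ₀)
    (hℓ : ℓ₀ ≤ ℓ₁) :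
    entropy q u₁ ℓ₁ - entropy q u₀ ℓ₀ + (ℓ₁ ^ q - ℓ₀ ^ q) * max (u₁ - ℓ₁) 0 ≤
      (u₁ ^ q - u₀ ^ q) * max (u₁ - ℓ₁) 0 := by
  have hn := entropy_nonneg (u := u₀) hq hℓ₀
  by_cases h : ℓ₁ < u₁
  swap
  · rw [max_eq_right (by linarith), show entropy q u₁ ℓ₁ = 0 by simp [entropy, h]]
    linarith
  rw [max_eq_left (by linarith)]
  have hℓ₁ : 0 ≤ ℓ₁ := hℓ₀.trans hℓ
  have hu₁ : 0 < u₁ := hℓ₁.trans_lt h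
  set v := u₁ - ℓ₁ with hv
  have hv0 : 0 < v := by simp [hv, h]
  have hq1 : q + 1 ≠ 0 := by linarith
  -- At the later time `v = u₁ - ℓ₁` is the optimal dual variable, so the Fenchel–Young inequality
  -- is an equality.
  have e1 : (u₁ ^ q - ℓ₁ ^ q) * v - entropy q u₁ ℓ₁ = entropyConj q v ℓ₁ := by
    rw [entropy, if_pos h, entropyConj, show v + ℓ₁ = u₁ by simp [hv],
      Real.rpow_add_one hu₁.ne', Real.rpow_add_one' hℓ₁ hq1, hv]
    field_simp
    ring
  -- At the earlier time `v` is an arbitrary nonnegative dual variable and only the inequality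
  -- holds. It reduces to Young's inequality with exponents `q + 1` and `(q + 1) / q` if `u₀ > ℓ₀`;
  -- if `u₀ ≤ ℓ₀`, the left-hand side is nonpositive.
  have e2 : (u₀ ^ q - ℓ₀ ^ q) * v ≤ entropyConj q v ℓ₀ + entropy q u₀ ℓ₀ := by
    by_cases h0 : ℓ₀ < u₀
    · have hp : (q + 1).HolderConjugate ((q + 1) / q) := by
        rw [Real.holderConjugate_iff]
        constructor
        · linarith
        · field_simp
          ring
      have hY := Real.young_inequality_of_nonneg (a := v + ℓ₀) (b := u₀ ^ q) (by positivity)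
        (by positivity) hp
      have e3 : (u₀ ^ q) ^ ((q + 1) / q) = u₀ ^ (q + 1) := by
        rw [← Real.rpow_mul hu₀]; congr 1; field_simp
      rw [e3] at hY
      rw [entropy, if_pos h0, entropyConj]
      have e4 : u₀ ^ (q + 1) / ((q + 1) / q) = q / (q + 1) * u₀ ^ (q + 1) := by
        field_simp
      rw [e4] at hY
      have e5 : ((v + ℓ₀) ^ (q + 1) - ℓ₀ ^ (q + 1)) / (q + 1) =
        (v + ℓ₀) ^ (q + 1) / (q + 1) - ℓ₀ ^ (q + 1) / (q + 1) := by ring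
      rw [e5]
      linarith
    · have h1 : u₀ ^ q ≤ ℓ₀ ^ q := Real.rpow_le_rpow hu₀ (not_lt.1 h0) (by linarith)
      have h2 : 0 ≤ entropyConj q v ℓ₀ := by
        have h3 : entropyConj q v 0 = v ^ (q + 1) / (q + 1) := by
          rw [entropyConj, Real.zero_rpow hq1, Real.zero_rpow (by linarith)]; simp
        exact (h3 ▸ by positivity : 0 ≤ entropyConj q v 0).trans
          (entropyConj_mono hq hv0.le le_rfl hℓ₀)
      nlinarith
  -- Comparing the conjugates at the two levels links the equality `e1` with the inequality `e2`.
  have e3 := entropyConj_mono hq hv0.le hℓ₀ hℓ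
  nlinarith

/-- Coercivity of the product of increments of a function and of its truncation. -/
lemma increment_mul_trunc_ge {u₁ u₂ ℓ₁ ℓ₂ : ℝ} :
    (max (u₁ - ℓ₁) 0 - max (u₂ - ℓ₂) 0) ^ 2 / 2
      - (if ℓ₁ < u₁ ∨ ℓ₂ < u₂ then (ℓ₁ - ℓ₂) ^ 2 / 2 else 0) ≤
      (u₁ - u₂) * (max (u₁ - ℓ₁) 0 - max (u₂ - ℓ₂) 0) := by
  -- Taking the positive part is nondecreasing and 1-Lipschitz in `u - ℓ`.
  have key : (max (u₁ - ℓ₁) 0 - max (u₂ - ℓ₂) 0) ^ 2 ≤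
      ((u₁ - ℓ₁) - (u₂ - ℓ₂)) * (max (u₁ - ℓ₁) 0 - max (u₂ - ℓ₂) 0) := by
    rcases le_total (u₁ - ℓ₁) 0 with h1 | h1 <;> rcases le_total (u₂ - ℓ₂) 0 with h2 | h2 <;>
      simp only [max_eq_left, max_eq_right, h1, h2] <;> nlinarith
  split_ifs with h
  -- Write `u₁ - u₂ = ((u₁ - ℓ₁) - (u₂ - ℓ₂)) + (ℓ₁ - ℓ₂)`; Young's inequality spends half of the
  -- square on the increment of the level.
  · nlinarith [sq_nonneg ((max (u₁ - ℓ₁) 0 - max (u₂ - ℓ₂) 0) + (ℓ₁ - ℓ₂))]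
  · rw [not_or] at h
    rw [max_eq_right (by linarith), max_eq_right (by linarith)]
    simp

/-! ### Limits of time differences. -/

lemma measurePreserving_shift {N : ℕ} (θ : ℝ) :
    MeasurePreserving (fun z : ℝ × (RN N × RN N) => (z.1 - θ, z.2)) :=
  (measurePreserving_sub_right volume θ).prod (MeasurePreserving.id volume)

/-- Time correlations of two square-integrable functions are continuous in the shift. -/
lemma continuous_integral_shift_mul {N : ℕ} {f g : ℝ × (RN N × RN N) → ℝ}
    (hf : MemLp f 2) (hg : MemLp g 2) :
    Continuous fun θ : ℝ => ∫ z : ℝ × (RN N × RN N), f (z.1 - θ, z.2) * g z := by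
  let F : Lp ℝ 2 (volume : Measure (ℝ × (RN N × RN N))) := hf.toLp f
  let G : Lp ℝ 2 (volume : Measure (ℝ × (RN N × RN N))) := hg.toLp g
  let S : C(ℝ, C(ℝ × (RN N × RN N), ℝ × (RN N × RN N))) :=
    (ContinuousMap.mk (fun w : ℝ × (ℝ × (RN N × RN N)) => (w.2.1 - w.1, w.2.2))
      (by fun_prop)).curry
  have hS : ∀ θ, MeasurePreserving (S θ) volume volume := measurePreserving_shift
  have hcont : Continuous fun θ : ℝ => Lp.compMeasurePreserving (S θ) (hS θ) F :=
    continuous_const.compMeasurePreservingLp S.continuous hS (by simp)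
  have h2 : Continuous fun θ : ℝ => inner ℝ (Lp.compMeasurePreserving (S θ) (hS θ) F) G :=
    hcont.inner continuous_const
  refine h2.congr fun θ => ?_
  rw [L2.inner_def]
  refine integral_congr_ae ?_
  filter_upwards [Lp.coeFn_compMeasurePreserving F (hS θ),
    (hS θ).quasiMeasurePreserving.ae_eq_comp hf.coeFn_toLp, hg.coeFn_toLp] with z h1 h2 h3
  have h4 : F (S θ z) = f (S θ z) := h2
  rw [h1, show G z = g z from h3, Function.comp_apply, h4]
  simp [S, mul_comm]

/-- Dominated by the sum of the squares, whose integral does not see the shift. It justifies the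
exchanges of integrals below. -/
lemma integrable_shift_mul {N : ℕ} {f g : ℝ × (RN N × RN N) → ℝ}
    (hf : MemLp f 2) (hg : MemLp g 2) (hfm : Measurable f) (hgm : Measurable g) (h : ℝ) :
    Integrable (fun w : ℝ × (ℝ × (RN N × RN N)) => f (w.2.1 - w.1, w.2.2) * g w.2)
      ((volume.restrict (Ioc 0 h)).prod volume) := by
  have hmp := measurePreserving_shift (N := N)
  have hf2 : Integrable (fun z => f z ^ 2) := hf.integrable_sq
  have hg2 : Integrable (fun z => g z ^ 2) := hg.integrable_sq
  have h1 : Integrable (fun w : ℝ × (ℝ × (RN N × RN N)) => f (w.2.1 - w.1, w.2.2) ^ 2)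
      ((volume.restrict (Ioc 0 h)).prod volume) := by
    rw [integrable_prod_iff (by
      exact (show Measurable _ by fun_prop : Measurable _).aestronglyMeasurable)]
    refine ⟨Eventually.of_forall fun θ => (hmp θ).integrable_comp_of_integrable hf2, ?_⟩
    have : ∀ θ : ℝ, ∫ z : ℝ × (RN N × RN N), ‖f (z.1 - θ, z.2) ^ 2‖ = ∫ z, ‖f z ^ 2‖ := by
      intro θ
      have := integral_map (hmp θ).aemeasurable (f := fun z => ‖f z ^ 2‖)
        (show Measurable _ by fun_prop : Measurable _).aestronglyMeasurable
      rw [(hmp θ).map_eq] at this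
      exact this.symm
    simp only [this]
    exact integrable_const _
  have h2 : Integrable (fun w : ℝ × (ℝ × (RN N × RN N)) => g w.2 ^ 2)
      ((volume.restrict (Ioc 0 h)).prod volume) := hg2.comp_snd _
  refine (h1.add h2).mono' (show Measurable _ by fun_prop : Measurable _).aestronglyMeasurable
    (Eventually.of_forall fun w => ?_)
  simp only [Pi.add_apply, Real.norm_eq_abs, abs_mul]
  nlinarith [sq_nonneg (|f (w.2.1 - w.1, w.2.2)| - |g w.2|), sq_abs (f (w.2.1 - w.1, w.2.2)),
    sq_abs (g w.2), abs_nonneg (f (w.2.1 - w.1, w.2.2)), abs_nonneg (g w.2)]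

/-- The substitution `τ = t - θ` and Fubini's theorem turn the window integral into an integral over
shifts `θ` of time correlations, which are continuous in `θ`. Dividing by `h` then has a limit. -/
lemma integral_window_mul {N : ℕ} {f g : ℝ × (RN N × RN N) → ℝ}
    (hf : MemLp f 2) (hg : MemLp g 2) (hfm : Measurable f) (hgm : Measurable g) {h : ℝ}
    (hh : 0 ≤ h) :
    Integrable (fun t : ℝ => ∫ τ in (t - h)..t, ∫ p, f (τ, p) * g (t, p)) ∧
    ∫ t : ℝ, (∫ τ in (t - h)..t, ∫ p, f (τ, p) * g (t, p)) =
      ∫ θ in (0 : ℝ)..h, ∫ z : ℝ × (RN N × RN N), f (z.1 - θ, z.2) * g z := by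
  have hI := integrable_shift_mul hf hg hfm hgm h
  have e0 : ∀ t : ℝ, (∫ τ in (t - h)..t, ∫ p, f (τ, p) * g (t, p)) =
      ∫ θ in Ioc 0 h, ∫ p, f (t - θ, p) * g (t, p) := by
    intro t
    rw [← intervalIntegral.integral_of_le hh,
      intervalIntegral.integral_comp_sub_left (fun τ => ∫ p, f (τ, p) * g (t, p)) t]
    simp
  have hI2 : Integrable (fun z : ℝ × (RN N × RN N) =>
      ∫ θ in Ioc 0 h, f (z.1 - θ, z.2) * g z) := hI.integral_prod_right
  have e1 : ∀ᵐ t : ℝ, (∫ p, ∫ θ in Ioc 0 h, f (t - θ, p) * g (t, p)) =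
      ∫ θ in Ioc 0 h, ∫ p, f (t - θ, p) * g (t, p) := by
    have hI3 : Integrable (fun w : ℝ × (ℝ × (RN N × RN N)) => f (w.1 - w.2.1, w.2.2) * g (w.1, w.2.2))
        (volume.prod ((volume.restrict (Ioc 0 h)).prod volume)) := by
      have hm1 : MeasurePreserving (fun w : ℝ × (ℝ × (RN N × RN N)) => ((w.1, w.2.1), w.2.2))
          (volume.prod ((volume.restrict (Ioc 0 h)).prod volume))
          ((volume.prod (volume.restrict (Ioc 0 h))).prod volume) :=
        (measurePreserving_prodAssoc _ _ _).symm
      have hm2 : MeasurePreserving (fun w : (ℝ × ℝ) × (RN N × RN N) => ((w.1.2, w.1.1), w.2))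
          (((volume : Measure ℝ).prod (volume.restrict (Ioc 0 h))).prod
            (volume : Measure (RN N × RN N)))
          (((volume.restrict (Ioc 0 h)).prod volume).prod volume) :=
        Measure.measurePreserving_swap.prod (MeasurePreserving.id _)
      have hm3 : MeasurePreserving (fun w : (ℝ × ℝ) × (RN N × RN N) => (w.1.1, (w.1.2, w.2)))
          (((volume.restrict (Ioc 0 h)).prod (volume : Measure ℝ)).prod
            (volume : Measure (RN N × RN N)))
          ((volume.restrict (Ioc 0 h)).prod (volume.prod volume)) :=
        measurePreserving_prodAssoc _ _ _
      exact ((hm3.comp hm2).comp hm1).integrable_comp_of_integrable hI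
    filter_upwards [hI3.prod_right_ae] with t ht
    exact (integral_integral_swap ht).symm
  constructor
  · simp only [e0]
    refine hI2.integral_prod_left.congr ?_
    filter_upwards [e1] with t ht using ht
  · simp only [e0]
    rw [integral_congr_ae (e1.mono fun t ht => ht.symm),
      intervalIntegral.integral_of_le hh,
      integral_integral_swap (f := fun θ (z : ℝ × (RN N × RN N)) => f (z.1 - θ, z.2) * g z) hI]
    exact (integral_prod _ hI2).symm

/-- Passage to the limit in the time differences of a weak inequality. -/
lemma sub_add_integral_le_of_window {N : ℕ} {f g : ℝ × (RN N × RN N) → ℝ}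
    (hf : MemLp f 2) (hg : MemLp g 2) (hfm : Measurable f) (hgm : Measurable g)
    {X : ℝ → ℝ} {a t₁ t₂ : ℝ} (hX : Integrable X) (ha : a < t₁) (h12 : t₁ < t₂)
    (hg0 : ∀ t p, t ∉ Ioo t₁ t₂ → g (t, p) = 0)
    (hw : ∀ h, 0 < h → h < t₁ - a → ∀ᵐ t, t ∈ Ioo t₁ t₂ →
      X t - X (t - h) + (∫ τ in (t - h)..t, ∫ p, f (τ, p) * g (t, p)) ≤ 0)
    (hd₁ : HasDerivAt (fun x => ∫ t in a..x, X t) (X t₁) t₁)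
    (hd₂ : HasDerivAt (fun x => ∫ t in a..x, X t) (X t₂) t₂) :
    X t₂ - X t₁ + ∫ z, f z * g z ≤ 0 := by
  set Ψ : ℝ → ℝ := fun x => ∫ t in a..x, X t with hΨ
  set D : ℝ → ℝ := fun θ => ∫ z : ℝ × (RN N × RN N), f (z.1 - θ, z.2) * g z with hD
  have hDc : Continuous D := continuous_integral_shift_mul hf hg
  have hD0 : D 0 = ∫ z, f z * g z := by simp [hD]
  -- `W h` is the left-hand side of the window inequality integrated over `t ∈ (t₁, t₂)`. It
  -- vanishes at `h = 0` and is nonpositive for small `h > 0`, so its derivative at `0`, which is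
  -- the quantity to be bounded, is nonpositive.
  set W : ℝ → ℝ := fun h => Ψ t₂ - Ψ t₁ - (Ψ (t₂ - h) - Ψ (t₁ - h)) + ∫ θ in (0 : ℝ)..h, D θ with hW
  have hW0 : W 0 = 0 := by simp [hW]
  have hWd : HasDerivAt W (X t₂ - X t₁ + D 0) 0 := by
    have d1 : HasDerivAt (fun h : ℝ => Ψ (t₂ - h)) (-X t₂) 0 := by
      exact HasDerivAt.comp_const_sub t₂ 0 (by rw [sub_zero]; exact hd₂)
    have d2 : HasDerivAt (fun h : ℝ => Ψ (t₁ - h)) (-X t₁) 0 := by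
      exact HasDerivAt.comp_const_sub t₁ 0 (by rw [sub_zero]; exact hd₁)
    have d3 : HasDerivAt (fun h : ℝ => ∫ θ in (0 : ℝ)..h, D θ) (D 0) 0 :=
      intervalIntegral.integral_hasDerivAt_right (hDc.intervalIntegrable _ _)
        hDc.stronglyMeasurable.stronglyMeasurableAtFilter hDc.continuousAt
    refine (((d1.sub d2).const_sub (Ψ t₂ - Ψ t₁)).add d3).congr_deriv ?_
    ring
  rw [← hD0]
  have hlim := hWd.tendsto_slope_zero_right
  refine le_of_tendsto hlim ?_
  have hpos : ∀ᶠ h in 𝓝[>] (0 : ℝ), h < t₁ - a :=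
    mem_nhdsWithin_of_mem_nhds (Iio_mem_nhds (by linarith))
  filter_upwards [hpos, self_mem_nhdsWithin] with h hh hh0
  have hh0 : 0 < h := hh0
  obtain ⟨hJ, hJe⟩ := integral_window_mul hf hg hfm hgm hh0.le
  have hXi : ∀ x y, IntervalIntegrable X volume x y := fun x y => hX.intervalIntegrable
  have hXs : ∀ x y, IntervalIntegrable (fun t => X (t - h)) volume x y := fun x y =>
    (hX.comp_sub_right h).intervalIntegrable
  have key : (∫ t in t₁..t₂, X t - X (t - h)) +
      (∫ t in t₁..t₂, ∫ τ in (t - h)..t, ∫ p, f (τ, p) * g (t, p)) ≤ 0 := by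
    rw [← intervalIntegral.integral_add ((hXi _ _).sub (hXs _ _)) hJ.intervalIntegrable,
      intervalIntegral.integral_of_le h12.le, integral_Ioc_eq_integral_Ioo]
    refine integral_nonpos_of_ae ?_
    exact (ae_restrict_iff' measurableSet_Ioo).2 (hw h hh0 hh)
  have e1 : (∫ t in t₁..t₂, ∫ τ in (t - h)..t, ∫ p, f (τ, p) * g (t, p)) =
      ∫ θ in (0 : ℝ)..h, D θ := by
    rw [hD, ← hJe, intervalIntegral.integral_of_le h12.le, integral_Ioc_eq_integral_Ioo,
      setIntegral_eq_integral_of_forall_compl_eq_zero]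
    intro t ht
    simp [hg0 t _ ht]
  have e2 : (∫ t in t₁..t₂, X t - X (t - h)) = Ψ t₂ - Ψ t₁ - (Ψ (t₂ - h) - Ψ (t₁ - h)) := by
    rw [intervalIntegral.integral_sub (hXi _ _) (hXs _ _),
      intervalIntegral.integral_comp_sub_right (fun t => X t) h, hΨ]
    rw [intervalIntegral.integral_interval_sub_left (hXi _ _) (hXi _ _),
      intervalIntegral.integral_interval_sub_left (hXi _ _) (hXi _ _)]
  have hWh : W h ≤ 0 := by
    rw [hW]; simp only; rw [← e2, ← e1]; exact key
  simp only [zero_add, hW0, sub_zero, smul_eq_mul]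
  exact mul_nonpos_of_nonneg_of_nonpos (inv_nonneg.2 hh0.le) hWh

/-! ### The barrier, near pairs and far pairs. -/

/-- The kernel `|x-y|^{-N-2s}`. -/
def kern {N : ℕ} (s : ℝ) (x y : RN N) : ℝ := 1 / ‖x - y‖ ^ ((N : ℝ) + 2 * s)

lemma kern_nonneg {N : ℕ} {s : ℝ} (x y : RN N) : 0 ≤ kern s x y := by
  unfold kern; positivity

lemma kern_comm {N : ℕ} {s : ℝ} (x y : RN N) : kern s x y = kern s y x := by
  unfold kern; rw [norm_sub_rev]

@[fun_prop]
lemma Measurable.kern {N : ℕ} {s : ℝ} {α : Type*} [MeasurableSpace α] {f g : α → RN N}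
    (hf : Measurable f) (hg : Measurable g) : Measurable fun a => kern s (f a) (g a) := by
  unfold _root_.kern; fun_prop

/-- The blow-up exponent of the barrier. -/
def barExp (N : ℕ) (s q : ℝ) : ℝ := N + 2 * s + 2 * s / (q - 1)

/-- The distance to the boundary of `B_R(x₀)`, relative to `R`. -/
def relDist {N : ℕ} (x₀ : RN N) (R : ℝ) (x : RN N) : ℝ := 1 - ‖x - x₀‖ / R

/-- A barrier that is at least `1` in `B_R(x₀)` and blows up at the boundary. -/
def barrier {N : ℕ} (s q : ℝ) (x₀ : RN N) (R : ℝ) (x : RN N) : ℝ :=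
  relDist x₀ R x ^ (-barExp N s q)

@[fun_prop]
lemma Measurable.relDist {N : ℕ} {x₀ : RN N} {R : ℝ} {α : Type*} [MeasurableSpace α]
    {f : α → RN N} (hf : Measurable f) : Measurable fun a => relDist x₀ R (f a) := by
  unfold _root_.relDist; fun_prop

@[fun_prop]
lemma Measurable.barrier {N : ℕ} {s q : ℝ} {x₀ : RN N} {R : ℝ} {α : Type*} [MeasurableSpace α]
    {f : α → RN N} (hf : Measurable f) : Measurable fun a => barrier s q x₀ R (f a) := by
  unfold _root_.barrier; fun_prop

/-- Pairs of points of `B_R(x₀)` that are close compared with their distance to the boundary. -/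
def nearSet {N : ℕ} (x₀ : RN N) (R : ℝ) : Set (RN N × RN N) :=
  {p | ‖p.1 - p.2‖ < R * relDist x₀ R p.1 / 2 ∧ ‖p.1 - p.2‖ < R * relDist x₀ R p.2 / 2}

lemma measurableSet_nearSet {N : ℕ} (x₀ : RN N) (R : ℝ) : MeasurableSet (nearSet x₀ R) := by
  have h1 : MeasurableSet {p : RN N × RN N | ‖p.1 - p.2‖ < R * relDist x₀ R p.1 / 2} :=
    measurableSet_lt (by fun_prop) (by fun_prop)
  have h2 : MeasurableSet {p : RN N × RN N | ‖p.1 - p.2‖ < R * relDist x₀ R p.2 / 2} :=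
    measurableSet_lt (by fun_prop) (by fun_prop)
  exact h1.inter h2

lemma mem_nearSet_swap {N : ℕ} {x₀ : RN N} {R : ℝ} {x y : RN N} :
    (x, y) ∈ nearSet x₀ R ↔ (y, x) ∈ nearSet x₀ R := by
  simp only [nearSet, mem_ofPred_eq, norm_sub_rev y x]
  exact and_comm

section
variable {N : ℕ} {s q : ℝ} {x₀ : RN N} {R : ℝ} {x y : RN N}

lemma barExp_pos (hN : 2 ≤ N) (hs0 : 0 < s) (hq : 1 < q) : 0 < barExp N s q := by
  have hN0 : (0 : ℝ) < N := by exact_mod_cast (by omega : 0 < N)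
  have : 0 < q - 1 := by linarith
  unfold barExp; positivity

lemma relDist_pos_iff (hR : 0 < R) : 0 < relDist x₀ R x ↔ x ∈ Metric.ball x₀ R := by
  unfold relDist
  rw [Metric.mem_ball, dist_eq_norm, sub_pos, div_lt_one hR]

lemma relDist_le_one (hR : 0 < R) : relDist x₀ R x ≤ 1 := by
  unfold relDist
  have : 0 ≤ ‖x - x₀‖ / R := by positivity
  linarith

lemma abs_relDist_sub_le (hR : 0 < R) :
    |relDist x₀ R x - relDist x₀ R y| ≤ ‖x - y‖ / R := by
  unfold relDist
  rw [show (1 - ‖x - x₀‖ / R - (1 - ‖y - x₀‖ / R)) = -((‖x - x₀‖ - ‖y - x₀‖) / R) by ring,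
    abs_neg, abs_div, abs_of_pos hR]
  gcongr
  have := abs_norm_sub_norm_le (x - x₀) (y - x₀)
  simpa using this

lemma left_mem_ball_of_mem_nearSet (hR : 0 < R) (h : (x, y) ∈ nearSet x₀ R) :
    x ∈ Metric.ball x₀ R := by
  rw [← relDist_pos_iff hR]
  have := (norm_nonneg _).trans_lt h.1
  simp only at this
  by_contra h'
  nlinarith

lemma right_mem_ball_of_mem_nearSet (hR : 0 < R) (h : (x, y) ∈ nearSet x₀ R) :
    y ∈ Metric.ball x₀ R :=
  left_mem_ball_of_mem_nearSet hR (mem_nearSet_swap.1 h)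

lemma one_le_barrier (hN : 2 ≤ N) (hs0 : 0 < s) (hq : 1 < q) (hR : 0 < R)
    (hx : x ∈ Metric.ball x₀ R) : 1 ≤ barrier s q x₀ R x :=
  Real.one_le_rpow_of_pos_of_le_one_of_nonpos ((relDist_pos_iff hR).2 hx) (relDist_le_one hR)
    (by linarith [barExp_pos hN hs0 hq])

lemma relDist_rpow_le_barrier_rpow (hR : 0 < R) (hx : x ∈ Metric.ball x₀ R) {α β : ℝ}
    (h : α ≤ barExp N s q * β) :
    relDist x₀ R x ^ (-α) ≤ barrier s q x₀ R x ^ β := by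
  have h0 := (relDist_pos_iff hR).2 hx
  rw [barrier, ← Real.rpow_mul h0.le]
  exact Real.rpow_le_rpow_of_exponent_ge h0 (relDist_le_one hR) (by linarith)

/-- Holds because `barExp N s q * q ≥ N + 2s`; the summand `N + 2s` of the exponent serves this
purpose. -/
lemma relDist_rpow_kernel_le (hN : 2 ≤ N) (hs0 : 0 < s) (hq : 1 < q) (hR : 0 < R)
    (hx : x ∈ Metric.ball x₀ R) :
    relDist x₀ R x ^ (-((N : ℝ) + 2 * s)) ≤ barrier s q x₀ R x ^ q := by
  refine relDist_rpow_le_barrier_rpow hR hx ?_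
  have hN0 : (0 : ℝ) < N := by exact_mod_cast (by omega : 0 < N)
  have h1 : 0 < q - 1 := by linarith
  have h2 : 0 ≤ 2 * s / (q - 1) := by positivity
  unfold barExp
  nlinarith

/-- Holds because `barExp N s q * (q - 1) ≥ 2s`, which is what the summand `2s / (q - 1)` of the
exponent ensures for `q` close to `1`. -/
lemma relDist_rpow_two_mul_le (hN : 2 ≤ N) (hs0 : 0 < s) (hq : 1 < q) (hR : 0 < R)
    (hx : x ∈ Metric.ball x₀ R) :
    relDist x₀ R x ^ (-(2 * s)) ≤ barrier s q x₀ R x ^ (q - 1) := by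
  refine relDist_rpow_le_barrier_rpow hR hx ?_
  have hN0 : (0 : ℝ) < N := by exact_mod_cast (by omega : 0 < N)
  have h1 : 0 < q - 1 := by linarith
  unfold barExp
  have : 2 * s / (q - 1) * (q - 1) = 2 * s := by field_simp
  nlinarith

/-- If `‖x - y‖` were below a third of the distance from `x` to the boundary, the distance from `y`
to the boundary would be more than two thirds of that of `x`, and both conditions of `nearSet` would
hold. -/
lemma le_norm_sub_of_notMem_nearSet (hR : 0 < R) (hx : x ∈ Metric.ball x₀ R)
    (h : (x, y) ∉ nearSet x₀ R) : R * relDist x₀ R x / 3 ≤ ‖x - y‖ := by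
  have h0 := (relDist_pos_iff hR).2 hx
  have h1 := abs_relDist_sub_le hR (x₀ := x₀) (x := x) (y := y)
  rw [le_div_iff₀ hR] at h1
  have h2 := le_abs_self (relDist x₀ R x - relDist x₀ R y)
  by_contra h3
  refine h ⟨?_, ?_⟩ <;> simp only <;> nlinarith

lemma kern_le_of_notMem_nearSet (hN : 2 ≤ N) (hs0 : 0 < s) (hq : 1 < q) (hR : 0 < R)
    (hx : x ∈ Metric.ball x₀ R) (h : (x, y) ∉ nearSet x₀ R) :
    kern s x y ≤ 7 ^ ((N : ℝ) + 2 * s) * barrier s q x₀ R x ^ q *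
      (1 / (R + ‖y - x₀‖) ^ ((N : ℝ) + 2 * s)) := by
  have h0 := (relDist_pos_iff hR).2 hx
  have h1 := le_norm_sub_of_notMem_nearSet hR hx h
  have hpos : 0 < ‖x - y‖ := lt_of_lt_of_le (by positivity) h1
  have hd : 0 < R + ‖y - x₀‖ := by positivity
  -- By the triangle inequality the left-hand side is at most `2R + ‖x - y‖`. The far condition
  -- gives `2R ≤ 6 ‖x - y‖ / d` with `d` the relative distance of `x`, and `d ≤ 1` adds the seventh
  -- unit.
  have h2 : R + ‖y - x₀‖ ≤ 7 * ‖x - y‖ / relDist x₀ R x := by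
    rw [le_div_iff₀ h0]
    have h3 : ‖x - x₀‖ < R := by simpa [dist_eq_norm] using hx
    have h4 : ‖y - x₀‖ ≤ ‖x - y‖ + ‖x - x₀‖ := by
      have := norm_add_le (y - x) (x - x₀)
      rw [norm_sub_rev x y]
      simpa using this
    have h5 := relDist_le_one hR (x₀ := x₀) (x := x)
    nlinarith
  have hexp : 0 < (N : ℝ) + 2 * s := by
    have hN0 : (0 : ℝ) < N := by exact_mod_cast (by omega : 0 < N)
    positivity
  have h6 := Real.rpow_le_rpow hd.le h2 hexp.le
  rw [Real.div_rpow (by positivity) h0.le, Real.mul_rpow (by norm_num) hpos.le] at h6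
  have h7 := relDist_rpow_kernel_le hN hs0 hq hR hx
  rw [Real.rpow_neg h0.le] at h7
  have p1 : 0 < ‖x - y‖ ^ ((N : ℝ) + 2 * s) := by positivity
  have p2 : 0 < (R + ‖y - x₀‖) ^ ((N : ℝ) + 2 * s) := by positivity
  have p3 : 0 < relDist x₀ R x ^ ((N : ℝ) + 2 * s) := by positivity
  unfold kern
  calc 1 / ‖x - y‖ ^ ((N : ℝ) + 2 * s) ≤ 7 ^ ((N : ℝ) + 2 * s) *
        (relDist x₀ R x ^ ((N : ℝ) + 2 * s))⁻¹ * (1 / (R + ‖y - x₀‖) ^ ((N : ℝ) + 2 * s)) := by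
        rw [div_le_iff₀ p1]
        rw [le_div_iff₀ p3] at h6
        field_simp
        linarith
    _ ≤ _ := by gcongr

lemma abs_rpow_neg_sub_le {M a b c : ℝ} (hM : 0 < M) (hc : 0 < c) (ha : c ≤ a) (hb : c ≤ b) :
    |a ^ (-M) - b ^ (-M)| ≤ M * c ^ (-M - 1) * |a - b| := by
  have := Convex.norm_image_sub_le_of_norm_hasDerivWithin_le (f := fun z : ℝ => z ^ (-M))
    (f' := fun z => -M * z ^ (-M - 1)) (s := Ici c) (C := M * c ^ (-M - 1)) (x := b) (y := a)
    (fun z hz => (Real.hasDerivAt_rpow_const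
      (Or.inl (hc.trans_le hz).ne')).hasDerivWithinAt)
    (fun z hz => by
      have hz0 : 0 < z := hc.trans_le hz
      rw [Real.norm_eq_abs, abs_mul, abs_neg, abs_of_pos hM, abs_of_pos (by positivity)]
      exact mul_le_mul_of_nonneg_left
        (Real.rpow_le_rpow_of_nonpos hc hz (by linarith)) hM.le)
    (convex_Ici c) hb ha
  simpa using this

/-- The Lipschitz constant of the barrier at the scale of the distance to the boundary. -/
def barLip (N : ℕ) (s q : ℝ) : ℝ := barExp N s q * 2 ^ (barExp N s q + 1)

lemma barLip_pos (hN : 2 ≤ N) (hs0 : 0 < s) (hq : 1 < q) : 0 < barLip N s q := by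
  have := barExp_pos hN hs0 hq
  unfold barLip; positivity

/-- For a near pair both relative distances are at least half of that of `x`, so the mean value
theorem loses only the factor `2 ^ (barExp N s q + 1)`. -/
lemma abs_barrier_sub_le (hN : 2 ≤ N) (hs0 : 0 < s) (hq : 1 < q) (hR : 0 < R)
    (h : (x, y) ∈ nearSet x₀ R) :
    |barrier s q x₀ R x - barrier s q x₀ R y| ≤
      barLip N s q * barrier s q x₀ R x / (R * relDist x₀ R x) * ‖x - y‖ := by
  have hM := barExp_pos hN hs0 hq
  have h0 := (relDist_pos_iff hR).2 (left_mem_ball_of_mem_nearSet hR h)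
  have h1 := abs_relDist_sub_le hR (x₀ := x₀) (x := x) (y := y)
  have h2 : ‖x - y‖ / R < relDist x₀ R x / 2 := by
    rw [div_lt_iff₀ hR]
    have := h.1
    simp only at this
    linarith
  have h3 := le_abs_self (relDist x₀ R x - relDist x₀ R y)
  have h4 := abs_rpow_neg_sub_le hM (half_pos h0) (a := relDist x₀ R x) (b := relDist x₀ R y)
    (by linarith) (by linarith)
  refine h4.trans ?_
  have e1 : (relDist x₀ R x / 2) ^ (-barExp N s q - 1) =
      2 ^ (barExp N s q + 1) * barrier s q x₀ R x / relDist x₀ R x := by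
    rw [Real.div_rpow h0.le (by norm_num), show -barExp N s q - 1 = -(barExp N s q + 1) by ring,
      Real.rpow_neg (by norm_num : (0 : ℝ) ≤ 2), barrier, Real.rpow_neg h0.le, Real.rpow_neg h0.le,
      Real.rpow_add_one h0.ne']
    have := (Real.rpow_pos_of_pos h0 (barExp N s q)).ne'
    field_simp
  rw [e1, barLip]
  have hb : 0 < barrier s q x₀ R x := Real.rpow_pos_of_pos h0 _
  calc _ ≤ barExp N s q * (2 ^ (barExp N s q + 1) * barrier s q x₀ R x / relDist x₀ R x) *
        (‖x - y‖ / R) := by gcongr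
    _ = _ := by field_simp

end

/-- Integral of the squared increments of the barrier over the near set. -/
lemma exists_lintegral_barrier_near_le {N : ℕ} (hN : 2 ≤ N) {s q : ℝ} (hs0 : 0 < s) (hs1 : s < 1)
    (hq : 1 < q) :
    ∃ C : ℝ, 0 < C ∧ ∀ (x₀ : RN N) (R : ℝ), 0 < R → ∀ x ∈ Metric.ball x₀ R,
      ∫⁻ y in {y | (x, y) ∈ nearSet x₀ R},
        ENNReal.ofReal ((barrier s q x₀ R x - barrier s q x₀ R y) ^ 2 * kern s x y) ≤
        ENNReal.ofReal (C * R ^ (-(2 * s)) * barrier s q x₀ R x ^ (q + 1)) := by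
  obtain ⟨C, hC, hCb⟩ := exists_lintegral_kernel_near_le hN hs1
  have hL := barLip_pos hN hs0 hq
  refine ⟨C * barLip N s q ^ 2, by positivity, fun x₀ R hR x hx => ?_⟩
  have h0 := (relDist_pos_iff hR).2 hx
  have hb : 0 < barrier s q x₀ R x := Real.rpow_pos_of_pos h0 _
  set D : ℝ := (barLip N s q * barrier s q x₀ R x / (R * relDist x₀ R x)) ^ 2 with hD
  have hRd : 0 < R * relDist x₀ R x := by positivity
  calc _ ≤ ∫⁻ y in {y | (x, y) ∈ nearSet x₀ R}, ENNReal.ofReal D *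
          ENNReal.ofReal (‖x - y‖ ^ 2 / ‖x - y‖ ^ ((N : ℝ) + 2 * s)) := by
        refine setLIntegral_mono' ((measurableSet_nearSet x₀ R).preimage (by fun_prop))
          fun y hy => ?_
        rw [← ENNReal.ofReal_mul (by positivity)]
        refine ENNReal.ofReal_le_ofReal ?_
        have h1 := abs_barrier_sub_le hN hs0 hq hR hy
        have h2 : (barrier s q x₀ R x - barrier s q x₀ R y) ^ 2 ≤ D * ‖x - y‖ ^ 2 := by
          rw [hD, ← mul_pow, ← sq_abs (barrier s q x₀ R x - _)]
          gcongr
        calc _ ≤ D * ‖x - y‖ ^ 2 * kern s x y := by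
              gcongr; exact kern_nonneg _ _
          _ = _ := by unfold kern; ring
    _ = ENNReal.ofReal D * ∫⁻ y in {y | (x, y) ∈ nearSet x₀ R},
          ENNReal.ofReal (‖x - y‖ ^ 2 / ‖x - y‖ ^ ((N : ℝ) + 2 * s)) :=
        lintegral_const_mul' _ _ ENNReal.ofReal_ne_top
    _ ≤ ENNReal.ofReal D * ∫⁻ y in {y | ‖x - y‖ < R * relDist x₀ R x},
          ENNReal.ofReal (‖x - y‖ ^ 2 / ‖x - y‖ ^ ((N : ℝ) + 2 * s)) := by
        refine mul_le_mul_right (lintegral_mono_set fun y hy => ?_) _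
        have := hy.1
        simp only at this
        show ‖x - y‖ < _
        linarith
    _ ≤ ENNReal.ofReal D * ENNReal.ofReal (C * (R * relDist x₀ R x) ^ (2 - 2 * s)) := by
        gcongr; exact hCb _ _ hRd
    _ ≤ _ := by
        rw [← ENNReal.ofReal_mul (by positivity)]
        refine ENNReal.ofReal_le_ofReal ?_
        -- The square of `R * relDist` cancels the denominator of the Lipschitz bound in `D`. What
        -- remains, `relDist ^ (-2s)`, is dominated by `barrier ^ (q - 1)`.
        have e1 : (R * relDist x₀ R x) ^ (2 - 2 * s) =
            (R * relDist x₀ R x) ^ 2 * (R ^ (-(2 * s)) * relDist x₀ R x ^ (-(2 * s))) := by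
          rw [← Real.mul_rpow hR.le h0.le, sub_eq_add_neg, Real.rpow_add hRd]; norm_num
        have e2 := relDist_rpow_two_mul_le hN hs0 hq hR hx
        have e3 : barrier s q x₀ R x ^ (q + 1) =
            barrier s q x₀ R x ^ 2 * barrier s q x₀ R x ^ (q - 1) := by
          rw [← Real.rpow_natCast, ← Real.rpow_add hb]; congr 1; push_cast; ring
        rw [e1, e3, hD]
        calc _ = C * barLip N s q ^ 2 * R ^ (-(2 * s)) * (barrier s q x₀ R x ^ 2 *
              relDist x₀ R x ^ (-(2 * s))) := by field_simp
          _ ≤ _ := by gcongr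

/-- Integral of the kernel off the near set. -/
lemma exists_lintegral_kern_far_le {N : ℕ} (hN : 2 ≤ N) {s q : ℝ} (hs0 : 0 < s) (hq : 1 < q) :
    ∃ C : ℝ, 0 < C ∧ ∀ (x₀ : RN N) (R : ℝ), 0 < R → ∀ x ∈ Metric.ball x₀ R,
      ∫⁻ y in {y | (x, y) ∉ nearSet x₀ R}, ENNReal.ofReal (kern s x y) ≤
        ENNReal.ofReal (C * R ^ (-(2 * s)) * barrier s q x₀ R x ^ (q - 1)) := by
  obtain ⟨C, hC, hCb⟩ := exists_lintegral_kernel_far_le hN hs0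
  refine ⟨C * 3 ^ (2 * s), by positivity, fun x₀ R hR x hx => ?_⟩
  have h0 := (relDist_pos_iff hR).2 hx
  calc _ ≤ ∫⁻ y in {y | R * relDist x₀ R x / 3 ≤ ‖x - y‖}, ENNReal.ofReal (kern s x y) :=
        lintegral_mono_set fun y hy => le_norm_sub_of_notMem_nearSet hR hx hy
    _ ≤ _ := hCb x _ (by positivity)
    _ ≤ _ := by
        refine ENNReal.ofReal_le_ofReal ?_
        rw [Real.div_rpow (by positivity) (by norm_num), Real.mul_rpow hR.le h0.le,
          Real.rpow_neg (by norm_num : (0 : ℝ) ≤ 3)]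
        have e2 := relDist_rpow_two_mul_le hN hs0 hq hR hx
        calc _ = C * 3 ^ (2 * s) * R ^ (-(2 * s)) * relDist x₀ R x ^ (-(2 * s)) := by
              field_simp
          _ ≤ _ := by gcongr

/-! ### Truncations above a multiple of the barrier. -/

lemma two_mul_ofReal (c : ℝ) : 2 * ENNReal.ofReal c = ENNReal.ofReal (2 * c) := by
  rw [ENNReal.ofReal_mul zero_le_two, ENNReal.ofReal_ofNat]

lemma setLIntegral_pair {N : ℕ} {S : Set (RN N × RN N)} (hS : MeasurableSet S)
    {F : RN N × RN N → ℝ≥0∞} (hF : Measurable F) :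
    ∫⁻ p in S, F p = ∫⁻ x, ∫⁻ y in {y | (x, y) ∈ S}, F (x, y) := by
  rw [← lintegral_indicator hS, Measure.volume_eq_prod, lintegral_prod _
    (hF.indicator hS).aemeasurable]
  refine lintegral_congr fun x => ?_
  rw [← lintegral_indicator (show MeasurableSet {y | (x, y) ∈ S} from hS.preimage (by fun_prop))]
  rfl

lemma setLIntegral_pair_swap {N : ℕ} {S : Set (RN N × RN N)} (hS : MeasurableSet S)
    (hsymm : ∀ x y, (x, y) ∈ S ↔ (y, x) ∈ S) {F : RN N × RN N → ℝ≥0∞} (hF : Measurable F) :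
    ∫⁻ p in S, F p.swap = ∫⁻ p in S, F p := by
  have hmp : MeasurePreserving (Prod.swap : RN N × RN N → RN N × RN N) :=
    Measure.measurePreserving_swap
  have := hmp.setLIntegral_comp_preimage hS hF
  rwa [show Prod.swap ⁻¹' S = S by ext ⟨x, y⟩; exact hsymm y x] at this

/-- The truncation `(w - κ P)₊` in `B_R(x₀)`, extended by zero, where `P` is the barrier. -/
def trunc {N : ℕ} (s q : ℝ) (x₀ : RN N) (R κ : ℝ) (w : RN N → ℝ) (x : RN N) : ℝ :=
  (Metric.ball x₀ R).indicator (fun x => max (w x - κ * barrier s q x₀ R x) 0) x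

/-- The set of positivity of the truncation. -/
def posSet {N : ℕ} (s q : ℝ) (x₀ : RN N) (R κ : ℝ) (w : RN N → ℝ) : Set (RN N) :=
  {x | x ∈ Metric.ball x₀ R ∧ κ * barrier s q x₀ R x < w x}

section
variable {N : ℕ} {s q : ℝ} {x₀ : RN N} {R κ : ℝ} {w : RN N → ℝ} {x y : RN N}

lemma measurable_trunc (hw : Measurable w) : Measurable (trunc s q x₀ R κ w) := by
  unfold trunc
  exact Measurable.indicator (by fun_prop) Metric.isOpen_ball.measurableSet

lemma measurableSet_posSet (hw : Measurable w) : MeasurableSet (posSet s q x₀ R κ w) :=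
  Metric.isOpen_ball.measurableSet.inter (measurableSet_lt (by fun_prop) hw)

lemma trunc_of_mem (hx : x ∈ Metric.ball x₀ R) :
    trunc s q x₀ R κ w x = max (w x - κ * barrier s q x₀ R x) 0 := indicator_of_mem hx _

lemma trunc_of_notMem (hx : x ∉ Metric.ball x₀ R) : trunc s q x₀ R κ w x = 0 :=
  indicator_of_notMem hx _

lemma trunc_nonneg : 0 ≤ trunc s q x₀ R κ w x :=
  indicator_nonneg (fun _ _ => le_max_right _ _) _

lemma trunc_eq_zero (hx : x ∉ posSet s q x₀ R κ w) : trunc s q x₀ R κ w x = 0 := by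
  by_cases h : x ∈ Metric.ball x₀ R
  · rw [trunc_of_mem h, max_eq_right]
    by_contra h'
    exact hx ⟨h, by linarith⟩
  · exact trunc_of_notMem h

lemma trunc_of_mem_posSet (hx : x ∈ posSet s q x₀ R κ w) :
    trunc s q x₀ R κ w x = w x - κ * barrier s q x₀ R x := by
  rw [trunc_of_mem hx.1, max_eq_left (by linarith [hx.2])]

lemma barrier_pos (hR : 0 < R) (hx : x ∈ Metric.ball x₀ R) : 0 < barrier s q x₀ R x :=
  Real.rpow_pos_of_pos ((relDist_pos_iff hR).2 hx) _

lemma pos_of_mem_posSet (hR : 0 < R) (hκ : 0 < κ) (hx : x ∈ posSet s q x₀ R κ w) : 0 < w x :=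
  (mul_pos hκ (barrier_pos hR hx.1)).trans hx.2

lemma trunc_le_of_mem_posSet (hR : 0 < R) (hκ : 0 < κ) (hx : x ∈ posSet s q x₀ R κ w) :
    trunc s q x₀ R κ w x ≤ w x := by
  rw [trunc_of_mem_posSet hx]
  linarith [mul_pos hκ (barrier_pos (s := s) (q := q) hR hx.1)]

lemma trunc_le (hR : 0 < R) (hκ : 0 < κ) (hw0 : ∀ x, 0 ≤ w x) :
    trunc s q x₀ R κ w x ≤ w x := by
  by_cases h : x ∈ posSet s q x₀ R κ w
  · exact trunc_le_of_mem_posSet hR hκ h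
  · rw [trunc_eq_zero h]; exact hw0 x

/-- On the positivity set `κ P < w`. This exchange of boundary weights for powers of `w` is what
makes cut-off functions superfluous, and it leaves the factor `κ ^ (-α)`. -/
lemma barrier_rpow_le (hR : 0 < R) (hκ : 0 < κ) (hx : x ∈ posSet s q x₀ R κ w) {α : ℝ}
    (hα : 0 ≤ α) : barrier s q x₀ R x ^ α ≤ κ ^ (-α) * w x ^ α := by
  have h0 := barrier_pos (s := s) (q := q) hR hx.1
  have h1 : barrier s q x₀ R x ≤ w x / κ := by rw [le_div_iff₀ hκ]; linarith [hx.2]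
  refine (Real.rpow_le_rpow h0.le h1 hα).trans (le_of_eq ?_)
  rw [Real.div_rpow (pos_of_mem_posSet hR hκ hx).le hκ.le, Real.rpow_neg hκ.le]
  field_simp

lemma trunc_mul_barrier_rpow_le (hR : 0 < R) (hκ : 0 < κ) {α : ℝ}
    (hα : 0 ≤ α) : trunc s q x₀ R κ w x * barrier s q x₀ R x ^ α ≤
      (posSet s q x₀ R κ w).indicator (fun x => κ ^ (-α) * w x ^ (α + 1)) x := by
  by_cases hx : x ∈ posSet s q x₀ R κ w
  · have hp := pos_of_mem_posSet hR hκ hx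
    have hb := barrier_pos (s := s) (q := q) hR hx.1
    rw [indicator_of_mem hx, Real.rpow_add_one hp.ne']
    calc _ ≤ w x * (κ ^ (-α) * w x ^ α) :=
          mul_le_mul (trunc_le_of_mem_posSet hR hκ hx) (barrier_rpow_le hR hκ hx hα)
            (by positivity) hp.le
      _ = _ := by ring
  · rw [trunc_eq_zero hx, indicator_of_notMem hx]; simp

end

lemma ofReal_rpow_indicator {N : ℕ} {A : Set (RN N)} {c : ℝ} (hc : 0 ≤ c) {f : RN N → ℝ}
    (hA : MeasurableSet A) :
    ∫⁻ x, ENNReal.ofReal (A.indicator (fun x => c * f x) x) =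
      ENNReal.ofReal c * ∫⁻ x in A, ENNReal.ofReal (f x) := by
  rw [← lintegral_const_mul' _ _ ENNReal.ofReal_ne_top, ← lintegral_indicator hA]
  refine lintegral_congr fun x => ?_
  by_cases hx : x ∈ A
  · rw [indicator_of_mem hx, indicator_of_mem hx, ENNReal.ofReal_mul hc]
  · rw [indicator_of_notMem hx, indicator_of_notMem hx, ENNReal.ofReal_zero]

/-- The weighted mass of the truncation. -/
lemma lintegral_trunc_mul_barrier_le {N : ℕ} {s q : ℝ} (hq : 1 < q) {x₀ : RN N} {R κ : ℝ}
    (hR : 0 < R) (hκ : 0 < κ) {w : RN N → ℝ} (hw : Measurable w) :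
    ∫⁻ x, ENNReal.ofReal (trunc s q x₀ R κ w x * barrier s q x₀ R x ^ q) ≤
      ENNReal.ofReal (κ ^ (-q)) *
        ∫⁻ x in posSet s q x₀ R κ w, ENNReal.ofReal (w x ^ (q + 1)) := by
  rw [← ofReal_rpow_indicator (by positivity) (measurableSet_posSet hw)]
  exact lintegral_mono fun x => ENNReal.ofReal_le_ofReal
    (trunc_mul_barrier_rpow_le hR hκ (by linarith))

/-- Far-range interaction with the value at the same point. -/
lemma exists_lintegral_far_diag_le {N : ℕ} (hN : 2 ≤ N) {s q : ℝ} (hs0 : 0 < s) (hq : 1 < q) :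
    ∃ C : ℝ, 0 < C ∧ ∀ (x₀ : RN N) (R κ : ℝ), 0 < R → 0 < κ → ∀ (w z : RN N → ℝ),
      Measurable w → Measurable z → (∀ x, 0 ≤ z x) →
      ∫⁻ p in (nearSet x₀ R)ᶜ,
        ENNReal.ofReal (z p.1 * trunc s q x₀ R κ w p.1 * kern s p.1 p.2) ≤
      ENNReal.ofReal (C * R ^ (-(2 * s)) * κ ^ (1 - q)) *
        ∫⁻ x in posSet s q x₀ R κ w, ENNReal.ofReal (z x * w x ^ q) := by
  obtain ⟨C, hC, hCb⟩ := exists_lintegral_kern_far_le hN hs0 hq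
  refine ⟨C, hC, fun x₀ R κ hR hκ w z hw hz hz0 => ?_⟩
  have ht := measurable_trunc (s := s) (q := q) (x₀ := x₀) (R := R) (κ := κ) hw
  rw [setLIntegral_pair (measurableSet_nearSet x₀ R).compl (by fun_prop),
    ← ofReal_rpow_indicator (by positivity) (measurableSet_posSet hw)]
  refine lintegral_mono fun x => ?_
  simp only
  have e1 : ∀ y : RN N, ENNReal.ofReal (z x * trunc s q x₀ R κ w x * kern s x y) =
      ENNReal.ofReal (z x * trunc s q x₀ R κ w x) * ENNReal.ofReal (kern s x y) := fun y =>
    ENNReal.ofReal_mul (mul_nonneg (hz0 x) trunc_nonneg)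
  simp only [e1]
  rw [lintegral_const_mul' _ _ ENNReal.ofReal_ne_top]
  by_cases hx : x ∈ Metric.ball x₀ R
  · calc _ ≤ ENNReal.ofReal (z x * trunc s q x₀ R κ w x) *
          ENNReal.ofReal (C * R ^ (-(2 * s)) * barrier s q x₀ R x ^ (q - 1)) :=
          mul_le_mul_right (hCb x₀ R hR x hx) _
      _ ≤ _ := by
        rw [← ENNReal.ofReal_mul (mul_nonneg (hz0 x) trunc_nonneg)]
        refine ENNReal.ofReal_le_ofReal ?_
        have h1 := trunc_mul_barrier_rpow_le (s := s) (q := q) (x₀ := x₀) (w := w) (x := x) hR hκ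
          (α := q - 1) (by linarith)
        rw [sub_add_cancel, neg_sub] at h1
        calc _ = z x * (C * R ^ (-(2 * s))) *
              (trunc s q x₀ R κ w x * barrier s q x₀ R x ^ (q - 1)) := by ring
          _ ≤ z x * (C * R ^ (-(2 * s))) *
              (posSet s q x₀ R κ w).indicator (fun x => κ ^ (1 - q) * w x ^ q) x :=
            mul_le_mul_of_nonneg_left h1 (mul_nonneg (hz0 x) (by positivity))
          _ = _ := by
            simp only [indicator]
            split_ifs
            · ring
            · simp
  · rw [trunc_of_notMem hx]; simp

/-- Far-range interaction with the values at other points, controlled by a weighted tail. -/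
lemma lintegral_far_cross_le {N : ℕ} (hN : 2 ≤ N) {s q : ℝ} (hs0 : 0 < s) (hq : 1 < q)
    {x₀ : RN N} {R κ : ℝ} (hR : 0 < R) {w z : RN N → ℝ}
    (hw : Measurable w) (hz : Measurable z) (hz0 : ∀ x, 0 ≤ z x) :
    ∫⁻ p in (nearSet x₀ R)ᶜ,
        ENNReal.ofReal (z p.2 * trunc s q x₀ R κ w p.1 * kern s p.1 p.2) ≤
      ENNReal.ofReal (7 ^ ((N : ℝ) + 2 * s)) *
        (∫⁻ x, ENNReal.ofReal (trunc s q x₀ R κ w x * barrier s q x₀ R x ^ q)) *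
        ∫⁻ y, ENNReal.ofReal (z y / (R + ‖y - x₀‖) ^ ((N : ℝ) + 2 * s)) := by
  have ht := measurable_trunc (s := s) (q := q) (x₀ := x₀) (R := R) (κ := κ) hw
  rw [setLIntegral_pair (measurableSet_nearSet x₀ R).compl (by fun_prop), mul_assoc,
    ← lintegral_mul_const _ (by fun_prop),
    ← lintegral_const_mul' _ _ ENNReal.ofReal_ne_top]
  refine lintegral_mono fun x => ?_
  simp only
  by_cases hx : x ∈ Metric.ball x₀ R
  · rw [← lintegral_const_mul' _ _ ENNReal.ofReal_ne_top,
      ← lintegral_const_mul' _ _ ENNReal.ofReal_ne_top]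
    refine (setLIntegral_mono' ((measurableSet_nearSet x₀ R).compl.preimage (by fun_prop))
      fun y hy => ?_).trans (setLIntegral_le_lintegral _ _)
    have hb := barrier_pos (s := s) (q := q) hR hx
    have ht0 : 0 ≤ trunc s q x₀ R κ w x := trunc_nonneg
    rw [← ENNReal.ofReal_mul (by positivity), ← ENNReal.ofReal_mul (by positivity)]
    refine ENNReal.ofReal_le_ofReal ?_
    calc _ ≤ z y * trunc s q x₀ R κ w x * (7 ^ ((N : ℝ) + 2 * s) * barrier s q x₀ R x ^ q *
          (1 / (R + ‖y - x₀‖) ^ ((N : ℝ) + 2 * s))) :=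
          mul_le_mul_of_nonneg_left (kern_le_of_notMem_nearSet hN hs0 hq hR hx hy)
            (mul_nonneg (hz0 y) ht0)
      _ = _ := by ring
  · rw [trunc_of_notMem hx]; simp

/-- Far-range part of the energy of the truncation. -/
lemma exists_lintegral_far_energy_le {N : ℕ} (hN : 2 ≤ N) {s q : ℝ} (hs0 : 0 < s) (hq : 1 < q) :
    ∃ C : ℝ, 0 < C ∧ ∀ (x₀ : RN N) (R κ : ℝ), 0 < R → 0 < κ → ∀ (w : RN N → ℝ),
      Measurable w →
      ∫⁻ p in (nearSet x₀ R)ᶜ,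
        ENNReal.ofReal ((trunc s q x₀ R κ w p.1 - trunc s q x₀ R κ w p.2) ^ 2 *
          kern s p.1 p.2) ≤
      ENNReal.ofReal (C * R ^ (-(2 * s)) * κ ^ (1 - q)) *
        ∫⁻ x in posSet s q x₀ R κ w, ENNReal.ofReal (w x ^ (q + 1)) := by
  obtain ⟨C, hC, hCb⟩ := exists_lintegral_far_diag_le hN hs0 hq
  refine ⟨2 * C, by positivity, fun x₀ R κ hR hκ w hw => ?_⟩
  have ht := measurable_trunc (s := s) (q := q) (x₀ := x₀) (R := R) (κ := κ) hw
  set v := trunc s q x₀ R κ w with hv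
  have hv0 : ∀ x, 0 ≤ v x := fun x => trunc_nonneg
  set F : RN N × RN N → ℝ≥0∞ := fun p => ENNReal.ofReal (v p.1 * v p.1 * kern s p.1 p.2) with hF
  have hFm : Measurable F := by fun_prop
  have h1 : ∫⁻ p in (nearSet x₀ R)ᶜ, F p ≤ ENNReal.ofReal (C * R ^ (-(2 * s)) * κ ^ (1 - q)) *
      ∫⁻ x in posSet s q x₀ R κ w, ENNReal.ofReal (w x ^ (q + 1)) := by
    refine (hCb x₀ R κ hR hκ w v hw ht hv0).trans (mul_le_mul_right ?_ _)
    refine setLIntegral_mono' (measurableSet_posSet hw) fun x hx => ENNReal.ofReal_le_ofReal ?_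
    have hp := pos_of_mem_posSet hR hκ hx
    rw [Real.rpow_add_one hp.ne', mul_comm]
    exact mul_le_mul_of_nonneg_left (trunc_le_of_mem_posSet hR hκ hx) (by positivity)
  have h2 := setLIntegral_pair_swap (measurableSet_nearSet x₀ R).compl
    (fun x y => not_congr mem_nearSet_swap) hFm
  -- For nonnegative values `(v x - v y) ^ 2 ≤ v x ^ 2 + v y ^ 2`; by symmetry of the region the two
  -- terms have equal integrals.
  calc _ ≤ ∫⁻ p in (nearSet x₀ R)ᶜ, (F p + F p.swap) := by
        refine lintegral_mono fun p => ?_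
        simp only [hF, Prod.fst_swap, Prod.snd_swap]
        rw [kern_comm p.2 p.1, ← ENNReal.ofReal_add
          (mul_nonneg (mul_nonneg (hv0 _) (hv0 _)) (kern_nonneg _ _))
          (mul_nonneg (mul_nonneg (hv0 _) (hv0 _)) (kern_nonneg _ _)), ← add_mul]
        refine ENNReal.ofReal_le_ofReal (mul_le_mul_of_nonneg_right ?_ (kern_nonneg _ _))
        nlinarith [mul_nonneg (hv0 p.1) (hv0 p.2)]
    _ = 2 * ∫⁻ p in (nearSet x₀ R)ᶜ, F p := by
        rw [lintegral_add_left hFm, h2, two_mul]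
    _ ≤ 2 * _ := mul_le_mul_right h1 2
    _ = _ := by
        rw [← mul_assoc, two_mul_ofReal]
        congr 2; ring

/-- The error produced by the variation of the barrier. -/
def barrierError {N : ℕ} (s q : ℝ) (x₀ : RN N) (R κ : ℝ) (w : RN N → ℝ) (p : RN N × RN N) : ℝ :=
  (posSet s q x₀ R κ w ×ˢ univ ∪ univ ×ˢ posSet s q x₀ R κ w).indicator
    (fun p => (κ * barrier s q x₀ R p.1 - κ * barrier s q x₀ R p.2) ^ 2) p

lemma barrierError_nonneg {N : ℕ} {s q : ℝ} {x₀ : RN N} {R κ : ℝ} {w : RN N → ℝ}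
    {p : RN N × RN N} : 0 ≤ barrierError s q x₀ R κ w p :=
  indicator_nonneg (fun _ _ => sq_nonneg _) _

lemma measurable_barrierError {N : ℕ} {s q : ℝ} {x₀ : RN N} {R κ : ℝ} {w : RN N → ℝ}
    (hw : Measurable w) : Measurable (barrierError s q x₀ R κ w) := by
  have h := measurableSet_posSet (s := s) (q := q) (x₀ := x₀) (R := R) (κ := κ) hw
  exact Measurable.indicator (by fun_prop)
    ((h.prod MeasurableSet.univ).union (MeasurableSet.univ.prod h))

/-- For fixed `x` in the positivity set the increments of `κ P` integrate to at most `C κ ^ 2 R ^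
(-2s) P x ^ (q + 1)`, and `P < w / κ` there converts this into `κ ^ (1 - q) w ^ (q + 1)`. Pairs
whose second point is in the positivity set are reached by symmetry. -/
lemma exists_lintegral_barrierError_le {N : ℕ} (hN : 2 ≤ N) {s q : ℝ} (hs0 : 0 < s)
    (hs1 : s < 1) (hq : 1 < q) :
    ∃ C : ℝ, 0 < C ∧ ∀ (x₀ : RN N) (R κ : ℝ), 0 < R → 0 < κ → ∀ (w : RN N → ℝ),
      Measurable w →
      ∫⁻ p in nearSet x₀ R, ENNReal.ofReal (barrierError s q x₀ R κ w p * kern s p.1 p.2) ≤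
      ENNReal.ofReal (C * R ^ (-(2 * s)) * κ ^ (1 - q)) *
        ∫⁻ x in posSet s q x₀ R κ w, ENNReal.ofReal (w x ^ (q + 1)) := by
  obtain ⟨C, hC, hCb⟩ := exists_lintegral_barrier_near_le hN hs0 hs1 hq
  refine ⟨2 * C, by positivity, fun x₀ R κ hR hκ w hw => ?_⟩
  set A := posSet s q x₀ R κ w with hA
  have hAm : MeasurableSet A := measurableSet_posSet hw
  set F : RN N × RN N → ℝ≥0∞ := fun p => (A ×ˢ univ).indicator (fun p => ENNReal.ofReal (κ ^ 2 *
    ((barrier s q x₀ R p.1 - barrier s q x₀ R p.2) ^ 2 * kern s p.1 p.2))) p with hF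
  have hFm : Measurable F := Measurable.indicator (by fun_prop) (hAm.prod MeasurableSet.univ)
  have h1 : ∫⁻ p in nearSet x₀ R, F p ≤ ENNReal.ofReal (C * R ^ (-(2 * s)) * κ ^ (1 - q)) *
      ∫⁻ x in A, ENNReal.ofReal (w x ^ (q + 1)) := by
    rw [setLIntegral_pair (measurableSet_nearSet x₀ R) hFm,
      ← ofReal_rpow_indicator (by positivity) hAm]
    refine lintegral_mono fun x => ?_
    by_cases hx : x ∈ A
    · simp only [indicator_of_mem hx, hF]
      have e1 : ∀ y : RN N, (A ×ˢ univ).indicator (fun p : RN N × RN N => ENNReal.ofReal (κ ^ 2 *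
          ((barrier s q x₀ R p.1 - barrier s q x₀ R p.2) ^ 2 * kern s p.1 p.2))) (x, y) =
          ENNReal.ofReal (κ ^ 2) *
          ENNReal.ofReal ((barrier s q x₀ R x - barrier s q x₀ R y) ^ 2 * kern s x y) := by
        intro y
        rw [indicator_of_mem (by exact ⟨hx, mem_univ _⟩), ENNReal.ofReal_mul (by positivity)]
      simp only [e1]
      rw [lintegral_const_mul' _ _ ENNReal.ofReal_ne_top]
      refine (mul_le_mul_right (hCb x₀ R hR x hx.1) _).trans ?_
      rw [← ENNReal.ofReal_mul (by positivity)]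
      refine ENNReal.ofReal_le_ofReal ?_
      have h2 := barrier_rpow_le hR hκ hx (α := q + 1) (by linarith)
      calc _ = κ ^ 2 * (C * R ^ (-(2 * s))) * barrier s q x₀ R x ^ (q + 1) := by ring
        _ ≤ κ ^ 2 * (C * R ^ (-(2 * s))) * (κ ^ (-(q + 1)) * w x ^ (q + 1)) := by gcongr
        _ = _ := by
          rw [show 1 - q = 2 + -(q + 1) by ring, Real.rpow_add hκ]
          norm_num; ring
    · simp only [indicator_of_notMem hx, hF]
      have e1 : ∀ y : RN N, (A ×ˢ univ).indicator (fun p : RN N × RN N => ENNReal.ofReal (κ ^ 2 *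
          ((barrier s q x₀ R p.1 - barrier s q x₀ R p.2) ^ 2 * kern s p.1 p.2))) (x, y) = 0 :=
        fun y => indicator_of_notMem (fun h => hx h.1) _
      simp [e1]
  have h2 := setLIntegral_pair_swap (measurableSet_nearSet x₀ R)
    (fun x y => mem_nearSet_swap) hFm
  -- The indicator of the union of the two strips is at most the sum of their indicators.
  calc _ ≤ ∫⁻ p in nearSet x₀ R, (F p + F p.swap) := by
        refine lintegral_mono fun p => ?_
        simp only [hF, barrierError]
        have e2 : (κ * barrier s q x₀ R p.1 - κ * barrier s q x₀ R p.2) ^ 2 * kern s p.1 p.2 =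
          κ ^ 2 * ((barrier s q x₀ R p.1 - barrier s q x₀ R p.2) ^ 2 * kern s p.1 p.2) := by ring
        have e3 : (κ * barrier s q x₀ R p.1 - κ * barrier s q x₀ R p.2) ^ 2 * kern s p.1 p.2 =
          κ ^ 2 * ((barrier s q x₀ R p.2 - barrier s q x₀ R p.1) ^ 2 * kern s p.2 p.1) := by
          rw [kern_comm p.2 p.1]; ring
        by_cases ha : p.1 ∈ A
        · rw [indicator_of_mem (show p ∈ A ×ˢ univ ∪ univ ×ˢ A from Or.inl ⟨ha, mem_univ _⟩),
            indicator_of_mem (by exact ⟨ha, mem_univ _⟩), e2]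
          exact le_self_add
        · by_cases hb : p.2 ∈ A
          · rw [indicator_of_mem (show p ∈ A ×ˢ univ ∪ univ ×ˢ A from Or.inr ⟨mem_univ _, hb⟩), e3]
            refine le_trans (le_of_eq ?_) le_add_self
            rw [indicator_of_mem (by exact ⟨hb, mem_univ _⟩)]
            rfl
          · rw [indicator_of_notMem (by rintro (h | h); exacts [ha h.1, hb h.2])]
            simp
    _ = 2 * ∫⁻ p in nearSet x₀ R, F p := by
        rw [lintegral_add_left hFm, h2, two_mul]
    _ ≤ 2 * _ := mul_le_mul_right h1 2
    _ = _ := by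
        rw [← mul_assoc, two_mul_ofReal]
        congr 2; ring

section
variable {N : ℕ} {s q : ℝ} {x₀ : RN N} {R κ : ℝ} {w : RN N → ℝ} {p : RN N × RN N}

lemma mem_posSet_iff_of_mem {x : RN N} (hx : x ∈ Metric.ball x₀ R) :
    x ∈ posSet s q x₀ R κ w ↔ κ * barrier s q x₀ R x < w x := and_iff_right hx

lemma barrierError_eq_ite (h1 : p.1 ∈ Metric.ball x₀ R) (h2 : p.2 ∈ Metric.ball x₀ R) :
    barrierError s q x₀ R κ w p =
      if κ * barrier s q x₀ R p.1 < w p.1 ∨ κ * barrier s q x₀ R p.2 < w p.2 then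
        (κ * barrier s q x₀ R p.1 - κ * barrier s q x₀ R p.2) ^ 2 else 0 := by
  classical
  rw [barrierError, indicator_apply]
  simp [mem_posSet_iff_of_mem h1, mem_posSet_iff_of_mem h2]

/-- Coercivity of the product of increments in the near set. -/
lemma increment_mul_trunc_near_ge (hR : 0 < R) (hp : p ∈ nearSet x₀ R) :
    (trunc s q x₀ R κ w p.1 - trunc s q x₀ R κ w p.2) ^ 2 / 2 -
      barrierError s q x₀ R κ w p / 2 ≤
      (w p.1 - w p.2) * (trunc s q x₀ R κ w p.1 - trunc s q x₀ R κ w p.2) := by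
  have h1 := left_mem_ball_of_mem_nearSet hR hp
  have h2 := right_mem_ball_of_mem_nearSet hR hp
  rw [trunc_of_mem h1, trunc_of_mem h2, barrierError_eq_ite h1 h2]
  refine le_trans (le_of_eq ?_) increment_mul_trunc_ge
  split_ifs <;> simp

lemma trunc_increment_sq_le (hR : 0 < R) (hp : p ∈ nearSet x₀ R) :
    (trunc s q x₀ R κ w p.1 - trunc s q x₀ R κ w p.2) ^ 2 ≤
      2 * (w p.1 - w p.2) ^ 2 + 2 * barrierError s q x₀ R κ w p := by
  have h1 := left_mem_ball_of_mem_nearSet hR hp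
  have h2 := right_mem_ball_of_mem_nearSet hR hp
  rw [trunc_of_mem h1, trunc_of_mem h2, barrierError_eq_ite h1 h2]
  split_ifs with h
  · have h3 := abs_max_sub_max_le_abs (w p.1 - κ * barrier s q x₀ R p.1)
      (w p.2 - κ * barrier s q x₀ R p.2) 0
    rw [← sq_le_sq] at h3
    refine h3.trans ?_
    nlinarith [sq_nonneg ((w p.1 - w p.2) + (κ * barrier s q x₀ R p.1 - κ * barrier s q x₀ R p.2))]
  · rw [not_or] at h
    rw [max_eq_right (by linarith), max_eq_right (by linarith)]
    simp; positivity

end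

/-! ### Convergence of the bilinear form and its far-range lower bound. -/

lemma mul_rpow_le_add {q z w : ℝ} (hq : 1 < q) (hz : 0 ≤ z) (hw : 0 ≤ w) :
    z * w ^ q ≤ z ^ (q + 1) + w ^ (q + 1) := by
  have hq1 : q + 1 ≠ 0 := by linarith
  rw [Real.rpow_add_one' hz hq1, Real.rpow_add_one' hw hq1]
  have h1 : 0 ≤ z ^ q := by positivity
  have h2 : 0 ≤ w ^ q := by positivity
  rcases le_total z w with h | h
  · nlinarith [mul_le_mul_of_nonneg_right h h2, mul_nonneg h1 hz]
  · nlinarith [mul_le_mul_of_nonneg_left (Real.rpow_le_rpow hw h (by linarith : (0 : ℝ) ≤ q)) hz,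
      mul_nonneg h2 hw]

/-- The weighted tail `∫ z(y) (R + |y - x₀|)^{-N-2s} dy`. -/
def weightedTail {N : ℕ} (s : ℝ) (x₀ : RN N) (R : ℝ) (z : RN N → ℝ) : ℝ≥0∞ :=
  ∫⁻ y, ENNReal.ofReal (z y / (R + ‖y - x₀‖) ^ ((N : ℝ) + 2 * s))

/-- The weighted mass `∫ (w - κ P)₊ P^q dx`. -/
def truncMass {N : ℕ} (s q : ℝ) (x₀ : RN N) (R κ : ℝ) (w : RN N → ℝ) : ℝ≥0∞ :=
  ∫⁻ x, ENNReal.ofReal (trunc s q x₀ R κ w x * barrier s q x₀ R x ^ q)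

lemma truncMass_ne_top {N : ℕ} {s q : ℝ} (hq : 1 < q) {x₀ : RN N} {R κ : ℝ}
    (hR : 0 < R) (hκ : 0 < κ) {w : RN N → ℝ} (hw : Measurable w)
    (hfin : ∫⁻ x in Metric.ball x₀ R, ENNReal.ofReal (w x ^ (q + 1)) ≠ ⊤) :
    truncMass s q x₀ R κ w ≠ ⊤ := by
  refine ne_top_of_le_ne_top (ENNReal.mul_ne_top ENNReal.ofReal_ne_top ?_)
    (lintegral_trunc_mul_barrier_le hq hR hκ hw)
  exact ne_top_of_le_ne_top hfin (lintegral_mono_set fun x hx => hx.1)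

/-- The absolute convergence of the bilinear form on a slice and its truncation at another time. -/
lemma exists_lintegral_form_le {N : ℕ} (hN : 2 ≤ N) {s q : ℝ} (hs0 : 0 < s) (hq : 1 < q) :
    ∃ C : ℝ, 0 < C ∧ ∀ (x₀ : RN N) (R κ L : ℝ), 0 < R → 0 < κ → 0 < L → ∀ (w z : RN N → ℝ),
      Measurable w → Measurable z → (∀ x, 0 ≤ w x) → (∀ x, 0 ≤ z x) →
      ∀ K : RN N × RN N → ℝ, (∀ p, 0 ≤ K p) → (∀ p, K p ≤ L * kern s p.1 p.2) →
      ∫⁻ p, ENNReal.ofReal |(z p.1 - z p.2) *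
        (trunc s q x₀ R κ w p.1 - trunc s q x₀ R κ w p.2) * K p| ≤
      ENNReal.ofReal L *
        ((∫⁻ p in Metric.ball x₀ R ×ˢ Metric.ball x₀ R,
          ENNReal.ofReal ((z p.1 - z p.2) ^ 2 * kern s p.1 p.2)) +
        (∫⁻ p in nearSet x₀ R, ENNReal.ofReal ((trunc s q x₀ R κ w p.1 -
          trunc s q x₀ R κ w p.2) ^ 2 * kern s p.1 p.2)) +
        2 * (ENNReal.ofReal (C * R ^ (-(2 * s)) * κ ^ (1 - q)) *
          ((∫⁻ x in Metric.ball x₀ R, ENNReal.ofReal (z x ^ (q + 1))) +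
          ∫⁻ x in Metric.ball x₀ R, ENNReal.ofReal (w x ^ (q + 1)))) +
        2 * (ENNReal.ofReal (7 ^ ((N : ℝ) + 2 * s)) * truncMass s q x₀ R κ w *
          weightedTail s x₀ R z)) := by
  obtain ⟨C, hC, hCb⟩ := exists_lintegral_far_diag_le hN hs0 hq
  refine ⟨C, hC, fun x₀ R κ L hR hκ hL w z hw hz hw0 hz0 K hK0 hK => ?_⟩
  have ht := measurable_trunc (s := s) (q := q) (x₀ := x₀) (R := R) (κ := κ) hw
  have hnear := measurableSet_nearSet x₀ R
  set v := trunc s q x₀ R κ w with hv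
  have hv0 : ∀ x, 0 ≤ v x := fun x => trunc_nonneg
  have hkn : ∀ p : RN N × RN N, 0 ≤ kern s p.1 p.2 := fun p => kern_nonneg _ _
  set F : RN N × RN N → ℝ≥0∞ := fun p => ENNReal.ofReal (z p.1 * v p.1 * kern s p.1 p.2) with hF
  set H : RN N × RN N → ℝ≥0∞ := fun p => ENNReal.ofReal (z p.2 * v p.1 * kern s p.1 p.2) with hH
  have hFm : Measurable F := by fun_prop
  have hHm : Measurable H := by fun_prop
  -- On far pairs no cancellation is used: all four products from `(z x + z y) (v x + v y)` are
  -- kept, and swapping the points pairs them into `F` (values at the same point) and `H` (values at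
  -- different points).
  have hnc : ∫⁻ p in (nearSet x₀ R)ᶜ, ENNReal.ofReal |(z p.1 - z p.2) * (v p.1 - v p.2) * K p| ≤
      ENNReal.ofReal L * (2 * (∫⁻ p in (nearSet x₀ R)ᶜ, F p) +
        2 * ∫⁻ p in (nearSet x₀ R)ᶜ, H p) := by
    have h2 := setLIntegral_pair_swap hnear.compl (fun x y => not_congr mem_nearSet_swap) hFm
    have h3 := setLIntegral_pair_swap hnear.compl (fun x y => not_congr mem_nearSet_swap) hHm
    calc _ ≤ ∫⁻ p in (nearSet x₀ R)ᶜ, ENNReal.ofReal L *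
          ((F p + F p.swap) + (H p + H p.swap)) := by
          refine lintegral_mono fun p => ?_
          simp only [hF, hH, Prod.fst_swap, Prod.snd_swap]
          have a1 := mul_nonneg (mul_nonneg (hz0 p.1) (hv0 p.1)) (hkn p)
          have a2 := mul_nonneg (mul_nonneg (hz0 p.2) (hv0 p.2)) (hkn p)
          have a3 := mul_nonneg (mul_nonneg (hz0 p.2) (hv0 p.1)) (hkn p)
          have a4 := mul_nonneg (mul_nonneg (hz0 p.1) (hv0 p.2)) (hkn p)
          rw [kern_comm p.2 p.1, ← ENNReal.ofReal_add a1 a2, ← ENNReal.ofReal_add a3 a4,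
            ← ENNReal.ofReal_add (by positivity) (by positivity), ← ENNReal.ofReal_mul hL.le]
          refine ENNReal.ofReal_le_ofReal ?_
          rw [abs_mul, abs_mul, abs_of_nonneg (hK0 p)]
          have b1 : |z p.1 - z p.2| ≤ z p.1 + z p.2 :=
            abs_le.2 ⟨by linarith [hz0 p.1], by linarith [hz0 p.2]⟩
          have b2 : |v p.1 - v p.2| ≤ v p.1 + v p.2 :=
            abs_le.2 ⟨by linarith [hv0 p.1], by linarith [hv0 p.2]⟩
          calc _ ≤ (z p.1 + z p.2) * (v p.1 + v p.2) * (L * kern s p.1 p.2) := by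
                have := hz0 p.1; have := hz0 p.2; have := hv0 p.1; have := hv0 p.2
                have := hK0 p
                exact mul_le_mul (mul_le_mul b1 b2 (abs_nonneg _) (by positivity)) (hK p)
                  (hK0 p) (by positivity)
            _ = _ := by ring
      _ = _ := by
          rw [lintegral_const_mul' _ _ ENNReal.ofReal_ne_top,
            lintegral_add_left (by fun_prop), lintegral_add_left hFm, lintegral_add_left hHm,
            h2, h3, two_mul, two_mul]
  -- On near pairs the singularity of the kernel is integrable only against increments, so the
  -- product is split into two energies.
  have hn : ∫⁻ p in nearSet x₀ R, ENNReal.ofReal |(z p.1 - z p.2) * (v p.1 - v p.2) * K p| ≤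
      ENNReal.ofReal L * ((∫⁻ p in Metric.ball x₀ R ×ˢ Metric.ball x₀ R,
          ENNReal.ofReal ((z p.1 - z p.2) ^ 2 * kern s p.1 p.2)) +
        (∫⁻ p in nearSet x₀ R, ENNReal.ofReal ((v p.1 - v p.2) ^ 2 * kern s p.1 p.2))) := by
    have hsub : nearSet x₀ R ⊆ Metric.ball x₀ R ×ˢ Metric.ball x₀ R := fun p hp =>
      ⟨left_mem_ball_of_mem_nearSet hR hp, right_mem_ball_of_mem_nearSet hR hp⟩
    refine le_trans ?_ (mul_le_mul_right (add_le_add (lintegral_mono_set hsub) le_rfl) _)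
    rw [← lintegral_add_left (by fun_prop), ← lintegral_const_mul' _ _ ENNReal.ofReal_ne_top]
    refine lintegral_mono fun p => ?_
    have a1 := hkn p
    simp only
    rw [← ENNReal.ofReal_add (by positivity) (by positivity), ← ENNReal.ofReal_mul hL.le]
    refine ENNReal.ofReal_le_ofReal ?_
    rw [abs_mul, abs_mul, abs_of_nonneg (hK0 p)]
    calc _ ≤ ((z p.1 - z p.2) ^ 2 + (v p.1 - v p.2) ^ 2) * (L * kern s p.1 p.2) := by
          refine mul_le_mul ?_ (hK p) (hK0 p) (by positivity)
          nlinarith [sq_nonneg (|z p.1 - z p.2| - |v p.1 - v p.2|), sq_abs (z p.1 - z p.2),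
            sq_abs (v p.1 - v p.2), sq_nonneg (z p.1 - z p.2), sq_nonneg (v p.1 - v p.2)]
      _ = _ := by ring
  have hFb : ∫⁻ p in (nearSet x₀ R)ᶜ, F p ≤ ENNReal.ofReal (C * R ^ (-(2 * s)) * κ ^ (1 - q)) *
      ((∫⁻ x in Metric.ball x₀ R, ENNReal.ofReal (z x ^ (q + 1))) +
        ∫⁻ x in Metric.ball x₀ R, ENNReal.ofReal (w x ^ (q + 1))) := by
    refine (hCb x₀ R κ hR hκ w z hw hz hz0).trans (mul_le_mul_right ?_ _)
    rw [← lintegral_add_left (by fun_prop)]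
    refine (lintegral_mono_set fun x hx => hx.1).trans (lintegral_mono fun x => ?_)
    rw [← ENNReal.ofReal_add (Real.rpow_nonneg (hz0 x) _) (Real.rpow_nonneg (hw0 x) _)]
    exact ENNReal.ofReal_le_ofReal (mul_rpow_le_add hq (hz0 x) (hw0 x))
  have hHb : ∫⁻ p in (nearSet x₀ R)ᶜ, H p ≤ ENNReal.ofReal (7 ^ ((N : ℝ) + 2 * s)) *
      truncMass s q x₀ R κ w * weightedTail s x₀ R z :=
    lintegral_far_cross_le hN hs0 hq hR hw hz hz0
  rw [← lintegral_add_compl _ hnear]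
  refine (add_le_add hn (hnc.trans (mul_le_mul_right (add_le_add (mul_le_mul_right hFb 2)
    (mul_le_mul_right hHb 2)) _))).trans (le_of_eq ?_)
  ring

/-- Lower bound for the far-range part of the bilinear form. -/
lemma neg_le_setIntegral_form_far {N : ℕ} (hN : 2 ≤ N) {s q : ℝ} (hs0 : 0 < s) (hq : 1 < q)
    {x₀ : RN N} {R κ L : ℝ} (hR : 0 < R) (hL : 0 < L) {w z : RN N → ℝ}
    (hw : Measurable w) (hz : Measurable z) (hz0 : ∀ x, 0 ≤ z x)
    {K : RN N × RN N → ℝ} (hK0 : ∀ p, 0 ≤ K p) (hK : ∀ p, K p ≤ L * kern s p.1 p.2)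
    (hM : truncMass s q x₀ R κ w ≠ ⊤) (hT : weightedTail s x₀ R z ≠ ⊤)
    (hint : Integrable fun p : RN N × RN N => (z p.1 - z p.2) *
      (trunc s q x₀ R κ w p.1 - trunc s q x₀ R κ w p.2) * K p) :
    -(2 * L * 7 ^ ((N : ℝ) + 2 * s) * (truncMass s q x₀ R κ w).toReal *
      (weightedTail s x₀ R z).toReal) ≤
    ∫ p in (nearSet x₀ R)ᶜ, (z p.1 - z p.2) *
      (trunc s q x₀ R κ w p.1 - trunc s q x₀ R κ w p.2) * K p := by
  have ht := measurable_trunc (s := s) (q := q) (x₀ := x₀) (R := R) (κ := κ) hw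
  have hnear := measurableSet_nearSet x₀ R
  have hb := lintegral_far_cross_le hN hs0 hq (x₀ := x₀) hR (κ := κ) hw hz hz0
  change _ ≤ ENNReal.ofReal (7 ^ ((N : ℝ) + 2 * s)) * truncMass s q x₀ R κ w *
    weightedTail s x₀ R z at hb
  set v := trunc s q x₀ R κ w with hv
  have hv0 : ∀ x, 0 ≤ v x := fun x => trunc_nonneg
  set H : RN N × RN N → ℝ≥0∞ := fun p => ENNReal.ofReal (z p.2 * v p.1 * kern s p.1 p.2) with hH
  have hHm : Measurable H := by fun_prop
  have hkn : ∀ p : RN N × RN N, 0 ≤ kern s p.1 p.2 := fun p => kern_nonneg _ _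
  set G : RN N × RN N → ℝ := fun p => L * ((z p.2 * v p.1 + z p.1 * v p.2) * kern s p.1 p.2) with hG
  have hG0 : ∀ p, 0 ≤ G p := fun p => by
    have := hz0 p.1; have := hz0 p.2; have := hv0 p.1; have := hv0 p.2; have := hkn p
    positivity
  have hGl : ∫⁻ p in (nearSet x₀ R)ᶜ, ENNReal.ofReal (G p) ≤
      ENNReal.ofReal L * (2 * (ENNReal.ofReal (7 ^ ((N : ℝ) + 2 * s)) *
        truncMass s q x₀ R κ w * weightedTail s x₀ R z)) := by
    have h3 := setLIntegral_pair_swap hnear.compl (fun x y => not_congr mem_nearSet_swap) hHm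
    calc _ = ∫⁻ p in (nearSet x₀ R)ᶜ, ENNReal.ofReal L * (H p + H p.swap) := by
          refine lintegral_congr fun p => ?_
          simp only [hH, hG, Prod.fst_swap, Prod.snd_swap]
          have a3 := mul_nonneg (mul_nonneg (hz0 p.2) (hv0 p.1)) (hkn p)
          have a4 := mul_nonneg (mul_nonneg (hz0 p.1) (hv0 p.2)) (hkn p)
          rw [kern_comm p.2 p.1, ← ENNReal.ofReal_add a3 a4, ← ENNReal.ofReal_mul hL.le]
          congr 1; ring
      _ = ENNReal.ofReal L * (2 * ∫⁻ p in (nearSet x₀ R)ᶜ, H p) := by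
          rw [lintegral_const_mul' _ _ ENNReal.ofReal_ne_top, lintegral_add_left hHm, h3, two_mul]
      _ ≤ _ := mul_le_mul_right (mul_le_mul_right hb 2) _
  have hfin : ENNReal.ofReal L * (2 * (ENNReal.ofReal (7 ^ ((N : ℝ) + 2 * s)) *
        truncMass s q x₀ R κ w * weightedTail s x₀ R z)) ≠ ⊤ := by
    refine ENNReal.mul_ne_top ENNReal.ofReal_ne_top (ENNReal.mul_ne_top (by simp)
      (ENNReal.mul_ne_top (ENNReal.mul_ne_top ENNReal.ofReal_ne_top hM) hT))
  have hGi : IntegrableOn G (nearSet x₀ R)ᶜ := by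
    rw [IntegrableOn, ← lintegral_ofReal_ne_top_iff_integrable
      (show Measurable G by fun_prop).aestronglyMeasurable (Eventually.of_forall hG0)]
    exact ne_top_of_le_ne_top hfin hGl
  have hGint : ∫ p in (nearSet x₀ R)ᶜ, G p ≤ 2 * L * 7 ^ ((N : ℝ) + 2 * s) *
      (truncMass s q x₀ R κ w).toReal * (weightedTail s x₀ R z).toReal := by
    rw [integral_eq_lintegral_of_nonneg_ae (Eventually.of_forall hG0)
      (show Measurable G by fun_prop).aestronglyMeasurable]
    refine (ENNReal.toReal_mono hfin hGl).trans (le_of_eq ?_)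
    simp only [ENNReal.toReal_mul, ENNReal.toReal_ofReal hL.le, ENNReal.toReal_ofNat]
    rw [ENNReal.toReal_ofReal (by positivity)]
    ring
  refine (neg_le_neg hGint).trans ?_
  rw [← integral_neg]
  refine integral_mono hGi.neg hint.integrableOn fun p => ?_
  simp only [hG]
  have := hz0 p.1; have := hz0 p.2; have := hv0 p.1; have := hv0 p.2; have := hkn p
  -- Of the four products in the expansion, the two with values at the same point have a favourable
  -- sign and are dropped; the two cross products are bounded with the upper bound of the kernel.
  have h1 : (z p.2 * v p.1 + z p.1 * v p.2) * K p ≤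
      (z p.2 * v p.1 + z p.1 * v p.2) * (L * kern s p.1 p.2) :=
    mul_le_mul_of_nonneg_left (hK p) (by positivity)
  have h2 : 0 ≤ (z p.1 * v p.1 + z p.2 * v p.2) * K p := mul_nonneg (by positivity) (hK0 p)
  nlinarith

/-! ### Sub-solutions in a cylinder and the time-increasing level. -/

/-- Nonnegative weak sub-solutions in the cylinder `B_R(x₀) × (a, b)`, tested with functions that do
not depend on time. -/
structure CylinderSubsolution {N : ℕ} (s q L : ℝ) (x₀ : RN N) (R a b : ℝ)
    (K : RN N × RN N → ℝ → ℝ) (u : RN N → ℝ → ℝ) : Prop where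
  measurable_u : Measurable fun z : RN N × ℝ => u z.1 z.2
  nonneg : ∀ x t, 0 ≤ u x t
  measurable_K : Measurable fun z : (RN N × RN N) × ℝ => K z.1 z.2
  lower : ∀ p t, L⁻¹ * kern s p.1 p.2 ≤ K p t
  upper : ∀ p t, K p t ≤ L * kern s p.1 p.2
  sup_bound : ∃ C : ℝ≥0∞, C ≠ ⊤ ∧ ∀ᵐ t ∂(volume.restrict (Ioo a b)),
    ∫⁻ x in Metric.ball x₀ R, ENNReal.ofReal (u x t ^ (q + 1)) ≤ C
  energy : ∫⁻ t in Ioo a b, ∫⁻ p in Metric.ball x₀ R ×ˢ Metric.ball x₀ R,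
    ENNReal.ofReal ((u p.1 t - u p.2 t) ^ 2 * kern s p.1 p.2) ≠ ⊤
  tail : ∫⁻ t in Ioo a b, weightedTail s x₀ R (fun y => u y t) ≠ ⊤
  weak : ∃ G : Set ℝ, (∀ᵐ t ∂(volume.restrict (Ioo a b)), t ∈ G) ∧
    ∀ t₁ ∈ G, ∀ t₂ ∈ G, a < t₁ → t₁ < t₂ → t₂ < b → ∀ φ : RN N → ℝ, Measurable φ →
      (∀ x, 0 ≤ φ x) → (∀ x, x ∉ Metric.ball x₀ R → φ x = 0) →
      ∫⁻ x, ENNReal.ofReal (φ x ^ (q + 1)) ≠ ⊤ →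
      ∫⁻ p : RN N × RN N, ENNReal.ofReal ((φ p.1 - φ p.2) ^ 2 * kern s p.1 p.2) ≠ ⊤ →
      (∫ x in Metric.ball x₀ R, (u x t₂ ^ q - u x t₁ ^ q) * φ x) +
        (∫ τ in t₁..t₂, ∫ p : RN N × RN N,
          (u p.1 τ - u p.2 τ) * (φ p.1 - φ p.2) * K p τ) ≤ 0

/-- The weighted tail as a real function of time, vanishing off `(a, b)`. -/
def tailDensity {N : ℕ} (s : ℝ) (x₀ : RN N) (R a b : ℝ) (u : RN N → ℝ → ℝ) (t : ℝ) : ℝ :=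
  (Ioo a b).indicator (fun t => (weightedTail s x₀ R fun y => u y t).toReal) t

/-- The weighted tail accumulated from time `a` to time `t`. -/
def tailMass {N : ℕ} (s : ℝ) (x₀ : RN N) (R a b : ℝ) (u : RN N → ℝ → ℝ) (t : ℝ) : ℝ :=
  ∫ r in a..t, tailDensity s x₀ R a b u r

/-- The constant in front of the tail. -/
def tailConst (N : ℕ) (s L : ℝ) : ℝ := 2 * L * 7 ^ ((N : ℝ) + 2 * s)

/-- The level that increases in time so as to absorb the tail. -/
def level {N : ℕ} (s q L : ℝ) (x₀ : RN N) (R a b : ℝ) (u : RN N → ℝ → ℝ) (k t : ℝ) : ℝ :=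
  (k ^ q + tailConst N s L * tailMass s x₀ R a b u t) ^ (1 / q)

lemma tailConst_pos {N : ℕ} {s L : ℝ} (hL : 0 < L) : 0 < tailConst N s L := by
  unfold tailConst; positivity

namespace CylinderSubsolution
variable {N : ℕ} {s q L : ℝ} {x₀ : RN N} {R a b : ℝ} {K : RN N × RN N → ℝ → ℝ}
  {u : RN N → ℝ → ℝ}

lemma measurable_slice (h : CylinderSubsolution s q L x₀ R a b K u) (t : ℝ) :
    Measurable fun x => u x t :=
  h.measurable_u.comp measurable_prodMk_right

lemma measurable_comp (h : CylinderSubsolution s q L x₀ R a b K u) {α : Type*} [MeasurableSpace α]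
    {f : α → RN N} {g : α → ℝ} (hf : Measurable f) (hg : Measurable g) :
    Measurable fun x => u (f x) (g x) :=
  h.measurable_u.comp (hf.prodMk hg)

lemma measurable_K_comp (h : CylinderSubsolution s q L x₀ R a b K u) {α : Type*}
    [MeasurableSpace α] {f : α → RN N × RN N} {g : α → ℝ} (hf : Measurable f)
    (hg : Measurable g) : Measurable fun x => K (f x) (g x) :=
  h.measurable_K.comp (hf.prodMk hg)

lemma K_nonneg (h : CylinderSubsolution s q L x₀ R a b K u) (hL : 0 < L) (p : RN N × RN N)
    (t : ℝ) : 0 ≤ K p t :=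
  le_trans (mul_nonneg (inv_nonneg.2 hL.le) (kern_nonneg _ _)) (h.lower p t)

lemma measurable_weightedTail (h : CylinderSubsolution s q L x₀ R a b K u) :
    Measurable fun t => weightedTail s x₀ R fun y => u y t := by
  unfold weightedTail
  have hm : Measurable fun z : ℝ × RN N => u z.2 z.1 := h.measurable_comp (by fun_prop) (by fun_prop)
  exact Measurable.lintegral_prod_right'
    (f := fun z : ℝ × RN N => ENNReal.ofReal (u z.2 z.1 / (R + ‖z.2 - x₀‖) ^ ((N : ℝ) + 2 * s)))
    (hm.div (by fun_prop)).ennreal_ofReal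

lemma integrable_tailDensity (h : CylinderSubsolution s q L x₀ R a b K u) :
    Integrable (tailDensity s x₀ R a b u) := by
  have h1 : IntegrableOn (fun t => (weightedTail s x₀ R fun y => u y t).toReal) (Ioo a b) :=
    integrable_toReal_of_lintegral_ne_top h.measurable_weightedTail.aemeasurable h.tail
  exact h1.integrable_indicator measurableSet_Ioo

lemma tailDensity_nonneg (t : ℝ) : 0 ≤ tailDensity s x₀ R a b u t :=
  indicator_nonneg (fun _ _ => ENNReal.toReal_nonneg) _

lemma tailMass_sub (h : CylinderSubsolution s q L x₀ R a b K u) (t₁ t₂ : ℝ) :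
    tailMass s x₀ R a b u t₂ - tailMass s x₀ R a b u t₁ =
      ∫ r in t₁..t₂, tailDensity s x₀ R a b u r :=
  intervalIntegral.integral_interval_sub_left h.integrable_tailDensity.intervalIntegrable
    h.integrable_tailDensity.intervalIntegrable

lemma tailMass_mono (h : CylinderSubsolution s q L x₀ R a b K u) {t₁ t₂ : ℝ} (ht : t₁ ≤ t₂) :
    tailMass s x₀ R a b u t₁ ≤ tailMass s x₀ R a b u t₂ := by
  rw [← sub_nonneg, h.tailMass_sub]
  exact intervalIntegral.integral_nonneg ht fun r _ => tailDensity_nonneg r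

lemma tailMass_nonneg {t : ℝ} (ht : a ≤ t) : 0 ≤ tailMass s x₀ R a b u t :=
  intervalIntegral.integral_nonneg ht fun r _ => tailDensity_nonneg r

lemma measurable_level (h : CylinderSubsolution s q L x₀ R a b K u) (k : ℝ) :
    Measurable (level s q L x₀ R a b u k) := by
  have : Continuous (tailMass s x₀ R a b u) :=
    intervalIntegral.continuous_primitive
      (fun _ _ => h.integrable_tailDensity.intervalIntegrable) a
  unfold level
  have := this.measurable
  fun_prop

/-- It is the `q`-th power of the level that is affine in the accumulated tail. Hence the gap
between the `q`-th powers of levels started from different `k` does not change in time. -/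
lemma level_rpow (hq : 1 < q) (hL : 0 < L) {k : ℝ} (hk : 0 < k) {t : ℝ} (ht : a ≤ t) :
    level s q L x₀ R a b u k t ^ q = k ^ q + tailConst N s L * tailMass s x₀ R a b u t := by
  have := tailMass_nonneg (s := s) (x₀ := x₀) (R := R) (b := b) (u := u) ht
  have h2 := tailConst_pos (N := N) (s := s) hL
  rw [level, one_div, Real.rpow_inv_rpow (by positivity) (by linarith)]

lemma le_level (hq : 1 < q) (hL : 0 < L) {k : ℝ} (hk : 0 < k) {t : ℝ} (ht : a ≤ t) :
    k ≤ level s q L x₀ R a b u k t := by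
  have h1 := tailMass_nonneg (s := s) (x₀ := x₀) (R := R) (b := b) (u := u) ht
  have h2 := tailConst_pos (N := N) (s := s) hL
  have h3 : 0 ≤ level s q L x₀ R a b u k t := by unfold level; positivity
  rw [← Real.rpow_le_rpow_iff hk.le h3 (by linarith : 0 < q), level_rpow hq hL hk ht]
  have : 0 ≤ tailConst N s L * tailMass s x₀ R a b u t := by positivity
  linarith

lemma level_pos (hq : 1 < q) (hL : 0 < L) {k : ℝ} (hk : 0 < k) {t : ℝ} (ht : a ≤ t) :
    0 < level s q L x₀ R a b u k t := hk.trans_le (le_level hq hL hk ht)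

lemma level_mono (h : CylinderSubsolution s q L x₀ R a b K u) (hq : 1 < q) (hL : 0 < L) {k : ℝ}
    (hk : 0 < k) {t₁ t₂ : ℝ} (h1 : a ≤ t₁) (h2 : t₁ ≤ t₂) :
    level s q L x₀ R a b u k t₁ ≤ level s q L x₀ R a b u k t₂ := by
  have h3 := tailConst_pos (N := N) (s := s) hL
  rw [← Real.rpow_le_rpow_iff (level_pos hq hL hk h1).le (level_pos hq hL hk (h1.trans h2)).le
    (by linarith : 0 < q), level_rpow hq hL hk h1, level_rpow hq hL hk (h1.trans h2)]
  have := h.tailMass_mono h2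
  gcongr

end CylinderSubsolution

/-! ### The energy inequality. -/

/-- The total entropy at time `t`, relative to the barrier at the given level. -/
def totalEntropy {N : ℕ} (s q L : ℝ) (x₀ : RN N) (R a b : ℝ) (u : RN N → ℝ → ℝ) (k t : ℝ) : ℝ :=
  ∫ x in Metric.ball x₀ R,
    entropy q (u x t) (level s q L x₀ R a b u k t * barrier s q x₀ R x)

/-- The truncation of `u` above the barrier at time `t`. -/
def truncAt {N : ℕ} (s q L : ℝ) (x₀ : RN N) (R a b : ℝ) (u : RN N → ℝ → ℝ) (k t : ℝ) :
    RN N → ℝ :=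
  trunc s q x₀ R (level s q L x₀ R a b u k t) fun x => u x t

lemma entropy_integrableOn {N : ℕ} {s q : ℝ} (hq : 1 < q) {x₀ : RN N} {R κ : ℝ}
    (hR : 0 < R) (hκ : 0 < κ) {w : RN N → ℝ} (hw : Measurable w) (hw0 : ∀ x, 0 ≤ w x)
    (hfin : ∫⁻ x in Metric.ball x₀ R, ENNReal.ofReal (w x ^ (q + 1)) ≠ ⊤) :
    IntegrableOn (fun x => entropy q (w x) (κ * barrier s q x₀ R x)) (Metric.ball x₀ R) := by
  have h1 : IntegrableOn (fun x => w x ^ (q + 1)) (Metric.ball x₀ R) := by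
    rw [IntegrableOn, ← lintegral_ofReal_ne_top_iff_integrable
      (by fun_prop : Measurable _).aestronglyMeasurable
      (Eventually.of_forall fun x => Real.rpow_nonneg (hw0 x) _)]
    exact hfin
  refine h1.mono' ?_ ?_
  · exact (measurable_entropy.comp (hw.prodMk (by fun_prop))).aestronglyMeasurable
  · refine (ae_restrict_iff' Metric.isOpen_ball.measurableSet).2 (Eventually.of_forall fun x hx => ?_)
    have hb : 0 ≤ κ * barrier s q x₀ R x := (mul_pos hκ (barrier_pos hR hx)).le
    rw [Real.norm_eq_abs, abs_of_nonneg (entropy_nonneg hq hb)]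
    refine (entropy_le hq hb).trans ?_
    split_ifs
    · exact le_rfl
    · exact Real.rpow_nonneg (hw0 x) _

/-- Near-range part of the energy of a truncation. -/
lemma exists_lintegral_near_energy_le {N : ℕ} (hN : 2 ≤ N) {s q : ℝ} (hs0 : 0 < s)
    (hs1 : s < 1) (hq : 1 < q) :
    ∃ C : ℝ, 0 < C ∧ ∀ (x₀ : RN N) (R κ : ℝ), 0 < R → 0 < κ → ∀ (w : RN N → ℝ),
      Measurable w →
      ∫⁻ p in nearSet x₀ R, ENNReal.ofReal
        ((trunc s q x₀ R κ w p.1 - trunc s q x₀ R κ w p.2) ^ 2 * kern s p.1 p.2) ≤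
      2 * (∫⁻ p in Metric.ball x₀ R ×ˢ Metric.ball x₀ R,
          ENNReal.ofReal ((w p.1 - w p.2) ^ 2 * kern s p.1 p.2)) +
        ENNReal.ofReal (C * R ^ (-(2 * s)) * κ ^ (1 - q)) *
        ∫⁻ x in posSet s q x₀ R κ w, ENNReal.ofReal (w x ^ (q + 1)) := by
  obtain ⟨C, hC, hCb⟩ := exists_lintegral_barrierError_le hN hs0 hs1 hq
  refine ⟨2 * C, by positivity, fun x₀ R κ hR hκ w hw => ?_⟩
  have hsub : nearSet x₀ R ⊆ Metric.ball x₀ R ×ˢ Metric.ball x₀ R := fun p hp =>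
    ⟨left_mem_ball_of_mem_nearSet hR hp, right_mem_ball_of_mem_nearSet hR hp⟩
  have hbm := measurable_barrierError (s := s) (q := q) (x₀ := x₀) (R := R) (κ := κ) hw
  calc _ ≤ ∫⁻ p in nearSet x₀ R, (2 * ENNReal.ofReal ((w p.1 - w p.2) ^ 2 * kern s p.1 p.2) +
        2 * ENNReal.ofReal (barrierError s q x₀ R κ w p * kern s p.1 p.2)) := by
        refine setLIntegral_mono' (measurableSet_nearSet x₀ R) fun p hp => ?_
        have a1 := kern_nonneg (s := s) p.1 p.2
        have a2 : 0 ≤ barrierError s q x₀ R κ w p := barrierError_nonneg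
        rw [two_mul_ofReal, two_mul_ofReal, ← ENNReal.ofReal_add (by positivity) (by positivity)]
        refine ENNReal.ofReal_le_ofReal ?_
        nlinarith [mul_le_mul_of_nonneg_right
          (trunc_increment_sq_le (s := s) (q := q) (κ := κ) (w := w) hR hp) a1]
    _ = 2 * (∫⁻ p in nearSet x₀ R, ENNReal.ofReal ((w p.1 - w p.2) ^ 2 * kern s p.1 p.2)) +
        2 * ∫⁻ p in nearSet x₀ R,
          ENNReal.ofReal (barrierError s q x₀ R κ w p * kern s p.1 p.2) := by
        rw [lintegral_add_left (by fun_prop), lintegral_const_mul' _ _ (by simp),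
          lintegral_const_mul' _ _ (by simp)]
    _ ≤ _ := by
        refine add_le_add (mul_le_mul_right (lintegral_mono_set hsub) 2)
          ((mul_le_mul_right (hCb x₀ R κ hR hκ w hw) 2).trans (le_of_eq ?_))
        rw [← mul_assoc, two_mul_ofReal]
        congr 2; ring

lemma lintegral_trunc_energy_ne_top {N : ℕ} (hN : 2 ≤ N) {s q : ℝ} (hs0 : 0 < s)
    (hs1 : s < 1) (hq : 1 < q) {x₀ : RN N} {R κ : ℝ} (hR : 0 < R) (hκ : 0 < κ) {w : RN N → ℝ}
    (hw : Measurable w)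
    (hfin : ∫⁻ x in Metric.ball x₀ R, ENNReal.ofReal (w x ^ (q + 1)) ≠ ⊤)
    (hE : ∫⁻ p in Metric.ball x₀ R ×ˢ Metric.ball x₀ R,
      ENNReal.ofReal ((w p.1 - w p.2) ^ 2 * kern s p.1 p.2) ≠ ⊤) :
    ∫⁻ p : RN N × RN N, ENNReal.ofReal
      ((trunc s q x₀ R κ w p.1 - trunc s q x₀ R κ w p.2) ^ 2 * kern s p.1 p.2) ≠ ⊤ := by
  obtain ⟨C, hC, hCb⟩ := exists_lintegral_near_energy_le hN hs0 hs1 hq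
  obtain ⟨D, hD, hDb⟩ := exists_lintegral_far_energy_le hN hs0 hq
  have hA : ∫⁻ x in posSet s q x₀ R κ w, ENNReal.ofReal (w x ^ (q + 1)) ≠ ⊤ :=
    ne_top_of_le_ne_top hfin (lintegral_mono_set fun x hx => hx.1)
  rw [← lintegral_add_compl _ (measurableSet_nearSet x₀ R)]
  refine ENNReal.add_ne_top.2 ⟨ne_top_of_le_ne_top ?_ (hCb x₀ R κ hR hκ w hw),
    ne_top_of_le_ne_top ?_ (hDb x₀ R κ hR hκ w hw)⟩
  · exact ENNReal.add_ne_top.2 ⟨ENNReal.mul_ne_top (by simp) hE,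
      ENNReal.mul_ne_top ENNReal.ofReal_ne_top hA⟩
  · exact ENNReal.mul_ne_top ENNReal.ofReal_ne_top hA

lemma integrableOn_of_lintegral_ne_top {α : Type*} [MeasurableSpace α] {μ : Measure α} {S : Set α}
    {f : α → ℝ} (hf : Measurable f) (h0 : ∀ x, 0 ≤ f x)
    (h : ∫⁻ x in S, ENNReal.ofReal (f x) ∂μ ≠ ⊤) : IntegrableOn f S μ := by
  rw [IntegrableOn, ← lintegral_ofReal_ne_top_iff_integrable hf.aestronglyMeasurable
    (Eventually.of_forall h0)]
  exact h

namespace CylinderSubsolution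
variable {N : ℕ} {s q L : ℝ} {x₀ : RN N} {R a b : ℝ} {K : RN N × RN N → ℝ → ℝ}
  {u : RN N → ℝ → ℝ}

lemma measurable_energy (h : CylinderSubsolution s q L x₀ R a b K u) :
    Measurable fun t => ∫⁻ p in Metric.ball x₀ R ×ˢ Metric.ball x₀ R,
      ENNReal.ofReal ((u p.1 t - u p.2 t) ^ 2 * kern s p.1 p.2) := by
  have h1 : Measurable fun z : ℝ × (RN N × RN N) => u z.2.1 z.1 :=
    h.measurable_comp (by fun_prop) (by fun_prop)
  have h2 : Measurable fun z : ℝ × (RN N × RN N) => u z.2.2 z.1 :=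
    h.measurable_comp (by fun_prop) (by fun_prop)
  exact Measurable.lintegral_prod_right'
    (f := fun z : ℝ × (RN N × RN N) =>
      ENNReal.ofReal ((u z.2.1 z.1 - u z.2.2 z.1) ^ 2 * kern s z.2.1 z.2.2))
    ((((h1.sub h2).pow_const 2).mul (by fun_prop)).ennreal_ofReal)

/-- The bilinear form is absolutely integrable on time intervals. -/
lemma integrable_form (h : CylinderSubsolution s q L x₀ R a b K u) (hN : 2 ≤ N) (hs0 : 0 < s)
    (hs1 : s < 1) (hq : 1 < q) (hL : 0 < L) (hR : 0 < R) {κ t₁ t₂ : ℝ} (hκ : 0 < κ)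
    (ha : a < t₁) (hb : t₂ < b) {w : RN N → ℝ} (hw : Measurable w) (hw0 : ∀ x, 0 ≤ w x)
    (hfin : ∫⁻ x in Metric.ball x₀ R, ENNReal.ofReal (w x ^ (q + 1)) ≠ ⊤)
    (hE : ∫⁻ p in Metric.ball x₀ R ×ˢ Metric.ball x₀ R,
      ENNReal.ofReal ((w p.1 - w p.2) ^ 2 * kern s p.1 p.2) ≠ ⊤) :
    Integrable (fun z : ℝ × (RN N × RN N) => (u z.2.1 z.1 - u z.2.2 z.1) *
      (trunc s q x₀ R κ w z.2.1 - trunc s q x₀ R κ w z.2.2) * K z.2 z.1)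
      ((volume.restrict (Ioc t₁ t₂)).prod volume) := by
  obtain ⟨C, hC, hCb⟩ := exists_lintegral_form_le hN hs0 hq
  obtain ⟨Cs, hCs, hsup⟩ := h.sup_bound
  have ht := measurable_trunc (s := s) (q := q) (x₀ := x₀) (R := R) (κ := κ) hw
  have hsub : Ioc t₁ t₂ ⊆ Ioo a b := fun t ht => ⟨ha.trans ht.1, ht.2.trans_lt hb⟩
  have h1 : Measurable fun z : ℝ × (RN N × RN N) => u z.2.1 z.1 :=
    h.measurable_comp (by fun_prop) (by fun_prop)
  have h2 : Measurable fun z : ℝ × (RN N × RN N) => u z.2.2 z.1 :=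
    h.measurable_comp (by fun_prop) (by fun_prop)
  have h3 : Measurable fun z : ℝ × (RN N × RN N) => K z.2 z.1 :=
    h.measurable_K_comp (by fun_prop) (by fun_prop)
  have hm : Measurable fun z : ℝ × (RN N × RN N) => (u z.2.1 z.1 - u z.2.2 z.1) *
      (trunc s q x₀ R κ w z.2.1 - trunc s q x₀ R κ w z.2.2) * K z.2 z.1 :=
    ((h1.sub h2).mul (by fun_prop)).mul h3
  have hV := lintegral_trunc_energy_ne_top hN hs0 hs1 hq hR hκ hw hfin hE
  have hM := truncMass_ne_top (s := s) hq hR hκ hw hfin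
  refine ⟨hm.aestronglyMeasurable, ?_⟩
  rw [hasFiniteIntegral_iff_norm, lintegral_prod _ hm.norm.ennreal_ofReal.aemeasurable]
  have key : ∀ᵐ t ∂(volume.restrict (Ioc t₁ t₂)),
      ∫⁻ p, ENNReal.ofReal ‖(u p.1 t - u p.2 t) *
        (trunc s q x₀ R κ w p.1 - trunc s q x₀ R κ w p.2) * K p t‖ ≤
      ENNReal.ofReal L * ((∫⁻ p in Metric.ball x₀ R ×ˢ Metric.ball x₀ R,
          ENNReal.ofReal ((u p.1 t - u p.2 t) ^ 2 * kern s p.1 p.2)) +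
        (∫⁻ p : RN N × RN N, ENNReal.ofReal ((trunc s q x₀ R κ w p.1 -
          trunc s q x₀ R κ w p.2) ^ 2 * kern s p.1 p.2)) +
        2 * (ENNReal.ofReal (C * R ^ (-(2 * s)) * κ ^ (1 - q)) *
          (Cs + ∫⁻ x in Metric.ball x₀ R, ENNReal.ofReal (w x ^ (q + 1)))) +
        2 * (ENNReal.ofReal (7 ^ ((N : ℝ) + 2 * s)) * truncMass s q x₀ R κ w *
          weightedTail s x₀ R fun y => u y t)) := by
    filter_upwards [ae_restrict_of_ae_restrict_of_subset hsub hsup] with t hts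
    refine (hCb x₀ R κ L hR hκ hL w (fun x => u x t) hw (h.measurable_slice t) hw0
      (fun x => h.nonneg x t) (fun p => K p t) (fun p => h.K_nonneg hL p t)
      (fun p => h.upper p t)).trans ?_
    gcongr
    exact Measure.restrict_le_self
  refine lt_of_le_of_lt (lintegral_mono_ae key) (lt_top_iff_ne_top.2 ?_)
  have hEm := h.measurable_energy
  have hTm := h.measurable_weightedTail
  rw [lintegral_const_mul' _ _ ENNReal.ofReal_ne_top,
    lintegral_add_right _ ((hTm.const_mul _).const_mul _),
    lintegral_add_right _ measurable_const, lintegral_add_right _ measurable_const,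
    lintegral_const, lintegral_const, lintegral_const_mul' _ _ (by simp),
    lintegral_const_mul' _ _ (ENNReal.mul_ne_top ENNReal.ofReal_ne_top hM)]
  have hvol : (volume.restrict (Ioc t₁ t₂)) univ ≠ ⊤ := by simp
  have hE' : ∫⁻ t in Ioc t₁ t₂, ∫⁻ p in Metric.ball x₀ R ×ˢ Metric.ball x₀ R,
      ENNReal.ofReal ((u p.1 t - u p.2 t) ^ 2 * kern s p.1 p.2) ≠ ⊤ :=
    ne_top_of_le_ne_top h.energy (lintegral_mono_set hsub)
  have hT' : ∫⁻ t in Ioc t₁ t₂, weightedTail s x₀ R (fun y => u y t) ≠ ⊤ :=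
    ne_top_of_le_ne_top h.tail (lintegral_mono_set hsub)
  refine ENNReal.mul_ne_top ENNReal.ofReal_ne_top (ENNReal.add_ne_top.2 ⟨ENNReal.add_ne_top.2
    ⟨ENNReal.add_ne_top.2 ⟨hE', ENNReal.mul_ne_top hV hvol⟩, ENNReal.mul_ne_top ?_ hvol⟩, ?_⟩)
  · exact ENNReal.mul_ne_top (by simp) (ENNReal.mul_ne_top ENNReal.ofReal_ne_top
      (ENNReal.add_ne_top.2 ⟨hCs, hfin⟩))
  · exact ENNReal.mul_ne_top (by simp) (ENNReal.mul_ne_top (ENNReal.mul_ne_top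
      ENNReal.ofReal_ne_top hM) hT')

/-- The weak inequality between two times, tested with the truncation at the later time, after the
far-range interaction has been absorbed by the growth of the level. -/
lemma exists_window (h : CylinderSubsolution s q L x₀ R a b K u) (hN : 2 ≤ N) (hs0 : 0 < s)
    (hs1 : s < 1) (hq : 1 < q) (hL : 0 < L) (hR : 0 < R) {k : ℝ} (hk : 0 < k) :
    ∃ G : Set ℝ, (∀ᵐ t ∂(volume.restrict (Ioo a b)), t ∈ G) ∧
      ∀ t₁ ∈ G, ∀ t₂ ∈ G, a < t₁ → t₁ < t₂ → t₂ < b →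
      totalEntropy s q L x₀ R a b u k t₂ - totalEntropy s q L x₀ R a b u k t₁ +
        (∫ τ in t₁..t₂, ∫ p in nearSet x₀ R, (u p.1 τ - u p.2 τ) *
          (truncAt s q L x₀ R a b u k t₂ p.1 - truncAt s q L x₀ R a b u k t₂ p.2) * K p τ) ≤ 0 := by
  obtain ⟨G, hG, hweak⟩ := h.weak
  obtain ⟨Cs, hCs, hsup⟩ := h.sup_bound
  have hE := ae_lt_top' h.measurable_energy.aemeasurable h.energy
  -- Besides the weak inequality, a good time needs finite `L^(q+1)` mass and finite energy of its
  -- slice, so that the truncation at that time is an admissible test function.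
  refine ⟨{t | t ∈ G ∧ (∫⁻ x in Metric.ball x₀ R, ENNReal.ofReal (u x t ^ (q + 1)) ≤ Cs) ∧
    ∫⁻ p in Metric.ball x₀ R ×ˢ Metric.ball x₀ R,
      ENNReal.ofReal ((u p.1 t - u p.2 t) ^ 2 * kern s p.1 p.2) < ⊤}, ?_, ?_⟩
  · filter_upwards [hG, hsup, hE] with t h1 h2 h3 using ⟨h1, h2, h3⟩
  rintro t₁ ⟨hG1, hS1, -⟩ t₂ ⟨hG2, hS2, hE2⟩ ha h12 hb
  set κ₁ := level s q L x₀ R a b u k t₁ with hκ₁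
  set κ := level s q L x₀ R a b u k t₂ with hκdef
  have hκ1 : 0 < κ₁ := level_pos hq hL hk ha.le
  have hκ : 0 < κ := level_pos hq hL hk (ha.trans h12).le
  have hκle : κ₁ ≤ κ := h.level_mono hq hL hk ha.le h12.le
  set w : RN N → ℝ := fun x => u x t₂ with hwdef
  have hw : Measurable w := h.measurable_slice t₂
  have hw0 : ∀ x, 0 ≤ w x := fun x => h.nonneg x t₂
  set z : RN N → ℝ := fun x => u x t₁ with hzdef
  have hz : Measurable z := h.measurable_slice t₁
  have hz0 : ∀ x, 0 ≤ z x := fun x => h.nonneg x t₁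
  have hfw : ∫⁻ x in Metric.ball x₀ R, ENNReal.ofReal (w x ^ (q + 1)) ≠ ⊤ :=
    ne_top_of_le_ne_top hCs hS2
  have hfz : ∫⁻ x in Metric.ball x₀ R, ENNReal.ofReal (z x ^ (q + 1)) ≠ ⊤ :=
    ne_top_of_le_ne_top hCs hS1
  set v : RN N → ℝ := trunc s q x₀ R κ w with hvdef
  have hv : Measurable v := measurable_trunc hw
  have hv0 : ∀ x, 0 ≤ v x := fun x => trunc_nonneg
  have hvw : ∀ x, v x ≤ w x := fun x => trunc_le hR hκ hw0
  have hM := truncMass_ne_top (s := s) hq hR hκ hw hfw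
  set M : ℝ := (truncMass s q x₀ R κ w).toReal with hMdef
  have hball : MeasurableSet (Metric.ball x₀ R) := Metric.isOpen_ball.measurableSet
  have hIw : IntegrableOn (fun x => w x ^ (q + 1)) (Metric.ball x₀ R) :=
    integrableOn_of_lintegral_ne_top (by fun_prop) (fun x => Real.rpow_nonneg (hw0 x) _) hfw
  have hIz : IntegrableOn (fun x => z x ^ (q + 1)) (Metric.ball x₀ R) :=
    integrableOn_of_lintegral_ne_top (by fun_prop) (fun x => Real.rpow_nonneg (hz0 x) _) hfz
  have hF := h.integrable_form hN hs0 hs1 hq hL hR hκ ha hb hw hw0 hfw hE2.ne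
  -- The test function does not depend on time: it is the truncation of the slice at `t₂`, used on
  -- the whole interval from `t₁` to `t₂`.
  have hW := hweak t₁ hG1 t₂ hG2 ha h12 hb v hv hv0
    (fun x hx => trunc_of_notMem hx) (by
      refine ne_top_of_le_ne_top hfw ?_
      rw [← lintegral_indicator hball]
      refine lintegral_mono fun x => ?_
      by_cases hx : x ∈ Metric.ball x₀ R
      · rw [indicator_of_mem hx]
        exact ENNReal.ofReal_le_ofReal (Real.rpow_le_rpow (hv0 x) (hvw x) (by linarith))
      · have : v x = 0 := trunc_of_notMem hx
        rw [this, Real.zero_rpow (by linarith)]; simp)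
    (lintegral_trunc_energy_ne_top hN hs0 hs1 hq hR hκ hw hfw hE2.ne)
  set Φ : ℝ × (RN N × RN N) → ℝ := fun y => (u y.2.1 y.1 - u y.2.2 y.1) *
      (v y.2.1 - v y.2.2) * K y.2 y.1 with hΦ
  -- Slice by slice, the far-range part is at least minus `tailConst` times the weighted mass `M`
  -- times the tail density.
  have hform : (∫ τ in t₁..t₂, ∫ p in nearSet x₀ R, Φ (τ, p)) -
      tailConst N s L * M * (∫ τ in t₁..t₂, tailDensity s x₀ R a b u τ) ≤
      ∫ τ in t₁..t₂, ∫ p, Φ (τ, p) := by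
    have hnear : MeasurableSet ((univ : Set ℝ) ×ˢ nearSet x₀ R) :=
      MeasurableSet.univ.prod (measurableSet_nearSet x₀ R)
    have hFn := hF.indicator hnear
    have hi1 : IntegrableOn (fun τ => ∫ p in nearSet x₀ R, Φ (τ, p)) (Ioc t₁ t₂) := by
      refine hFn.integral_prod_left.congr (Eventually.of_forall fun τ => ?_)
      simp only
      rw [← integral_indicator (measurableSet_nearSet x₀ R)]
      congr 1; ext p
      by_cases hp : p ∈ nearSet x₀ R
      · rw [indicator_of_mem (by exact ⟨mem_univ _, hp⟩), indicator_of_mem hp]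
      · rw [indicator_of_notMem (by exact fun h => hp h.2), indicator_of_notMem hp]
    have hi2 : IntegrableOn (fun τ => ∫ p, Φ (τ, p)) (Ioc t₁ t₂) := hF.integral_prod_left
    have hi3 : IntegrableOn (tailDensity s x₀ R a b u) (Ioc t₁ t₂) :=
      h.integrable_tailDensity.integrableOn
    have hTfin := ae_lt_top' h.measurable_weightedTail.aemeasurable h.tail
    rw [intervalIntegral.integral_of_le h12.le, intervalIntegral.integral_of_le h12.le,
      intervalIntegral.integral_of_le h12.le, ← integral_const_mul, ← integral_sub hi1
      (hi3.const_mul _)]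
    refine integral_mono_ae (hi1.sub (hi3.const_mul _)) hi2 ?_
    have hsub : Ioc t₁ t₂ ⊆ Ioo a b := fun t ht => ⟨ha.trans ht.1, ht.2.trans_lt hb⟩
    filter_upwards [hF.prod_right_ae, ae_restrict_of_ae_restrict_of_subset hsub hTfin,
      ae_restrict_mem measurableSet_Ioc] with τ hτ hTτ hmem
    have hlow := neg_le_setIntegral_form_far hN hs0 hq hR hL hw (h.measurable_slice τ)
      (fun x => h.nonneg x τ) (K := fun p => K p τ) (fun p => h.K_nonneg hL p τ)
      (fun p => h.upper p τ) hM hTτ.ne hτ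
    have hsplit := integral_add_compl (measurableSet_nearSet x₀ R) hτ
    have htd : tailDensity s x₀ R a b u τ = (weightedTail s x₀ R fun y => u y τ).toReal :=
      indicator_of_mem (hsub hmem) _
    rw [htd]
    change _ ≤ ∫ p, (u p.1 τ - u p.2 τ) * (v p.1 - v p.2) * K p τ
    rw [← hsplit]
    unfold tailConst
    change (∫ p in nearSet x₀ R, (u p.1 τ - u p.2 τ) * (v p.1 - v p.2) * K p τ) - _ ≤ _
    linarith
  have hMint : Integrable (fun x => v x * barrier s q x₀ R x ^ q) := by
    rw [← integrableOn_univ]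
    refine integrableOn_of_lintegral_ne_top (by fun_prop) (fun x => ?_) (by
      rw [Measure.restrict_univ]; exact hM)
    by_cases hx : x ∈ Metric.ball x₀ R
    · have := barrier_pos (s := s) (q := q) hR hx
      have := hv0 x
      positivity
    · have : v x = 0 := trunc_of_notMem hx
      rw [this, zero_mul]
  have hMval : ∫ x in Metric.ball x₀ R, v x * barrier s q x₀ R x ^ q = M := by
    rw [setIntegral_eq_integral_of_forall_compl_eq_zero
      (fun x hx => by rw [show v x = 0 from trunc_of_notMem hx, zero_mul]),
      integral_eq_lintegral_of_nonneg_ae (Eventually.of_forall fun x => ?_)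
        (by fun_prop : Measurable _).aestronglyMeasurable]
    · rfl
    · by_cases hx : x ∈ Metric.ball x₀ R
      · have := barrier_pos (s := s) (q := q) hR hx
        have := hv0 x
        simp only [Pi.zero_apply]; positivity
      · have : v x = 0 := trunc_of_notMem hx
        simp [this]
  have hent1 : IntegrableOn (fun x => entropy q (z x) (κ₁ * barrier s q x₀ R x))
      (Metric.ball x₀ R) := entropy_integrableOn hq hR hκ1 hz hz0 hfz
  have hent2 : IntegrableOn (fun x => entropy q (w x) (κ * barrier s q x₀ R x))
      (Metric.ball x₀ R) := entropy_integrableOn hq hR hκ hw hw0 hfw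
  have hT := h.tailMass_sub t₁ t₂
  set D : ℝ := ∫ τ in t₁..t₂, tailDensity s x₀ R a b u τ with hD
  have hdiff : κ ^ q - κ₁ ^ q = tailConst N s L * D := by
    rw [hκdef, hκ₁, level_rpow hq hL hk ha.le, level_rpow hq hL hk (ha.trans h12).le, ← hT]
    ring
  -- The discrete chain rule at the levels `κ₁ P` and `κ P`, integrated in space. The growth of the
  -- level enters as `(κ ^ q - κ₁ ^ q) ∫ v P ^ q = tailConst * D * M` by `hdiff`.
  have hpar : totalEntropy s q L x₀ R a b u k t₂ - totalEntropy s q L x₀ R a b u k t₁ +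
      tailConst N s L * D * M ≤
      ∫ x in Metric.ball x₀ R, (u x t₂ ^ q - u x t₁ ^ q) * v x := by
    have e0 : IntegrableOn (fun x => entropy q (w x) (κ * barrier s q x₀ R x) -
        entropy q (z x) (κ₁ * barrier s q x₀ R x)) (Metric.ball x₀ R) := hent2.sub hent1
    rw [← hMval, totalEntropy, totalEntropy, ← integral_sub hent2 hent1, ← integral_const_mul,
      ← integral_add e0 (hMint.integrableOn.const_mul _)]
    refine setIntegral_mono_on (e0.add (hMint.integrableOn.const_mul _)) ?_
      hball fun x hx => ?_
    · refine (((hIw.add hIz).add hIw).add hIw).mono' ?_ (Eventually.of_forall fun x => ?_)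
      · have : Measurable fun x => (w x ^ q - z x ^ q) * v x := by fun_prop
        exact this.aestronglyMeasurable
      · simp only [Pi.add_apply]
        change ‖(w x ^ q - z x ^ q) * v x‖ ≤ _
        rw [Real.norm_eq_abs, abs_mul, abs_of_nonneg (hv0 x)]
        have e1 : |w x ^ q - z x ^ q| ≤ w x ^ q + z x ^ q := by
          have := Real.rpow_nonneg (hw0 x) q
          have := Real.rpow_nonneg (hz0 x) q
          exact abs_le.2 ⟨by linarith, by linarith⟩
        have e2 := mul_rpow_le_add hq (hw0 x) (hw0 x)
        have e3 := mul_rpow_le_add hq (hw0 x) (hz0 x)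
        have e4 : |w x ^ q - z x ^ q| * v x ≤ (w x ^ q + z x ^ q) * w x :=
          mul_le_mul e1 (hvw x) (hv0 x) (le_trans (abs_nonneg _) e1)
        linarith
    · have hb0 := barrier_pos (s := s) (q := q) hR hx
      have e1 := entropy_sub_le (u₀ := z x) (u₁ := w x) (ℓ₀ := κ₁ * barrier s q x₀ R x)
        (ℓ₁ := κ * barrier s q x₀ R x) hq (hz0 x) (by positivity) (by gcongr)
      rw [Real.mul_rpow hκ.le hb0.le, Real.mul_rpow hκ1.le hb0.le, ← sub_mul, hdiff,
        ← trunc_of_mem (s := s) (q := q) (R := R) (κ := κ) (w := w) hx] at e1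
      change entropy q (w x) (κ * barrier s q x₀ R x) -
        entropy q (z x) (κ₁ * barrier s q x₀ R x) +
        tailConst N s L * D * (v x * barrier s q x₀ R x ^ q) ≤ (w x ^ q - z x ^ q) * v x
      calc _ = _ := by ring
        _ ≤ _ := e1
  -- The gain `tailConst * D * M` in `hpar` cancels the loss in `hform` exactly.
  change _ + (∫ τ in t₁..t₂, ∫ p in nearSet x₀ R, Φ (τ, p)) ≤ 0
  change _ + (∫ τ in t₁..t₂, ∫ p, Φ (τ, p)) ≤ 0 at hW
  linarith

end CylinderSubsolution

/-- The set where `u` exceeds the barrier at time `t`. -/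
def posAt {N : ℕ} (s q L : ℝ) (x₀ : RN N) (R a b : ℝ) (u : RN N → ℝ → ℝ) (k t : ℝ) : Set (RN N) :=
  posSet s q x₀ R (level s q L x₀ R a b u k t) fun x => u x t

/-- The near-range barrier error at time `t`. -/
def errorAt {N : ℕ} (s q L : ℝ) (x₀ : RN N) (R a b : ℝ) (u : RN N → ℝ → ℝ) (k t : ℝ) :
    RN N × RN N → ℝ :=
  barrierError s q x₀ R (level s q L x₀ R a b u k t) fun x => u x t

lemma setLIntegral_prod_set {α β : Type*} [MeasureSpace α] [MeasureSpace β]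
    [SFinite (volume : Measure α)] [SFinite (volume : Measure β)] {F : α × β → ℝ≥0∞}
    (hF : Measurable F) (I : Set α) (S : Set β) :
    ∫⁻ z in I ×ˢ S, F z = ∫⁻ x in I, ∫⁻ y in S, F (x, y) := by
  rw [Measure.volume_eq_prod, ← Measure.prod_restrict, lintegral_prod _ hF.aemeasurable]

lemma memLp_two_indicator_prod {α β : Type*} [MeasureSpace α] [MeasureSpace β]
    [SFinite (volume : Measure α)] [SFinite (volume : Measure β)] {F : α × β → ℝ}
    (hF : Measurable F) {I : Set α} {S : Set β} (hI : MeasurableSet I) (hS : MeasurableSet S)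
    (hfin : ∫⁻ x in I, ∫⁻ y in S, ENNReal.ofReal (F (x, y) ^ 2) ≠ ⊤) :
    MemLp ((I ×ˢ S).indicator F) 2 := by
  rw [memLp_two_iff_integrable_sq (hF.indicator (hI.prod hS)).aestronglyMeasurable]
  have h1 : IntegrableOn (fun z => F z ^ 2) (I ×ˢ S) :=
    integrableOn_of_lintegral_ne_top (hF.pow_const 2) (fun z => sq_nonneg _)
      (by rwa [setLIntegral_prod_set (hF.pow_const 2).ennreal_ofReal])
  refine (h1.integrable_indicator (hI.prod hS)).congr (Eventually.of_forall fun z => ?_)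
  by_cases hz : z ∈ I ×ˢ S
  · simp only [indicator_of_mem hz]
  · simp [indicator_of_notMem hz]

namespace CylinderSubsolution
variable {N : ℕ} {s q L : ℝ} {x₀ : RN N} {R a b : ℝ} {K : RN N × RN N → ℝ → ℝ}
  {u : RN N → ℝ → ℝ}

lemma measurable_truncAt (h : CylinderSubsolution s q L x₀ R a b K u) {α : Type*}
    [MeasurableSpace α] {k : ℝ} {f : α → RN N} {g : α → ℝ} (hf : Measurable f)
    (hg : Measurable g) : Measurable fun z => truncAt s q L x₀ R a b u k (g z) (f z) := by
  have h1 := h.measurable_comp hf hg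
  have h2 : Measurable fun z => level s q L x₀ R a b u k (g z) := (h.measurable_level k).comp hg
  have h3 : MeasurableSet {z | f z ∈ Metric.ball x₀ R} := hf Metric.isOpen_ball.measurableSet
  exact Measurable.indicator
    (f := fun z => max (u (f z) (g z) - level s q L x₀ R a b u k (g z) *
      barrier s q x₀ R (f z)) 0) ((h1.sub (h2.mul (by fun_prop))).max measurable_const) h3

lemma measurableSet_posAt (h : CylinderSubsolution s q L x₀ R a b K u) {α : Type*}
    [MeasurableSpace α] {k : ℝ} {f : α → RN N} {g : α → ℝ} (hf : Measurable f)
    (hg : Measurable g) : MeasurableSet {z | f z ∈ posAt s q L x₀ R a b u k (g z)} := by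
  have h1 := h.measurable_comp hf hg
  have h2 : Measurable fun z => level s q L x₀ R a b u k (g z) := (h.measurable_level k).comp hg
  have h3 : MeasurableSet {z | f z ∈ Metric.ball x₀ R} := hf Metric.isOpen_ball.measurableSet
  exact h3.inter (measurableSet_lt (f := fun z => level s q L x₀ R a b u k (g z) *
    barrier s q x₀ R (f z)) (by fun_prop) h1)

lemma measurableSet_posAt_slice (h : CylinderSubsolution s q L x₀ R a b K u) {k : ℝ} (t : ℝ) :
    MeasurableSet (posAt s q L x₀ R a b u k t) :=
  measurableSet_posSet (h.measurable_slice t)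

lemma measurable_errorAt (h : CylinderSubsolution s q L x₀ R a b K u) {k : ℝ} :
    Measurable fun z : ℝ × (RN N × RN N) => errorAt s q L x₀ R a b u k z.1 z.2 := by
  have h2 : Measurable fun z : ℝ × (RN N × RN N) => level s q L x₀ R a b u k z.1 :=
    (h.measurable_level k).comp measurable_fst
  have h3 := h.measurableSet_posAt (k := k) (f := fun z : ℝ × (RN N × RN N) => z.2.1)
    (g := fun z => z.1) (by fun_prop) (by fun_prop)
  have h4 := h.measurableSet_posAt (k := k) (f := fun z : ℝ × (RN N × RN N) => z.2.2)
    (g := fun z => z.1) (by fun_prop) (by fun_prop)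
  have h5 := Measurable.indicator
    (f := fun z : ℝ × (RN N × RN N) => (level s q L x₀ R a b u k z.1 * barrier s q x₀ R z.2.1 -
      level s q L x₀ R a b u k z.1 * barrier s q x₀ R z.2.2) ^ 2) (by fun_prop) (h3.union h4)
  convert h5 using 1
  ext z
  unfold errorAt barrierError
  by_cases hz : z ∈ {z : ℝ × (RN N × RN N) | z.2.1 ∈ posAt s q L x₀ R a b u k z.1} ∪
      {z : ℝ × (RN N × RN N) | z.2.2 ∈ posAt s q L x₀ R a b u k z.1}
  · rw [indicator_of_mem hz, indicator_of_mem]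
    rcases hz with hz | hz
    · exact Or.inl ⟨hz, mem_univ _⟩
    · exact Or.inr ⟨mem_univ _, hz⟩
  · rw [indicator_of_notMem hz, indicator_of_notMem]
    rintro (hz' | hz')
    · exact hz (Or.inl hz'.1)
    · exact hz (Or.inr hz'.2)

lemma measurable_posAt_mass (h : CylinderSubsolution s q L x₀ R a b K u) {k p : ℝ} :
    Measurable fun t => ∫⁻ x in posAt s q L x₀ R a b u k t, ENNReal.ofReal (u x t ^ p) := by
  have h1 : Measurable fun z : ℝ × RN N => u z.2 z.1 := h.measurable_comp (by fun_prop) (by fun_prop)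
  have h2 := h.measurableSet_posAt (k := k) (f := fun z : ℝ × RN N => z.2)
    (g := fun z => z.1) (by fun_prop) (by fun_prop)
  have h3 := Measurable.lintegral_prod_right' (ν := (volume : Measure (RN N)))
    ((h1.pow_const p).ennreal_ofReal.indicator h2)
  convert h3 using 2 with t
  rw [← lintegral_indicator (h.measurableSet_posAt_slice t)]
  rfl

lemma measurable_trunc_energy (h : CylinderSubsolution s q L x₀ R a b K u) {k : ℝ} :
    Measurable fun z : ℝ × (RN N × RN N) => (truncAt s q L x₀ R a b u k z.1 z.2.1 -
      truncAt s q L x₀ R a b u k z.1 z.2.2) ^ 2 * kern s z.2.1 z.2.2 := by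
  have h1 := h.measurable_truncAt (k := k) (f := fun z : ℝ × (RN N × RN N) => z.2.1)
    (g := fun z => z.1) (by fun_prop) (by fun_prop)
  have h2 := h.measurable_truncAt (k := k) (f := fun z : ℝ × (RN N × RN N) => z.2.2)
    (g := fun z => z.1) (by fun_prop) (by fun_prop)
  exact ((h1.sub h2).pow_const 2).mul (by fun_prop)

lemma posAt_mass_le_ball {k t p : ℝ} :
    ∫⁻ x in posAt s q L x₀ R a b u k t, ENNReal.ofReal (u x t ^ p) ≤
    ∫⁻ x in Metric.ball x₀ R, ENNReal.ofReal (u x t ^ p) :=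
  lintegral_mono_set fun _ hx => hx.1

lemma measurable_totalEntropy (h : CylinderSubsolution s q L x₀ R a b K u) {k : ℝ} :
    Measurable (totalEntropy s q L x₀ R a b u k) := by
  have h1 : Measurable fun z : ℝ × RN N => u z.2 z.1 := h.measurable_comp (by fun_prop) (by fun_prop)
  have h2 : Measurable fun z : ℝ × RN N => level s q L x₀ R a b u k z.1 :=
    (h.measurable_level k).comp measurable_fst
  have h3 : Measurable fun z : ℝ × RN N => entropy q (u z.2 z.1)
      (level s q L x₀ R a b u k z.1 * barrier s q x₀ R z.2) :=
    measurable_entropy.comp (h1.prodMk (h2.mul (by fun_prop)))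
  exact (h3.stronglyMeasurable.integral_prod_right'
    (ν := (volume : Measure (RN N)).restrict (Metric.ball x₀ R))).measurable

lemma totalEntropy_nonneg (hq : 1 < q) (hL : 0 < L) (hR : 0 < R) {k : ℝ} (hk : 0 < k) {t : ℝ}
    (ht : a ≤ t) : 0 ≤ totalEntropy s q L x₀ R a b u k t :=
  setIntegral_nonneg Metric.isOpen_ball.measurableSet fun _ hx =>
    entropy_nonneg hq (mul_pos (level_pos hq hL hk ht) (barrier_pos hR hx)).le

lemma totalEntropy_le (h : CylinderSubsolution s q L x₀ R a b K u) (hq : 1 < q) (hL : 0 < L)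
    (hR : 0 < R) {k : ℝ} (hk : 0 < k) {t : ℝ} (ht : a ≤ t) :
    ENNReal.ofReal (totalEntropy s q L x₀ R a b u k t) ≤
      ∫⁻ x in posAt s q L x₀ R a b u k t, ENNReal.ofReal (u x t ^ (q + 1)) := by
  refine (ENNReal.ofReal_le_ofReal (le_abs_self _)).trans ?_
  rw [← Real.norm_eq_abs, ofReal_norm]
  refine (enorm_integral_le_lintegral_enorm _).trans ?_
  rw [← lintegral_indicator Metric.isOpen_ball.measurableSet, ← lintegral_indicator
    (h.measurableSet_posAt_slice t)]
  refine lintegral_mono fun x => ?_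
  by_cases hx : x ∈ Metric.ball x₀ R
  · have hℓ := (mul_pos (level_pos (s := s) (x₀ := x₀) (R := R) (b := b) (u := u) hq hL hk ht)
      (barrier_pos (s := s) (q := q) hR hx)).le
    have he := entropy_le (u := u x t) hq hℓ
    rw [indicator_of_mem hx, ← ofReal_norm, Real.norm_eq_abs, abs_of_nonneg (entropy_nonneg hq hℓ)]
    by_cases hp : x ∈ posAt s q L x₀ R a b u k t
    · rw [indicator_of_mem (by exact hp)]
      rw [if_pos hp.2] at he
      exact ENNReal.ofReal_le_ofReal he
    · rw [if_neg fun h' => hp ⟨hx, h'⟩] at he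
      rw [ENNReal.ofReal_of_nonpos he]
      exact zero_le
  · rw [indicator_of_notMem hx]
    exact zero_le

lemma le_totalEntropy (h : CylinderSubsolution s q L x₀ R a b K u) (hq : 1 < q) (hL : 0 < L)
    (hR : 0 < R) {k : ℝ} (hk : 0 < k) {t : ℝ} (ht : a ≤ t)
    (hfin : ∫⁻ x in Metric.ball x₀ R, ENNReal.ofReal (u x t ^ (q + 1)) ≠ ⊤) :
    ∫⁻ x, ENNReal.ofReal (truncAt s q L x₀ R a b u k t x ^ (q + 1)) ≤
      ENNReal.ofReal ((q + 1) * totalEntropy s q L x₀ R a b u k t) := by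
  have hint := entropy_integrableOn (s := s) hq hR (level_pos (s := s) (x₀ := x₀) (R := R) (b := b)
    (u := u) hq hL hk ht) (h.measurable_slice t) (fun x => h.nonneg x t) hfin
  rw [totalEntropy, ← integral_const_mul, ofReal_integral_eq_lintegral_ofReal (hint.const_mul _)
    ((ae_restrict_iff' Metric.isOpen_ball.measurableSet).2 (Eventually.of_forall fun x hx =>
      mul_nonneg (by linarith) (entropy_nonneg hq (mul_pos (level_pos hq hL hk ht)
        (barrier_pos hR hx)).le))), ← lintegral_indicator Metric.isOpen_ball.measurableSet]
  refine lintegral_mono fun x => ?_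
  by_cases hx : x ∈ Metric.ball x₀ R
  · rw [indicator_of_mem hx, truncAt, trunc_of_mem hx]
    refine ENNReal.ofReal_le_ofReal ?_
    have := rpow_add_one_div_le_entropy (u := u x t) hq
      (mul_pos (level_pos (s := s) (x₀ := x₀) (R := R) (b := b) (u := u) hq hL hk ht)
      (barrier_pos (s := s) (q := q) hR hx)).le
    rw [div_le_iff₀ (by linarith)] at this
    linarith
  · rw [truncAt, trunc_of_notMem hx, Real.zero_rpow (by linarith)]
    simp

/-- The inequality of `exists_window` compares two times with a test function frozen at the later
one. Applied to `t - h` and `t` for almost every `t`, it passes to the limit `h → 0`; the form is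
then paired with the truncation at the same time, where near-range coercivity applies. -/
lemma exists_energy_window (h : CylinderSubsolution s q L x₀ R a b K u) (hN : 2 ≤ N) (hs0 : 0 < s)
    (hs1 : s < 1) (hq : 1 < q) (hL : 0 < L) (hR : 0 < R) {k : ℝ} (hk : 0 < k) :
    ∃ G : Set ℝ, (∀ᵐ t ∂(volume.restrict (Ioo a b)), t ∈ G) ∧
      ∀ t₁ ∈ G, ∀ t₂ ∈ G, a < t₁ → t₁ < t₂ → t₂ < b →
      ENNReal.ofReal (totalEntropy s q L x₀ R a b u k t₂) +
        ENNReal.ofReal (1 / (2 * L)) * (∫⁻ τ in Ioo t₁ t₂, ∫⁻ p in nearSet x₀ R,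
          ENNReal.ofReal ((truncAt s q L x₀ R a b u k τ p.1 -
            truncAt s q L x₀ R a b u k τ p.2) ^ 2 * kern s p.1 p.2)) ≤
      ENNReal.ofReal (totalEntropy s q L x₀ R a b u k t₁) +
        ENNReal.ofReal (L / 2) * ∫⁻ τ in Ioo t₁ t₂, ∫⁻ p in nearSet x₀ R,
          ENNReal.ofReal (errorAt s q L x₀ R a b u k τ p * kern s p.1 p.2) := by
  obtain ⟨G, hG, hwin⟩ := h.exists_window hN hs0 hs1 hq hL hR hk
  obtain ⟨Cs, hCs, hsup⟩ := h.sup_bound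
  obtain ⟨Cn, hCn, hnear⟩ := exists_lintegral_near_energy_le hN hs0 hs1 hq
  obtain ⟨Ce, hCe, herr⟩ := exists_lintegral_barrierError_le hN hs0 hs1 hq
  set X : ℝ → ℝ := (Ioo a b).indicator (totalEntropy s q L x₀ R a b u k) with hXdef
  have hX : Integrable X := by
    refine IntegrableOn.integrable_indicator ?_ measurableSet_Ioo
    refine Integrable.mono' (g := fun _ => Cs.toReal) (by simp)
      h.measurable_totalEntropy.aestronglyMeasurable ?_
    filter_upwards [hsup, ae_restrict_mem measurableSet_Ioo] with t ht hmem
    have h0 := totalEntropy_nonneg (s := s) (x₀ := x₀) (b := b) (u := u) hq hL hR hk hmem.1.le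
    rw [Real.norm_eq_abs, abs_of_nonneg h0]
    rw [← ENNReal.ofReal_le_iff_le_toReal hCs]
    exact (h.totalEntropy_le hq hL hR hk hmem.1.le).trans (posAt_mass_le_ball.trans ht)
  -- The end times must be Lebesgue points of the entropy, since the entropy need not be continuous
  -- in time.
  have hder := _root_.LocallyIntegrable.ae_hasDerivAt_integral hX.locallyIntegrable
  refine ⟨{t | ∀ c, HasDerivAt (fun x => ∫ τ in c..x, X τ) (X t) t},
    ae_restrict_of_ae hder, fun t₁ hd₁ t₂ hd₂ ha h12 hb => ?_⟩
  have hsub : Ioo t₁ t₂ ⊆ Ioo a b := Ioo_subset_Ioo ha.le hb.le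
  have hns := measurableSet_nearSet x₀ R
  have hlev : ∀ τ, a ≤ τ → ∀ C : ℝ, 0 < C →
      ENNReal.ofReal (C * R ^ (-(2 * s)) * level s q L x₀ R a b u k τ ^ (1 - q)) ≤
      ENNReal.ofReal (C * R ^ (-(2 * s)) * k ^ (1 - q)) := by
    intro τ hτ C hC
    refine ENNReal.ofReal_le_ofReal (mul_le_mul_of_nonneg_left ?_ (by positivity))
    exact Real.rpow_le_rpow_of_nonpos hk (le_level hq hL hk hτ) (by linarith)
  have hu1 : Measurable fun z : ℝ × (RN N × RN N) => u z.2.1 z.1 :=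
    h.measurable_comp (by fun_prop) (by fun_prop)
  have hu2 : Measurable fun z : ℝ × (RN N × RN N) => u z.2.2 z.1 :=
    h.measurable_comp (by fun_prop) (by fun_prop)
  have hK : Measurable fun z : ℝ × (RN N × RN N) => K z.2 z.1 :=
    h.measurable_K_comp (by fun_prop) (by fun_prop)
  have hv1 := h.measurable_truncAt (k := k) (f := fun z : ℝ × (RN N × RN N) => z.2.1)
    (g := fun z => z.1) (by fun_prop) (by fun_prop)
  have hv2 := h.measurable_truncAt (k := k) (f := fun z : ℝ × (RN N × RN N) => z.2.2)
    (g := fun z => z.1) (by fun_prop) (by fun_prop)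
  have hkern : Measurable fun z : ℝ × (RN N × RN N) => kern s z.2.1 z.2.2 := by fun_prop
  -- The kernel is split as `K / √kern` and `√kern`, so that both factors of the form are square
  -- integrable on near pairs in space-time.
  set F : ℝ × (RN N × RN N) → ℝ := fun z =>
    (u z.2.1 z.1 - u z.2.2 z.1) * K z.2 z.1 / √(kern s z.2.1 z.2.2) with hF
  set V : ℝ × (RN N × RN N) → ℝ := fun z => (truncAt s q L x₀ R a b u k z.1 z.2.1 -
    truncAt s q L x₀ R a b u k z.1 z.2.2) * √(kern s z.2.1 z.2.2) with hV
  have hFm : Measurable F := ((hu1.sub hu2).mul hK).div hkern.sqrt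
  have hVm : Measurable V := (hv1.sub hv2).mul hkern.sqrt
  have hEnear : ∫⁻ τ in Ioo a b, ∫⁻ p in nearSet x₀ R,
      ENNReal.ofReal ((u p.1 τ - u p.2 τ) ^ 2 * kern s p.1 p.2) ≠ ⊤ :=
    ne_top_of_le_ne_top h.energy (lintegral_mono fun τ => lintegral_mono_set fun p hp =>
      ⟨left_mem_ball_of_mem_nearSet hR hp, right_mem_ball_of_mem_nearSet hR hp⟩)
  have hf : MemLp ((Ioo a b ×ˢ nearSet x₀ R).indicator F) 2 := by
    refine memLp_two_indicator_prod hFm measurableSet_Ioo hns ?_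
    refine ne_top_of_le_ne_top (ENNReal.mul_ne_top (ENNReal.ofReal_ne_top (r := L ^ 2)) hEnear) ?_
    rw [← lintegral_const_mul' _ _ ENNReal.ofReal_ne_top]
    refine lintegral_mono fun τ => ?_
    simp only
    rw [← lintegral_const_mul' _ _ ENNReal.ofReal_ne_top]
    refine lintegral_mono fun p => ?_
    rw [← ENNReal.ofReal_mul (by positivity)]
    refine ENNReal.ofReal_le_ofReal ?_
    have hk0 := kern_nonneg (s := s) p.1 p.2
    have hK0 := h.K_nonneg hL p τ
    have hKu := h.upper p τ
    rw [hF]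
    simp only
    rw [div_pow, mul_pow, Real.sq_sqrt hk0]
    rcases hk0.eq_or_lt with h0 | h0
    · rw [← h0]; simp
    · rw [div_le_iff₀ h0]
      have : K p τ ^ 2 ≤ (L * kern s p.1 p.2) ^ 2 := by gcongr
      calc _ ≤ (u p.1 τ - u p.2 τ) ^ 2 * (L * kern s p.1 p.2) ^ 2 := by gcongr
        _ = _ := by ring
  have hEv : ∫⁻ τ in Ioo t₁ t₂, ∫⁻ p in nearSet x₀ R,
      ENNReal.ofReal ((truncAt s q L x₀ R a b u k τ p.1 -
        truncAt s q L x₀ R a b u k τ p.2) ^ 2 * kern s p.1 p.2) ≠ ⊤ := by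
    have hb1 : ∫⁻ τ in Ioo t₁ t₂, (2 * (∫⁻ p in Metric.ball x₀ R ×ˢ Metric.ball x₀ R,
        ENNReal.ofReal ((u p.1 τ - u p.2 τ) ^ 2 * kern s p.1 p.2)) +
        ENNReal.ofReal (Cn * R ^ (-(2 * s)) * k ^ (1 - q)) * Cs) ≠ ⊤ := by
      rw [lintegral_add_right _ measurable_const, lintegral_const,
        lintegral_const_mul' _ _ (by simp)]
      refine ENNReal.add_ne_top.2 ⟨ENNReal.mul_ne_top (by simp)
        (ne_top_of_le_ne_top h.energy (lintegral_mono_set hsub)), ENNReal.mul_ne_top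
        (ENNReal.mul_ne_top ENNReal.ofReal_ne_top hCs) (by simp)⟩
    refine ne_top_of_le_ne_top hb1 (lintegral_mono_ae ?_)
    filter_upwards [ae_restrict_of_ae_restrict_of_subset hsub hsup,
      ae_restrict_mem measurableSet_Ioo] with τ hτ hmem
    refine (hnear x₀ R _ hR (level_pos hq hL hk (ha.trans hmem.1).le) _
      (h.measurable_slice τ)).trans ?_
    exact add_le_add le_rfl (mul_le_mul' (hlev τ (ha.trans hmem.1).le Cn hCn)
      (posAt_mass_le_ball.trans hτ))
  have hEe : ∫⁻ τ in Ioo t₁ t₂, ∫⁻ p in nearSet x₀ R,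
      ENNReal.ofReal (errorAt s q L x₀ R a b u k τ p * kern s p.1 p.2) ≠ ⊤ := by
    have hb1 : ∫⁻ τ in Ioo t₁ t₂,
        (ENNReal.ofReal (Ce * R ^ (-(2 * s)) * k ^ (1 - q)) * Cs) ≠ ⊤ := by
      rw [lintegral_const]
      exact ENNReal.mul_ne_top (ENNReal.mul_ne_top ENNReal.ofReal_ne_top hCs) (by simp)
    refine ne_top_of_le_ne_top hb1 (lintegral_mono_ae ?_)
    filter_upwards [ae_restrict_of_ae_restrict_of_subset hsub hsup,
      ae_restrict_mem measurableSet_Ioo] with τ hτ hmem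
    refine (herr x₀ R _ hR (level_pos hq hL hk (ha.trans hmem.1).le) _
      (h.measurable_slice τ)).trans ?_
    exact mul_le_mul' (hlev τ (ha.trans hmem.1).le Ce hCe) (posAt_mass_le_ball.trans hτ)
  have hVsq : ∀ τ p, V (τ, p) ^ 2 = (truncAt s q L x₀ R a b u k τ p.1 -
        truncAt s q L x₀ R a b u k τ p.2) ^ 2 * kern s p.1 p.2 := fun τ p => by
    rw [hV]
    simp only
    rw [mul_pow, Real.sq_sqrt (kern_nonneg _ _)]
  have hg : MemLp ((Ioo t₁ t₂ ×ˢ nearSet x₀ R).indicator V) 2 := by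
    refine memLp_two_indicator_prod hVm measurableSet_Ioo hns ?_
    simp only [hVsq]
    exact hEv
  have hFV : ∀ τ t p, F (τ, p) * V (t, p) = (u p.1 τ - u p.2 τ) *
      (truncAt s q L x₀ R a b u k t p.1 - truncAt s q L x₀ R a b u k t p.2) * K p τ := by
    intro τ t p
    rw [hF, hV]
    simp only
    have hk0 := kern_nonneg (s := s) p.1 p.2
    -- Where `kern` vanishes, as it does on the diagonal through division by zero, `K` vanishes too
    -- because it lies between multiples of `kern`.
    rcases hk0.eq_or_lt with h0 | h0
    · have hK0 := h.K_nonneg hL p τ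
      have hKu := h.upper p τ
      rw [← h0] at hKu ⊢
      have : K p τ = 0 := by linarith
      rw [this]; simp
    · have : √(kern s p.1 p.2) ≠ 0 := (Real.sqrt_pos.2 h0).ne'
      field_simp
  have hmain := sub_add_integral_le_of_window hf hg (hFm.indicator (measurableSet_Ioo.prod hns))
    (hVm.indicator (measurableSet_Ioo.prod hns)) hX ha h12
    (fun t p ht => indicator_of_notMem (fun hmem => ht hmem.1) _) ?_ (hd₁ a) (hd₂ a)
  swap
  · intro θ hθ0 hθ
    rw [ae_restrict_iff' measurableSet_Ioo] at hG
    -- For fixed shift `θ`, almost every `t` is a good time together with `t - θ`, because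
    -- translations preserve null sets.
    filter_upwards [hG, (measurePreserving_sub_right volume θ).quasiMeasurePreserving.ae hG]
      with t ht1 ht2 hmem
    have m1 : t ∈ Ioo a b := hsub hmem
    have m2 : t - θ ∈ Ioo a b := ⟨by linarith [hmem.1], by linarith [m1.2]⟩
    have := hwin (t - θ) (ht2 m2) t (ht1 m1) m2.1 (by linarith) m1.2
    rw [hXdef, indicator_of_mem m1, indicator_of_mem m2]
    convert this using 2
    refine intervalIntegral.integral_congr fun τ hτ => ?_
    rw [uIcc_of_le (by linarith)] at hτ
    rw [← integral_indicator hns]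
    congr 1; ext p
    have mτ : τ ∈ Ioo a b := ⟨m2.1.trans_le hτ.1, hτ.2.trans_lt m1.2⟩
    by_cases hp : p ∈ nearSet x₀ R
    · rw [indicator_of_mem (show (τ, p) ∈ Ioo a b ×ˢ nearSet x₀ R from ⟨mτ, hp⟩),
        indicator_of_mem (show (t, p) ∈ Ioo t₁ t₂ ×ˢ nearSet x₀ R from ⟨hmem, hp⟩),
        indicator_of_mem hp, hFV]
    · rw [indicator_of_notMem hp, indicator_of_notMem (fun hmem => hp hmem.2), zero_mul]
  set S := Ioo t₁ t₂ ×ˢ nearSet x₀ R with hS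
  have hSm : MeasurableSet S := measurableSet_Ioo.prod hns
  set A : ℝ × (RN N × RN N) → ℝ := fun z => 1 / (2 * L) * V z ^ 2 with hA
  set E : ℝ × (RN N × RN N) → ℝ := fun z =>
    L / 2 * (errorAt s q L x₀ R a b u k z.1 z.2 * kern s z.2.1 z.2.2) with hE
  have hAm : Measurable A := (hVm.pow_const 2).const_mul _
  have hEm : Measurable E := (h.measurable_errorAt.mul hkern).const_mul _
  have hA0 : ∀ z, 0 ≤ A z := fun z => by rw [hA]; positivity
  have hE0 : ∀ z, 0 ≤ E z := fun z => by
    have h1 : 0 ≤ errorAt s q L x₀ R a b u k z.1 z.2 := barrierError_nonneg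
    have h2 := kern_nonneg (s := s) z.2.1 z.2.2
    rw [hE]; positivity
  have hAl : ∫⁻ z in S, ENNReal.ofReal (A z) = ENNReal.ofReal (1 / (2 * L)) *
      ∫⁻ τ in Ioo t₁ t₂, ∫⁻ p in nearSet x₀ R,
        ENNReal.ofReal ((truncAt s q L x₀ R a b u k τ p.1 -
          truncAt s q L x₀ R a b u k τ p.2) ^ 2 * kern s p.1 p.2) := by
    simp only [hA, ENNReal.ofReal_mul (show 0 ≤ 1 / (2 * L) by positivity)]
    rw [lintegral_const_mul' _ _ ENNReal.ofReal_ne_top,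
      setLIntegral_prod_set (hVm.pow_const 2).ennreal_ofReal]
    simp only [hVsq]
  have hEl : ∫⁻ z in S, ENNReal.ofReal (E z) = ENNReal.ofReal (L / 2) *
      ∫⁻ τ in Ioo t₁ t₂, ∫⁻ p in nearSet x₀ R,
        ENNReal.ofReal (errorAt s q L x₀ R a b u k τ p * kern s p.1 p.2) := by
    simp only [hE, ENNReal.ofReal_mul (show 0 ≤ L / 2 by positivity)]
    have hm : Measurable fun z : ℝ × (RN N × RN N) => ENNReal.ofReal
        (errorAt s q L x₀ R a b u k z.1 z.2 * kern s z.2.1 z.2.2) :=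
      (h.measurable_errorAt.mul hkern).ennreal_ofReal
    rw [lintegral_const_mul' _ _ ENNReal.ofReal_ne_top, setLIntegral_prod_set hm]
  have hAi : IntegrableOn A S := integrableOn_of_lintegral_ne_top hAm hA0
    (by rw [hAl]; exact ENNReal.mul_ne_top ENNReal.ofReal_ne_top hEv)
  have hEi : IntegrableOn E S := integrableOn_of_lintegral_ne_top hEm hE0
    (by rw [hEl]; exact ENNReal.mul_ne_top ENNReal.ofReal_ne_top hEe)
  -- Pointwise coercivity: `L⁻¹ kern ≤ K` is used for the energy and `K ≤ L kern` for the barrier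
  -- error.
  have hcomp : ∫ z in S, A z ≤ (∫ z, (Ioo a b ×ˢ nearSet x₀ R).indicator F z *
      S.indicator V z) + ∫ z in S, E z := by
    have hfg : Integrable fun z => (Ioo a b ×ˢ nearSet x₀ R).indicator F z * S.indicator V z :=
      MemLp.integrable_mul hf hg
    rw [← integral_indicator hSm, ← integral_indicator hSm, ← integral_add hfg
      (hEi.integrable_indicator hSm)]
    refine integral_mono (hAi.integrable_indicator hSm)
      (hfg.add (hEi.integrable_indicator hSm)) ?_
    rintro ⟨τ, p⟩
    simp only
    by_cases hz : (τ, p) ∈ S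
    · have hz' : (τ, p) ∈ Ioo a b ×ˢ nearSet x₀ R := ⟨hsub hz.1, hz.2⟩
      rw [indicator_of_mem hz, indicator_of_mem hz, indicator_of_mem hz', indicator_of_mem hz, hFV,
        hA, hE]
      simp only [hVsq]
      have e1 := increment_mul_trunc_near_ge (s := s) (q := q)
        (κ := level s q L x₀ R a b u k τ) (w := fun x => u x τ) hR hz.2
      have e2 := h.lower p τ
      have e3 := h.upper p τ
      have e4 := h.K_nonneg hL p τ
      have e5 : 0 ≤ errorAt s q L x₀ R a b u k τ p := barrierError_nonneg
      have e6 := mul_le_mul_of_nonneg_right e1 e4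
      change ((truncAt s q L x₀ R a b u k τ p.1 - truncAt s q L x₀ R a b u k τ p.2) ^ 2 / 2 -
        errorAt s q L x₀ R a b u k τ p / 2) * K p τ ≤ (u p.1 τ - u p.2 τ) *
        (truncAt s q L x₀ R a b u k τ p.1 - truncAt s q L x₀ R a b u k τ p.2) * K p τ at e6
      have e7 := mul_le_mul_of_nonneg_left e2 (sq_nonneg
        (truncAt s q L x₀ R a b u k τ p.1 - truncAt s q L x₀ R a b u k τ p.2))
      have e8 := mul_le_mul_of_nonneg_left e3 e5
      have e9 : 1 / (2 * L) = L⁻¹ / 2 := by field_simp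
      rw [e9]
      linarith
    · rw [indicator_of_notMem hz, indicator_of_notMem hz, indicator_of_notMem hz]
      simp
  rw [hXdef, indicator_of_mem (show t₁ ∈ Ioo a b from ⟨ha, h12.trans hb⟩),
    indicator_of_mem (show t₂ ∈ Ioo a b from ⟨ha.trans h12, hb⟩)] at hmain
  rw [← hAl, ← hEl, ← ofReal_integral_eq_lintegral_ofReal hAi (Eventually.of_forall hA0),
    ← ofReal_integral_eq_lintegral_ofReal hEi (Eventually.of_forall hE0),
    ← ENNReal.ofReal_add (totalEntropy_nonneg hq hL hR hk (ha.trans h12).le)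
      (integral_nonneg hA0), ← ENNReal.ofReal_add (totalEntropy_nonneg hq hL hR hk ha.le)
      (integral_nonneg hE0)]
  refine ENNReal.ofReal_le_ofReal ?_
  linarith

end CylinderSubsolution

/-- The energy inequality above the growing barrier. -/
lemma exists_energy_le {N : ℕ} (hN : 2 ≤ N) {s q L : ℝ} (hs0 : 0 < s) (hs1 : s < 1) (hq : 1 < q)
    (hL : 0 < L) : ∃ C : ℝ, 0 < C ∧ ∀ (x₀ : RN N) (R a b : ℝ) (K : RN N × RN N → ℝ → ℝ)
      (u : RN N → ℝ → ℝ), CylinderSubsolution s q L x₀ R a b K u → 0 < R → ∀ k : ℝ, 0 < k →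
    ∃ G : Set ℝ, (∀ᵐ t ∂(volume.restrict (Ioo a b)), t ∈ G) ∧
      ∀ t₁ ∈ G, ∀ t₂ ∈ G, a < t₁ → t₁ < t₂ → t₂ < b →
      (∫⁻ x, ENNReal.ofReal (truncAt s q L x₀ R a b u k t₂ x ^ (q + 1))) +
        (∫⁻ τ in Ioo t₁ t₂, ∫⁻ p : RN N × RN N, ENNReal.ofReal ((truncAt s q L x₀ R a b u k τ p.1 -
            truncAt s q L x₀ R a b u k τ p.2) ^ 2 * kern s p.1 p.2)) ≤
      ENNReal.ofReal C * ((∫⁻ x in posAt s q L x₀ R a b u k t₁, ENNReal.ofReal (u x t₁ ^ (q + 1))) +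
        ENNReal.ofReal (R ^ (-(2 * s)) * k ^ (1 - q)) * ∫⁻ τ in Ioo t₁ t₂,
          ∫⁻ x in posAt s q L x₀ R a b u k τ, ENNReal.ofReal (u x τ ^ (q + 1))) := by
  obtain ⟨Ce, hCe, herr⟩ := exists_lintegral_barrierError_le hN hs0 hs1 hq
  obtain ⟨Cf, hCf, hfar⟩ := exists_lintegral_far_energy_le hN hs0 hq
  -- `q + 1` passes from the entropy to the `L^(q+1)` mass, `2 * L` removes the factor in front of
  -- the near energy, `L / 2 * Ce` is the barrier error and `Cf` the far energy.
  refine ⟨(q + 1 + 2 * L) * (1 + L / 2 * Ce) + Cf, by positivity,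
    fun x₀ R a b K u h hR k hk => ?_⟩
  obtain ⟨G, hG, hen⟩ := h.exists_energy_window hN hs0 hs1 hq hL hR hk
  obtain ⟨Cs, hCs, hsup⟩ := h.sup_bound
  refine ⟨{t | t ∈ G ∧ ∫⁻ x in Metric.ball x₀ R, ENNReal.ofReal (u x t ^ (q + 1)) ≤ Cs}, ?_, ?_⟩
  · filter_upwards [hG, hsup] with t h1 h2 using ⟨h1, h2⟩
  rintro t₁ ⟨hG1, -⟩ t₂ ⟨hG2, hS2⟩ ha h12 hb
  have hE := hen t₁ hG1 t₂ hG2 ha h12 hb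
  have hlev : ∀ τ, a ≤ τ → ∀ C : ℝ, 0 < C →
      ENNReal.ofReal (C * R ^ (-(2 * s)) * level s q L x₀ R a b u k τ ^ (1 - q)) ≤
      ENNReal.ofReal C * ENNReal.ofReal (R ^ (-(2 * s)) * k ^ (1 - q)) := by
    intro τ hτ C hC
    rw [← ENNReal.ofReal_mul hC.le, ← mul_assoc]
    refine ENNReal.ofReal_le_ofReal (mul_le_mul_of_nonneg_left ?_ (by positivity))
    exact Real.rpow_le_rpow_of_nonpos hk
      (CylinderSubsolution.le_level hq hL hk hτ) (by linarith)
  have ht1 := h.totalEntropy_le hq hL hR hk ha.le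
  have ht2 := h.le_totalEntropy hq hL hR hk (ha.trans h12).le (ne_top_of_le_ne_top hCs hS2)
  set c := ENNReal.ofReal (R ^ (-(2 * s)) * k ^ (1 - q)) with hc
  set X2 := ENNReal.ofReal (totalEntropy s q L x₀ R a b u k t₂)
  set M1 := ∫⁻ x in posAt s q L x₀ R a b u k t₁, ENNReal.ofReal (u x t₁ ^ (q + 1))
  set J := ∫⁻ τ in Ioo t₁ t₂, ∫⁻ x in posAt s q L x₀ R a b u k τ, ENNReal.ofReal (u x τ ^ (q + 1))
    with hJ
  have hns := measurableSet_nearSet x₀ R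
  have herrl : ∫⁻ τ in Ioo t₁ t₂, ∫⁻ p in nearSet x₀ R,
      ENNReal.ofReal (errorAt s q L x₀ R a b u k τ p * kern s p.1 p.2) ≤
      ENNReal.ofReal Ce * c * J := by
    rw [hJ, ← lintegral_const_mul _ h.measurable_posAt_mass]
    refine setLIntegral_mono' measurableSet_Ioo fun τ hτ => ?_
    exact (herr x₀ R _ hR (CylinderSubsolution.level_pos hq hL hk (ha.trans hτ.1).le) _
      (h.measurable_slice τ)).trans (mul_le_mul_left (hlev τ (ha.trans hτ.1).le Ce hCe) _)
  have hfarl : ∫⁻ τ in Ioo t₁ t₂, ∫⁻ p in (nearSet x₀ R)ᶜ, ENNReal.ofReal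
      ((truncAt s q L x₀ R a b u k τ p.1 - truncAt s q L x₀ R a b u k τ p.2) ^ 2 *
        kern s p.1 p.2) ≤ ENNReal.ofReal Cf * c * J := by
    rw [hJ, ← lintegral_const_mul _ h.measurable_posAt_mass]
    refine setLIntegral_mono' measurableSet_Ioo fun τ hτ => ?_
    exact (hfar x₀ R _ hR (CylinderSubsolution.level_pos hq hL hk (ha.trans hτ.1).le) _
      (h.measurable_slice τ)).trans (mul_le_mul_left (hlev τ (ha.trans hτ.1).le Cf hCf) _)
  set Fa := ∫⁻ τ in Ioo t₁ t₂, ∫⁻ p in (nearSet x₀ R)ᶜ, ENNReal.ofReal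
      ((truncAt s q L x₀ R a b u k τ p.1 - truncAt s q L x₀ R a b u k τ p.2) ^ 2 *
        kern s p.1 p.2) with hFa
  set Ne := ∫⁻ τ in Ioo t₁ t₂, ∫⁻ p in nearSet x₀ R, ENNReal.ofReal
      ((truncAt s q L x₀ R a b u k τ p.1 - truncAt s q L x₀ R a b u k τ p.2) ^ 2 *
        kern s p.1 p.2) with hNe
  have hsplit : (∫⁻ τ in Ioo t₁ t₂, ∫⁻ p : RN N × RN N, ENNReal.ofReal
      ((truncAt s q L x₀ R a b u k τ p.1 - truncAt s q L x₀ R a b u k τ p.2) ^ 2 *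
        kern s p.1 p.2)) = Ne + Fa := by
    rw [hNe, hFa, ← lintegral_add_left]
    · refine lintegral_congr fun τ => ?_
      rw [lintegral_add_compl _ hns]
    · exact Measurable.lintegral_prod_right' (ν := volume.restrict (nearSet x₀ R))
        (h.measurable_trunc_energy (k := k)).ennreal_ofReal
  have hNe' : Ne = ENNReal.ofReal (2 * L) * (ENNReal.ofReal (1 / (2 * L)) * Ne) := by
    rw [← mul_assoc, ← ENNReal.ofReal_mul (by positivity), mul_one_div_cancel (by positivity)]
    simp
  have hE' : X2 + ENNReal.ofReal (1 / (2 * L)) * Ne ≤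
      M1 + ENNReal.ofReal (L / 2) * (ENNReal.ofReal Ce * c * J) :=
    hE.trans (add_le_add ht1 (mul_le_mul_right herrl _))
  rw [hsplit]
  rw [ENNReal.ofReal_mul (by linarith)] at ht2
  calc _ ≤ ENNReal.ofReal (q + 1) * X2 + (ENNReal.ofReal (2 * L) *
          (ENNReal.ofReal (1 / (2 * L)) * Ne) + ENNReal.ofReal Cf * c * J) := by
        rw [← hNe']; gcongr
    _ ≤ ENNReal.ofReal (q + 1) * (X2 + ENNReal.ofReal (1 / (2 * L)) * Ne) + (ENNReal.ofReal (2 * L) *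
          (X2 + ENNReal.ofReal (1 / (2 * L)) * Ne) + ENNReal.ofReal Cf * c * J) := by
        gcongr
        · exact le_self_add
        · exact le_add_self
    _ ≤ ENNReal.ofReal (q + 1) * (M1 + ENNReal.ofReal (L / 2) * (ENNReal.ofReal Ce * c * J)) +
          (ENNReal.ofReal (2 * L) * (M1 + ENNReal.ofReal (L / 2) * (ENNReal.ofReal Ce * c * J)) +
          ENNReal.ofReal Cf * c * J) := by gcongr
    _ = ENNReal.ofReal ((q + 1 + 2 * L)) * M1 +
        ENNReal.ofReal ((q + 1 + 2 * L) * (L / 2 * Ce) + Cf) * (c * J) := by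
        rw [ENNReal.ofReal_add (p := (q + 1 + 2 * L) * (L / 2 * Ce)) (by positivity) hCf.le,
          ENNReal.ofReal_mul (p := q + 1 + 2 * L) (by positivity),
          ENNReal.ofReal_mul (p := L / 2) (by positivity),
          ENNReal.ofReal_add (p := q + 1) (by positivity) (by positivity)]
        ring
    _ ≤ _ := by
        rw [mul_add]
        have e1 : 0 < (q + 1 + 2 * L) * (L / 2 * Ce) := by positivity
        have e2 : 0 < q + 1 + 2 * L := by positivity
        exact add_le_add (mul_le_mul_left (ENNReal.ofReal_le_ofReal (by linarith)) _)
          (mul_le_mul_left (ENNReal.ofReal_le_ofReal (by linarith)) _)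

/-! ### De Giorgi iteration. -/

/-- Fast geometric convergence. -/
lemma le_of_superlinear_recursion {Z : ℕ → ℝ≥0∞} {D B α z₀ : ℝ} (hD : 0 < D) (hB : 0 < B)
    (hα : 0 < α) (hz₀ : 0 < z₀) (h0 : Z 0 ≤ ENNReal.ofReal z₀)
    (hstep : ∀ j : ℕ, ∀ z : ℝ, 0 < z → Z j ≤ ENNReal.ofReal z →
      Z (j + 1) ≤ ENNReal.ofReal (D * B ^ j * z ^ (1 + α)))
    (hsmall : D * z₀ ^ α * B ^ (1 / α) ≤ 1) (j : ℕ) :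
    Z j ≤ ENNReal.ofReal (z₀ * (B ^ (-(1 / α))) ^ j) := by
  induction j with
  | zero => simpa using h0
  | succ j ih =>
    refine (hstep j _ (by positivity) ih).trans (ENNReal.ofReal_le_ofReal ?_)
    -- The geometric rate `B ^ (-1 / α)` is the one whose `α`-th power compensates the growth `B ^
    -- j` of the recursion.
    have e1 : (z₀ * (B ^ (-(1 / α))) ^ j) ^ (1 + α) =
        z₀ * z₀ ^ α * ((B ^ (-(1 / α))) ^ j * (B ^ j)⁻¹) := by
      rw [Real.mul_rpow hz₀.le (by positivity), Real.rpow_add hz₀, Real.rpow_one,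
        Real.rpow_add (by positivity), Real.rpow_one]
      congr 2
      rw [← Real.rpow_natCast, ← Real.rpow_mul hB.le, ← Real.rpow_mul hB.le, ← Real.rpow_natCast,
        ← Real.rpow_neg hB.le]
      congr 1
      field_simp
    have e2 : B ^ (1 / α) * B ^ (-(1 / α)) = 1 := by
      rw [← Real.rpow_add hB, add_neg_cancel, Real.rpow_zero]
    have hBj : B ^ j ≠ 0 := by positivity
    have hb : 0 < B ^ (-(1 / α)) := by positivity
    rw [e1]
    calc D * B ^ j * (z₀ * z₀ ^ α * ((B ^ (-(1 / α))) ^ j * (B ^ j)⁻¹))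
        = D * z₀ ^ α * (B ^ (1 / α) * B ^ (-(1 / α))) * (z₀ * (B ^ (-(1 / α))) ^ j) := by
          rw [e2]; field_simp
      _ = (D * z₀ ^ α * B ^ (1 / α)) * (z₀ * (B ^ (-(1 / α))) ^ (j + 1)) := by ring
      _ ≤ 1 * (z₀ * (B ^ (-(1 / α))) ^ (j + 1)) := by gcongr
      _ = _ := one_mul _

/-- Monotone convergence. The energy inequality holds only for end times strictly before `b`. -/
lemma setLIntegral_Ioo_le_of_forall_lt {f : ℝ → ℝ≥0∞} {a b : ℝ} {E : ℝ≥0∞}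
    (h : ∀ c, a < c → c < b → ∫⁻ t in Ioo a c, f t ≤ E) : ∫⁻ t in Ioo a b, f t ≤ E := by
  rcases le_or_gt b a with hab | hab
  · simp [Ioo_eq_empty_of_le hab]
  obtain ⟨c, hc, hlt, hlim⟩ := exists_seq_strictMono_tendsto' hab
  have hU : Ioo a b = ⋃ n, Ioo a (c n) := by
    ext t
    simp only [mem_Ioo, mem_iUnion]
    constructor
    · rintro ⟨h1, h2⟩
      obtain ⟨n, hn⟩ := (hlim.eventually (lt_mem_nhds h2)).exists
      exact ⟨n, h1, hn⟩
    · rintro ⟨n, h1, h2⟩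
      exact ⟨h1, h2.trans (hlt n).2⟩
  rw [hU, setLIntegral_iUnion_of_directed _
    (Monotone.directed_le fun m n hmn => Ioo_subset_Ioo_right (hc.monotone hmn))]
  exact iSup_le fun n => h _ (hlt n).1 (hlt n).2

section
variable {N : ℕ} {s q L : ℝ} {x₀ : RN N} {R a b : ℝ} {K : RN N × RN N → ℝ → ℝ}
  {u : RN N → ℝ → ℝ}

/-- The energy inequality, averaged over the initial time. -/
lemma exists_energy_average_le (hN : 2 ≤ N) (hs0 : 0 < s) (hs1 : s < 1) (hq : 1 < q)
    (hL : 0 < L) : ∃ C : ℝ, 0 < C ∧ ∀ (x₀ : RN N) (R a b : ℝ) (K : RN N × RN N → ℝ → ℝ)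
      (u : RN N → ℝ → ℝ), CylinderSubsolution s q L x₀ R a b K u → 0 < R →
      ∀ k a₁ a₂ : ℝ, 0 < k → a ≤ a₁ → a₁ < a₂ → a₂ < b →
      R ^ (-(2 * s)) * k ^ (1 - q) ≤ 1 / (a₂ - a₁) → ∀ E : ℝ≥0∞,
      E = ENNReal.ofReal (C / (a₂ - a₁)) * (∫⁻ t in Ioo a₁ b,
        ∫⁻ x in posAt s q L x₀ R a b u k t, ENNReal.ofReal (u x t ^ (q + 1))) →
      (∀ᵐ t ∂(volume.restrict (Ioo a₂ b)),
        ∫⁻ x, ENNReal.ofReal (truncAt s q L x₀ R a b u k t x ^ (q + 1)) ≤ E) ∧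
      ∫⁻ t in Ioo a₂ b, ∫⁻ p : RN N × RN N, ENNReal.ofReal ((truncAt s q L x₀ R a b u k t p.1 -
            truncAt s q L x₀ R a b u k t p.2) ^ 2 * kern s p.1 p.2) ≤ E := by
  obtain ⟨C, hC, hen⟩ := exists_energy_le hN hs0 hs1 hq hL
  refine ⟨2 * C, by positivity, fun x₀ R a b K u h hR k a₁ a₂ hk ha h12 hb hsmall E hE => ?_⟩
  obtain ⟨G, hG, hG'⟩ := hen x₀ R a b K u h hR k hk
  set M : ℝ → ℝ≥0∞ := fun t =>
    ∫⁻ x in posAt s q L x₀ R a b u k t, ENNReal.ofReal (u x t ^ (q + 1)) with hM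
  set Z := ∫⁻ t in Ioo a₁ b, M t with hZ
  have hd : 0 < a₂ - a₁ := sub_pos.2 h12
  have hμ : (volume.restrict (Ioo a₁ a₂)) ≠ 0 := by
    rw [Ne, Measure.restrict_eq_zero, Real.volume_Ioo]
    simpa using h12
  have hnull : (volume.restrict (Ioo a₁ a₂)) {t | ¬(t ∈ G ∧ t ∈ Ioo a₁ a₂)} = 0 := by
    have : ∀ᵐ t ∂(volume.restrict (Ioo a₁ a₂)), t ∈ G ∧ t ∈ Ioo a₁ a₂ := by
      filter_upwards [ae_restrict_of_ae_restrict_of_subset (Ioo_subset_Ioo ha hb.le) hG,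
        ae_restrict_mem measurableSet_Ioo] with t h1 h2 using ⟨h1, h2⟩
    exact this
  -- Among the good times in `(a₁, a₂)` one has mass at most the average. This bounds the initial
  -- term and replaces a cut-off in time.
  obtain ⟨t₁, ht₁, hav⟩ := exists_notMem_null_le_laverage hμ
    (h.measurable_posAt_mass (k := k) (p := q + 1)).aemeasurable hnull
  rw [mem_ofPred_eq, not_not] at ht₁
  obtain ⟨htG, htm⟩ := ht₁
  have hMt : M t₁ ≤ ENNReal.ofReal (1 / (a₂ - a₁)) * Z := by
    refine hav.trans ?_
    rw [laverage_eq, Measure.restrict_apply_univ, Real.volume_Ioo, ENNReal.div_eq_inv_mul,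
      ← ENNReal.ofReal_inv_of_pos hd, one_div]
    exact mul_le_mul_right (lintegral_mono_set (Ioo_subset_Ioo_right hb.le)) _
  have hle : ∀ t ∈ G, a₂ < t → t < b →
      (∫⁻ x, ENNReal.ofReal (truncAt s q L x₀ R a b u k t x ^ (q + 1))) +
        (∫⁻ τ in Ioo a₂ t, ∫⁻ p : RN N × RN N, ENNReal.ofReal
          ((truncAt s q L x₀ R a b u k τ p.1 -
            truncAt s q L x₀ R a b u k τ p.2) ^ 2 * kern s p.1 p.2)) ≤ E := by
    intro t htg ht2 htb
    have h1 := hG' t₁ htG t htg (ha.trans_lt htm.1) (htm.2.trans ht2) htb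
    refine (add_le_add le_rfl (lintegral_mono_set (Ioo_subset_Ioo_left htm.2.le))).trans
      (h1.trans ?_)
    have h2 : (∫⁻ τ in Ioo t₁ t, M τ) ≤ Z := lintegral_mono_set (Ioo_subset_Ioo htm.1.le htb.le)
    -- The smallness hypothesis makes the coefficient of the barrier term no larger than that of the
    -- time average; the two equal contributions account for the factor `2` in the constant.
    calc _ ≤ ENNReal.ofReal C * (ENNReal.ofReal (1 / (a₂ - a₁)) * Z +
          ENNReal.ofReal (1 / (a₂ - a₁)) * Z) :=
          mul_le_mul_right (add_le_add hMt (mul_le_mul' (ENNReal.ofReal_le_ofReal hsmall) h2)) _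
      _ = E := by
          rw [hE, ← two_mul, ← mul_assoc 2, two_mul_ofReal, ← mul_assoc, ← ENNReal.ofReal_mul hC.le]
          congr 2; ring
  refine ⟨?_, setLIntegral_Ioo_le_of_forall_lt fun c hac hcb => ?_⟩
  · filter_upwards [ae_restrict_of_ae_restrict_of_subset (Ioo_subset_Ioo (ha.trans h12.le) le_rfl)
      hG, ae_restrict_mem measurableSet_Ioo] with t h1 h2
    exact le_self_add.trans (hle t h1 h2.1 h2.2)
  · have hsub : Ioo c b ⊆ Ioo a b := Ioo_subset_Ioo (ha.trans (h12.trans hac).le) le_rfl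
    have hne : (volume.restrict (Ioo c b)) ≠ 0 := by
      rw [Ne, Measure.restrict_eq_zero, Real.volume_Ioo]
      simpa using hcb
    have : (ae (volume.restrict (Ioo c b))).NeBot := ae_neBot.2 hne
    obtain ⟨t, h1, h2⟩ := ((ae_restrict_of_ae_restrict_of_subset hsub hG).and
      (ae_restrict_mem measurableSet_Ioo)).exists
    exact (lintegral_mono_set (Ioo_subset_Ioo_right h2.1.le)).trans
      (le_add_self.trans (hle t h1 (hac.trans h2.1) h2.2))


/-- The right-hand side is the exponent `2 + 2sp / N` of the Gagliardo–Nirenberg inequality for `p =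
q + 1`. -/
lemma mExp_eq (hN : 2 ≤ N) : mExp N s q = 2 + 2 * s * (q + 1) / N := by
  have hN0 : (N : ℝ) ≠ 0 := by positivity
  unfold mExp; field_simp

/-- Gain of integrability for the truncations. -/
lemma exists_lintegral_trunc_rpow_le (hN : 2 ≤ N) (hs0 : 0 < s) (hs1 : s < 1) (hq : 1 < q)
    (hL : 0 < L) : ∃ C : ℝ, 0 < C ∧ ∀ (x₀ : RN N) (R a b : ℝ) (K : RN N × RN N → ℝ → ℝ)
      (u : RN N → ℝ → ℝ), CylinderSubsolution s q L x₀ R a b K u → 0 < R →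
      ∀ k a₁ a₂ : ℝ, 0 < k → a ≤ a₁ → a₁ < a₂ → a₂ < b →
      R ^ (-(2 * s)) * k ^ (1 - q) ≤ 1 / (a₂ - a₁) → ∀ z : ℝ, 0 < z →
      (∫⁻ t in Ioo a₁ b, ∫⁻ x in posAt s q L x₀ R a b u k t, ENNReal.ofReal (u x t ^ (q + 1)) ≤
        ENNReal.ofReal z) →
      ∫⁻ t in Ioo a₂ b, ∫⁻ x, ENNReal.ofReal (truncAt s q L x₀ R a b u k t x ^ mExp N s q) ≤
        ENNReal.ofReal (C * (z / (a₂ - a₁)) ^ (1 + 2 * s / N)) := by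
  obtain ⟨C, hC, hav⟩ := exists_energy_average_le hN hs0 hs1 hq hL
  have hN0 : (0 : ℝ) < N := by exact_mod_cast (by omega : 0 < N)
  have hg := gnConst_pos (N := N) (s := s) (p := q + 1)
  refine ⟨gnConst N s (q + 1) * C ^ (1 + 2 * s / N), by positivity,
    fun x₀ R a b K u h hR k a₁ a₂ hk ha h12 hb hsmall z hz hZ => ?_⟩
  have hd : 0 < a₂ - a₁ := sub_pos.2 h12
  obtain ⟨hsup, hint⟩ := hav x₀ R a b K u h hR k a₁ a₂ hk ha h12 hb hsmall _ rfl
  set E : ℝ := C * (z / (a₂ - a₁)) with hE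
  have hE0 : 0 < E := by positivity
  have hEle : ENNReal.ofReal (C / (a₂ - a₁)) * (∫⁻ t in Ioo a₁ b,
      ∫⁻ x in posAt s q L x₀ R a b u k t, ENNReal.ofReal (u x t ^ (q + 1))) ≤ ENNReal.ofReal E := by
    refine (mul_le_mul_right hZ _).trans (le_of_eq ?_)
    rw [← ENNReal.ofReal_mul (by positivity), hE]
    congr 1; ring
  have hm : Measurable fun t => ∫⁻ p : RN N × RN N, ENNReal.ofReal
      ((truncAt s q L x₀ R a b u k t p.1 - truncAt s q L x₀ R a b u k t p.2) ^ 2 *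
        kern s p.1 p.2) :=
    Measurable.lintegral_prod_right' (ν := (volume : Measure (RN N × RN N)))
      (h.measurable_trunc_energy (k := k)).ennreal_ofReal
  -- On each slice the Gagliardo–Nirenberg inequality bounds the `m`-th power by `E ^ (2s / N)`
  -- times the energy; integrating in time contributes one more factor `E`, hence the superlinear
  -- power `1 + 2s / N`.
  calc _ ≤ ∫⁻ t in Ioo a₂ b, ENNReal.ofReal (gnConst N s (q + 1) * E ^ (2 * s / N)) *
        ∫⁻ p : RN N × RN N, ENNReal.ofReal ((truncAt s q L x₀ R a b u k t p.1 -
          truncAt s q L x₀ R a b u k t p.2) ^ 2 * kern s p.1 p.2) := by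
        refine lintegral_mono_ae ?_
        filter_upwards [hsup] with t ht
        have hv : Measurable (truncAt s q L x₀ R a b u k t) :=
          measurable_trunc (h.measurable_slice t)
        have := lintegral_rpow_le_gagliardo hN hs0 (by linarith : 0 < q + 1) hv
          (fun x => trunc_nonneg) hE0 (ht.trans hEle)
        rw [← mExp_eq hN] at this
        refine this.trans (le_of_eq ?_)
        congr 1
        rw [Measure.volume_eq_prod, lintegral_prod _ (by fun_prop)]
        refine lintegral_congr fun x => lintegral_congr fun y => ?_
        rw [sq_abs, kern, mul_one_div]
    _ = ENNReal.ofReal (gnConst N s (q + 1) * E ^ (2 * s / N)) *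
        ∫⁻ t in Ioo a₂ b, ∫⁻ p : RN N × RN N, ENNReal.ofReal ((truncAt s q L x₀ R a b u k t p.1 -
          truncAt s q L x₀ R a b u k t p.2) ^ 2 * kern s p.1 p.2) :=
        lintegral_const_mul _ hm
    _ ≤ ENNReal.ofReal (gnConst N s (q + 1) * E ^ (2 * s / N)) * ENNReal.ofReal E :=
        mul_le_mul_right (hint.trans hEle) _
    _ = _ := by
        rw [← ENNReal.ofReal_mul (by positivity)]
        congr 1
        have e1 : E ^ (1 + 2 * s / N) = E ^ (2 * s / N) * E := by
          rw [add_comm, Real.rpow_add_one hE0.ne']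
        rw [mul_assoc, ← e1, hE, Real.mul_rpow hC.le (by positivity), mul_assoc]

/-- A relative gap `ε` between the `q`-th powers of the levels gives a relative gap of at least `ε /
q` between the levels, by Bernoulli's inequality. Above the higher one, the truncation at the lower
one is then comparable with `u` itself. -/
lemma mul_le_truncAt (hq : 1 < q) (hL : 0 < L) (hR : 0 < R) {k₁ k₂ ε t : ℝ} (hk₁ : 0 < k₁)
    (hk₂ : 0 < k₂) (ht : a ≤ t) (hε : ε ≤ 1)
    (hgap : ε * level s q L x₀ R a b u k₂ t ^ q ≤ k₂ ^ q - k₁ ^ q) {x : RN N}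
    (hx : x ∈ posAt s q L x₀ R a b u k₂ t) (hε0 : 0 ≤ ε) :
    ε / q * u x t ≤ truncAt s q L x₀ R a b u k₁ t x := by
  have h1 := CylinderSubsolution.level_rpow (s := s) (x₀ := x₀) (R := R) (b := b) (u := u)
    hq hL hk₁ ht
  have h2 := CylinderSubsolution.level_rpow (s := s) (x₀ := x₀) (R := R) (b := b) (u := u)
    hq hL hk₂ ht
  have hℓ₁ := CylinderSubsolution.level_pos (s := s) (x₀ := x₀) (R := R) (b := b) (u := u)
    hq hL hk₁ ht
  have hℓ₂ := CylinderSubsolution.level_pos (s := s) (x₀ := x₀) (R := R) (b := b) (u := u)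
    hq hL hk₂ ht
  set ℓ₁ := level s q L x₀ R a b u k₁ t
  set ℓ₂ := level s q L x₀ R a b u k₂ t
  have hq0 : 0 < q := by linarith
  have hεq : ε / q ≤ 1 := by rw [div_le_one hq0]; linarith
  have hεq0 : 0 ≤ ε / q := by positivity
  have h3 : ℓ₁ ≤ (1 - ε / q) * ℓ₂ := by
    rw [← Real.rpow_le_rpow_iff hℓ₁.le (mul_nonneg (by linarith) hℓ₂.le) hq0,
      Real.mul_rpow (by linarith) hℓ₂.le]
    -- This is `(1 - ε / q) ^ q ≥ 1 - ε`.
    have hB := one_add_mul_self_le_rpow_one_add (s := -(ε / q)) (by linarith) hq.le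
    have e : 1 + q * -(ε / q) = 1 - ε := by field_simp; ring
    rw [e, ← sub_eq_add_neg] at hB
    calc ℓ₁ ^ q ≤ (1 - ε) * ℓ₂ ^ q := by linarith
      _ ≤ _ := by gcongr
  obtain ⟨hx1, hx2⟩ := hx
  change ℓ₂ * barrier s q x₀ R x < u x t at hx2
  have hP := barrier_pos (s := s) (q := q) hR hx1
  rw [truncAt, trunc_of_mem hx1]
  refine le_trans ?_ (le_max_left _ _)
  change ε / q * u x t ≤ u x t - ℓ₁ * barrier s q x₀ R x
  have h4 : ℓ₁ * barrier s q x₀ R x ≤ (1 - ε / q) * (ℓ₂ * barrier s q x₀ R x) := by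
    rw [← mul_assoc]; gcongr
  have h5 := mul_le_mul_of_nonneg_left hx2.le (by linarith : 0 ≤ 1 - ε / q)
  linarith

/-- The increasing sequence of levels. -/
def levelSeq (q k : ℝ) (j : ℕ) : ℝ := (k ^ q * (2 - (1 / 2) ^ j)) ^ (1 / q)

/-- The increasing sequence of initial times. -/
def timeSeq (a g : ℝ) (j : ℕ) : ℝ := a + g * (1 - (1 / 2) ^ j)

/-- The mass above the levels. -/
def levelMass (s q L : ℝ) (x₀ : RN N) (R a b : ℝ) (u : RN N → ℝ → ℝ) (k g p : ℝ) (j : ℕ) : ℝ≥0∞ :=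
  ∫⁻ t in Ioo (timeSeq a g j) b,
    ∫⁻ x in posAt s q L x₀ R a b u (levelSeq q k (j + 1)) t, ENNReal.ofReal (u x t ^ p)

lemma half_pow_le_one (j : ℕ) : (1 / 2 : ℝ) ^ j ≤ 1 := pow_le_one₀ (by norm_num) (by norm_num)

lemma levelSeq_rpow {k : ℝ} (hq : 1 < q) (hk : 0 < k) (j : ℕ) :
    levelSeq q k j ^ q = k ^ q * (2 - (1 / 2) ^ j) := by
  have := half_pow_le_one j
  have h2 : 0 ≤ k ^ q * (2 - (1 / 2) ^ j) := mul_nonneg (by positivity) (by linarith)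
  rw [levelSeq, ← Real.rpow_mul h2, one_div_mul_cancel (by linarith), Real.rpow_one]

lemma le_levelSeq {k : ℝ} (hq : 1 < q) (hk : 0 < k) (j : ℕ) : k ≤ levelSeq q k j := by
  have := half_pow_le_one j
  have h0 : 0 ≤ levelSeq q k j :=
    Real.rpow_nonneg (mul_nonneg (by positivity) (by linarith)) _
  rw [← Real.rpow_le_rpow_iff hk.le h0 (by linarith : 0 < q), levelSeq_rpow hq hk]
  have : 0 < k ^ q := by positivity
  nlinarith

lemma levelSeq_pos {k : ℝ} (hq : 1 < q) (hk : 0 < k) (j : ℕ) : 0 < levelSeq q k j :=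
  hk.trans_le (le_levelSeq hq hk j)

lemma timeSeq_succ_sub (a g : ℝ) (j : ℕ) :
    timeSeq a g (j + 1) - timeSeq a g j = g * (1 / 2) ^ (j + 1) := by
  unfold timeSeq; ring

lemma le_timeSeq {g : ℝ} (hg : 0 < g) (j : ℕ) : a ≤ timeSeq a g j := by
  have := half_pow_le_one j
  unfold timeSeq
  nlinarith

lemma timeSeq_le {g : ℝ} (hg : 0 < g) (j : ℕ) : timeSeq a g j ≤ a + g := by
  have : (0 : ℝ) < (1 / 2) ^ j := by positivity
  unfold timeSeq
  nlinarith

/-- Of the factor `3`, two units come from the bound `2 k ^ q` for the sequence and one from the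
accumulated tail. -/
lemma level_levelSeq_rpow_le (h : CylinderSubsolution s q L x₀ R a b K u) (hq : 1 < q)
    (hL : 0 < L) {k t : ℝ} (hk : 0 < k) (ht : a ≤ t) (htb : t ≤ b)
    (htail : tailConst N s L * tailMass s x₀ R a b u b ≤ k ^ q) (j : ℕ) :
    level s q L x₀ R a b u (levelSeq q k j) t ^ q ≤ 3 * k ^ q := by
  rw [CylinderSubsolution.level_rpow hq hL (levelSeq_pos hq hk j) ht, levelSeq_rpow hq hk]
  have h1 := mul_le_mul_of_nonneg_left (h.tailMass_mono htb) (tailConst_pos (N := N) (s := s) hL).le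
  have h2 : 0 < k ^ q := by positivity
  have h3 : (0 : ℝ) < (1 / 2) ^ j := by positivity
  nlinarith

/-- One step of the De Giorgi iteration. -/
lemma exists_levelMass_step (hN : 2 ≤ N) (hs0 : 0 < s) (hs1 : s < 1) (hq : 1 < q)
    (hL : 0 < L) : ∃ C : ℝ, 0 < C ∧ ∀ (x₀ : RN N) (R a b : ℝ) (K : RN N × RN N → ℝ → ℝ)
      (u : RN N → ℝ → ℝ), CylinderSubsolution s q L x₀ R a b K u → 0 < R →
      ∀ k g : ℝ, 0 < k → 0 < g → a + g < b → g * R ^ (-(2 * s)) ≤ k ^ (q - 1) →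
      tailConst N s L * tailMass s x₀ R a b u b ≤ k ^ q → ∀ (j : ℕ) (z : ℝ), 0 < z →
      levelMass s q L x₀ R a b u k g (q + 1) j ≤ ENNReal.ofReal z →
      levelMass s q L x₀ R a b u k g (mExp N s q) (j + 1) ≤
        ENNReal.ofReal (C * (2 ^ (mExp N s q + (1 + 2 * s / N))) ^ j *
          (z / g) ^ (1 + 2 * s / N)) := by
  obtain ⟨C, hC, hgain⟩ := exists_lintegral_trunc_rpow_le hN hs0 hs1 hq hL
  have hN0 : (0 : ℝ) < N := by exact_mod_cast (by omega : 0 < N)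
  have hq0 : 0 < q := by linarith
  -- The relative gap of the levels is `ε = (1/2) ^ (j + 2) / 3`, so `q / ε = 12 * q * 2 ^ j`. The
  -- factor `2 ^ (1 + 2s / N)` belongs to the time step `g * (1/2) ^ (j + 1)`.
  refine ⟨(12 * q) ^ mExp N s q * (C * 2 ^ (1 + 2 * s / N)), by positivity,
    fun x₀ R a b K u h hR k g hk hg hgb hgR htail j z hz hZ => ?_⟩
  set m := mExp N s q with hm
  have hm0 : 0 < m := by rw [hm, mExp_eq hN]; positivity
  have hkj := levelSeq_pos hq hk (j + 1)
  have hkle := le_levelSeq hq hk (j + 1)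
  have hdt := timeSeq_succ_sub a g j
  have hpow : (0 : ℝ) < (1 / 2) ^ (j + 1) := by positivity
  have hsmall : R ^ (-(2 * s)) * levelSeq q k (j + 1) ^ (1 - q) ≤
      1 / (timeSeq a g (j + 1) - timeSeq a g j) := by
    have e1 : R ^ (-(2 * s)) * levelSeq q k (j + 1) ^ (1 - q) ≤ 1 / g := by
      have e2 : levelSeq q k (j + 1) ^ (1 - q) ≤ k ^ (1 - q) :=
        Real.rpow_le_rpow_of_nonpos hk hkle (by linarith)
      have e3 : k ^ (q - 1) * k ^ (1 - q) = 1 := by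
        rw [← Real.rpow_add hk]; simp
      rw [le_div_iff₀ hg]
      calc _ ≤ R ^ (-(2 * s)) * k ^ (1 - q) * g := by gcongr
        _ = (g * R ^ (-(2 * s))) * k ^ (1 - q) := by ring
        _ ≤ k ^ (q - 1) * k ^ (1 - q) := by gcongr
        _ = 1 := e3
    refine e1.trans (one_div_le_one_div_of_le (by rw [hdt]; positivity) ?_)
    rw [hdt]
    exact mul_le_of_le_one_right hg.le (half_pow_le_one _)
  -- The mass of index `j` is taken above the level of index `j + 1`; that same level truncates
  -- here, and it lies below the level used in the mass of index `j + 1`.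
  have hW := hgain x₀ R a b K u h hR (levelSeq q k (j + 1)) (timeSeq a g j) (timeSeq a g (j + 1))
    hkj (le_timeSeq hg j) (by rw [← sub_pos, hdt]; positivity)
    ((timeSeq_le hg _).trans_lt hgb) hsmall z hz hZ
  have hcomp : levelMass s q L x₀ R a b u k g m (j + 1) ≤
      ENNReal.ofReal ((12 * q * 2 ^ j) ^ m) * ∫⁻ t in Ioo (timeSeq a g (j + 1)) b,
        ∫⁻ x, ENNReal.ofReal (truncAt s q L x₀ R a b u (levelSeq q k (j + 1)) t x ^ m) := by
    rw [← lintegral_const_mul' _ _ ENNReal.ofReal_ne_top]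
    refine setLIntegral_mono' measurableSet_Ioo fun t ht => ?_
    have hat : a ≤ t := (le_timeSeq hg _).trans ht.1.le
    rw [← lintegral_const_mul' _ _ ENNReal.ofReal_ne_top]
    refine (setLIntegral_mono' (h.measurableSet_posAt_slice t) fun x hx => ?_).trans
      (setLIntegral_le_lintegral _ _)
    rw [← ENNReal.ofReal_mul (by positivity),
      ← Real.mul_rpow (by positivity) (show 0 ≤ truncAt s q L x₀ R a b u _ t x from trunc_nonneg)]
    refine ENNReal.ofReal_le_ofReal (Real.rpow_le_rpow (h.nonneg x t) ?_ hm0.le)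
    have hgap : (1 / 2) ^ (j + 1 + 1) / 3 *
        level s q L x₀ R a b u (levelSeq q k (j + 1 + 1)) t ^ q ≤
        levelSeq q k (j + 1 + 1) ^ q - levelSeq q k (j + 1) ^ q := by
      have e1 := level_levelSeq_rpow_le h hq hL hk hat ht.2.le htail (j + 1 + 1)
      rw [levelSeq_rpow hq hk, levelSeq_rpow hq hk]
      calc _ ≤ (1 / 2) ^ (j + 1 + 1) / 3 * (3 * k ^ q) := by gcongr
        _ = _ := by ring
    have e2 := mul_le_truncAt hq hL hR hkj (levelSeq_pos hq hk _) hat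
      (by have := half_pow_le_one (j + 1 + 1); linarith) hgap hx (by positivity)
    have e3 : u x t = 12 * q * 2 ^ j * ((1 / 2) ^ (j + 1 + 1) / 3 / q * u x t) := by
      have : (2 : ℝ) ^ j * (1 / 2) ^ j = 1 := by rw [← mul_pow]; norm_num
      field_simp
      rw [pow_succ, pow_succ]
      linear_combination (-3 * u x t) * this
    calc u x t = _ := e3
      _ ≤ _ := by gcongr
  refine hcomp.trans ((mul_le_mul_right hW _).trans (le_of_eq ?_))
  rw [← ENNReal.ofReal_mul (by positivity)]
  congr 1
  rw [hdt]
  have e1 : z / (g * (1 / 2) ^ (j + 1)) = z / g * (2 * 2 ^ j) := by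
    rw [one_div, inv_pow, pow_succ]; field_simp
  have e2 : ((2 : ℝ) ^ (m + (1 + 2 * s / N))) ^ j = (2 ^ j) ^ m * (2 ^ j) ^ (1 + 2 * s / N) := by
    rw [← Real.rpow_add (by positivity), ← Real.rpow_natCast, ← Real.rpow_natCast,
      ← Real.rpow_mul (by norm_num), ← Real.rpow_mul (by norm_num), mul_comm]
  have hzg : 0 ≤ z / g := by positivity
  rw [e1, e2, Real.mul_rpow (x := 12 * q) (y := 2 ^ j) (by positivity) (by positivity),
    Real.mul_rpow (x := z / g) (y := 2 * 2 ^ j) hzg (by positivity),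
    Real.mul_rpow (x := 2) (y := 2 ^ j) (by norm_num) (by positivity)]
  ring

/-- Conclusion of the De Giorgi iteration. -/
lemma ae_le_of_levelMass_le (h : CylinderSubsolution s q L x₀ R a b K u) (hq : 1 < q)
    (hL : 0 < L) (hR : 0 < R) {k g : ℝ} (hk : 0 < k) (hg : 0 < g)
    (htail : tailConst N s L * tailMass s x₀ R a b u b ≤ k ^ q) {c β : ℝ} (hβ0 : 0 ≤ β)
    (hβ : β < 1)
    (hZ : ∀ j, levelMass s q L x₀ R a b u k g (q + 1) j ≤ ENNReal.ofReal (c * β ^ j)) :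
    ∀ᵐ z ∂((volume : Measure (RN N × ℝ)).restrict (Metric.ball x₀ R ×ˢ Ioo (a + g) b)),
      u z.1 z.2 ≤ 3 * k * barrier s q x₀ R z.1 := by
  have hq0 : 0 < q := by linarith
  have hu : Measurable fun z : RN N × ℝ => u z.1 z.2 := h.measurable_u
  -- All levels stay below `3 * k` and all initial times below `a + g`, so the mass on this set is
  -- at most every `levelMass`, and these tend to zero.
  set S : Set (RN N × ℝ) := {z | z.1 ∈ Metric.ball x₀ R ∧ z.2 ∈ Ioo (a + g) b ∧
    3 * k * barrier s q x₀ R z.1 < u z.1 z.2} with hS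
  have hSm : MeasurableSet S := by
    refine MeasurableSet.inter (measurable_fst Metric.isOpen_ball.measurableSet)
      (MeasurableSet.inter (measurable_snd measurableSet_Ioo) (measurableSet_lt (by fun_prop) hu))
  have hF : Measurable (S.indicator fun z => ENNReal.ofReal (u z.1 z.2 ^ (q + 1))) :=
    (hu.pow_const _).ennreal_ofReal.indicator hSm
  have hle : ∀ j, ∫⁻ z, S.indicator (fun z => ENNReal.ofReal (u z.1 z.2 ^ (q + 1))) z ≤
      ENNReal.ofReal (c * β ^ j) := by
    intro j
    refine le_trans ?_ (hZ j)
    rw [Measure.volume_eq_prod, lintegral_prod_symm _ hF.aemeasurable, levelMass,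
      ← lintegral_indicator measurableSet_Ioo]
    refine lintegral_mono fun t => ?_
    by_cases ht : t ∈ Ioo (a + g) b
    · have ht' : t ∈ Ioo (timeSeq a g j) b := ⟨(timeSeq_le hg j).trans_lt ht.1, ht.2⟩
      have hat : a ≤ t := by linarith [ht.1]
      rw [indicator_of_mem ht', ← lintegral_indicator (h.measurableSet_posAt_slice t)]
      refine lintegral_mono fun x => ?_
      by_cases hx : (x, t) ∈ S
      · rw [indicator_of_mem hx, indicator_of_mem]
        refine ⟨hx.1, lt_of_le_of_lt ?_ hx.2.2⟩
        refine mul_le_mul_of_nonneg_right ?_ (barrier_pos hR hx.1).le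
        rw [← Real.rpow_le_rpow_iff (CylinderSubsolution.level_pos hq hL
          (levelSeq_pos hq hk _) hat).le (by positivity) hq0, Real.mul_rpow (by norm_num) hk.le]
        refine (level_levelSeq_rpow_le h hq hL hk hat ht.2.le htail (j + 1)).trans ?_
        -- The bound `3 * k ^ q` for the `q`-th power of the levels is weakened to `(3 * k) ^ q`.
        have : (3 : ℝ) ≤ 3 ^ q := by
          simpa using Real.rpow_le_rpow_of_exponent_le (by norm_num : (1 : ℝ) ≤ 3) hq.le
        gcongr
      · rw [indicator_of_notMem hx]; exact zero_le
    · have : ∀ x, (x, t) ∉ S := fun x hx => ht hx.2.1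
      simp [this]
  have hlim : Tendsto (fun j => ENNReal.ofReal (c * β ^ j)) atTop (𝓝 0) := by
    have := (tendsto_pow_atTop_nhds_zero_of_lt_one hβ0 hβ).const_mul c
    rw [mul_zero] at this
    simpa using ENNReal.tendsto_ofReal this
  have hzero : ∫⁻ z, S.indicator (fun z => ENNReal.ofReal (u z.1 z.2 ^ (q + 1))) z = 0 :=
    le_antisymm (ge_of_tendsto' hlim hle) zero_le
  rw [lintegral_eq_zero_iff hF] at hzero
  rw [ae_restrict_iff' (Metric.isOpen_ball.measurableSet.prod measurableSet_Ioo)]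
  filter_upwards [hzero] with z hz hmem
  by_contra hlt
  rw [not_le] at hlt
  have hzS : z ∈ S := ⟨hmem.1, hmem.2, hlt⟩
  rw [indicator_of_mem hzS] at hz
  have hpos : 0 < u z.1 z.2 := lt_of_le_of_lt
    (mul_nonneg (by positivity) (barrier_pos hR hmem.1).le) hlt
  have : 0 < ENNReal.ofReal (u z.1 z.2 ^ (q + 1)) := ENNReal.ofReal_pos.2 (by positivity)
  exact this.ne' hz

end

section
variable {N : ℕ} {s q L : ℝ} {x₀ : RN N} {R a b : ℝ} {K : RN N × RN N → ℝ → ℝ}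
  {u : RN N → ℝ → ℝ}

lemma le_of_mem_posAt_levelSeq (hq : 1 < q) (hs0 : 0 < s) (hN : 2 ≤ N) (hL : 0 < L) (hR : 0 < R)
    {k t : ℝ} (hk : 0 < k) (ht : a ≤ t) {j : ℕ} {x : RN N}
    (hx : x ∈ posAt s q L x₀ R a b u (levelSeq q k j) t) : k ≤ u x t := by
  have h1 := one_le_barrier (s := s) (q := q) hN hs0 hq hR hx.1
  have h2 := CylinderSubsolution.le_level (s := s) (x₀ := x₀) (R := R) (b := b) (u := u)
    hq hL (levelSeq_pos hq hk j) ht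
  have h3 := le_levelSeq hq hk j
  refine le_trans ?_ hx.2.le
  nlinarith

/-- The barrier is at least `1`, so `u ≥ k` above every level, and a power of `u` can be raised at
the price of a negative power of `k`. -/
lemma levelMass_le_mul (hq : 1 < q) (hs0 : 0 < s) (hN : 2 ≤ N) (hL : 0 < L) (hR : 0 < R)
    (h : CylinderSubsolution s q L x₀ R a b K u)
    {k g : ℝ} (hk : 0 < k) (hg : 0 < g) {p r : ℝ} (hpr : p ≤ r) (j : ℕ) :
    levelMass s q L x₀ R a b u k g p j ≤
      ENNReal.ofReal (k ^ (p - r)) * levelMass s q L x₀ R a b u k g r j := by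
  unfold levelMass
  rw [← lintegral_const_mul' _ _ ENNReal.ofReal_ne_top]
  refine setLIntegral_mono' measurableSet_Ioo fun t ht => ?_
  rw [← lintegral_const_mul' _ _ ENNReal.ofReal_ne_top]
  refine setLIntegral_mono' (h.measurableSet_posAt_slice t) fun x hx => ?_
  have hku := le_of_mem_posAt_levelSeq hq hs0 hN hL hR hk ((le_timeSeq hg j).trans ht.1.le) hx
  have hu : 0 < u x t := hk.trans_le hku
  rw [← ENNReal.ofReal_mul (by positivity)]
  refine ENNReal.ofReal_le_ofReal ?_
  calc u x t ^ p = u x t ^ (p - r) * u x t ^ r := by rw [← Real.rpow_add hu]; ring_nf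
    _ ≤ k ^ (p - r) * u x t ^ r := mul_le_mul_of_nonneg_right
      (Real.rpow_le_rpow_of_nonpos hk hku (by linarith)) (by positivity)

lemma levelMass_le_lintegral {k g p : ℝ} (hg : 0 < g) (j : ℕ) :
    levelMass s q L x₀ R a b u k g p j ≤
      ∫⁻ t in Ioo a b, ∫⁻ x in Metric.ball x₀ R, ENNReal.ofReal (u x t ^ p) :=
  (lintegral_mono_set (Ioo_subset_Ioo_left (le_timeSeq hg j))).trans
    (lintegral_mono fun _ => CylinderSubsolution.posAt_mass_le_ball)

lemma levelMass_eq (h : CylinderSubsolution s q L x₀ R a b K u) {k g p : ℝ} (j : ℕ) :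
    levelMass s q L x₀ R a b u k g p j =
      ∫⁻ z in {z : ℝ × RN N | z.1 ∈ Ioo (timeSeq a g j) b ∧
        z.2 ∈ posAt s q L x₀ R a b u (levelSeq q k (j + 1)) z.1}, ENNReal.ofReal (u z.2 z.1 ^ p) := by
  have hu : Measurable fun z : ℝ × RN N => u z.2 z.1 := h.measurable_comp (by fun_prop) (by fun_prop)
  have hS := h.measurableSet_posAt (k := levelSeq q k (j + 1)) (f := fun z : ℝ × RN N => z.2)
    (g := fun z => z.1) (by fun_prop) (by fun_prop)
  have hS' : MeasurableSet {z : ℝ × RN N | z.1 ∈ Ioo (timeSeq a g j) b ∧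
      z.2 ∈ posAt s q L x₀ R a b u (levelSeq q k (j + 1)) z.1} :=
    (measurable_fst measurableSet_Ioo).inter hS
  rw [← lintegral_indicator hS', Measure.volume_eq_prod, lintegral_prod _
    ((hu.pow_const p).ennreal_ofReal.indicator hS').aemeasurable, levelMass,
    ← lintegral_indicator measurableSet_Ioo]
  refine lintegral_congr fun t => ?_
  by_cases ht : t ∈ Ioo (timeSeq a g j) b
  · rw [indicator_of_mem ht, ← lintegral_indicator (h.measurableSet_posAt_slice t)]
    refine lintegral_congr fun x => ?_
    by_cases hx : x ∈ posAt s q L x₀ R a b u (levelSeq q k (j + 1)) t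
    · rw [indicator_of_mem hx, indicator_of_mem (by exact ⟨ht, hx⟩)]
    · rw [indicator_of_notMem hx, indicator_of_notMem (fun h => hx h.2)]
  · rw [indicator_of_notMem ht]
    have : ∀ x, (t, x) ∉ {z : ℝ × RN N | z.1 ∈ Ioo (timeSeq a g j) b ∧
      z.2 ∈ posAt s q L x₀ R a b u (levelSeq q k (j + 1)) z.1} := fun x hx => ht hx.1
    rw [lintegral_congr fun x => indicator_of_notMem (this x) _, lintegral_zero]

/-- Interpolation of the masses. -/
lemma levelMass_interpolate (h : CylinderSubsolution s q L x₀ R a b K u) {k g p₀ p₁ θ : ℝ}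
    (hθ0 : 0 ≤ θ) (hθ1 : θ ≤ 1) (hp : 0 < (1 - θ) * p₀ + θ * p₁) (j : ℕ) :
    levelMass s q L x₀ R a b u k g ((1 - θ) * p₀ + θ * p₁) j ≤
      levelMass s q L x₀ R a b u k g p₀ j ^ (1 - θ) * levelMass s q L x₀ R a b u k g p₁ j ^ θ := by
  have hu : Measurable fun z : ℝ × RN N => u z.2 z.1 := h.measurable_comp (by fun_prop) (by fun_prop)
  rw [levelMass_eq h, levelMass_eq h, levelMass_eq h]
  refine le_trans (lintegral_mono fun z => ?_) (ENNReal.lintegral_mul_norm_pow_le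
    (hu.pow_const p₀).ennreal_ofReal.aemeasurable (hu.pow_const p₁).ennreal_ofReal.aemeasurable
    (by linarith : 0 ≤ 1 - θ) hθ0 (by ring))
  have h0 := h.nonneg z.2 z.1
  rcases h0.eq_or_lt with h0 | h0
  · simp only
    rw [← h0, Real.zero_rpow hp.ne']; simp
  · simp only
    rw [ENNReal.ofReal_rpow_of_pos (by positivity), ENNReal.ofReal_rpow_of_pos (by positivity),
      ← ENNReal.ofReal_mul (by positivity), ← Real.rpow_mul h0.le, ← Real.rpow_mul h0.le,
      ← Real.rpow_add h0]
    refine le_of_eq ?_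
    congr 2; ring

/-- Local boundedness from smallness of a high power, when `q + 1 < m`. -/
lemma exists_ae_le_of_lt_mExp (hN : 2 ≤ N) (hs0 : 0 < s) (hs1 : s < 1) (hq : 1 < q)
    (hL : 0 < L) (hm : q + 1 < mExp N s q) :
    ∃ c : ℝ, 0 < c ∧ ∀ (x₀ : RN N) (R a b : ℝ) (K : RN N × RN N → ℝ → ℝ)
      (u : RN N → ℝ → ℝ), CylinderSubsolution s q L x₀ R a b K u → 0 < R →
      ∀ k g r : ℝ, 0 < k → 0 < g → a + g < b → g * R ^ (-(2 * s)) ≤ k ^ (q - 1) →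
      tailConst N s L * tailMass s x₀ R a b u b ≤ k ^ q → q + 1 ≤ r →
      (∫⁻ t in Ioo a b, ∫⁻ x in Metric.ball x₀ R, ENNReal.ofReal (u x t ^ r) ≤
        ENNReal.ofReal (c * (k ^ (lamExp N s q r / (2 * s)) * g ^ ((N + 2 * s) / (2 * s))))) →
      ∀ᵐ z ∂((volume : Measure (RN N × ℝ)).restrict (Metric.ball x₀ R ×ˢ Ioo (a + g) b)),
        u z.1 z.2 ≤ 3 * k * barrier s q x₀ R z.1 := by
  obtain ⟨C, hC, hstep⟩ := exists_levelMass_step hN hs0 hs1 hq hL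
  have hN0 : (0 : ℝ) < N := by exact_mod_cast (by omega : 0 < N)
  set m := mExp N s q with hmdef
  set α : ℝ := 2 * s / N with hα
  have hα0 : 0 < α := by positivity
  set B : ℝ := 2 ^ (m + (1 + α)) with hB
  have hB1 : 1 < B := Real.one_lt_rpow (by norm_num) (by linarith)
  -- Chosen so that the smallness condition `hsmall` of the recursion holds with equality; all
  -- powers of `k` and `g` cancel there by scaling.
  set c : ℝ := (C * B ^ (1 / α)) ^ (-(1 / α)) with hc
  have hc0 : 0 < c := by positivity
  refine ⟨c, hc0, fun x₀ R a b K u h hR k g r hk hg hgb hgR htail hr hU => ?_⟩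
  set U : ℝ := c * (k ^ (lamExp N s q r / (2 * s)) * g ^ ((N + 2 * s) / (2 * s))) with hUdef
  have hU0 : 0 < U := by positivity
  have hB0 : 0 < B := by linarith
  set D : ℝ := k ^ (q + 1 - m) * C * g ^ (-(1 + α)) with hD
  have hsmall : D * (k ^ (q + 1 - r) * U) ^ α * B ^ (1 / α) ≤ 1 := by
    have e1 : c ^ α = (C * B ^ (1 / α))⁻¹ := by
      rw [hc, ← Real.rpow_mul (by positivity), neg_mul, one_div_mul_cancel hα0.ne',
        Real.rpow_neg_one]
    have e2 : (k ^ (q + 1 - r) * U) ^ α = c ^ α * k ^ ((q + 1 - r) * α +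
        lamExp N s q r / (2 * s) * α) * g ^ ((N + 2 * s) / (2 * s) * α) := by
      rw [hUdef, Real.mul_rpow (by positivity) (by positivity),
        Real.mul_rpow hc0.le (by positivity), Real.mul_rpow (by positivity) (by positivity),
        ← Real.rpow_mul hk.le, ← Real.rpow_mul hk.le, ← Real.rpow_mul hg.le, Real.rpow_add hk]
      ring
    have e3 : k ^ (q + 1 - m) * k ^ ((q + 1 - r) * α + lamExp N s q r / (2 * s) * α) = 1 := by
      rw [← Real.rpow_add hk]
      refine (congrArg _ ?_).trans (Real.rpow_zero _)
      rw [hmdef, mExp_eq hN, hα, lamExp]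
      field_simp
      ring
    have e4 : g ^ (-(1 + α)) * g ^ ((N + 2 * s) / (2 * s) * α) = 1 := by
      rw [← Real.rpow_add hg]
      refine (congrArg _ ?_).trans (Real.rpow_zero _)
      rw [hα]
      field_simp
      ring
    refine le_of_eq ?_
    rw [e2, hD, e1]
    calc _ = (k ^ (q + 1 - m) * k ^ ((q + 1 - r) * α + lamExp N s q r / (2 * s) * α)) *
          (g ^ (-(1 + α)) * g ^ ((N + 2 * s) / (2 * s) * α)) *
          ((C * B ^ (1 / α)) * (C * B ^ (1 / α))⁻¹) := by ring
      _ = 1 := by rw [e3, e4, mul_inv_cancel₀ (by positivity)]; norm_num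
  have h0 : levelMass s q L x₀ R a b u k g (q + 1) 0 ≤ ENNReal.ofReal (k ^ (q + 1 - r) * U) := by
    refine (levelMass_le_mul hq hs0 hN hL hR h hk hg hr 0).trans ?_
    rw [ENNReal.ofReal_mul (by positivity)]
    exact mul_le_mul_right ((levelMass_le_lintegral hg 0).trans hU) _
  have hgeo := le_of_superlinear_recursion (Z := levelMass s q L x₀ R a b u k g (q + 1))
    (D := D) (B := B) (α := α) (by positivity) hB0 hα0 (by positivity) h0 (fun j z hz hZ => ?_)
    hsmall
  · refine ae_le_of_levelMass_le h hq hL hR hk hg htail (c := k ^ (q + 1 - r) * U)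
      (β := B ^ (-(1 / α))) (by positivity) (Real.rpow_lt_one_of_one_lt_of_neg hB1 ?_) hgeo
    rw [neg_lt_zero]; positivity
  -- Since `q + 1 < m`, the step bounding the `m` mass also bounds the `q + 1` mass.
  · refine (levelMass_le_mul hq hs0 hN hL hR h hk hg hm.le (j + 1)).trans ?_
    refine (mul_le_mul_right (hstep x₀ R a b K u h hR k g hk hg hgb hgR htail j z hz hZ) _).trans ?_
    rw [← ENNReal.ofReal_mul (by positivity)]
    refine le_of_eq ?_
    congr 1
    rw [Real.div_rpow hz.le hg.le, hD, Real.rpow_neg hg.le]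
    ring

/-- Local boundedness from smallness of a high power, when `m ≤ q + 1`. -/
lemma exists_ae_le_of_mExp_le (hN : 2 ≤ N) (hs0 : 0 < s) (hs1 : s < 1) (hq : 1 < q)
    (hL : 0 < L) (hm : mExp N s q ≤ q + 1) {A : ℝ} (hA : q + 1 < A) (hΛ : 0 < lamExp N s q A) :
    ∃ c : ℝ, 0 < c ∧ ∀ (x₀ : RN N) (R a b : ℝ) (K : RN N × RN N → ℝ → ℝ)
      (u : RN N → ℝ → ℝ), CylinderSubsolution s q L x₀ R a b K u → 0 < R →
      ∀ k g : ℝ, 0 < k → 0 < g → a + g < b → g * R ^ (-(2 * s)) ≤ k ^ (q - 1) →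
      tailConst N s L * tailMass s x₀ R a b u b ≤ k ^ q →
      (∫⁻ t in Ioo a b, ∫⁻ x in Metric.ball x₀ R, ENNReal.ofReal (u x t ^ A) ≤
        ENNReal.ofReal (c * (k ^ (lamExp N s q A / (2 * s)) * g ^ ((N + 2 * s) / (2 * s))))) →
      ∀ᵐ z ∂((volume : Measure (RN N × ℝ)).restrict (Metric.ball x₀ R ×ˢ Ioo (a + g) b)),
        u z.1 z.2 ≤ 3 * k * barrier s q x₀ R z.1 := by
  obtain ⟨C, hC, hstep⟩ := exists_levelMass_step hN hs0 hs1 hq hL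
  have hN0 : (0 : ℝ) < N := by exact_mod_cast (by omega : 0 < N)
  set m := mExp N s q with hmdef
  have hmA : 0 < A - m := by linarith
  -- The interpolation parameter with `q + 1 = (1 - θ) m + θ A`.
  set θ : ℝ := (q + 1 - m) / (A - m) with hθ
  have hθ0 : 0 ≤ θ := div_nonneg (by linarith) hmA.le
  have hθ1 : 1 - θ = (A - q - 1) / (A - m) := by rw [hθ]; field_simp; ring
  have hθ1' : 0 < 1 - θ := by rw [hθ1]; exact div_pos (by linarith) hmA
  set α : ℝ := (1 + 2 * s / N) * (1 - θ) - 1 with hα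
  -- The recursion has exponent `(1 + 2s / N) (1 - θ) = 1 + α`, and `α = Λ_A / (N (A - m))`. It is
  -- superlinear precisely because `Λ_A > 0`.
  have hα0 : 0 < α := by
    have : α = lamExp N s q A / (N * (A - m)) := by
      rw [hα, hθ1]
      have e : (1 + 2 * s / N) * ((A - q - 1) / (A - m)) - 1 =
          ((N + 2 * s) * (A - q - 1) - N * (A - m)) / (N * (A - m)) := by
        field_simp
      rw [e, hmdef, mExp_eq hN, lamExp]
      congr 1
      field_simp
      ring
    rw [this]; positivity
  have hαθ : α + θ = 2 * s / N * (1 - θ) := by rw [hα]; ring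
  have hαθ0 : 0 < α + θ := by linarith
  set B : ℝ := (2 ^ (m + (1 + 2 * s / N))) ^ (1 - θ) with hB
  have hm0 : 0 < m := by rw [hmdef, mExp_eq hN]; positivity
  have hB1 : 1 < B := Real.one_lt_rpow (Real.one_lt_rpow (by norm_num) (by positivity)) hθ1'
  have hB0 : 0 < B := by linarith
  set c : ℝ := (C ^ (1 - θ) * B ^ (1 / α)) ^ (-(1 / (α + θ))) with hc
  have hc0 : 0 < c := by positivity
  refine ⟨c, hc0, fun x₀ R a b K u h hR k g hk hg hgb hgR htail hU => ?_⟩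
  set U : ℝ := c * (k ^ (lamExp N s q A / (2 * s)) * g ^ ((N + 2 * s) / (2 * s))) with hUdef
  have hU0 : 0 < U := by positivity
  set D : ℝ := C ^ (1 - θ) * g ^ (-(1 + α)) * U ^ θ with hD
  have hsmall : D * (k ^ (q + 1 - A) * U) ^ α * B ^ (1 / α) ≤ 1 := by
    have e1 : c ^ (α + θ) = (C ^ (1 - θ) * B ^ (1 / α))⁻¹ := by
      rw [hc, ← Real.rpow_mul (by positivity), neg_mul, one_div_mul_cancel hαθ0.ne',
        Real.rpow_neg_one]
    have e2 : U ^ (α + θ) = c ^ (α + θ) * k ^ (lamExp N s q A / (2 * s) * (α + θ)) *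
        g ^ ((N + 2 * s) / (2 * s) * (α + θ)) := by
      rw [hUdef, Real.mul_rpow hc0.le (by positivity), Real.mul_rpow (by positivity)
        (by positivity), ← Real.rpow_mul hk.le, ← Real.rpow_mul hg.le]
      ring
    have e3 : k ^ ((q + 1 - A) * α) * k ^ (lamExp N s q A / (2 * s) * (α + θ)) = 1 := by
      rw [← Real.rpow_add hk]
      refine (congrArg _ ?_).trans (Real.rpow_zero _)
      rw [hαθ, hα, hθ1]
      have hm' : m = 2 + 2 * s * (q + 1) / N := by rw [hmdef, mExp_eq hN]
      have hmA' : A - m ≠ 0 := hmA.ne'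
      have hmN : m * N = 2 * N + 2 * s * (q + 1) := by rw [hm']; field_simp
      rw [lamExp]
      field_simp
      linear_combination (-(A - q - 1)) * hmN
    have e4 : g ^ (-(1 + α)) * g ^ ((N + 2 * s) / (2 * s) * (α + θ)) = 1 := by
      rw [← Real.rpow_add hg]
      refine (congrArg _ ?_).trans (Real.rpow_zero _)
      rw [hαθ, hα]
      field_simp
      ring
    refine le_of_eq ?_
    rw [hD, Real.mul_rpow (by positivity) hU0.le, ← Real.rpow_mul hk.le]
    calc _ = (k ^ ((q + 1 - A) * α) * (C ^ (1 - θ) * B ^ (1 / α)) * g ^ (-(1 + α))) *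
          (U ^ α * U ^ θ) := by ring
      _ = (k ^ ((q + 1 - A) * α) * k ^ (lamExp N s q A / (2 * s) * (α + θ))) *
          (g ^ (-(1 + α)) * g ^ ((N + 2 * s) / (2 * s) * (α + θ))) *
          ((C ^ (1 - θ) * B ^ (1 / α)) * (C ^ (1 - θ) * B ^ (1 / α))⁻¹) := by
          rw [← Real.rpow_add hU0, e2, e1]; ring
      _ = 1 := by rw [e3, e4, mul_inv_cancel₀ (by positivity)]; norm_num
  -- The `A` mass is bounded uniformly in `j` and does not decay; it enters the recursion only
  -- through the constant `U ^ θ`.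
  have hle : ∀ j, levelMass s q L x₀ R a b u k g A j ≤ ENNReal.ofReal U := fun j =>
    (levelMass_le_lintegral hg j).trans hU
  have h0 : levelMass s q L x₀ R a b u k g (q + 1) 0 ≤ ENNReal.ofReal (k ^ (q + 1 - A) * U) := by
    refine (levelMass_le_mul hq hs0 hN hL hR h hk hg hA.le 0).trans ?_
    rw [ENNReal.ofReal_mul (by positivity)]
    exact mul_le_mul_right (hle 0) _
  have hgeo := le_of_superlinear_recursion (Z := levelMass s q L x₀ R a b u k g (q + 1))
    (D := D) (B := B) (α := α) (by positivity) hB0 hα0 (by positivity) h0 (fun j z hz hZ => ?_)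
    hsmall
  · refine ae_le_of_levelMass_le h hq hL hR hk hg htail (c := k ^ (q + 1 - A) * U)
      (β := B ^ (-(1 / α))) (by positivity) (Real.rpow_lt_one_of_one_lt_of_neg hB1 ?_) hgeo
    rw [neg_lt_zero]; positivity
  · have hexp : q + 1 = (1 - θ) * m + θ * A := by
      rw [hθ]; field_simp; ring
    have hint := levelMass_interpolate h (k := k) (g := g) (p₀ := m) (p₁ := A) hθ0
      (by linarith) (by rw [← hexp]; linarith) (j + 1)
    rw [← hexp] at hint
    refine hint.trans ?_
    have hst := hstep x₀ R a b K u h hR k g hk hg hgb hgR htail j z hz hZ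
    refine (mul_le_mul' (ENNReal.rpow_le_rpow hst hθ1'.le)
      (ENNReal.rpow_le_rpow (hle (j + 1)) hθ0)).trans ?_
    rw [ENNReal.ofReal_rpow_of_pos (by positivity), ENNReal.ofReal_rpow_of_pos hU0,
      ← ENNReal.ofReal_mul (by positivity)]
    refine le_of_eq ?_
    congr 1
    have e1 : (((2 : ℝ) ^ (m + (1 + 2 * s / N))) ^ j) ^ (1 - θ) = B ^ j := by
      exact (Real.rpow_pow_comm (by positivity) _ _).symm
    have e2 : ((z / g) ^ (1 + 2 * s / N)) ^ (1 - θ) = z ^ (1 + α) * g ^ (-(1 + α)) := by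
      rw [← Real.rpow_mul (by positivity), Real.div_rpow hz.le hg.le, Real.rpow_neg hg.le,
        show (1 + 2 * s / N) * (1 - θ) = 1 + α by rw [hα]; ring]
      ring
    have hzg : 0 ≤ z / g := by positivity
    rw [Real.mul_rpow (by positivity) (by positivity), Real.mul_rpow hC.le (by positivity), e1, e2, hD]
    ring

end

/-! ### From weak sub-solutions to Borel representatives in cylinders. -/

lemma ae_ae_of_ae_restrict_univ_prod {X : Type*} [MeasureSpace X] [SFinite (volume : Measure X)]
    {J : Set ℝ} {p : X × ℝ → Prop}
    (h : ∀ᵐ z ∂((volume : Measure (X × ℝ)).restrict (univ ×ˢ J)), p z) :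
    ∀ᵐ t ∂(volume.restrict J), ∀ᵐ x : X, p (x, t) := by
  rw [Measure.volume_eq_prod, ← Measure.prod_restrict, Measure.restrict_univ] at h
  exact Measure.ae_ae_of_ae_prod (Measure.measurePreserving_swap.quasiMeasurePreserving.ae h)

/-- A Borel, everywhere nonnegative representative. -/
lemma exists_measurable_nonneg_representative {N : ℕ} {T : ℝ} {u : RN N → ℝ → ℝ}
    (hu : AEMeasurable (fun z : RN N × ℝ => u z.1 z.2) (volume.restrict (univ ×ˢ Ioc 0 T)))
    (h0 : IsNonneg T u) :
    ∃ w : RN N → ℝ → ℝ, Measurable (fun z : RN N × ℝ => w z.1 z.2) ∧ (∀ x t, 0 ≤ w x t) ∧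
      ∀ᵐ z ∂((volume : Measure (RN N × ℝ)).restrict (univ ×ˢ Ioc 0 T)), w z.1 z.2 = u z.1 z.2 := by
  refine ⟨fun x t => max (hu.mk _ (x, t)) 0, hu.measurable_mk.max measurable_const,
    fun x t => le_max_right _ _, ?_⟩
  filter_upwards [hu.ae_eq_mk, h0] with z h1 h2
  rw [← h1, max_eq_left h2]

lemma ae_fst_ne_snd {N : ℕ} (hN : 2 ≤ N) : ∀ᵐ p : RN N × RN N, p.1 ≠ p.2 := by
  have : Nonempty (Fin N) := ⟨⟨0, by omega⟩⟩
  have hm : MeasurableSet {p : RN N × RN N | p.1 ≠ p.2} :=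
    (measurableSet_eq_fun measurable_fst measurable_snd).compl
  rw [Measure.volume_eq_prod, Measure.ae_prod_iff_ae_ae hm]
  refine Eventually.of_forall fun x => ?_
  filter_upwards [compl_mem_ae_iff.2 (measure_singleton x)] with y hy h
  exact hy h.symm

/-- A Borel representative of the kernel that satisfies the bounds everywhere. -/
lemma exists_kernel_representative {N : ℕ} (hN : 2 ≤ N) {s L T : ℝ} (hL : 1 ≤ L)
    {K : RN N → RN N → ℝ → ℝ} (hK : IsKernel s L T K) :
    ∃ K' : RN N × RN N → ℝ → ℝ, Measurable (fun z : (RN N × RN N) × ℝ => K' z.1 z.2) ∧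
      (∀ p t, L⁻¹ * kern s p.1 p.2 ≤ K' p t) ∧ (∀ p t, K' p t ≤ L * kern s p.1 p.2) ∧
      ∀ᵐ t ∂(volume.restrict (Ioc 0 T)), ∀ᵐ p : RN N × RN N, K' p t = K p.1 p.2 t := by
  have hm := hK.aemeasurable
  have hL1 : L⁻¹ ≤ L := (inv_le_one_of_one_le₀ hL).trans hL
  -- A Borel version is clamped between the two bounds. Off the diagonal, a null set, the original
  -- kernel satisfies them, so clamping changes nothing almost everywhere.
  refine ⟨fun p t => max (L⁻¹ * kern s p.1 p.2) (min (L * kern s p.1 p.2) (hm.mk _ (p, t))), ?_,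
    fun p t => le_max_left _ _, fun p t => max_le ?_ (min_le_left _ _), ?_⟩
  · have := hm.measurable_mk
    have h1 : Measurable fun z : (RN N × RN N) × ℝ => kern s z.1.1 z.1.2 := by fun_prop
    exact (h1.const_mul _).max ((h1.const_mul _).min this)
  · exact mul_le_mul_of_nonneg_right hL1 (kern_nonneg _ _)
  · filter_upwards [ae_ae_of_ae_restrict_univ_prod hm.ae_eq_mk, ae_restrict_mem measurableSet_Ioc]
      with t ht hmem
    filter_upwards [ht, ae_fst_ne_snd hN] with p hp hne
    have h1 := hK.lower t hmem p.1 p.2 hne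
    have h2 := hK.upper t hmem p.1 p.2 hne
    rw [← hp]
    have e1 : L⁻¹ * kern s p.1 p.2 = L⁻¹ / ‖p.1 - p.2‖ ^ ((N : ℝ) + 2 * s) := by
      rw [kern, mul_one_div]
    have e2 : L * kern s p.1 p.2 = L / ‖p.1 - p.2‖ ^ ((N : ℝ) + 2 * s) := by
      rw [kern, mul_one_div]
    rw [e1, e2, min_eq_right h2, max_eq_right h1]

lemma eLpNorm_rpow_eq_lintegral {α : Type*} [MeasurableSpace α] {μ : Measure α} {f : α → ℝ} {p : ℝ}
    (hp : 0 < p) :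
    eLpNorm f (ENNReal.ofReal p) μ ^ p = ∫⁻ x, ENNReal.ofReal (|f x| ^ p) ∂μ := by
  rw [eLpNorm_eq_lintegral_rpow_enorm_toReal (by simpa using hp) ENNReal.ofReal_ne_top,
    ENNReal.toReal_ofReal hp.le, ← ENNReal.rpow_mul, one_div_mul_cancel hp.ne', ENNReal.rpow_one]
  refine lintegral_congr fun x => ?_
  rw [← ofReal_norm, ENNReal.ofReal_rpow_of_nonneg (norm_nonneg _) hp.le, Real.norm_eq_abs]

/-- Continuity bounds the norm near each time, and finitely many such neighbourhoods cover the
compact interval. -/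
lemma MemCLocLp.exists_bound {N : ℕ} {p : ℝ} (hp : 1 ≤ p) {Ω : Set (RN N)} {T : ℝ}
    {u : RN N → ℝ → ℝ} (h : MemCLocLp p Ω T u) {U : Set (RN N)} (hU : IsOpen U)
    (hUΩ : CompactlyContained U Ω) {t₁ t₂ : ℝ} (h1 : 0 < t₁) (h2 : t₂ ≤ T) :
    ∃ C : ℝ≥0∞, C ≠ ⊤ ∧ ∀ t ∈ Icc t₁ t₂,
      eLpNorm (fun x => u x t) (ENNReal.ofReal p) (volume.restrict U) ≤ C := by
  obtain ⟨hmem, hcont⟩ := h U hU hUΩ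
  have hp1 : 1 ≤ ENNReal.ofReal p := by simpa using ENNReal.ofReal_le_ofReal hp
  have hsub : Icc t₁ t₂ ⊆ Ioc 0 T := fun t ht => ⟨h1.trans_le ht.1, ht.2.trans h2⟩
  refine isCompact_Icc.induction_on (p := fun S => ∃ C : ℝ≥0∞, C ≠ ⊤ ∧ ∀ t ∈ S,
    eLpNorm (fun x => u x t) (ENNReal.ofReal p) (volume.restrict U) ≤ C) ⟨0, by simp, by simp⟩
    (fun S S' hS ⟨C, hC, hC'⟩ => ⟨C, hC, fun t ht => hC' t (hS ht)⟩)
    (fun S S' ⟨C, hC, hC'⟩ ⟨D, hD, hD'⟩ => ⟨C + D, ENNReal.add_ne_top.2 ⟨hC, hD⟩, fun t ht => ?_⟩)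
    fun τ hτ => ?_
  · rcases ht with ht | ht
    · exact (hC' t ht).trans le_self_add
    · exact (hD' t ht).trans le_add_self
  · have hev := (hcont τ (hsub hτ)).eventually (gt_mem_nhds (zero_lt_one' ℝ≥0∞))
    refine ⟨_, nhdsWithin_mono τ hsub (hev.and self_mem_nhdsWithin),
      1 + eLpNorm (fun x => u x τ) (ENNReal.ofReal p) (volume.restrict U),
      ENNReal.add_ne_top.2 ⟨by simp, (hmem τ (hsub hτ)).2.ne⟩, fun t ht => ?_⟩
    have e : (fun x => u x t) = (fun x => u x t - u x τ) + fun x => u x τ := by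
      ext x; simp
    rw [e]
    refine (eLpNorm_add_le (((hmem t ht.2).1.sub (hmem τ (hsub hτ)).1)) (hmem τ (hsub hτ)).1
      hp1).trans (add_le_add (le_of_lt ht.1) le_rfl)

/-- Time-independent test functions. -/
lemma isTest_const {N : ℕ} {s q T : ℝ} (hq : 1 < q) {U : Set (RN N)}
    (hUm : MeasurableSet U) (hUv : volume U ≠ ⊤) {φ : RN N → ℝ} (hφ : Measurable φ)
    (hφ0 : ∀ x, 0 ≤ φ x) (hφU : ∀ x, x ∉ U → φ x = 0)
    (hφp : ∫⁻ x, ENNReal.ofReal (φ x ^ (q + 1)) ≠ ⊤)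
    (hφE : ∫⁻ p : RN N × RN N, ENNReal.ofReal ((φ p.1 - φ p.2) ^ 2 * kern s p.1 p.2) ≠ ⊤) :
    IsTest s q U T (fun x _ => φ x) fun _ _ => 0 where
  aemeasurable := (hφ.comp measurable_fst).aemeasurable
  nonneg _ _ x := hφ0 x
  zero_outside _ _ x hx := hφU x hx
  sobolev t₁ t₂ _ _ _ := by
    have hfin : sobolevSq s univ φ ≠ ⊤ := by
      refine ENNReal.add_ne_top.2 ⟨?_, ?_⟩
      -- The exponent `q + 1` exceeds `2` and `U` has finite measure, so square integrability
      -- follows from the `L^(q+1)` bound.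
      · have hle : ∀ x, ENNReal.ofReal (|φ x| ^ 2) ≤
            U.indicator 1 x + ENNReal.ofReal (φ x ^ (q + 1)) := by
          intro x
          by_cases hx : x ∈ U
          · rw [indicator_of_mem hx, Pi.one_apply, ← ENNReal.ofReal_one, ← ENNReal.ofReal_add
              zero_le_one (Real.rpow_nonneg (hφ0 x) _)]
            refine ENNReal.ofReal_le_ofReal ?_
            rw [sq_abs]
            rcases le_total (φ x) 1 with h1 | h1
            · have := Real.rpow_nonneg (hφ0 x) (q + 1)
              nlinarith [hφ0 x]
            · have : φ x ^ (2 : ℝ) ≤ φ x ^ (q + 1) :=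
                Real.rpow_le_rpow_of_exponent_le h1 (by linarith)
              rw [Real.rpow_two] at this
              linarith
          · rw [hφU x hx]; simp
        rw [Measure.restrict_univ]
        refine ne_top_of_le_ne_top ?_ (lintegral_mono hle)
        rw [lintegral_add_left (measurable_one.indicator hUm), lintegral_indicator_one hUm]
        exact ENNReal.add_ne_top.2 ⟨hUv, hφp⟩
      · rw [univ_prod_univ, Measure.restrict_univ]
        convert hφE using 4 with p
        rw [sq_abs, kern, mul_one_div]
    rw [lintegral_const]
    exact (ENNReal.mul_ne_top hfin (by simp)).lt_top
  memLp t₁ t₂ _ _ _ := by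
    have h1 : MemLp φ (ENNReal.ofReal (q + 1)) (volume.restrict U) := by
      refine ⟨hφ.aestronglyMeasurable, ?_⟩
      rw [lt_top_iff_ne_top]
      intro htop
      have := eLpNorm_rpow_eq_lintegral (f := φ) (μ := volume.restrict U)
        (by linarith : 0 < q + 1)
      rw [htop, ENNReal.top_rpow_of_pos (by linarith)] at this
      refine hφp (top_le_iff.1 (this.le.trans ((setLIntegral_le_lintegral _ _).trans (le_of_eq ?_))))
      exact lintegral_congr fun x => by rw [abs_of_nonneg (hφ0 x)]
    rw [Measure.volume_eq_prod, ← Measure.prod_restrict]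
    exact h1.comp_fst _
  memLp_deriv _ _ _ _ _ := MemLp.zero'
  deriv _ _ _ _ _ := by simp

/-- The weight centred at `x₀` is bounded by a multiple of the one centred at the origin. In the
constant `C` the first summand absorbs the `1` and the second the power of `‖x‖`. -/
lemma lintegral_weightedTail_ne_top {N : ℕ} {s : ℝ} (hs0 : 0 < s) {w : RN N → ℝ → ℝ}
    (hw : Measurable fun z : RN N × ℝ => w z.1 z.2) (hw0 : ∀ x t, 0 ≤ w x t) {t₁ t₂ : ℝ}
    (hint : IntegrableOn (fun z : RN N × ℝ => w z.1 z.2 / (1 + ‖z.1‖ ^ ((N : ℝ) + 2 * s)))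
      (univ ×ˢ Icc t₁ t₂)) {x₀ : RN N} {R : ℝ} (hR : 0 < R) :
    ∫⁻ t in Icc t₁ t₂, weightedTail s x₀ R (fun y => w y t) ≠ ⊤ := by
  set γ : ℝ := (N : ℝ) + 2 * s with hγ
  have hγ0 : 0 < γ := by positivity
  set C : ℝ := R ^ (-γ) + (1 + ‖x₀‖ / R) ^ γ with hC
  have hfin : ∫⁻ z in univ ×ˢ Icc t₁ t₂, ENNReal.ofReal (w z.1 z.2 / (1 + ‖z.1‖ ^ γ)) ≠ ⊤ :=
    hint.lintegral_lt_top.ne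
  have hm : Measurable fun z : RN N × ℝ => ENNReal.ofReal (w z.1 z.2 / (R + ‖z.1 - x₀‖) ^ γ) :=
    (hw.div (by fun_prop)).ennreal_ofReal
  have heq : ∫⁻ t in Icc t₁ t₂, weightedTail s x₀ R (fun y => w y t) =
      ∫⁻ z in univ ×ˢ Icc t₁ t₂, ENNReal.ofReal (w z.1 z.2 / (R + ‖z.1 - x₀‖) ^ γ) := by
    rw [Measure.volume_eq_prod, ← Measure.prod_restrict, Measure.restrict_univ,
      lintegral_prod_symm _ hm.aemeasurable]
    rfl
  rw [heq]
  refine ne_top_of_le_ne_top (ENNReal.mul_ne_top (ENNReal.ofReal_ne_top (r := C)) hfin) ?_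
  rw [← lintegral_const_mul' _ _ ENNReal.ofReal_ne_top]
  refine lintegral_mono fun z => ?_
  rw [← ENNReal.ofReal_mul (by positivity)]
  refine ENNReal.ofReal_le_ofReal ?_
  have hd : 0 ≤ ‖z.1 - x₀‖ := norm_nonneg _
  have hx : ‖z.1‖ ≤ (1 + ‖x₀‖ / R) * (R + ‖z.1 - x₀‖) := by
    have h1 : ‖z.1‖ ≤ ‖z.1 - x₀‖ + ‖x₀‖ := by simpa using norm_add_le (z.1 - x₀) x₀
    have h2 : (1 + ‖x₀‖ / R) * (R + ‖z.1 - x₀‖) =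
        R + ‖z.1 - x₀‖ + ‖x₀‖ + ‖x₀‖ / R * ‖z.1 - x₀‖ := by field_simp; ring
    have h3 : 0 ≤ ‖x₀‖ / R * ‖z.1 - x₀‖ := by positivity
    linarith
  have h1 : ‖z.1‖ ^ γ ≤ (1 + ‖x₀‖ / R) ^ γ * (R + ‖z.1 - x₀‖) ^ γ := by
    rw [← Real.mul_rpow (by positivity) (by positivity)]
    exact Real.rpow_le_rpow (norm_nonneg _) hx hγ0.le
  have h2 : 1 ≤ R ^ (-γ) * (R + ‖z.1 - x₀‖) ^ γ := by
    calc (1 : ℝ) = R ^ (-γ) * R ^ γ := by rw [← Real.rpow_add hR]; simp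
      _ ≤ _ := by gcongr; linarith
  have h3 : 1 + ‖z.1‖ ^ γ ≤ C * (R + ‖z.1 - x₀‖) ^ γ := by rw [hC, add_mul]; linarith
  rw [div_le_iff₀ (by positivity), ← mul_div_assoc, div_mul_eq_mul_div, le_div_iff₀ (by positivity)]
  calc w z.1 z.2 * (1 + ‖z.1‖ ^ γ) ≤ w z.1 z.2 * (C * (R + ‖z.1 - x₀‖) ^ γ) :=
        mul_le_mul_of_nonneg_left h3 (hw0 _ _)
    _ = _ := by ring

/-- Weak sub-solutions are sub-solutions in cylinders, for Borel representatives. -/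
lemma cylinderSubsolution_of_isWeakSubsolution {N : ℕ} {s q L : ℝ} (hs0 : 0 < s)
    (hq : 1 < q) {Ω : Set (RN N)} {T : ℝ} {K : RN N → RN N → ℝ → ℝ}
    {u : RN N → ℝ → ℝ} (hsub : IsWeakSubsolution s q K Ω T u)
    {w : RN N → ℝ → ℝ} (hw : Measurable fun z : RN N × ℝ => w z.1 z.2) (hw0 : ∀ x t, 0 ≤ w x t)
    (hwu : ∀ᵐ z ∂((volume : Measure (RN N × ℝ)).restrict (univ ×ˢ Ioc 0 T)),
      w z.1 z.2 = u z.1 z.2)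
    {K' : RN N × RN N → ℝ → ℝ} (hKm : Measurable fun z : (RN N × RN N) × ℝ => K' z.1 z.2)
    (hKl : ∀ p t, L⁻¹ * kern s p.1 p.2 ≤ K' p t) (hKu : ∀ p t, K' p t ≤ L * kern s p.1 p.2)
    (hKK : ∀ᵐ t ∂(volume.restrict (Ioc 0 T)), ∀ᵐ p : RN N × RN N, K' p t = K p.1 p.2 t)
    {x₀ : RN N} {R a b : ℝ} (hR : 0 < R) (ha : 0 < a) (hab : a < b) (hb : b ≤ T)
    (hΩ : Metric.closedBall x₀ R ⊆ Ω) : CylinderSubsolution s q L x₀ R a b K' w := by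
  set U := Metric.ball x₀ R with hU
  have hUo : IsOpen U := Metric.isOpen_ball
  have hUm : MeasurableSet U := hUo.measurableSet
  have hUΩ : CompactlyContained U Ω := by
    rw [CompactlyContained, hU, closure_ball x₀ hR.ne']
    exact ⟨isCompact_closedBall _ _, hΩ⟩
  have hsl := ae_ae_of_ae_restrict_univ_prod hwu
  have hIoo : Ioo a b ⊆ Ioc 0 T := fun t ht => ⟨ha.trans ht.1, ht.2.le.trans hb⟩
  have hIcc : Icc a b ⊆ Ioc 0 T := fun t ht => ⟨ha.trans_le ht.1, ht.2.trans hb⟩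
  have hq1 : 0 < q + 1 := by linarith
  have hpair : ∀ t, (∀ᵐ x, w x t = u x t) →
      ∀ᵐ p : RN N × RN N, w p.1 t = u p.1 t ∧ w p.2 t = u p.2 t := by
    intro t ht
    exact (Measure.quasiMeasurePreserving_fst.ae ht).and (Measure.quasiMeasurePreserving_snd.ae ht)
  refine ⟨hw, hw0, hKm, hKl, hKu, ?_, ?_, ?_, ?_⟩
  · obtain ⟨C, hC, hCb⟩ := hsub.continuous.exists_bound (by linarith) hUo hUΩ ha hb
    refine ⟨C ^ (q + 1), ENNReal.rpow_ne_top_of_nonneg hq1.le hC, ?_⟩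
    filter_upwards [ae_restrict_of_ae_restrict_of_subset hIoo hsl,
      ae_restrict_mem measurableSet_Ioo] with t ht hmem
    refine le_trans (le_of_eq ?_) (ENNReal.rpow_le_rpow (hCb t ⟨hmem.1.le, hmem.2.le⟩) hq1.le)
    rw [eLpNorm_rpow_eq_lintegral hq1]
    refine lintegral_congr_ae ((ae_restrict_of_ae ht).mono fun x hx => ?_)
    simp only
    rw [← hx, abs_of_nonneg (hw0 x t)]
  · refine ne_top_of_le_ne_top (hsub.sobolev U hUo hUΩ a b ha hab hb).ne ?_
    refine le_trans ?_ (lintegral_mono_set Ioo_subset_Icc_self)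
    refine lintegral_mono_ae ((ae_restrict_of_ae_restrict_of_subset hIoo hsl).mono fun t ht => ?_)
    refine le_trans (le_of_eq ?_) le_add_self
    refine lintegral_congr_ae ((ae_restrict_of_ae (hpair t ht)).mono fun p hp => ?_)
    simp only
    rw [hp.1, hp.2, sq_abs, kern, mul_one_div]
  · refine ne_top_of_le_ne_top (lintegral_weightedTail_ne_top hs0 hw hw0 (t₁ := a) (t₂ := b) ?_ hR)
      (lintegral_mono_set Ioo_subset_Icc_self)
    refine (hsub.tail a b ha hab hb).congr ?_
    refine (ae_restrict_of_ae_restrict_of_subset (prod_mono le_rfl hIcc) hwu).mono fun z hz => ?_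
    simp only
    rw [← hz, abs_of_nonneg (hw0 _ _)]
  -- The weak inequality holds at all times for `u`, but `w` represents `u` only on almost every
  -- slice.
  · refine ⟨{t | ∀ᵐ x, w x t = u x t}, ae_restrict_of_ae_restrict_of_subset hIoo hsl, ?_⟩
    intro t₁ h1 t₂ h2 ha1 h12 h2b φ hφ hφ0 hφU hφp hφE
    have hweak := hsub.weak t₁ t₂ (ha.trans ha1) h12 (h2b.le.trans hb) U hUo hUΩ _ _
      (isTest_const (T := T) hq hUm Metric.isBounded_ball.measure_lt_top.ne hφ hφ0 hφU hφp hφE)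
    have hslice : ∀ t, Measurable fun x => w x t := fun t => hw.comp measurable_prodMk_right
    have hpow : ∀ t, (∀ᵐ x, w x t = u x t) → ∫ x in U, |u x t| ^ (q - 1) * u x t * φ x =
        ∫ x in U, w x t ^ q * φ x := by
      intro t ht
      refine integral_congr_ae ((ae_restrict_of_ae ht).mono fun x hx => ?_)
      simp only
      rw [← hx, abs_of_nonneg (hw0 x t), ← Real.rpow_add_one' (hw0 x t) (by linarith)]
      simp
    have hmass : ∀ t, t ∈ Ioc 0 T → (∀ᵐ x, w x t = u x t) →
        IntegrableOn (fun x => w x t ^ q * φ x) U := by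
      intro t hmem ht
      have hwt := hslice t
      refine integrableOn_of_lintegral_ne_top (by fun_prop)
        (fun x => mul_nonneg (Real.rpow_nonneg (hw0 x t) _) (hφ0 x)) ?_
      have hfin : ∫⁻ x in U, ENNReal.ofReal (w x t ^ (q + 1)) ≠ ⊤ := by
        have h3 := ((hsub.continuous U hUo hUΩ).1 t hmem).2.ne
        have h4 := eLpNorm_rpow_eq_lintegral (f := fun x => u x t) (μ := volume.restrict U) hq1
        refine ne_top_of_le_ne_top (ENNReal.rpow_ne_top_of_nonneg hq1.le h3) (le_of_eq ?_)
        rw [h4]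
        refine lintegral_congr_ae ((ae_restrict_of_ae ht).mono fun x hx => ?_)
        simp only
        rw [← hx, abs_of_nonneg (hw0 x t)]
      have hle : ∀ x, ENNReal.ofReal (w x t ^ q * φ x) ≤
          ENNReal.ofReal (φ x ^ (q + 1)) + ENNReal.ofReal (w x t ^ (q + 1)) := by
        intro x
        rw [← ENNReal.ofReal_add (Real.rpow_nonneg (hφ0 x) _) (Real.rpow_nonneg (hw0 x t) _), mul_comm]
        exact ENNReal.ofReal_le_ofReal (mul_rpow_le_add hq (hφ0 x) (hw0 x t))
      refine ne_top_of_le_ne_top ?_ (lintegral_mono hle)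
      rw [lintegral_add_left (by fun_prop)]
      exact ENNReal.add_ne_top.2 ⟨ne_top_of_le_ne_top hφp (setLIntegral_le_lintegral _ _), hfin⟩
    have m1 : t₁ ∈ Ioc 0 T := hIoo ⟨ha1, h12.trans h2b⟩
    have m2 : t₂ ∈ Ioc 0 T := hIoo ⟨ha1.trans h12, h2b⟩
    have hform : (∫ t in t₁..t₂, ∫ p : RN N × RN N,
        (u p.1 t - u p.2 t) * (φ p.1 - φ p.2) * K p.1 p.2 t) =
        ∫ t in t₁..t₂, ∫ p : RN N × RN N, (w p.1 t - w p.2 t) * (φ p.1 - φ p.2) * K' p t := by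
      rw [intervalIntegral.integral_of_le h12.le, intervalIntegral.integral_of_le h12.le]
      have hI : Ioc t₁ t₂ ⊆ Ioc 0 T := Ioc_subset_Ioc m1.1.le m2.2
      refine integral_congr_ae ?_
      filter_upwards [ae_restrict_of_ae_restrict_of_subset hI hsl,
        ae_restrict_of_ae_restrict_of_subset hI hKK] with t ht hKt
      refine integral_congr_ae ?_
      filter_upwards [hpair t ht, hKt] with p hp hKp
      rw [hp.1, hp.2, hKp]
    have hsplit : ∫ x in U, (w x t₂ ^ q - w x t₁ ^ q) * φ x =
        (∫ x in U, w x t₂ ^ q * φ x) - ∫ x in U, w x t₁ ^ q * φ x := by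
      rw [← integral_sub (hmass t₂ m2 h2) (hmass t₁ m1 h1)]
      simp only [sub_mul]
    rw [hpow t₁ h1, hpow t₂ h2, hform] at hweak
    simp only [mul_zero, integral_zero, intervalIntegral.integral_zero, sub_zero] at hweak
    rw [hsplit]
    exact hweak

/-- Higher integrability in the interior. -/
lemma CylinderSubsolution.lintegral_mExp_ne_top {N : ℕ} (hN : 2 ≤ N) {s q L : ℝ} (hs0 : 0 < s)
    (hq : 1 < q) {x₀ : RN N} {R a b : ℝ} {K : RN N × RN N → ℝ → ℝ} {u : RN N → ℝ → ℝ}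
    (h : CylinderSubsolution s q L x₀ R a b K u) {ρ : ℝ} (hρ : ρ < R) :
    ∫⁻ t in Ioo a b, ∫⁻ x in Metric.ball x₀ ρ, ENNReal.ofReal (u x t ^ mExp N s q) ≠ ⊤ := by
  obtain ⟨C, hC, hsup⟩ := h.sup_bound
  set I : ℝ := C.toReal + 1 with hI
  have hI0 : 0 < I := by positivity
  have hCI : C ≤ ENNReal.ofReal I := by
    rw [hI, ENNReal.ofReal_add ENNReal.toReal_nonneg zero_le_one, ENNReal.ofReal_toReal hC]
    exact le_self_add
  have hE : ∫⁻ t in Ioo a b, ∫⁻ x in Metric.ball x₀ R, ∫⁻ y in Metric.ball x₀ R,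
      ENNReal.ofReal (|u x t - u y t| ^ 2 / ‖x - y‖ ^ ((N : ℝ) + 2 * s)) ≠ ⊤ := by
    refine ne_top_of_le_ne_top h.energy (le_of_eq (lintegral_congr fun t => ?_))
    have hu := h.measurable_slice t
    rw [Measure.volume_eq_prod, ← Measure.prod_restrict, lintegral_prod _ (by fun_prop)]
    refine lintegral_congr fun x => lintegral_congr fun y => ?_
    rw [sq_abs, kern, mul_one_div]
  set c₁ := ENNReal.ofReal (gnConst N s (q + 1) * I ^ (2 * s / N))
  set c₂ := ENNReal.ofReal ((2 ^ (q + 1 + 1) * I / (unitVol N * (R - ρ) ^ N)) ^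
    ((2 + 2 * s * (q + 1) / N) / (q + 1))) * volume (Metric.ball x₀ ρ)
  have hc₂ : c₂ ≠ ⊤ := ENNReal.mul_ne_top ENNReal.ofReal_ne_top Metric.isBounded_ball.measure_lt_top.ne
  refine ne_top_of_le_ne_top (b := c₁ * (∫⁻ t in Ioo a b, ∫⁻ x in Metric.ball x₀ R,
      ∫⁻ y in Metric.ball x₀ R, ENNReal.ofReal (|u x t - u y t| ^ 2 /
        ‖x - y‖ ^ ((N : ℝ) + 2 * s))) + c₂ * volume (Ioo a b)) ?_ ?_
  · exact ENNReal.add_ne_top.2 ⟨ENNReal.mul_ne_top ENNReal.ofReal_ne_top hE,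
      ENNReal.mul_ne_top hc₂ (by simp)⟩
  · rw [← lintegral_const_mul' _ _ ENNReal.ofReal_ne_top, ← setLIntegral_const,
      ← lintegral_add_right _ measurable_const]
    refine lintegral_mono_ae ?_
    filter_upwards [hsup] with t ht
    rw [mExp_eq hN]
    exact lintegral_rpow_ball_le hN hs0 (by linarith) (h.measurable_slice t)
      (fun x => h.nonneg x t) hI0 hρ (ht.trans hCI)

/-! ### Scale-invariant estimates and interpolation between cylinders. -/

/-- Interpolation along an increasing family of sets. -/
lemma ae_le_of_sublinear_iteration {X : Type*} [MeasurableSpace X] {μ : Measure X} {f : X → ℝ}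
    {Q : ℕ → Set X} {S D B δ : ℝ} (hS : 0 < S) (hD : 1 ≤ D) (hB : 1 ≤ B) (hδ0 : 0 < δ)
    (hδ1 : δ < 1)
    (hstep : ∀ i : ℕ, ∀ y : ℝ, 1 ≤ y → (∀ᵐ z ∂(μ.restrict (Q (i + 1))), f z ≤ S * y) →
      ∀ᵐ z ∂(μ.restrict (Q i)), f z ≤ S * (D * B ^ i * y ^ δ))
    (hbd : ∃ y : ℝ, 1 ≤ y ∧ ∀ i : ℕ, ∀ᵐ z ∂(μ.restrict (Q i)), f z ≤ S * y) :
    ∀ᵐ z ∂(μ.restrict (Q 0)), f z ≤ S * (D * (B ^ (1 / (1 - δ))) ^ δ) ^ (1 / (1 - δ)) := by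
  have hδ' : 0 < 1 - δ := by linarith
  -- With `β ^ (1 - δ) = B` and `A ^ (1 - δ) = D * β ^ δ`, the sequence `A * β ^ i` solves the
  -- recursion `y_i = D * B ^ i * y_{i+1} ^ δ` exactly, and any excess factor is raised to the power
  -- `δ` in each step.
  set β : ℝ := B ^ (1 / (1 - δ)) with hβ
  have hβ1 : 1 ≤ β := Real.one_le_rpow hB (by positivity)
  have hβB : β ^ (1 - δ) = B := by
    rw [hβ, ← Real.rpow_mul (by linarith), one_div_mul_cancel hδ'.ne', Real.rpow_one]
  set A : ℝ := (D * β ^ δ) ^ (1 / (1 - δ)) with hA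
  have hβδ : 1 ≤ β ^ δ := Real.one_le_rpow hβ1 hδ0.le
  have hA1 : 1 ≤ A := Real.one_le_rpow (one_le_mul_of_one_le_of_one_le hD hβδ) (by positivity)
  have hAD : A ^ (1 - δ) = D * β ^ δ := by
    rw [hA, ← Real.rpow_mul (by positivity), one_div_mul_cancel hδ'.ne', Real.rpow_one]
  have hA0 : 0 < A := by linarith
  have hβ0 : 0 < β := by linarith
  have hstep' : ∀ i : ℕ, ∀ x : ℝ, 1 ≤ x →
      (∀ᵐ z ∂(μ.restrict (Q (i + 1))), f z ≤ S * (A * β ^ (i + 1) * x)) →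
      ∀ᵐ z ∂(μ.restrict (Q i)), f z ≤ S * (A * β ^ i * x ^ δ) := by
    intro i x hx h
    have h1 : 1 ≤ A * β ^ (i + 1) * x := one_le_mul_of_one_le_of_one_le
      (one_le_mul_of_one_le_of_one_le hA1 (one_le_pow₀ hβ1)) hx
    refine (hstep i _ h1 h).mono fun z hz => hz.trans (le_of_eq ?_)
    congr 1
    rw [Real.mul_rpow (by positivity) (by linarith), Real.mul_rpow hA0.le (by positivity)]
    have e1 : A = A ^ (1 - δ) * A ^ δ := by rw [← Real.rpow_add hA0]; simp
    have e2 : β ^ i = B ^ i * (β ^ i) ^ δ := by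
      rw [← hβB, ← Real.rpow_natCast, ← Real.rpow_natCast, ← Real.rpow_mul hβ0.le,
        ← Real.rpow_mul hβ0.le, ← Real.rpow_add hβ0]
      congr 1; ring
    have e3 : (β ^ (i + 1)) ^ δ = (β ^ i) ^ δ * β ^ δ := by
      rw [pow_succ, Real.mul_rpow (by positivity) hβ0.le]
    calc D * B ^ i * (A ^ δ * (β ^ (i + 1)) ^ δ * x ^ δ)
        = ((D * β ^ δ) * A ^ δ) * (B ^ i * (β ^ i) ^ δ) * x ^ δ := by rw [e3]; ring
      _ = A * β ^ i * x ^ δ := by rw [← hAD, ← e1, ← e2]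
  have hiter : ∀ n : ℕ, ∀ x : ℝ, 1 ≤ x →
      (∀ᵐ z ∂(μ.restrict (Q n)), f z ≤ S * (A * β ^ n * x)) →
      ∀ᵐ z ∂(μ.restrict (Q 0)), f z ≤ S * (A * x ^ (δ ^ n)) := by
    intro n
    induction n with
    | zero => intro x _ h; simpa using h
    | succ n ih =>
      intro x hx h
      have := ih _ (Real.one_le_rpow hx hδ0.le) (hstep' n x hx h)
      rw [← Real.rpow_mul (by linarith), ← pow_succ'] at this
      exact this
  obtain ⟨y, hy, hQ⟩ := hbd
  have hall : ∀ n : ℕ, ∀ᵐ z ∂(μ.restrict (Q 0)), f z ≤ S * (A * y ^ (δ ^ n)) := fun n => by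
    refine hiter n y hy ((hQ n).mono fun z hz => hz.trans ?_)
    have : 1 ≤ A * β ^ n := one_le_mul_of_one_le_of_one_le hA1 (one_le_pow₀ hβ1)
    gcongr
    nlinarith
  filter_upwards [ae_all_iff.2 hall] with z hz
  -- The a priori bound `y` enters with exponent `δ ^ n → 0`, so only its finiteness matters.
  have hlim : Tendsto (fun n : ℕ => S * (A * y ^ (δ ^ n))) atTop (𝓝 (S * (A * y ^ (0 : ℝ)))) := by
    have h1 := tendsto_pow_atTop_nhds_zero_of_lt_one hδ0.le hδ1
    exact ((((Real.continuous_const_rpow (by linarith : y ≠ 0)).tendsto 0).comp h1).const_mul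
      A).const_mul S
  rw [Real.rpow_zero, mul_one] at hlim
  exact ge_of_tendsto' hlim hz

lemma barrier_le {N : ℕ} (hN : 2 ≤ N) {s q : ℝ} (hs0 : 0 < s) (hq : 1 < q) {x₀ x : RN N}
    {R r d : ℝ} (hR : 0 < R) (hd : 0 < d) (hr : d ≤ 1 - r / R) (hx : x ∈ Metric.ball x₀ r) :
    barrier s q x₀ R x ≤ d ^ (-barExp N s q) := by
  refine Real.rpow_le_rpow_of_nonpos hd (hr.trans ?_) (by linarith [barExp_pos hN hs0 hq])
  rw [Metric.mem_ball, dist_eq_norm] at hx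
  unfold relDist
  gcongr

/-- Sub-solutions in all cylinders with vertex `(x₀, t₀)` below the cylinder of size `(ρ, σ)`,
together with a number `S` that controls the scaling, the tail and the `L^r` norm. -/
structure ScaledSubsolution {N : ℕ} (s q L r : ℝ) (x₀ : RN N) (t₀ ρ σ S : ℝ)
    (K : RN N × RN N → ℝ → ℝ) (u : RN N → ℝ → ℝ) : Prop where
  cylinder : ∀ R a : ℝ, 0 < R → R ≤ ρ → t₀ - σ ≤ a → a < t₀ →
    CylinderSubsolution s q L x₀ R a t₀ K u
  radius_pos : 0 < ρ
  time_pos : 0 < σ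
  size_pos : 0 < S
  scaling : σ * ρ ^ (-(2 * s)) ≤ S ^ (q - 1)
  mass : ∫⁻ t in Ioo (t₀ - σ) t₀, ∫⁻ x in Metric.ball x₀ ρ, ENNReal.ofReal (u x t ^ r) ≤
    ENNReal.ofReal (unitVol N * (S ^ (lamExp N s q r / (2 * s)) * σ ^ ((N + 2 * s) / (2 * s))))
  tail : ∫⁻ t in Ioo (t₀ - σ) t₀, ∫⁻ y in (Metric.ball x₀ (ρ / 2))ᶜ,
    ENNReal.ofReal (u y t / ‖y - x₀‖ ^ ((N : ℝ) + 2 * s)) ≤ ENNReal.ofReal (S ^ q)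

namespace ScaledSubsolution
variable {N : ℕ} {s q L r : ℝ} {x₀ : RN N} {t₀ ρ σ S : ℝ} {K : RN N × RN N → ℝ → ℝ}
  {u : RN N → ℝ → ℝ}

/-- The accumulated tail is controlled by the size. -/
lemma tailMass_le (h : ScaledSubsolution s q L r x₀ t₀ ρ σ S K u) (hs0 : 0 < s)
    (hr : 1 ≤ r) {R a : ℝ} (hR1 : ρ / 2 ≤ R) (hR2 : R ≤ ρ) (ha : t₀ - σ ≤ a)
    (hat : a < t₀) :
    tailMass s x₀ R a t₀ u t₀ ≤ (1 + 2 * 2 ^ ((N : ℝ) + 2 * s) * unitVol N) * S ^ q := by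
  have hρ := h.radius_pos
  have hσ := h.time_pos
  have hS := h.size_pos
  have hω := unitVol_pos (N := N)
  have hR0 : 0 < R := by linarith
  have hc := h.cylinder R a hR0 hR2 ha hat
  set γ : ℝ := (N : ℝ) + 2 * s with hγ
  have hγ0 : 0 < γ := by positivity
  have hslice := hc.measurable_slice
  have htm : ENNReal.ofReal (tailMass s x₀ R a t₀ u t₀) =
      ∫⁻ t in Ioo a t₀, weightedTail s x₀ R fun y => u y t := by
    have hTfin := ae_lt_top' hc.measurable_weightedTail.aemeasurable hc.tail
    rw [tailMass, intervalIntegral.integral_of_le hat.le, ofReal_integral_eq_lintegral_ofReal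
      hc.integrable_tailDensity.integrableOn
      (Eventually.of_forall fun t => CylinderSubsolution.tailDensity_nonneg t),
      ← restrict_Ioo_eq_restrict_Ioc]
    refine lintegral_congr_ae ?_
    filter_upwards [hTfin, ae_restrict_mem measurableSet_Ioo] with t ht hmem
    rw [tailDensity, indicator_of_mem hmem, ENNReal.ofReal_toReal ht.ne]
  set c₁ : ℝ := (ρ / 2) ^ (-γ) with hc₁
  have hc₁0 : 0 < c₁ := by positivity
  -- Outside `B_{ρ/2}` the weight is at most that of the given tail. Inside, it is at most `(ρ / 2)
  -- ^ (-γ)` because `R ≥ ρ / 2`, and `u` is controlled by `S` and its `r`-th power.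
  have hw : ∀ t, weightedTail s x₀ R (fun y => u y t) ≤
      (∫⁻ y in (Metric.ball x₀ (ρ / 2))ᶜ, ENNReal.ofReal (u y t / ‖y - x₀‖ ^ γ)) +
      (ENNReal.ofReal (c₁ * S) * volume (Metric.ball x₀ ρ) + ENNReal.ofReal (c₁ * S ^ (1 - r)) *
        ∫⁻ x in Metric.ball x₀ ρ, ENNReal.ofReal (u x t ^ r)) := by
    intro t
    have hut := hslice t
    rw [weightedTail, ← lintegral_add_compl _
      (Metric.isOpen_ball (x := x₀) (ε := ρ / 2)).measurableSet, add_comm]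
    refine add_le_add ?_ ?_
    · refine setLIntegral_mono' Metric.isOpen_ball.measurableSet.compl fun y hy => ?_
      have hy' : ρ / 2 ≤ ‖y - x₀‖ := by simpa [dist_eq_norm] using hy
      have hy0 : 0 < ‖y - x₀‖ := by linarith
      refine ENNReal.ofReal_le_ofReal (div_le_div_of_nonneg_left (hc.nonneg y t) (by positivity) ?_)
      exact Real.rpow_le_rpow hy0.le (by linarith) hγ0.le
    · rw [← setLIntegral_const, ← lintegral_const_mul' _ _ ENNReal.ofReal_ne_top,
        ← lintegral_add_left measurable_const]
      refine le_trans (setLIntegral_mono' Metric.isOpen_ball.measurableSet fun y _ => ?_)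
        (lintegral_mono_set (Metric.ball_subset_ball (by linarith)))
      have hu0 := hc.nonneg y t
      rw [← ENNReal.ofReal_mul (by positivity), ← ENNReal.ofReal_add (by positivity) (by positivity)]
      refine ENNReal.ofReal_le_ofReal ?_
      -- Either `u ≤ S`, or `u ^ (1 - r) ≤ S ^ (1 - r)` because `r ≥ 1`.
      have h1 : u y t ≤ S + S ^ (1 - r) * u y t ^ r := by
        rcases le_total (u y t) S with h2 | h2
        · have : 0 ≤ S ^ (1 - r) * u y t ^ r := by positivity
          linarith
        · have h3 : 0 < u y t := hS.trans_le h2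
          have h4 : u y t ^ (1 - r) ≤ S ^ (1 - r) :=
            Real.rpow_le_rpow_of_nonpos hS h2 (by linarith)
          have h5 : u y t = u y t ^ (1 - r) * u y t ^ r := by rw [← Real.rpow_add h3]; simp
          have h6 : u y t ^ (1 - r) * u y t ^ r ≤ S ^ (1 - r) * u y t ^ r := by gcongr
          linarith
      have h2 : u y t / (R + ‖y - x₀‖) ^ γ ≤ c₁ * u y t := by
        rw [div_eq_mul_inv, mul_comm, ← Real.rpow_neg (by positivity)]
        refine mul_le_mul_of_nonneg_right ?_ hu0
        exact Real.rpow_le_rpow_of_nonpos (by linarith)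
          (by linarith [norm_nonneg (y - x₀)]) (by linarith)
      calc _ ≤ c₁ * u y t := h2
        _ ≤ c₁ * (S + S ^ (1 - r) * u y t ^ r) := by gcongr
        _ = _ := by ring
  have hsub : Ioo a t₀ ⊆ Ioo (t₀ - σ) t₀ := Ioo_subset_Ioo_left ha
  set X : ℝ := unitVol N * (S ^ (lamExp N s q r / (2 * s)) * σ ^ (((N : ℝ) + 2 * s) / (2 * s)))
    with hX
  have hX0 : 0 ≤ X := by positivity
  have hmX : Measurable fun t => ∫⁻ x in Metric.ball x₀ ρ, ENNReal.ofReal (u x t ^ r) := by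
    have h1 : Measurable fun z : ℝ × RN N => u z.2 z.1 :=
      hc.measurable_comp (by fun_prop) (by fun_prop)
    exact Measurable.lintegral_prod_right' (ν := volume.restrict (Metric.ball x₀ ρ))
      (h1.pow_const r).ennreal_ofReal
  have hbound : ENNReal.ofReal (tailMass s x₀ R a t₀ u t₀) ≤
      ENNReal.ofReal (S ^ q + (c₁ * S * (unitVol N * ρ ^ N) * σ + c₁ * S ^ (1 - r) * X)) := by
    rw [htm]
    refine (lintegral_mono_set hsub).trans ((lintegral_mono hw).trans ?_)
    have hm2 : Measurable fun t => ENNReal.ofReal (c₁ * S) * volume (Metric.ball x₀ ρ) +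
        ENNReal.ofReal (c₁ * S ^ (1 - r)) *
          ∫⁻ x in Metric.ball x₀ ρ, ENNReal.ofReal (u x t ^ r) :=
      measurable_const.add (hmX.const_mul _)
    rw [lintegral_add_right _ hm2,
      lintegral_add_left measurable_const, setLIntegral_const, lintegral_const_mul _ hmX,
      Real.volume_Ioo, volume_ball_eq _ hρ, ← ENNReal.ofReal_mul (by positivity),
      ← ENNReal.ofReal_mul (by positivity), ENNReal.ofReal_add (by positivity) (by positivity),
      ENNReal.ofReal_add (by positivity) (by positivity)]
    refine add_le_add h.tail (add_le_add (le_of_eq ?_) ?_)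
    · congr 2; ring
    · rw [ENNReal.ofReal_mul (p := c₁ * S ^ (1 - r)) (by positivity)]
      exact mul_le_mul_right h.mass _
  have hreal := (ENNReal.ofReal_le_ofReal_iff (by positivity)).1 hbound
  refine hreal.trans ?_
  have hρ2 : c₁ = 2 ^ γ * ρ ^ (-γ) := by
    rw [hc₁, Real.div_rpow hρ.le (by norm_num), Real.rpow_neg (by norm_num : (0 : ℝ) ≤ 2),
      div_inv_eq_mul, mul_comm]
  have e1 : c₁ * S * (unitVol N * ρ ^ N) * σ ≤ 2 ^ γ * unitVol N * S ^ q := by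
    have h1 : ρ ^ (-γ) * ρ ^ N = ρ ^ (-(2 * s)) := by
      rw [← Real.rpow_natCast, ← Real.rpow_add hρ]; congr 1; rw [hγ]; ring
    have h2 : S ^ (q - 1) * S = S ^ q := by
      rw [← Real.rpow_add_one hS.ne']; congr 1; ring
    calc _ = 2 ^ γ * unitVol N * S * σ * (ρ ^ (-γ) * ρ ^ N) := by rw [hρ2]; ring
      _ = 2 ^ γ * unitVol N * S * (σ * ρ ^ (-(2 * s))) := by rw [h1]; ring
      _ ≤ 2 ^ γ * unitVol N * S * S ^ (q - 1) := by gcongr; exact h.scaling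
      _ = _ := by rw [← h2]; ring
  -- The excess power of `σ` is written through `σ * ρ ^ (-2s) ≤ S ^ (q - 1)`; the exponents of `S`
  -- then add up to `q` and those of `ρ` to `0`.
  have e2 : c₁ * S ^ (1 - r) * X ≤ 2 ^ γ * unitVol N * S ^ q := by
    have h1 : σ ^ (γ / (2 * s)) = (σ * ρ ^ (-(2 * s))) ^ (γ / (2 * s)) * ρ ^ γ := by
      rw [Real.mul_rpow hσ.le (by positivity), ← Real.rpow_mul hρ.le, mul_assoc,
        ← Real.rpow_add hρ]
      rw [show -(2 * s) * (γ / (2 * s)) + γ = 0 by field_simp; ring]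
      simp
    have h2 : (σ * ρ ^ (-(2 * s))) ^ (γ / (2 * s)) ≤ S ^ ((q - 1) * (γ / (2 * s))) := by
      rw [Real.rpow_mul hS.le]
      exact Real.rpow_le_rpow (by positivity) h.scaling (by positivity)
    have h3 : ρ ^ (-γ) * ρ ^ γ = 1 := by rw [← Real.rpow_add hρ]; simp
    have h4 : S ^ (1 - r) * S ^ (lamExp N s q r / (2 * s)) * S ^ ((q - 1) * (γ / (2 * s))) =
        S ^ q := by
      rw [← Real.rpow_add hS, ← Real.rpow_add hS]
      congr 1
      rw [lamExp, hγ]; field_simp; ring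
    calc _ = 2 ^ γ * unitVol N * (S ^ (1 - r) * S ^ (lamExp N s q r / (2 * s)) *
          (σ * ρ ^ (-(2 * s))) ^ (γ / (2 * s))) * (ρ ^ (-γ) * ρ ^ γ) := by
          rw [hX, hρ2, h1]; ring
      _ ≤ 2 ^ γ * unitVol N * (S ^ (1 - r) * S ^ (lamExp N s q r / (2 * s)) *
          S ^ ((q - 1) * (γ / (2 * s)))) * 1 := by rw [h3]; gcongr
      _ = _ := by rw [h4, mul_one]
  linarith

end ScaledSubsolution

namespace ScaledSubsolution
variable {N : ℕ} {s q L r : ℝ} {x₀ : RN N} {t₀ ρ σ S : ℝ} {K : RN N × RN N → ℝ → ℝ}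
  {u : RN N → ℝ → ℝ}

lemma step_le_level (h : ScaledSubsolution s q L r x₀ t₀ ρ σ S K u) (hs0 : 0 < s) (hs1 : s < 1)
    (hq : 1 < q) {R g k : ℝ} (hR : ρ / 2 ≤ R) (hg : g ≤ σ)
    (hk : 4 ^ (1 / (q - 1)) * S ≤ k) : g * R ^ (-(2 * s)) ≤ k ^ (q - 1) := by
  have hρ := h.radius_pos
  have hS := h.size_pos
  have hσ := h.time_pos
  have hR0 : 0 < R := by linarith
  have h1 : R ^ (-(2 * s)) ≤ 4 * ρ ^ (-(2 * s)) := by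
    calc R ^ (-(2 * s)) ≤ (ρ / 2) ^ (-(2 * s)) :=
          Real.rpow_le_rpow_of_nonpos (by linarith) hR (by linarith)
      _ = 2 ^ (2 * s) * ρ ^ (-(2 * s)) := by
          rw [Real.div_rpow hρ.le (by norm_num), Real.rpow_neg (by norm_num : (0 : ℝ) ≤ 2),
            div_inv_eq_mul, mul_comm]
      _ ≤ 2 ^ (2 : ℝ) * ρ ^ (-(2 * s)) := by
          gcongr
          · norm_num
          · linarith
      _ = _ := by norm_num
  have hq1 : 0 < q - 1 := by linarith
  calc g * R ^ (-(2 * s)) ≤ σ * (4 * ρ ^ (-(2 * s))) := by gcongr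
    _ = 4 * (σ * ρ ^ (-(2 * s))) := by ring
    _ ≤ 4 * S ^ (q - 1) := by gcongr; exact h.scaling
    _ = (4 ^ (1 / (q - 1)) * S) ^ (q - 1) := by
        rw [Real.mul_rpow (by positivity) hS.le, ← Real.rpow_mul (by norm_num),
          one_div_mul_cancel hq1.ne', Real.rpow_one]
    _ ≤ k ^ (q - 1) := by gcongr

lemma tail_le_level (h : ScaledSubsolution s q L r x₀ t₀ ρ σ S K u) (hs0 : 0 < s)
    (hq : 1 < q) (hL : 0 < L) (hr : 1 ≤ r) {R a k : ℝ} (hR1 : ρ / 2 ≤ R) (hR2 : R ≤ ρ)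
    (ha : t₀ - σ ≤ a) (hat : a < t₀)
    (hk : (tailConst N s L * (1 + 2 * 2 ^ ((N : ℝ) + 2 * s) * unitVol N)) ^ (1 / q) * S ≤ k) :
    tailConst N s L * tailMass s x₀ R a t₀ u t₀ ≤ k ^ q := by
  have hS := h.size_pos
  have h1 := h.tailMass_le hs0 hr hR1 hR2 ha hat
  have hω := unitVol_pos (N := N)
  have hc := tailConst_pos (N := N) (s := s) hL
  have hq0 : 0 < q := by linarith
  calc _ ≤ tailConst N s L * ((1 + 2 * 2 ^ ((N : ℝ) + 2 * s) * unitVol N) * S ^ q) := by gcongr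
    _ = ((tailConst N s L * (1 + 2 * 2 ^ ((N : ℝ) + 2 * s) * unitVol N)) ^ (1 / q) * S) ^ q := by
        rw [Real.mul_rpow (by positivity) hS.le, ← Real.rpow_mul (by positivity),
          one_div_mul_cancel hq0.ne', Real.rpow_one]
        ring
    _ ≤ k ^ q := by gcongr

end ScaledSubsolution

/-- The local boundedness criterion with exponent `p` and threshold `c`. -/
def BoundednessCriterion (N : ℕ) (s q L p c : ℝ) : Prop :=
  ∀ (x₀ : RN N) (R a b : ℝ) (K : RN N × RN N → ℝ → ℝ) (u : RN N → ℝ → ℝ),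
    CylinderSubsolution s q L x₀ R a b K u → 0 < R → ∀ k g : ℝ, 0 < k → 0 < g → a + g < b →
    g * R ^ (-(2 * s)) ≤ k ^ (q - 1) → tailConst N s L * tailMass s x₀ R a b u b ≤ k ^ q →
    (∫⁻ t in Ioo a b, ∫⁻ x in Metric.ball x₀ R, ENNReal.ofReal (u x t ^ p) ≤
      ENNReal.ofReal (c * (k ^ (lamExp N s q p / (2 * s)) * g ^ ((N + 2 * s) / (2 * s))))) →
    ∀ᵐ z ∂((volume : Measure (RN N × ℝ)).restrict (Metric.ball x₀ R ×ˢ Ioo (a + g) b)),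
      u z.1 z.2 ≤ 3 * k * barrier s q x₀ R z.1

/-- The factor by which the level has to exceed the size. -/
def levelFactor (N : ℕ) (s q L : ℝ) : ℝ :=
  1 + 4 ^ (1 / (q - 1)) +
    (tailConst N s L * (1 + 2 * 2 ^ ((N : ℝ) + 2 * s) * unitVol N)) ^ (1 / q)

lemma one_le_levelFactor {N : ℕ} {s q L : ℝ} (hL : 0 < L) : 1 ≤ levelFactor N s q L := by
  have hω := unitVol_pos (N := N)
  have hc := tailConst_pos (N := N) (s := s) hL
  have h1 : 0 ≤ (4 : ℝ) ^ (1 / (q - 1)) := by positivity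
  have h2 : 0 ≤ (tailConst N s L * (1 + 2 * 2 ^ ((N : ℝ) + 2 * s) * unitVol N)) ^ (1 / q) := by
    positivity
  unfold levelFactor
  linarith

section
variable {N : ℕ} {s q L r : ℝ} {x₀ : RN N} {t₀ ρ σ S : ℝ} {K : RN N × RN N → ℝ → ℝ}
  {u : RN N → ℝ → ℝ}

/-- The criterion at intermediate radii. -/
lemma ScaledSubsolution.ae_le (h : ScaledSubsolution s q L r x₀ t₀ ρ σ S K u) (hN : 2 ≤ N)
    (hs0 : 0 < s) (hs1 : s < 1) (hq : 1 < q) (hL : 0 < L) (hr : 1 ≤ r) {p c : ℝ}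
    (hcrit : BoundednessCriterion N s q L p c) {R R' θ θ' d k : ℝ} (hR1 : ρ / 2 ≤ R)
    (hR2 : R ≤ ρ) (hθ : θ ≤ σ) (hθ' : 0 < θ') (hθθ' : θ' < θ) (hd : 0 < d) (hd' : d ≤ 1 - R' / R)
    (hR' : R' ≤ R)
    (hk : levelFactor N s q L * S ≤ k)
    (hmass : ∫⁻ t in Ioo (t₀ - θ) t₀, ∫⁻ x in Metric.ball x₀ R, ENNReal.ofReal (u x t ^ p) ≤
      ENNReal.ofReal (c * (k ^ (lamExp N s q p / (2 * s)) * (θ - θ') ^ ((N + 2 * s) / (2 * s))))) :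
    ∀ᵐ z ∂((volume : Measure (RN N × ℝ)).restrict (paraCyl x₀ t₀ R' θ')),
      u z.1 z.2 ≤ 3 * d ^ (-barExp N s q) * k := by
  have hρ := h.radius_pos
  have hS := h.size_pos
  have hR0 : 0 < R := by linarith
  have hF := one_le_levelFactor (N := N) (s := s) (q := q) hL
  have hk0 : 0 < k := lt_of_lt_of_le (by positivity) hk
  have hω := unitVol_pos (N := N)
  have htc := tailConst_pos (N := N) (s := s) hL
  have h1 : 0 ≤ (4 : ℝ) ^ (1 / (q - 1)) := by positivity
  have h2 : 0 ≤ (tailConst N s L * (1 + 2 * 2 ^ ((N : ℝ) + 2 * s) * unitVol N)) ^ (1 / q) := by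
    positivity
  have hk1 : 4 ^ (1 / (q - 1)) * S ≤ k := by
    refine le_trans (mul_le_mul_of_nonneg_right ?_ hS.le) hk
    unfold levelFactor; linarith
  have hk2 : (tailConst N s L * (1 + 2 * 2 ^ ((N : ℝ) + 2 * s) * unitVol N)) ^ (1 / q) * S ≤ k := by
    refine le_trans (mul_le_mul_of_nonneg_right ?_ hS.le) hk
    unfold levelFactor; linarith
  have hmain := hcrit x₀ R (t₀ - θ) t₀ K u (h.cylinder R (t₀ - θ) hR0 hR2 (by linarith)
    (by linarith)) hR0 k (θ - θ') hk0 (by linarith) (by linarith)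
    (h.step_le_level hs0 hs1 hq hR1 (by linarith) hk1)
    (h.tail_le_level hs0 hq hL hr hR1 hR2 (by linarith) (by linarith) hk2) hmass
  rw [show t₀ - θ + (θ - θ') = t₀ - θ' by ring] at hmain
  have hsub : paraCyl x₀ t₀ R' θ' ⊆ Metric.ball x₀ R ×ˢ Ioo (t₀ - θ') t₀ :=
    prod_mono (Metric.ball_subset_ball hR') le_rfl
  filter_upwards [ae_restrict_of_ae_restrict_of_subset hsub hmain,
    ae_restrict_mem (Metric.isOpen_ball.measurableSet.prod measurableSet_Ioo)] with z hz hmem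
  refine hz.trans ?_
  have := barrier_le hN hs0 hq hR0 hd hd' hmem.1
  calc _ ≤ 3 * k * d ^ (-barExp N s q) := by gcongr
    _ = _ := by ring

/-- The sup estimate for a single exponent. -/
lemma exists_ae_le_mul_size (hN : 2 ≤ N) (hs0 : 0 < s) (hs1 : s < 1) (hq : 1 < q) (hL : 0 < L)
    {c lam0 : ℝ} (hc : 0 < c) (hlam : 0 < lam0) : ∃ C : ℝ, 0 < C ∧
      ∀ r : ℝ, 1 ≤ r → lam0 ≤ lamExp N s q r → BoundednessCriterion N s q L r c →
      ∀ (x₀ : RN N) (t₀ ρ σ S : ℝ) (K : RN N × RN N → ℝ → ℝ) (u : RN N → ℝ → ℝ),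
      ScaledSubsolution s q L r x₀ t₀ ρ σ S K u →
      ∀ᵐ z ∂((volume : Measure (RN N × ℝ)).restrict (paraCyl x₀ t₀ (ρ / 2) (σ / 2))),
        u z.1 z.2 ≤ C * S := by
  have hω := unitVol_pos (N := N)
  have hF := one_le_levelFactor (N := N) (s := s) (q := q) hL
  -- `A` makes `c * A * (1/2) ^ ((N + 2s) / 2s)` at least `unitVol N`, the constant of the mass
  -- bound. In `B` below, the power `2s / lam0` yields `B ^ (Λ_r / 2s) ≥ A` for every `r` with `Λ_r
  -- ≥ lam0`, which keeps the constant uniform in `r`.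
  set A : ℝ := 1 + unitVol N * 2 ^ (((N : ℝ) + 2 * s) / (2 * s)) / c with hA
  have hA1 : 1 ≤ A := by
    have : 0 ≤ unitVol N * 2 ^ (((N : ℝ) + 2 * s) / (2 * s)) / c := by positivity
    linarith
  set B : ℝ := levelFactor N s q L * A ^ (2 * s / lam0) with hB
  have hA2 : 1 ≤ A ^ (2 * s / lam0) := Real.one_le_rpow hA1 (by positivity)
  refine ⟨3 * (1 / 2) ^ (-barExp N s q) * B, by positivity,
    fun r hr hΛ hcrit x₀ t₀ ρ σ S K u h => ?_⟩
  have hρ := h.radius_pos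
  have hσ := h.time_pos
  have hS := h.size_pos
  have hΛ0 : 0 < lamExp N s q r := by linarith
  have := h.ae_le hN hs0 hs1 hq hL hr hcrit (R := ρ) (R' := ρ / 2) (θ := σ) (θ' := σ / 2)
    (d := 1 / 2) (k := B * S) (by linarith) le_rfl le_rfl (by linarith) (by linarith)
    (by norm_num) (by field_simp; norm_num) (by linarith) (by
      rw [hB]; gcongr; exact le_mul_of_one_le_right (by linarith) hA2) ?_
  · refine this.mono fun z hz => hz.trans (le_of_eq ?_)
    ring
  · refine h.mass.trans (ENNReal.ofReal_le_ofReal ?_)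
    have e1 : (B * S) ^ (lamExp N s q r / (2 * s)) =
        B ^ (lamExp N s q r / (2 * s)) * S ^ (lamExp N s q r / (2 * s)) :=
      Real.mul_rpow (by positivity) hS.le
    have e2 : A ≤ B ^ (lamExp N s q r / (2 * s)) := by
      calc A = (A ^ (2 * s / lam0)) ^ (lam0 / (2 * s)) := by
            rw [← Real.rpow_mul (by positivity), show 2 * s / lam0 * (lam0 / (2 * s)) = 1 by
              field_simp, Real.rpow_one]
        _ ≤ B ^ (lam0 / (2 * s)) := by
            refine Real.rpow_le_rpow (by positivity) ?_ (by positivity)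
            exact le_mul_of_one_le_left (by positivity) hF
        _ ≤ B ^ (lamExp N s q r / (2 * s)) := by
            refine Real.rpow_le_rpow_of_exponent_le ?_ (by gcongr)
            exact one_le_mul_of_one_le_of_one_le hF hA2
    have e3 : σ - σ / 2 = σ / 2 := by ring
    have e4 : unitVol N ≤ c * A * (1 / 2) ^ (((N : ℝ) + 2 * s) / (2 * s)) := by
      have h1 : (2 : ℝ) ^ (((N : ℝ) + 2 * s) / (2 * s)) *
          (1 / 2) ^ (((N : ℝ) + 2 * s) / (2 * s)) = 1 := by
        rw [← Real.mul_rpow (by norm_num) (by norm_num)]; norm_num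
      have h2 : c * A = c + unitVol N * 2 ^ (((N : ℝ) + 2 * s) / (2 * s)) := by
        rw [hA]; field_simp
      rw [h2, add_mul, mul_assoc, h1]
      have : 0 ≤ c * (1 / 2 : ℝ) ^ (((N : ℝ) + 2 * s) / (2 * s)) := by positivity
      linarith
    rw [e1, e3, div_eq_mul_one_div σ 2, Real.mul_rpow hσ.le (by norm_num)]
    calc _ ≤ (c * A * (1 / 2) ^ (((N : ℝ) + 2 * s) / (2 * s))) *
          (S ^ (lamExp N s q r / (2 * s)) * σ ^ (((N : ℝ) + 2 * s) / (2 * s))) := by gcongr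
      _ ≤ (c * B ^ (lamExp N s q r / (2 * s)) * (1 / 2) ^ (((N : ℝ) + 2 * s) / (2 * s))) *
          (S ^ (lamExp N s q r / (2 * s)) * σ ^ (((N : ℝ) + 2 * s) / (2 * s))) := by gcongr
      _ = _ := by ring

end

section
variable {N : ℕ} {s q L r : ℝ} {x₀ : RN N} {t₀ ρ σ S : ℝ} {K : RN N × RN N → ℝ → ℝ}
  {u : RN N → ℝ → ℝ}

/-- An upper bound trades integrability exponents. -/
lemma lintegral_rpow_le_of_ae_le (hu0 : ∀ x t, 0 ≤ u x t) {R θ M p : ℝ} (hM : 0 < M) (hr : 0 < r) (hrp : r ≤ p)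
    (hle : ∀ᵐ z ∂((volume : Measure (RN N × ℝ)).restrict (paraCyl x₀ t₀ R θ)), u z.1 z.2 ≤ M) :
    ∫⁻ t in Ioo (t₀ - θ) t₀, ∫⁻ x in Metric.ball x₀ R, ENNReal.ofReal (u x t ^ p) ≤
      ENNReal.ofReal (M ^ (p - r)) *
        ∫⁻ t in Ioo (t₀ - θ) t₀, ∫⁻ x in Metric.ball x₀ R, ENNReal.ofReal (u x t ^ r) := by
  rw [paraCyl, Measure.volume_eq_prod, ← Measure.prod_restrict] at hle
  have hle' := Measure.ae_ae_of_ae_prod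
    (Measure.measurePreserving_swap.quasiMeasurePreserving.ae hle)
  rw [← lintegral_const_mul' _ _ ENNReal.ofReal_ne_top]
  refine lintegral_mono_ae (hle'.mono fun t ht => ?_)
  rw [← lintegral_const_mul' _ _ ENNReal.ofReal_ne_top]
  refine lintegral_mono_ae (ht.mono fun x hx => ?_)
  simp only [Prod.swap_prod_mk] at hx
  rw [← ENNReal.ofReal_mul (by positivity)]
  refine ENNReal.ofReal_le_ofReal ?_
  rcases (hu0 x t).eq_or_lt with h0 | h0
  · rw [← h0, Real.zero_rpow hr.ne', Real.zero_rpow (by linarith), mul_zero]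
  · calc u x t ^ p = u x t ^ (p - r) * u x t ^ r := by rw [← Real.rpow_add h0]; ring_nf
      _ ≤ M ^ (p - r) * u x t ^ r := by gcongr

/-- The fractions of the cylinder used in the interpolation. -/
def fracSeq (i : ℕ) : ℝ := 3 / 4 - 1 / 4 * (1 / 2) ^ i

lemma fracSeq_succ_sub (i : ℕ) : fracSeq (i + 1) - fracSeq i = 1 / 8 * (1 / 2) ^ i := by
  unfold fracSeq; ring

lemma half_le_fracSeq (i : ℕ) : 1 / 2 ≤ fracSeq i := by
  have := half_pow_le_one i
  unfold fracSeq; linarith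

lemma fracSeq_le (i : ℕ) : fracSeq i ≤ 3 / 4 := by
  have : (0 : ℝ) < (1 / 2) ^ i := by positivity
  unfold fracSeq; linarith

/-- A qualitative bound, depending on `u`, from the criterion with exponent `q + 1` at a
sufficiently high level. It only serves as starting point of the sublinear iteration. -/
lemma ScaledSubsolution.exists_bound (h : ScaledSubsolution s q L r x₀ t₀ ρ σ S K u) (hN : 2 ≤ N)
    (hs0 : 0 < s) (hs1 : s < 1) (hq : 1 < q) (hL : 0 < L) (hr : 1 ≤ r) {c : ℝ} (hc : 0 < c)
    (hΛ : 0 < lamExp N s q (q + 1)) (hcrit : BoundednessCriterion N s q L (q + 1) c) :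
    ∃ M : ℝ, 0 < M ∧ ∀ᵐ z ∂((volume : Measure (RN N × ℝ)).restrict
      (paraCyl x₀ t₀ (3 / 4 * ρ) (3 / 4 * σ))), u z.1 z.2 ≤ M := by
  have hρ := h.radius_pos
  have hσ := h.time_pos
  have hS := h.size_pos
  have hF := one_le_levelFactor (N := N) (s := s) (q := q) hL
  have hcyl := h.cylinder ρ (t₀ - σ) hρ le_rfl le_rfl (by linarith)
  obtain ⟨C, hC, hsup⟩ := hcyl.sup_bound
  set X := ∫⁻ t in Ioo (t₀ - σ) t₀, ∫⁻ x in Metric.ball x₀ ρ, ENNReal.ofReal (u x t ^ (q + 1))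
    with hX
  have hXfin : X ≠ ⊤ := by
    refine ne_top_of_le_ne_top ?_ (lintegral_mono_ae hsup)
    rw [setLIntegral_const]
    exact ENNReal.mul_ne_top hC (by simp)
  set Λ := lamExp N s q (q + 1)
  set e : ℝ := ((N : ℝ) + 2 * s) / (2 * s) with he
  set Y : ℝ := X.toReal / (c * (σ - 3 / 4 * σ) ^ e) with hY
  have hg : 0 < σ - 3 / 4 * σ := by linarith
  have hY0 : 0 ≤ Y := by positivity
  -- The second summand makes `k ^ (Λ / 2s) ≥ Y`, which puts the finite mass `X` below the threshold
  -- of the criterion.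
  set k : ℝ := levelFactor N s q L * S + Y ^ (2 * s / Λ) with hk
  have hYp : 0 ≤ Y ^ (2 * s / Λ) := by positivity
  have hk0 : 0 < k := by positivity
  refine ⟨3 * (1 / 4) ^ (-barExp N s q) * k, by positivity, ?_⟩
  refine h.ae_le hN hs0 hs1 hq hL hr hcrit (R := ρ) (θ := σ) (by linarith) le_rfl le_rfl
    (by linarith) (by linarith) (by norm_num) (by field_simp; norm_num) (by linarith)
    (by linarith) ?_
  rw [← hX, ENNReal.le_ofReal_iff_toReal_le hXfin (by positivity)]
  have h1 : Y ≤ k ^ (Λ / (2 * s)) := by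
    calc Y = (Y ^ (2 * s / Λ)) ^ (Λ / (2 * s)) := by
          rw [← Real.rpow_mul hY0, show 2 * s / Λ * (Λ / (2 * s)) = 1 by field_simp, Real.rpow_one]
      _ ≤ _ := Real.rpow_le_rpow hYp (by rw [hk]; nlinarith) (by positivity)
  calc X.toReal = c * (Y * (σ - 3 / 4 * σ) ^ e) := by rw [hY]; field_simp
    _ ≤ _ := by gcongr

/-- The choice of level in the interpolation. -/
lemma mul_rpow_le_level_rpow {s ω e c Λ F σ S y p' Λ' : ℝ} (hs0 : 0 < s) (hc : 0 < c) (hω : 0 < ω)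
    (hΛ : 0 < Λ) (hF : 1 ≤ F) (hσ : 0 ≤ σ) (hS : 0 < S) (hy : 0 < y) (i : ℕ)
    (hsum : p' + Λ' / (2 * s) = Λ / (2 * s)) :
    (S * y) ^ p' * (ω * (S ^ (Λ' / (2 * s)) * σ ^ e)) ≤
      c * ((F * (1 + ω * 8 ^ e / c) ^ (2 * s / Λ) * (2 ^ (e * (2 * s / Λ))) ^ i *
        y ^ (2 * s * p' / Λ) * S) ^ (Λ / (2 * s)) * (σ * (1 / 8 * (1 / 2) ^ i)) ^ e) := by
  set A : ℝ := 1 + ω * 8 ^ e / c with hA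
  have hA0 : 0 < A := by positivity
  set H : ℝ := F * A ^ (2 * s / Λ) with hH
  have hH0 : 0 < H := by positivity
  set b : ℝ := 2 ^ (e * (2 * s / Λ)) with hb
  have hb0 : 0 < b := by positivity
  have hbe : b ^ (Λ / (2 * s)) = 2 ^ e := by
    rw [hb, ← Real.rpow_mul (by norm_num)]
    congr 1; field_simp
  have e2 : (1 / 8 * (1 / 2) ^ i : ℝ) ^ e = (1 / 8) ^ e * ((1 / 2) ^ e) ^ i := by
    rw [Real.mul_rpow (by norm_num) (by positivity), Real.rpow_pow_comm (by norm_num)]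
  have e3 : (H * b ^ i * y ^ (2 * s * p' / Λ) * S) ^ (Λ / (2 * s)) =
      H ^ (Λ / (2 * s)) * (2 ^ e) ^ i * y ^ p' * S ^ (Λ / (2 * s)) := by
    rw [Real.mul_rpow (by positivity) hS.le, Real.mul_rpow (by positivity) (by positivity),
      Real.mul_rpow (by positivity) (by positivity), ← Real.rpow_mul hy.le,
      ← Real.rpow_pow_comm hb0.le, hbe,
      show 2 * s * p' / Λ * (Λ / (2 * s)) = p' by field_simp]
  have e4 : A ≤ H ^ (Λ / (2 * s)) := by
    calc A = (A ^ (2 * s / Λ)) ^ (Λ / (2 * s)) := by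
          rw [← Real.rpow_mul hA0.le, show 2 * s / Λ * (Λ / (2 * s)) = 1 by
            field_simp, Real.rpow_one]
      _ ≤ _ := by
          refine Real.rpow_le_rpow (by positivity) ?_ (by positivity)
          exact le_mul_of_one_le_left (by positivity) hF
  have e5 : ω ≤ c * A * (1 / 8) ^ e := by
    have h1 : (8 : ℝ) ^ e * (1 / 8) ^ e = 1 := by
      rw [← Real.mul_rpow (by norm_num) (by norm_num)]; norm_num
    have h2 : c * A = c + ω * 8 ^ e := by rw [hA]; field_simp
    rw [h2, add_mul, mul_assoc, h1]
    have : 0 ≤ c * (1 / 8 : ℝ) ^ e := by positivity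
    linarith
  have e6 : S ^ p' * S ^ (Λ' / (2 * s)) = S ^ (Λ / (2 * s)) := by
    rw [← Real.rpow_add hS, hsum]
  have e7 : ((2 : ℝ) ^ e) ^ i * ((1 / 2) ^ e) ^ i = 1 := by
    rw [← mul_pow, ← Real.mul_rpow (by norm_num) (by norm_num)]; norm_num
  rw [Real.mul_rpow hσ (by positivity), e2, e3, Real.mul_rpow hS.le hy.le]
  calc _ = ω * (y ^ p' * (S ^ p' * S ^ (Λ' / (2 * s))) * σ ^ e) := by ring
    _ ≤ c * A * (1 / 8) ^ e * (y ^ p' * (S ^ p' * S ^ (Λ' / (2 * s))) * σ ^ e) := by gcongr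
    _ ≤ c * H ^ (Λ / (2 * s)) * (1 / 8) ^ e *
        (y ^ p' * (S ^ p' * S ^ (Λ' / (2 * s))) * σ ^ e) := by gcongr
    _ = c * H ^ (Λ / (2 * s)) * (1 / 8) ^ e * (y ^ p' * S ^ (Λ / (2 * s)) * σ ^ e) *
        (((2 : ℝ) ^ e) ^ i * ((1 / 2) ^ e) ^ i) := by rw [e6, e7, mul_one]
    _ = _ := by ring

/-- One step of the interpolation. -/
lemma ScaledSubsolution.ae_le_of_ae_le (h : ScaledSubsolution s q L r x₀ t₀ ρ σ S K u) (hN : 2 ≤ N)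
    (hs0 : 0 < s) (hs1 : s < 1) (hq : 1 < q) (hL : 0 < L) (hr : 1 ≤ r) (hrq : r < q + 1) {c : ℝ}
    (hc : 0 < c) (hΛ : 0 < lamExp N s q (q + 1))
    (hcrit : BoundednessCriterion N s q L (q + 1) c) (i : ℕ) {y : ℝ} (hy : 1 ≤ y)
    (hQ : ∀ᵐ z ∂((volume : Measure (RN N × ℝ)).restrict
      (paraCyl x₀ t₀ (ρ * fracSeq (i + 1)) (σ * fracSeq (i + 1)))), u z.1 z.2 ≤ S * y) :
    ∀ᵐ z ∂((volume : Measure (RN N × ℝ)).restrict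
      (paraCyl x₀ t₀ (ρ * fracSeq i) (σ * fracSeq i))),
      u z.1 z.2 ≤ 3 * (1 / 8 * (1 / 2) ^ i) ^ (-barExp N s q) *
        (levelFactor N s q L *
          (1 + unitVol N * 8 ^ (((N : ℝ) + 2 * s) / (2 * s)) / c) ^
            (2 * s / lamExp N s q (q + 1)) *
          (2 ^ (((N : ℝ) + 2 * s) / (2 * s) * (2 * s / lamExp N s q (q + 1)))) ^ i *
          y ^ (2 * s * (q + 1 - r) / lamExp N s q (q + 1)) * S) := by
  have hω := unitVol_pos (N := N)
  have hF := one_le_levelFactor (N := N) (s := s) (q := q) hL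
  have hρ := h.radius_pos
  have hσ := h.time_pos
  have hS := h.size_pos
  have hcyl := h.cylinder ρ (t₀ - σ) hρ le_rfl le_rfl (by linarith)
  have hτ1 := half_le_fracSeq i
  have hτ2 := fracSeq_le (i + 1)
  have hτ3 := half_le_fracSeq (i + 1)
  have hdiff := fracSeq_succ_sub i
  have hpow : (0 : ℝ) < (1 / 2) ^ i := by positivity
  have hd0 : (0 : ℝ) < 1 / 8 * (1 / 2) ^ i := by positivity
  have hy0 : 0 < y := by linarith
  have hτlt : fracSeq i < fracSeq (i + 1) := by linarith
  have hσlt : σ * fracSeq i < σ * fracSeq (i + 1) := mul_lt_mul_of_pos_left hτlt hσ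
  have hρ1 : ρ * (1 / 2) ≤ ρ * fracSeq (i + 1) := mul_le_mul_of_nonneg_left hτ3 hρ.le
  have hρ2 : ρ * fracSeq (i + 1) ≤ ρ := mul_le_of_le_one_right hρ.le (by linarith)
  have hσ2 : σ * fracSeq (i + 1) ≤ σ := mul_le_of_le_one_right hσ.le (by linarith)
  have hσ3 : 0 < σ * fracSeq i := mul_pos hσ (by linarith)
  have hρ3 : ρ * fracSeq i ≤ ρ * fracSeq (i + 1) := mul_le_mul_of_nonneg_left hτlt.le hρ.le
  refine h.ae_le hN hs0 hs1 hq hL hr hcrit (R := ρ * fracSeq (i + 1)) (θ := σ * fracSeq (i + 1))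
    (by linarith) hρ2 hσ2 hσ3 hσlt hd0 ?_ hρ3 ?_ ?_
  -- The relative gap of the radii is at least the difference of the fractions, because the larger
  -- fraction is at most `1`.
  · rw [mul_div_mul_left _ _ hρ.ne', le_sub_iff_add_le, ← le_sub_iff_add_le', sub_eq_add_neg]
    rw [← sub_eq_add_neg, ← hdiff]
    have h1 : (fracSeq (i + 1) - fracSeq i) * fracSeq (i + 1) ≤
        (fracSeq (i + 1) - fracSeq i) * 1 :=
      mul_le_mul_of_nonneg_left (by linarith) (by linarith)
    have h2 : fracSeq i / fracSeq (i + 1) ≤ 1 - (fracSeq (i + 1) - fracSeq i) := by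
      rw [div_le_iff₀ (by linarith)]
      linarith
    linarith
  · refine mul_le_mul_of_nonneg_right ?_ hS.le
    rw [mul_assoc, mul_assoc]
    refine le_mul_of_one_le_right (by linarith) (one_le_mul_of_one_le_of_one_le ?_
      (one_le_mul_of_one_le_of_one_le ?_ ?_))
    · refine Real.one_le_rpow ?_ (by positivity)
      have : 0 ≤ unitVol N * 8 ^ (((N : ℝ) + 2 * s) / (2 * s)) / c := by positivity
      linarith
    · exact one_le_pow₀ (Real.one_le_rpow (by norm_num) (by positivity))
    · exact Real.one_le_rpow hy (div_nonneg (mul_nonneg (by linarith) (by linarith)) hΛ.le)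
  · have hMy : 0 < S * y := by positivity
    -- The current bound `S * y` on the larger cylinder pays for raising the exponent from `r` to `q
    -- + 1`.
    refine (lintegral_rpow_le_of_ae_le hcyl.nonneg hMy (by linarith : 0 < r)
      hrq.le hQ).trans ?_
    have hI : t₀ - σ ≤ t₀ - σ * fracSeq (i + 1) := by linarith
    have hsubm : ∫⁻ t in Ioo (t₀ - σ * fracSeq (i + 1)) t₀,
        ∫⁻ x in Metric.ball x₀ (ρ * fracSeq (i + 1)), ENNReal.ofReal (u x t ^ r) ≤
        ENNReal.ofReal (unitVol N * (S ^ (lamExp N s q r / (2 * s)) *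
          σ ^ (((N : ℝ) + 2 * s) / (2 * s)))) := by
      refine le_trans ?_ h.mass
      refine (lintegral_mono_set (Ioo_subset_Ioo_left hI)).trans ?_
      exact lintegral_mono fun t => lintegral_mono_set (Metric.ball_subset_ball hρ2)
    refine (mul_le_mul_right hsubm _).trans ?_
    rw [← ENNReal.ofReal_mul (by positivity)]
    refine ENNReal.ofReal_le_ofReal ?_
    have hdσ : σ * fracSeq (i + 1) - σ * fracSeq i = σ * (1 / 8 * (1 / 2) ^ i) := by
      rw [← mul_sub, hdiff]
    rw [hdσ]
    have hsum : (q + 1 - r) + lamExp N s q r / (2 * s) = lamExp N s q (q + 1) / (2 * s) := by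
      rw [lamExp, lamExp]; field_simp; ring
    exact mul_rpow_le_level_rpow hs0 hc hω hΛ hF hσ.le hS hy0 i hsum

/-- The sup estimate for exponents below `q + 1`, by interpolation. -/
lemma exists_ae_le_mul_size_of_lt (hN : 2 ≤ N) (hs0 : 0 < s) (hs1 : s < 1) (hq : 1 < q)
    (hL : 0 < L) {c lam0 : ℝ} (hc : 0 < c) (hlam : 0 < lam0) (hΛ : 0 < lamExp N s q (q + 1))
    (hcrit : BoundednessCriterion N s q L (q + 1) c) : ∃ C : ℝ, 0 < C ∧
      ∀ r : ℝ, 1 ≤ r → r < q + 1 → lam0 ≤ lamExp N s q r →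
      ∀ (x₀ : RN N) (t₀ ρ σ S : ℝ) (K : RN N × RN N → ℝ → ℝ) (u : RN N → ℝ → ℝ),
      ScaledSubsolution s q L r x₀ t₀ ρ σ S K u →
      ∀ᵐ z ∂((volume : Measure (RN N × ℝ)).restrict (paraCyl x₀ t₀ (ρ / 2) (σ / 2))),
        u z.1 z.2 ≤ C * S := by
  have hω := unitVol_pos (N := N)
  have hF := one_le_levelFactor (N := N) (s := s) (q := q) hL
  have hM := barExp_pos (N := N) hN hs0 hq
  set Mb := barExp N s q with hMb
  set Λ := lamExp N s q (q + 1) with hΛdef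
  set e : ℝ := ((N : ℝ) + 2 * s) / (2 * s) with he
  have he0 : 0 < e := by positivity
  set A : ℝ := 1 + unitVol N * 8 ^ e / c with hA
  have hA1 : 1 ≤ A := by
    have : 0 ≤ unitVol N * 8 ^ e / c := by positivity
    linarith
  set H : ℝ := levelFactor N s q L * A ^ (2 * s / Λ) with hH
  have hA2 : 1 ≤ A ^ (2 * s / Λ) := Real.one_le_rpow hA1 (by positivity)
  have hH1 : 1 ≤ H := one_le_mul_of_one_le_of_one_le hF hA2
  set b : ℝ := 2 ^ (e * (2 * s / Λ)) with hb
  have hb1 : 1 ≤ b := Real.one_le_rpow (by norm_num) (by positivity)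
  -- The natural exponent is `2s (q + 1 - r) / Λ = 1 - Λ_r / Λ`. It is replaced by this upper bound,
  -- valid for all `r` with `Λ_r ≥ lam0`, so that the constant does not depend on `r`.
  set δ : ℝ := 1 - lam0 / Λ with hδ
  set D : ℝ := 3 * 8 ^ Mb * H with hD
  have h8 : (1 : ℝ) ≤ 8 ^ Mb := Real.one_le_rpow (by norm_num) hM.le
  have hD1 : 1 ≤ D := one_le_mul_of_one_le_of_one_le (by linarith) hH1
  set B : ℝ := 2 ^ Mb * b with hB
  have hB1 : 1 ≤ B :=
    one_le_mul_of_one_le_of_one_le (Real.one_le_rpow (by norm_num) hM.le) hb1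
  refine ⟨(D * (B ^ (1 / (1 - δ))) ^ δ) ^ (1 / (1 - δ)), by positivity,
    fun r hr hrq hΛr x₀ t₀ ρ σ S K u h => ?_⟩
  have hρ := h.radius_pos
  have hσ := h.time_pos
  have hS := h.size_pos
  have hΛΛ : Λ - lamExp N s q r = 2 * s * (q + 1 - r) := by rw [hΛdef, lamExp, lamExp]; ring
  have hΛlt : lamExp N s q r < Λ := by
    have : 0 < 2 * s * (q + 1 - r) := mul_pos (by linarith) (by linarith)
    linarith
  have hδ0 : 0 < δ := by
    rw [hδ, sub_pos, div_lt_one hΛ]; linarith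
  have hδ1 : δ < 1 := by
    have : 0 < lam0 / Λ := by positivity
    linarith
  have hmain := ae_le_of_sublinear_iteration (μ := (volume : Measure (RN N × ℝ)))
    (f := fun z => u z.1 z.2) (Q := fun i => paraCyl x₀ t₀ (ρ * fracSeq i) (σ * fracSeq i))
    hS hD1 hB1 hδ0 hδ1 ?_ ?_
  · rw [show ρ * fracSeq 0 = ρ / 2 by unfold fracSeq; ring,
      show σ * fracSeq 0 = σ / 2 by unfold fracSeq; ring] at hmain
    exact hmain.mono fun z hz => hz.trans (le_of_eq (mul_comm _ _))
  · intro i y hy hQ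
    have hδ'δ : 2 * s * (q + 1 - r) / Λ ≤ δ := by
      rw [hδ, ← hΛΛ, sub_div, div_self hΛ.ne']
      gcongr
    have hstep := h.ae_le_of_ae_le hN hs0 hs1 hq hL hr hrq hc hΛ hcrit i hy hQ
    refine hstep.mono fun z hz => hz.trans ?_
    have e1 : (1 / 8 * (1 / 2) ^ i : ℝ) ^ (-Mb) = 8 ^ Mb * (2 ^ Mb) ^ i := by
      have h2i : (2 : ℝ) ^ i * (1 / 2) ^ i = 1 := by rw [← mul_pow]; norm_num
      have e0 : (1 / 8 * (1 / 2) ^ i : ℝ)⁻¹ = 8 * 2 ^ i := by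
        refine inv_eq_of_mul_eq_one_left ?_
        linarith
      rw [Real.rpow_neg (by positivity), ← Real.inv_rpow (by positivity), e0,
        Real.mul_rpow (by norm_num) (by positivity), Real.rpow_pow_comm (by norm_num)]
    have e2 : y ^ (2 * s * (q + 1 - r) / Λ) ≤ y ^ δ :=
      Real.rpow_le_rpow_of_exponent_le hy hδ'δ
    rw [e1]
    calc _ = S * (D * B ^ i * y ^ (2 * s * (q + 1 - r) / Λ)) := by rw [hD, hB, mul_pow]; ring
      _ ≤ _ := by gcongr
  · obtain ⟨M, hM0, hbd⟩ := h.exists_bound hN hs0 hs1 hq hL hr hc hΛ hcrit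
    refine ⟨1 + M / S, by have : 0 < M / S := by positivity
                          linarith, fun i => ?_⟩
    have hρi := mul_le_mul_of_nonneg_left (fracSeq_le i) hρ.le
    have hσi := mul_le_mul_of_nonneg_left (fracSeq_le i) hσ.le
    have hρi' : ρ * fracSeq i ≤ 3 / 4 * ρ := by linarith
    have hσi' : t₀ - 3 / 4 * σ ≤ t₀ - σ * fracSeq i := by linarith
    have hsub : paraCyl x₀ t₀ (ρ * fracSeq i) (σ * fracSeq i) ⊆
        paraCyl x₀ t₀ (3 / 4 * ρ) (3 / 4 * σ) :=
      prod_mono (Metric.ball_subset_ball hρi') (Ioo_subset_Ioo_left hσi')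
    refine (ae_restrict_of_ae_restrict_of_subset hsub hbd).mono fun z hz => hz.trans ?_
    rw [mul_add, mul_div_cancel₀ _ hS.ne']
    linarith

end

/-! ### Conclusion for weak sub-solutions. -/

lemma closedBall_subset_of_compactlyContained {N : ℕ} {x₀ : RN N} {t₀ ρ σ T : ℝ} {Ω : Set (RN N)}
    (hρ : 0 < ρ) (hσ : 0 < σ) (h : CompactlyContained (paraCyl x₀ t₀ ρ σ) (spaceTime Ω T)) :
    Metric.closedBall x₀ ρ ⊆ Ω ∧ σ < t₀ ∧ t₀ ≤ T := by
  have h2 := h.2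
  rw [paraCyl, closure_prod_eq, closure_ball x₀ hρ.ne', closure_Ioo (by linarith : t₀ - σ ≠ t₀),
    spaceTime] at h2
  have hx : x₀ ∈ Metric.closedBall x₀ ρ := Metric.mem_closedBall_self hρ.le
  refine ⟨fun x hxm => (h2 (mk_mem_prod hxm (right_mem_Icc.2 (by linarith)))).1, ?_,
    (h2 (mk_mem_prod hx (right_mem_Icc.2 (by linarith)))).2.2⟩
  have := (h2 (mk_mem_prod hx (left_mem_Icc.2 (by linarith : t₀ - σ ≤ t₀)))).2.1
  linarith

lemma lintegral_lintegral_eq_prod {N : ℕ} {E : Set (RN N)} {J : Set ℝ} {f : RN N × ℝ → ℝ≥0∞}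
    (hf : Measurable f) :
    ∫⁻ t in J, ∫⁻ x in E, f (x, t) = ∫⁻ z in E ×ˢ J, f z := by
  rw [Measure.volume_eq_prod, ← Measure.prod_restrict, lintegral_prod_symm _ hf.aemeasurable]

section
variable {N : ℕ} {s q : ℝ} {K : RN N → RN N → ℝ → ℝ} {Ω : Set (RN N)} {T : ℝ}
  {u w : RN N → ℝ → ℝ} {x₀ : RN N} {t₀ ρ σ : ℝ}

lemma IsWeakSubsolution.integrableOn_tailIntegrand (h : IsWeakSubsolution s q K Ω T u)
    (hs0 : 0 < s) {R : ℝ} (hR : 0 < R) (hσ : 0 < σ) (hσt : σ < t₀) (ht : t₀ ≤ T) :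
    IntegrableOn (tailIntegrand s u x₀) (tailRegion x₀ t₀ R σ) := by
  set γ : ℝ := (N : ℝ) + 2 * s with hγ
  have hγ0 : 0 < γ := by positivity
  set C : ℝ := R ^ (-γ) + (1 + ‖x₀‖ / R) ^ γ with hC
  have hI : Ioo (t₀ - σ) t₀ ⊆ Ioc 0 T := fun t h => ⟨by linarith [h.1], h.2.le.trans ht⟩
  have htail := (h.tail (t₀ - σ) t₀ (by linarith) (by linarith) ht).mono_set
    (prod_mono (subset_univ (Metric.ball x₀ R)ᶜ) Ioo_subset_Icc_self)
  have hm : MeasurableSet (tailRegion x₀ t₀ R σ) :=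
    Metric.isOpen_ball.measurableSet.compl.prod measurableSet_Ioo
  have hmeas : AEMeasurable (fun z : RN N × ℝ => u z.1 z.2)
      (volume.restrict (tailRegion x₀ t₀ R σ)) :=
    h.aemeasurable.mono_measure (Measure.restrict_mono (prod_mono (subset_univ _) hI) le_rfl)
  refine (htail.const_mul C).mono' ?_ ?_
  · have h1 : Measurable fun z : RN N × ℝ => ‖z.1 - x₀‖ ^ γ := by fun_prop
    exact ((continuous_abs.measurable.comp_aemeasurable hmeas).div
      h1.aemeasurable).aestronglyMeasurable
  · filter_upwards [ae_restrict_mem hm] with z hz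
    have hd : R ≤ ‖z.1 - x₀‖ := by
      have := hz.1
      rw [mem_compl_iff, Metric.mem_ball, not_lt, dist_eq_norm] at this
      exact this
    have hd0 : 0 < ‖z.1 - x₀‖ := hR.trans_le hd
    have hx : ‖z.1‖ ≤ (1 + ‖x₀‖ / R) * ‖z.1 - x₀‖ := by
      have h1 : ‖z.1‖ ≤ ‖z.1 - x₀‖ + ‖x₀‖ := by simpa using norm_add_le (z.1 - x₀) x₀
      have h2 : ‖x₀‖ ≤ ‖x₀‖ / R * ‖z.1 - x₀‖ := by
        rw [div_mul_eq_mul_div, le_div_iff₀ hR]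
        gcongr
      linarith
    have h1 : ‖z.1‖ ^ γ ≤ (1 + ‖x₀‖ / R) ^ γ * ‖z.1 - x₀‖ ^ γ := by
      rw [← Real.mul_rpow (by positivity) (by positivity)]
      exact Real.rpow_le_rpow (norm_nonneg _) hx hγ0.le
    have h2 : 1 ≤ R ^ (-γ) * ‖z.1 - x₀‖ ^ γ := by
      calc (1 : ℝ) = R ^ (-γ) * R ^ γ := by rw [← Real.rpow_add hR]; simp
        _ ≤ _ := by gcongr
    have h3 : 1 + ‖z.1‖ ^ γ ≤ C * ‖z.1 - x₀‖ ^ γ := by rw [hC, add_mul]; linarith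
    rw [tailIntegrand, Real.norm_of_nonneg (by positivity), div_le_iff₀ (by positivity),
      ← mul_div_assoc, div_mul_eq_mul_div, le_div_iff₀ (by positivity)]
    calc |u z.1 z.2| * (1 + ‖z.1‖ ^ γ) ≤ |u z.1 z.2| * (C * ‖z.1 - x₀‖ ^ γ) := by gcongr
      _ = _ := by ring

/-- The three terms of the sup estimate control the cylinder average. -/
lemma integral_le_of_scale_le {N : ℕ} {s Λ ω ρ σ S Y : ℝ} (hs0 : 0 < s) (hΛ : 0 < Λ) (hω : 0 ≤ ω)
    (hρ : 0 < ρ) (hσ : 0 < σ) (hY : 0 ≤ Y)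
    (hS : (ρ ^ (2 * s) / σ) ^ ((N : ℝ) / Λ) * Y ^ (2 * s / Λ) ≤ S) :
    ω * ρ ^ N * σ * Y ≤ ω * (S ^ (Λ / (2 * s)) * σ ^ (((N : ℝ) + 2 * s) / (2 * s))) := by
  have e1 : ((ρ ^ (2 * s) / σ) ^ ((N : ℝ) / Λ) * Y ^ (2 * s / Λ)) ^ (Λ / (2 * s)) =
      ρ ^ N / σ ^ ((N : ℝ) / (2 * s)) * Y := by
    rw [Real.mul_rpow (by positivity) (by positivity), ← Real.rpow_mul (by positivity),
      ← Real.rpow_mul hY, show (N : ℝ) / Λ * (Λ / (2 * s)) = N / (2 * s) by field_simp,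
      show 2 * s / Λ * (Λ / (2 * s)) = 1 by field_simp, Real.rpow_one,
      Real.div_rpow (by positivity) hσ.le, ← Real.rpow_mul hρ.le,
      show 2 * s * ((N : ℝ) / (2 * s)) = N by field_simp, Real.rpow_natCast]
  have e2 : σ ^ (((N : ℝ) + 2 * s) / (2 * s)) = σ ^ ((N : ℝ) / (2 * s)) * σ := by
    rw [add_div, div_self (by positivity), Real.rpow_add hσ, Real.rpow_one]
  have h1 : ρ ^ N / σ ^ ((N : ℝ) / (2 * s)) * Y ≤ S ^ (Λ / (2 * s)) := by
    rw [← e1]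
    exact Real.rpow_le_rpow (by positivity) hS (by positivity)
  rw [e2]
  calc ω * ρ ^ N * σ * Y =
        ω * (ρ ^ N / σ ^ ((N : ℝ) / (2 * s)) * Y * (σ ^ ((N : ℝ) / (2 * s)) * σ)) := by
        field_simp
    _ ≤ _ := by gcongr

lemma volume_real_paraCyl (hρ : 0 < ρ) (hσ : 0 < σ) :
    volume.real (paraCyl x₀ t₀ ρ σ) = unitVol N * ρ ^ N * σ := by
  rw [paraCyl, Measure.volume_eq_prod, measureReal_prod_prod, Real.volume_real_Ioo_of_le
    (by linarith), measureReal_def, volume_ball_eq x₀ hρ, ENNReal.toReal_ofReal]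
  · ring
  · have := unitVol_pos (N := N)
    positivity

/-- The sup estimate follows from its scale-invariant form. -/
lemma IsWeakSubsolution.supEstimate {L r c : ℝ} (hN : 2 ≤ N) (hs0 : 0 < s) (hq : 1 < q)
    (hL : 1 ≤ L) (hΛ : 0 < lamExp N s q r)
    (H : ∀ (x₀ : RN N) (t₀ ρ σ S : ℝ) (K : RN N × RN N → ℝ → ℝ) (u : RN N → ℝ → ℝ),
      ScaledSubsolution s q L r x₀ t₀ ρ σ S K u →
      ∀ᵐ z ∂((volume : Measure (RN N × ℝ)).restrict (paraCyl x₀ t₀ (ρ / 2) (σ / 2))),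
        u z.1 z.2 ≤ c * S)
    (hK : IsKernel s L T K) (h : IsWeakSubsolution s q K Ω T u) (h0 : IsNonneg T u)
    (hρ : 0 < ρ) (hσ : 0 < σ) (hQ : CompactlyContained (paraCyl x₀ t₀ ρ σ) (spaceTime Ω T))
    (hint : IntegrableOn (fun z : RN N × ℝ => u z.1 z.2 ^ r) (paraCyl x₀ t₀ ρ σ)) :
    SupEstimate s q r c u x₀ t₀ ρ σ := by
  obtain ⟨hball, hσt, ht⟩ := closedBall_subset_of_compactlyContained hρ hσ hQ
  have htail := h.integrableOn_tailIntegrand (x₀ := x₀) hs0 (half_pos hρ) hσ hσt ht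
  refine ⟨hint, htail, ?_⟩
  obtain ⟨w, hw, hw0, hwu⟩ := exists_measurable_nonneg_representative h.aemeasurable h0
  obtain ⟨K', hKm, hKl, hKu, hKK⟩ := exists_kernel_representative hN hL hK
  have hI : Ioo (t₀ - σ) t₀ ⊆ Ioc 0 T := fun t h => ⟨by linarith [h.1], h.2.le.trans ht⟩
  have hwQ : ∀ᵐ z ∂((volume : Measure (RN N × ℝ)).restrict (paraCyl x₀ t₀ ρ σ)),
      w z.1 z.2 = u z.1 z.2 :=
    ae_restrict_of_ae_restrict_of_subset (prod_mono (subset_univ _) hI) hwu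
  have hwt : ∀ᵐ z ∂((volume : Measure (RN N × ℝ)).restrict (tailRegion x₀ t₀ (ρ / 2) σ)),
      w z.1 z.2 = u z.1 z.2 :=
    ae_restrict_of_ae_restrict_of_subset (prod_mono (subset_univ _) hI) hwu
  set Y : ℝ := ⨍ z in paraCyl x₀ t₀ ρ σ, u z.1 z.2 ^ r with hY
  have hω := unitVol_pos (N := N)
  have hvol : 0 < unitVol N * ρ ^ N * σ := by positivity
  have hYX : unitVol N * ρ ^ N * σ * Y = ∫ z in paraCyl x₀ t₀ ρ σ, u z.1 z.2 ^ r := by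
    rw [hY, setAverage_eq, volume_real_paraCyl hρ hσ, smul_eq_mul, mul_inv_cancel_left₀ hvol.ne']
  have hI0 : 0 ≤ ∫ z in paraCyl x₀ t₀ ρ σ, u z.1 z.2 ^ r :=
    integral_nonneg_of_ae (hwQ.mono fun z hz => by
      simp only [Pi.zero_apply]
      rw [← hz]; exact Real.rpow_nonneg (hw0 _ _) _)
  have hY0 : 0 ≤ Y := by
    rw [← hYX] at hI0
    exact nonneg_of_mul_nonneg_right hI0 hvol
  set τ : ℝ := parabolicTail s u x₀ t₀ (ρ / 2) σ with hτ
  have hτ0 : 0 ≤ τ := integral_nonneg fun z => by rw [tailIntegrand]; positivity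
  set S₁ : ℝ := (ρ ^ (2 * s) / σ) ^ ((N : ℝ) / lamExp N s q r) * Y ^ (2 * s / lamExp N s q r)
    with hS₁
  set S₂ : ℝ := (σ / ρ ^ (2 * s)) ^ (1 / (q - 1)) with hS₂
  set S₃ : ℝ := τ ^ (1 / q) with hS₃
  have hS₁0 : 0 ≤ S₁ := by positivity
  have hS₂0 : 0 < S₂ := by positivity
  have hS₃0 : 0 ≤ S₃ := by positivity
  -- Each summand of the size serves one requirement: `S₁` the mass, `S₂` the scaling and its
  -- positivity, `S₃` the tail.
  have hscaled : ScaledSubsolution s q L r x₀ t₀ ρ σ (S₁ + S₂ + S₃) K' w := by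
    refine ⟨fun R a hR hRρ ha hat => cylinderSubsolution_of_isWeakSubsolution hs0 hq h hw hw0 hwu
      hKm hKl hKu hKK hR (by linarith) hat ht ((Metric.closedBall_subset_closedBall hRρ).trans hball),
      hρ, hσ, by linarith, ?_, ?_, ?_⟩
    · have h1 : σ * ρ ^ (-(2 * s)) = S₂ ^ (q - 1) := by
        rw [hS₂, ← Real.rpow_mul (by positivity), one_div_mul_cancel (by linarith), Real.rpow_one,
          Real.rpow_neg hρ.le, div_eq_mul_inv]
      rw [h1]
      exact Real.rpow_le_rpow hS₂0.le (by linarith) (by linarith)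
    · have hm : Measurable fun z : RN N × ℝ => ENNReal.ofReal (w z.1 z.2 ^ r) :=
        (hw.pow_const r).ennreal_ofReal
      rw [lintegral_lintegral_eq_prod hm]
      change ∫⁻ z in paraCyl x₀ t₀ ρ σ, _ ≤ _
      have hwi : IntegrableOn (fun z : RN N × ℝ => w z.1 z.2 ^ r) (paraCyl x₀ t₀ ρ σ) :=
        hint.congr (hwQ.mono fun z hz => by simp only; rw [hz])
      rw [← ofReal_integral_eq_lintegral_ofReal hwi
        (Eventually.of_forall fun z => Real.rpow_nonneg (hw0 _ _) _)]
      refine ENNReal.ofReal_le_ofReal ?_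
      rw [integral_congr_ae (g := fun z : RN N × ℝ => u z.1 z.2 ^ r)
        (hwQ.mono fun z hz => by simp only; rw [hz]), ← hYX]
      exact integral_le_of_scale_le hs0 hΛ hω.le hρ hσ hY0 (by linarith)
    · have hm : Measurable fun z : RN N × ℝ =>
          ENNReal.ofReal (w z.1 z.2 / ‖z.1 - x₀‖ ^ ((N : ℝ) + 2 * s)) :=
        (hw.div (by fun_prop)).ennreal_ofReal
      rw [lintegral_lintegral_eq_prod hm]
      change ∫⁻ z in tailRegion x₀ t₀ (ρ / 2) σ, _ ≤ _
      have e : ∫⁻ z in tailRegion x₀ t₀ (ρ / 2) σ,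
          ENNReal.ofReal (w z.1 z.2 / ‖z.1 - x₀‖ ^ ((N : ℝ) + 2 * s)) =
          ∫⁻ z in tailRegion x₀ t₀ (ρ / 2) σ, ENNReal.ofReal (tailIntegrand s u x₀ z) :=
        lintegral_congr_ae (hwt.mono fun z hz => by
          simp only
          rw [tailIntegrand, ← hz, abs_of_nonneg (hw0 _ _)])
      rw [e, ← ofReal_integral_eq_lintegral_ofReal htail
        (Eventually.of_forall fun z => by rw [Pi.zero_apply, tailIntegrand]; positivity)]
      refine ENNReal.ofReal_le_ofReal ?_
      calc τ = S₃ ^ q := by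
            rw [hS₃, ← Real.rpow_mul hτ0, one_div_mul_cancel (by linarith), Real.rpow_one]
        _ ≤ _ := Real.rpow_le_rpow hS₃0 (by linarith) (by linarith)
  have hsup := H _ _ _ _ _ _ _ hscaled
  have hsubQ : paraCyl x₀ t₀ (ρ / 2) (σ / 2) ⊆ paraCyl x₀ t₀ ρ σ :=
    prod_mono (Metric.ball_subset_ball (by linarith)) (Ioo_subset_Ioo_left (by linarith))
  refine essSup_le_of_ae_le _ ?_
  filter_upwards [hsup, ae_restrict_of_ae_restrict_of_subset hsubQ hwQ] with z h1 h2
  rw [EReal.coe_le_coe_iff, ← h2]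
  refine h1.trans (le_of_eq ?_)
  rw [supBound, hS₁]
  ring

/-- Nonnegative weak sub-solutions are locally integrable to the power `mExp`. -/
lemma IsWeakSubsolution.integrableOn_rpow {L r : ℝ} (hN : 2 ≤ N) (hs0 : 0 < s) (hq : 1 < q)
    (hL : 1 ≤ L) (hr : 1 ≤ r) (hrm : r ≤ mExp N s q) (hΩ : IsOpen Ω)
    (hK : IsKernel s L T K) (h : IsWeakSubsolution s q K Ω T u) (h0 : IsNonneg T u)
    (hρ : 0 < ρ) (hσ : 0 < σ) (hQ : CompactlyContained (paraCyl x₀ t₀ ρ σ) (spaceTime Ω T)) :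
    IntegrableOn (fun z : RN N × ℝ => u z.1 z.2 ^ r) (paraCyl x₀ t₀ ρ σ) := by
  obtain ⟨hball, hσt, ht⟩ := closedBall_subset_of_compactlyContained hρ hσ hQ
  obtain ⟨w, hw, hw0, hwu⟩ := exists_measurable_nonneg_representative h.aemeasurable h0
  obtain ⟨K', hKm, hKl, hKu, hKK⟩ := exists_kernel_representative hN hL hK
  have hI : Ioo (t₀ - σ) t₀ ⊆ Ioc 0 T := fun t h => ⟨by linarith [h.1], h.2.le.trans ht⟩
  -- The gain of integrability loses some radius, so a slightly larger ball inside `Ω` is needed.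
  obtain ⟨δ, hδ, hδΩ⟩ := (isCompact_closedBall x₀ ρ).exists_cthickening_subset_open hΩ hball
  rw [cthickening_closedBall hδ.le hρ.le] at hδΩ
  have hcyl : CylinderSubsolution s q L x₀ (ρ + δ) (t₀ - σ) t₀ K' w :=
    cylinderSubsolution_of_isWeakSubsolution hs0 hq h hw hw0 hwu hKm hKl hKu hKK
      (by linarith) (by linarith) (by linarith) ht (by rwa [add_comm])
  have hfin := hcyl.lintegral_mExp_ne_top hN hs0 hq (ρ := ρ) (by linarith)
  have hmm : Measurable fun z : RN N × ℝ => ENNReal.ofReal (w z.1 z.2 ^ mExp N s q) :=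
    (hw.pow_const _).ennreal_ofReal
  rw [lintegral_lintegral_eq_prod hmm] at hfin
  have hwi : IntegrableOn (fun z : RN N × ℝ => w z.1 z.2 ^ r) (paraCyl x₀ t₀ ρ σ) := by
    refine integrableOn_of_lintegral_ne_top (hw.pow_const r)
      (fun z => Real.rpow_nonneg (hw0 _ _) _) ?_
    have hle : ∀ z : RN N × ℝ, ENNReal.ofReal (w z.1 z.2 ^ r) ≤
        1 + ENNReal.ofReal (w z.1 z.2 ^ mExp N s q) := by
      intro z
      rw [← ENNReal.ofReal_one, ← ENNReal.ofReal_add zero_le_one (Real.rpow_nonneg (hw0 _ _) _)]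
      refine ENNReal.ofReal_le_ofReal ?_
      have hp := Real.rpow_nonneg (hw0 z.1 z.2) (mExp N s q)
      rcases le_total (w z.1 z.2) 1 with h1 | h1
      · linarith [Real.rpow_le_one (hw0 z.1 z.2) h1 (by linarith : 0 ≤ r)]
      · linarith [Real.rpow_le_rpow_of_exponent_le h1 hrm]
    refine ne_top_of_le_ne_top ?_ (lintegral_mono hle)
    rw [lintegral_add_left measurable_const, setLIntegral_one]
    refine ENNReal.add_ne_top.2 ⟨?_, hfin⟩
    exact (Metric.isBounded_ball.prod (Metric.isBounded_Ioo _ _)).measure_lt_top.ne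
  refine hwi.congr ?_
  refine (ae_restrict_of_ae_restrict_of_subset (prod_mono (subset_univ _) hI) hwu).mono
    fun z hz => ?_
  simp only
  rw [hz]

lemma MemLpLoc.integrableOn_rpow {A : ℝ} (hA : 0 < A) (hu : MemLpLoc A Ω T u) (h0 : IsNonneg T u)
    (hQ : CompactlyContained (paraCyl x₀ t₀ ρ σ) (spaceTime Ω T)) :
    IntegrableOn (fun z : RN N × ℝ => u z.1 z.2 ^ A) (paraCyl x₀ t₀ ρ σ) := by
  have h1 := (hu _ hQ.1 hQ.2).integrable_norm_rpow (by simpa using hA) ENNReal.ofReal_ne_top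
  rw [ENNReal.toReal_ofReal hA.le] at h1
  have h2 : IntegrableOn (fun z : RN N × ℝ => ‖u z.1 z.2‖ ^ A) (paraCyl x₀ t₀ ρ σ) :=
    IntegrableOn.mono_set h1 subset_closure
  refine h2.congr ?_
  have hsub : paraCyl x₀ t₀ ρ σ ⊆ univ ×ˢ Ioc 0 T := fun z hz =>
    ⟨mem_univ _, (hQ.2 (subset_closure hz)).2⟩
  refine (ae_restrict_of_ae_restrict_of_subset hsub h0).mono fun z hz => ?_
  simp only
  rw [Real.norm_of_nonneg hz]

end

lemma lamExp_mono {N : ℕ} {s q a b : ℝ} (hs0 : 0 < s) (hab : a ≤ b) :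
    lamExp N s q a ≤ lamExp N s q b := by
  unfold lamExp
  nlinarith

/-- The sign of `Λ_{q+1}` decides whether `q + 1 < m`; with the monotonicity of `Λ`, it determines
for which parameters each part of the theorem has content. -/
lemma lamExp_add_one {N : ℕ} (hN : 2 ≤ N) {s q : ℝ} :
    lamExp N s q (q + 1) = N * (mExp N s q - (q + 1)) := by
  have hN0 : (N : ℝ) ≠ 0 := by positivity
  rw [mExp_eq hN, lamExp]
  field_simp
  ring

/-- The two forms of the scale-invariant estimate in the range `r ≤ mExp`. -/
lemma exists_ae_le_mul_size_of_le_mExp {N : ℕ} (hN : 2 ≤ N) {s q L : ℝ} (hs0 : 0 < s) (hs1 : s < 1)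
    (hq : 1 < q) (hL : 0 < L) {lam0 : ℝ} (hlam : 0 < lam0) : ∃ C : ℝ, 0 < C ∧
      ∀ r : ℝ, 1 ≤ r → r ≤ mExp N s q → lam0 ≤ lamExp N s q r →
      ∀ (x₀ : RN N) (t₀ ρ σ S : ℝ) (K : RN N × RN N → ℝ → ℝ) (u : RN N → ℝ → ℝ),
      ScaledSubsolution s q L r x₀ t₀ ρ σ S K u →
      ∀ᵐ z ∂((volume : Measure (RN N × ℝ)).restrict (paraCyl x₀ t₀ (ρ / 2) (σ / 2))),
        u z.1 z.2 ≤ C * S := by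
  have hN0 : (0 : ℝ) < N := by positivity
  have hΛ := lamExp_add_one (s := s) (q := q) hN
  by_cases hm : q + 1 < mExp N s q
  · have hΛ0 : 0 < lamExp N s q (q + 1) := by
      rw [hΛ]; exact mul_pos hN0 (by linarith)
    obtain ⟨c, hc, hcrit⟩ := exists_ae_le_of_lt_mExp hN hs0 hs1 hq hL hm
    have hcrit' : ∀ r, q + 1 ≤ r → BoundednessCriterion N s q L r c :=
      fun r hr x₀ R a b K u h hR k g hk hg hab h1 h2 h3 =>
        hcrit x₀ R a b K u h hR k g r hk hg hab h1 h2 hr h3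
    obtain ⟨C₁, hC₁, hge⟩ := exists_ae_le_mul_size (L := L) hN hs0 hs1 hq hL hc hlam
    obtain ⟨C₂, hC₂, hlt⟩ := exists_ae_le_mul_size_of_lt hN hs0 hs1 hq hL hc hlam hΛ0
      (hcrit' _ le_rfl)
    refine ⟨max C₁ C₂, lt_max_of_lt_left hC₁, fun r hr hrm hΛr x₀ t₀ ρ σ S K u h => ?_⟩
    have hS := h.size_pos
    rcases lt_or_ge r (q + 1) with h1 | h1
    · exact (hlt r hr h1 hΛr x₀ t₀ ρ σ S K u h).mono fun z hz =>
        hz.trans (mul_le_mul_of_nonneg_right (le_max_right _ _) hS.le)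
    · exact (hge r hr hΛr (hcrit' r h1) x₀ t₀ ρ σ S K u h).mono fun z hz =>
        hz.trans (mul_le_mul_of_nonneg_right (le_max_left _ _) hS.le)
  · refine ⟨1, one_pos, fun r hr hrm hΛr => absurd hΛr (not_le.2 ?_)⟩
    have h1 := lamExp_mono (N := N) (q := q) hs0 (hrm.trans (not_lt.1 hm))
    have h2 : (N : ℝ) * (mExp N s q - (q + 1)) ≤ 0 :=
      mul_nonpos_of_nonneg_of_nonpos hN0.le (by linarith)
    linarith

theorem theorem1p2 (N : ℕ) (hN : 2 ≤ N) (s q L : ℝ) (hs0 : 0 < s) (hs1 : s < 1) (hq : 1 < q)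
    (hL : 1 ≤ L) :
    (∀ lam0 : ℝ, 0 < lam0 → ∃ c : ℝ, 0 < c ∧
      ∀ (Ω : Set (RN N)) (T : ℝ) (K : RN N → RN N → ℝ → ℝ) (u : RN N → ℝ → ℝ),
        IsOpen Ω → Bornology.IsBounded Ω → 0 < T → IsKernel s L T K →
        IsWeakSubsolution s q K Ω T u → IsNonneg T u →
        ∀ r : ℝ, 1 ≤ r → r ≤ mExp N s q → lam0 ≤ lamExp N s q r →
        ∀ (x₀ : RN N) (t₀ ρ σ : ℝ), 0 < ρ → 0 < σ →
          CompactlyContained (paraCyl x₀ t₀ ρ σ) (spaceTime Ω T) →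
          SupEstimate s q r c u x₀ t₀ ρ σ) ∧
    (∀ A : ℝ, (N : ℝ) / (2 * s) * (q - 1) < A → ∃ c : ℝ, 0 < c ∧
      ∀ (Ω : Set (RN N)) (T : ℝ) (K : RN N → RN N → ℝ → ℝ) (u : RN N → ℝ → ℝ),
        IsOpen Ω → Bornology.IsBounded Ω → 0 < T → IsKernel s L T K →
        IsWeakSubsolution s q K Ω T u → IsNonneg T u →
        ∀ r : ℝ, 1 ≤ r → mExp N s q < r → lamExp N s q r ≤ 0 → MemLpLoc A Ω T u →
        ∀ (x₀ : RN N) (t₀ ρ σ : ℝ), 0 < ρ → 0 < σ →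
          CompactlyContained (paraCyl x₀ t₀ ρ σ) (spaceTime Ω T) →
          SupEstimate s q A c u x₀ t₀ ρ σ) := by
  have hL0 : 0 < L := by linarith
  have hN0 : (0 : ℝ) < N := by positivity
  constructor
  · intro lam0 hlam
    obtain ⟨c, hc, H⟩ := exists_ae_le_mul_size_of_le_mExp hN hs0 hs1 hq hL0 hlam
    refine ⟨c, hc, fun Ω T K u hΩ _ _ hK h h0 r hr hrm hΛ x₀ t₀ ρ σ hρ hσ hQ => ?_⟩
    exact h.supEstimate hN hs0 hq hL (hlam.trans_le hΛ) (H r hr hrm hΛ) hK h0 hρ hσ hQ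
      (h.integrableOn_rpow hN hs0 hq hL hr hrm hΩ hK h0 hρ hσ hQ)
  · intro A hA
    have hΛA : 0 < lamExp N s q A := by
      rw [div_mul_eq_mul_div, div_lt_iff₀ (by positivity)] at hA
      unfold lamExp
      linarith
    have hΛ := lamExp_add_one (s := s) (q := q) hN
    by_cases hm : mExp N s q ≤ q + 1
    -- Here `Λ_{q+1} ≤ 0 < Λ_A`, and `Λ` is nondecreasing.
    · have hAq : q + 1 < A := by
        by_contra! hcon
        have h1 := lamExp_mono (N := N) (q := q) hs0 hcon
        have h2 : (N : ℝ) * (mExp N s q - (q + 1)) ≤ 0 :=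
          mul_nonpos_of_nonneg_of_nonpos hN0.le (by linarith)
        linarith
      obtain ⟨c, hc, hcrit⟩ := exists_ae_le_of_mExp_le hN hs0 hs1 hq hL0 hm hAq hΛA
      obtain ⟨C, hC, H⟩ := exists_ae_le_mul_size (L := L) hN hs0 hs1 hq hL0 hc hΛA
      refine ⟨C, hC, fun Ω T K u _ _ _ hK h h0 r _ _ _ hu x₀ t₀ ρ σ hρ hσ hQ => ?_⟩
      exact h.supEstimate hN hs0 hq hL hΛA (H A (by linarith) le_rfl hcrit) hK h0
        hρ hσ hQ (hu.integrableOn_rpow (by linarith) h0 hQ)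
    -- If `m > q + 1`, then `r > m` gives `Λ_r ≥ Λ_{q+1} > 0`, contrary to `Λ_r ≤ 0`.
    · refine ⟨1, one_pos, fun Ω T K u _ _ _ _ _ _ r _ hmr hΛr => absurd hΛr (not_le.2 ?_)⟩
      rw [not_le] at hm
      have h1 := lamExp_mono (N := N) (q := q) hs0 (hm.trans hmr).le
      have h2 : 0 < (N : ℝ) * (mExp N s q - (q + 1)) := mul_pos hN0 (by linarith)
      linarith
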